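/- Let $\mathbb{K}$ be a commutative ground ring. A dg-module is a (lower) $\mathbb{N}$-graded $\mathbb{K}$-module with a differential of degree $-1$. A dg-$\Sigma_*$-module $M$ is a sequence of dg-modules $M(r)$, $r\ge 0$, with actions of the symmetric groups $\Sigma_r$ by degree-preserving maps commuting with the differential. It is *connected* if $M(0)=0$, and *projective as a $\mathbb{K}$-module* if every $M(r)$ is a projective $\mathbb{K}$-module. A morphism of dg-$\Sigma_*$-modules is a *quasi-isomorphism* if it induces an isomorphism in homology in each arity. The composition product is $M\circ N=\bigoplus_{r\ge 0}(M(r)\otimes N^{\otimes r})_{\Sigma_r}$ (with the Koszul sign rule), where $N^{\otimes r}$ is the tensor power of $\Sigma_*$-modules. A dg-operad is a monoid $P$ for $\circ$ in dg-$\Sigma_*$-modules. Right (left) $P$-modules are dg-$\Sigma_*$-modules $L$ (resp. $R$) with an associative and unital action $\lambda: L\circ P\to L$ (resp. $\rho: P\circ R\to R$). The relative composition product $L\circ_P R$ is the cokernel, in dg-$\Sigma_*$-modules, of $\lambda\circ R,\ L\circ\rho : L\circ P\circ R\rightrightarrows L\circ R$. A dg-operad $P$ is *connected* if $P(0)=0$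 and the unit gives $\mathbb{K}\cong P(1)$. A right $P$-module $L$ is *quasi-free*, $L=\bar L\circ P$, if it is identified, as a graded right $P$-module, with the free one on a dg-$\Sigma_*$-module $\bar L$, its differential being $\delta+d_\theta$, where $\delta$ is the canonical differential of $\bar L\circ P$ and the composite $\bar L\to\bar L\circ P\xrightarrow{d_\theta}\bar L\circ P\to\bar L$ is zero (so that $\bar L$ is the indecomposable quotient of $L$). Quasi-free left $P$-modules $R=P\circ\bar R$ are defined symmetrically (the composite $\bar R\to P\circ\bar R\xrightarrow{d_\theta}P\circ\bar R\to\bar R$ is zero). **Theorem.** Let $P$ be a connected dg-operad. (1) Let $\phi: L\to L'$ be a quasi-isomorphism of quasi-free right $P$-modules, $L=\bar L\circ P$ and $L'=\bar L'\circ P$, and let $R$ be a connected left $P$-module. If $\mathbb{K}$ is not a field, assume in addition that $P$, $\bar L$, $\bar L'$ and $R$ are projective as $\mathbb{K}$-modules. Then $\phi\circ_P R: L\circ_P R\to L'\circ_P R$ is a quasi-isomorphism. (2) Let $\psi: R\to R'$ be a quasi-isomorphism of quasi-free left $P$-modules, $R=P\circ\bar R$ and $R'=P\circ\bar R'$, with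 $\bar R(0)=0$ and $\bar R'(0)=0$, and let $L$ be any right $P$-module. If $\mathbb{K}$ is not a field, assume in addition that $\bar R$ and $\bar R'$ are projective as $\mathbb{K}$-modules. Then $L\circ_P\psi: L\circ_P R\to L\circ_P R'$ is a quasi-isomorphism. -/

import Mathlib

set_option linter.unusedSimpArgs false

universe u v w v₁ v₂ v₃ v₄

/-- A dg-`Σ_*`-module over `K`: a sequence `M(r)` of (lower) `ℕ`-graded `K`-modules with a
differential of degree `-1`, equipped with a left action of the symmetric groups `Σ_r` by morphisms
of dg-modules.  (For a multilinear operation `p`, the element `w • p` is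
`(x_1,…,x_r) ↦ p(x_{w(1)},…,x_{w(r)})`.) -/
structure DGSymModule (K : Type u) [CommRing K] where
  /-- the module `M(r)` (the sum of all its homogeneous components) -/
  carrier : ℕ → Type v
  [addCommGroup : ∀ r, AddCommGroup (carrier r)]
  [module : ∀ r, Module K (carrier r)]
  /-- the homogeneous component `M(r)_k` -/
  gr : ∀ r, ℕ → Submodule K (carrier r)
  isInternal : ∀ r, DirectSum.IsInternal (gr r)
  /-- the action of `Σ_r` -/
  rep : ∀ r, Representation K (Equiv.Perm (Fin r)) (carrier r)
  rep_mem : ∀ r (s : Equiv.Perm (Fin r)) k x, x ∈ gr r k → rep r s x ∈ gr r k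
  /-- the differential -/
  d : ∀ r, carrier r →ₗ[K] carrier r
  d_mem : ∀ r k x, x ∈ gr r (k + 1) → d r x ∈ gr r k
  d_zero : ∀ r x, x ∈ gr r 0 → d r x = 0
  d_d : ∀ r x, d r (d r x) = 0
  d_rep : ∀ r (s : Equiv.Perm (Fin r)) x, d r (rep r s x) = rep r s (d r x)

namespace DGSymModule

attribute [instance] DGSymModule.addCommGroup DGSymModule.module

instance (K : Type u) [CommRing K] : CoeFun (DGSymModule.{u, v} K) (fun _ => ℕ → Type v) :=
  ⟨DGSymModule.carrier⟩

variable {K : Type u} [CommRing K]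

/-- `M` is connected: `M(0) = 0`. -/
def Connected (M : DGSymModule.{u, v} K) : Prop := Subsingleton (M 0)

/-- `M` is projective as a `K`-module. -/
def KProjective (M : DGSymModule.{u, v} K) : Prop := ∀ r, Module.Projective K (M r)

theorem d_mem_pred (M : DGSymModule.{u, v} K) (r k : ℕ) (x : M r) (hx : x ∈ M.gr r k) :
    M.d r x ∈ M.gr r (k - 1) := by
  cases k with
  | zero => rw [M.d_zero r x hx]; exact zero_mem _
  | succ k => exact M.d_mem r k x hx

/-- The homology `ker d / im d` of `M(r)` (the sum of the homology modules of all degrees). -/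
abbrev Homology (M : DGSymModule.{u, v} K) (r : ℕ) : Type v :=
  LinearMap.ker (M.d r) ⧸ (LinearMap.range (M.d r)).submoduleOf (LinearMap.ker (M.d r))

end DGSymModule

/-- A morphism of the underlying graded `Σ_*`-modules (compatibility with differentials is not
required): degree-preserving equivariant `K`-linear maps. -/
structure GrHom {K : Type u} [CommRing K] (M : DGSymModule.{u, v} K) (N : DGSymModule.{u, w} K) where
  toFun : ∀ r, M r →ₗ[K] N r
  map_mem : ∀ r k x, x ∈ M.gr r k → toFun r x ∈ N.gr r k
  map_rep : ∀ r (s : Equiv.Perm (Fin r)) x, toFun r (M.rep r s x) = N.rep r s (toFun r x)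

/-- A morphism of dg-`Σ_*`-modules. -/
structure DGHom {K : Type u} [CommRing K] (M : DGSymModule.{u, v} K) (N : DGSymModule.{u, w} K)
    extends GrHom M N where
  map_d : ∀ r x, toFun r (M.d r x) = N.d r (toFun r x)

/-- The identity morphism. -/
def GrHom.id {K : Type u} [CommRing K] (M : DGSymModule.{u, v} K) : GrHom M M where
  toFun _ := LinearMap.id
  map_mem _ _ _ h := h
  map_rep _ _ _ := rfl

/-- The identity morphism. -/
def DGHom.id {K : Type u} [CommRing K] (M : DGSymModule.{u, v} K) : DGHom M M where
  toGrHom := GrHom.id M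
  map_d _ _ := rfl

/-- The morphism induced in homology. -/
def DGHom.homologyMap {K : Type u} [CommRing K] {M : DGSymModule.{u, v} K}
    {N : DGSymModule.{u, w} K} (f : DGHom M N) (r : ℕ) : M.Homology r →ₗ[K] N.Homology r :=
  Submodule.mapQ _ _
    ((f.toFun r).restrict (p := LinearMap.ker (M.d r)) (q := LinearMap.ker (N.d r)) (by
      intro x hx
      rw [LinearMap.mem_ker] at hx ⊢
      rw [← f.map_d, hx, map_zero]))
    (by
      rintro ⟨x, hx⟩ ⟨z, hz⟩
      refine ⟨f.toFun r z, ?_⟩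
      rw [← f.map_d, hz]
      rfl)

/-- `f` is a quasi-isomorphism: it induces an isomorphism in homology. -/
def DGHom.QuasiIso {K : Type u} [CommRing K] {M : DGSymModule.{u, v} K}
    {N : DGSymModule.{u, w} K} (f : DGHom M N) : Prop :=
  ∀ r, Function.Bijective (f.homologyMap r)

/-- A criterion for a family of submodules to be a grading. -/
theorem isInternal_of_projections {K : Type u} [CommRing K] {A : Type v} [AddCommGroup A]
    [Module K A] (gr : ℕ → Submodule K A) (p : ℕ → A →ₗ[K] A)
    (hp : ∀ k x, x ∈ gr k → p k x = x) (hp0 : ∀ k l x, x ∈ gr k → l ≠ k → p l x = 0)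
    (htop : ⨆ k, gr k = ⊤) : DirectSum.IsInternal gr := by
  rw [DirectSum.isInternal_submodule_iff_iSupIndep_and_iSup_eq_top]
  refine ⟨?_, htop⟩
  rw [iSupIndep_def]
  intro i
  rw [Submodule.disjoint_def]
  intro x hx hx'
  rw [← hp i x hx]
  have : (⨆ j, ⨆ (_ : j ≠ i), gr j) ≤ LinearMap.ker (p i) := by
    refine iSup_le fun j => iSup_le fun hj => ?_
    intro z hz
    exact hp0 j i z hz (Ne.symm hj)
  exact this hx'

noncomputable section Composition

variable {K : Type u} [CommRing K]

/-- The data of a homogeneous composite element `x(y_1,…,y_r)` of `(M ∘ N)(m)`, where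
`x ∈ M(r)_a` and `y_i ∈ N(n_i)_{b_i}`, together with a labelling `e` of the inputs of
`y_1,…,y_r` by `1,…,m`.  Its blocks `J_i = e({i} × Fin (n i))` form an ordered partition
`J_1 ⊔ … ⊔ J_r` of `{1,…,m}`, and `y_i` together with the restriction of `e` represents an
element of `N(J_i)`. -/
structure CompositeSymbol (M : DGSymModule.{u, v} K) (N : DGSymModule.{u, w} K) (m : ℕ) where
  r : ℕ
  n : Fin r → ℕ
  e : (Σ i, Fin (n i)) ≃ Fin m
  a : ℕ
  x : M r
  hx : x ∈ M.gr r a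
  b : Fin r → ℕ
  y : ∀ i, N (n i)
  hy : ∀ i, y i ∈ N.gr (n i) (b i)

/-- The exponent of the Koszul sign of the permutation of tensors
`y_1 ⊗ … ⊗ y_r ↦ y_{s(1)} ⊗ … ⊗ y_{s(r)}`, where `b i` is the degree of `y_i`. -/
def koszulExp {r : ℕ} (s : Equiv.Perm (Fin r)) (b : Fin r → ℕ) : ℕ :=
  ∑ i, ∑ j, if i < j ∧ s j < s i then b (s i) * b (s j) else 0

namespace CompositeSymbol

variable {M : DGSymModule.{u, v} K} {N : DGSymModule.{u, w} K} {m : ℕ}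

/-- The total degree of a composite element. -/
abbrev deg (c : CompositeSymbol M N m) : ℕ := c.a + ∑ i, c.b i

/-- Relabelling of the inputs: the action of `Σ_m`. -/
abbrev relabel (s : Equiv.Perm (Fin m)) (c : CompositeSymbol M N m) : CompositeSymbol M N m :=
  { c with e := c.e.trans s }

/-- `δ(x)(y_1,…,y_r)` -/
abbrev dLeft (c : CompositeSymbol M N m) : CompositeSymbol M N m :=
  { c with a := c.a - 1, x := M.d c.r c.x, hx := M.d_mem_pred _ _ _ c.hx }

/-- `x(y_1,…,δ(y_i),…,y_r)` -/
abbrev dRight (c : CompositeSymbol M N m) (i : Fin c.r) : CompositeSymbol M N m :=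
  { c with
    b := Function.update c.b i (c.b i - 1)
    y := Function.update c.y i (N.d (c.n i) (c.y i))
    hy := by
      intro j
      rcases eq_or_ne j i with rfl | hj
      · simpa using N.d_mem_pred _ _ _ (c.hy j)
      · simpa [Function.update_of_ne hj] using c.hy j }

/-- The sign exponent `|x| + |y_1| + … + |y_{i-1}|` of the `i`-th term of the differential. -/
abbrev dExp (c : CompositeSymbol M N m) (i : Fin c.r) : ℕ :=
  c.a + ∑ j, if j < i then c.b j else 0

/-- `(y_1,…,y_r) ↦ (σ_1 y_1,…,σ_r y_r)` -/
abbrev inner (c : CompositeSymbol M N m) (σ : ∀ i, Equiv.Perm (Fin (c.n i))) : CompositeSymbol M N m :=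
  { c with
    y := fun i => N.rep _ (σ i) (c.y i)
    hy := fun i => N.rep_mem _ _ _ _ (c.hy i) }

/-- Relabelling inside the blocks. -/
abbrev innerLabel (c : CompositeSymbol M N m) (σ : ∀ i, Equiv.Perm (Fin (c.n i))) : CompositeSymbol M N m :=
  { c with e := (Equiv.sigmaCongrRight σ).trans c.e }

/-- `x ↦ s x` -/
abbrev outer (c : CompositeSymbol M N m) (s : Equiv.Perm (Fin c.r)) : CompositeSymbol M N m :=
  { c with
    x := M.rep _ s c.x
    hx := M.rep_mem _ _ _ _ c.hx }

/-- `(y_1,…,y_r) ↦ (y_{s(1)},…,y_{s(r)})`, together with the permutation of the blocks. -/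
abbrev outerPerm (c : CompositeSymbol M N m) (s : Equiv.Perm (Fin c.r)) : CompositeSymbol M N m where
  r := c.r
  n := fun i => c.n (s i)
  e := (Equiv.sigmaCongrLeft (β := fun i => Fin (c.n i)) s).trans c.e
  a := c.a
  x := c.x
  hx := c.hx
  b := fun i => c.b (s i)
  y := fun i => c.y (s i)
  hy := fun i => c.hy (s i)

end CompositeSymbol

/-- The relations between composite elements: `K`-multilinearity in `x, y_1, …, y_r`, and the
equivariance relations which say that `y_i` together with its labelling represents an element of
`N(J_i)`, and that coinvariants are taken under the action of `Σ_r`. -/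
inductive CompositeRel (M : DGSymModule.{u, v} K) (N : DGSymModule.{u, w} K) (m : ℕ) :
    (CompositeSymbol M N m →₀ K) → Prop
  | add_left (c : CompositeSymbol M N m) (x' : M c.r) (hx' : x' ∈ M.gr c.r c.a) :
      CompositeRel M N m (Finsupp.single { c with x := c.x + x', hx := add_mem c.hx hx' } 1
        - Finsupp.single c 1 - Finsupp.single { c with x := x', hx := hx' } 1)
  | smul_left (c : CompositeSymbol M N m) (t : K) :
      CompositeRel M N m (Finsupp.single { c with x := t • c.x, hx := Submodule.smul_mem _ t c.hx } 1
        - t • Finsupp.single c 1)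
  | add_right (c : CompositeSymbol M N m) (i : Fin c.r) (y' y'' : ∀ j, N (c.n j))
      (hy' : ∀ j, y' j ∈ N.gr (c.n j) (c.b j)) (hy'' : ∀ j, y'' j ∈ N.gr (c.n j) (c.b j))
      (h : c.y i = y' i + y'' i) (h' : ∀ j, j ≠ i → y' j = c.y j)
      (h'' : ∀ j, j ≠ i → y'' j = c.y j) :
      CompositeRel M N m (Finsupp.single c 1 - Finsupp.single { c with y := y', hy := hy' } 1
        - Finsupp.single { c with y := y'', hy := hy'' } 1)
  | smul_right (c : CompositeSymbol M N m) (i : Fin c.r) (t : K) (y' : ∀ j, N (c.n j))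
      (hy' : ∀ j, y' j ∈ N.gr (c.n j) (c.b j))
      (h : c.y i = t • y' i) (h' : ∀ j, j ≠ i → y' j = c.y j) :
      CompositeRel M N m (Finsupp.single c 1 - t • Finsupp.single { c with y := y', hy := hy' } 1)
  | inner (c : CompositeSymbol M N m) (σ : ∀ i, Equiv.Perm (Fin (c.n i))) :
      CompositeRel M N m (Finsupp.single (c.inner σ) 1 - Finsupp.single (c.innerLabel σ) 1)
  | outer (c : CompositeSymbol M N m) (s : Equiv.Perm (Fin c.r)) :
      CompositeRel M N m (Finsupp.single (c.outer s) 1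
        - (-1 : K) ^ koszulExp s c.b • Finsupp.single (c.outerPerm s) 1)

/-- The `K`-module `(M ∘ N)(m) = ⨁_r (M(r) ⊗ N^{⊗ r}(m))_{Σ_r}`, presented by generators (the
homogeneous composite elements) and relations. -/
abbrev CompositeModule (M : DGSymModule.{u, v} K) (N : DGSymModule.{u, w} K) (m : ℕ) :=
  (CompositeSymbol M N m →₀ K) ⧸ Submodule.span K {z | CompositeRel M N m z}

namespace CompositeModule

variable {M : DGSymModule.{u, v} K} {N : DGSymModule.{u, w} K} {m : ℕ}

/-- The composite element `x(y_1,…,y_r)` of `(M ∘ N)(m)`. -/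
def mk (c : CompositeSymbol M N m) : CompositeModule M N m :=
  Submodule.Quotient.mk (Finsupp.single c 1)

theorem mk_rel (z : CompositeSymbol M N m →₀ K) (hz : CompositeRel M N m z) :
    (Submodule.Quotient.mk z : CompositeModule M N m) = 0 :=
  (Submodule.Quotient.mk_eq_zero _).2 (Submodule.subset_span hz)

theorem mk_add_left (c : CompositeSymbol M N m) (x' : M c.r) (hx' : x' ∈ M.gr c.r c.a) :
    mk { c with x := c.x + x', hx := add_mem c.hx hx' } = mk c + mk { c with x := x', hx := hx' } := by
  have := mk_rel _ (CompositeRel.add_left c x' hx')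
  rw [Submodule.Quotient.mk_sub, Submodule.Quotient.mk_sub, sub_sub, sub_eq_zero] at this
  exact this

theorem mk_smul_left (c : CompositeSymbol M N m) (t : K) :
    mk { c with x := t • c.x, hx := Submodule.smul_mem _ t c.hx } = t • mk c := by
  have := mk_rel _ (CompositeRel.smul_left c t)
  rw [Submodule.Quotient.mk_sub, Submodule.Quotient.mk_smul, sub_eq_zero] at this
  exact this

theorem mk_add_right (c : CompositeSymbol M N m) (i : Fin c.r) (y' y'' : ∀ j, N (c.n j))
      (hy' : ∀ j, y' j ∈ N.gr (c.n j) (c.b j)) (hy'' : ∀ j, y'' j ∈ N.gr (c.n j) (c.b j))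
      (h : c.y i = y' i + y'' i) (h' : ∀ j, j ≠ i → y' j = c.y j)
      (h'' : ∀ j, j ≠ i → y'' j = c.y j) :
    mk c = mk { c with y := y', hy := hy' } + mk { c with y := y'', hy := hy'' } := by
  have := mk_rel _ (CompositeRel.add_right c i y' y'' hy' hy'' h h' h'')
  rw [Submodule.Quotient.mk_sub, Submodule.Quotient.mk_sub, sub_sub, sub_eq_zero] at this
  exact this

theorem mk_smul_right (c : CompositeSymbol M N m) (i : Fin c.r) (t : K) (y' : ∀ j, N (c.n j))
      (hy' : ∀ j, y' j ∈ N.gr (c.n j) (c.b j))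
      (h : c.y i = t • y' i) (h' : ∀ j, j ≠ i → y' j = c.y j) :
    mk c = t • mk { c with y := y', hy := hy' } := by
  have := mk_rel _ (CompositeRel.smul_right c i t y' hy' h h')
  rw [Submodule.Quotient.mk_sub, Submodule.Quotient.mk_smul, sub_eq_zero] at this
  exact this

theorem mk_inner (c : CompositeSymbol M N m) (σ : ∀ i, Equiv.Perm (Fin (c.n i))) :
    mk (c.inner σ) = mk (c.innerLabel σ) := by
  have := mk_rel _ (CompositeRel.inner c σ)
  rw [Submodule.Quotient.mk_sub, sub_eq_zero] at this
  exact this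

theorem mk_outer (c : CompositeSymbol M N m) (s : Equiv.Perm (Fin c.r)) :
    mk (c.outer s) = (-1 : K) ^ koszulExp s c.b • mk (c.outerPerm s) := by
  have := mk_rel _ (CompositeRel.outer c s)
  rw [Submodule.Quotient.mk_sub, Submodule.Quotient.mk_smul, sub_eq_zero] at this
  exact this

theorem mk_eq_zero_of_left (c : CompositeSymbol M N m) (h : c.x = 0) : mk c = 0 := by
  have := mk_smul_left c 0
  rw [zero_smul K (mk c)] at this
  rw [← this]
  congr 1
  obtain ⟨r, n, e, a, x, hx, b, y, hy⟩ := c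
  simp only [CompositeSymbol.mk.injEq, heq_eq_eq, true_and, and_true]
  simpa using h

theorem mk_eq_zero_of_right (c : CompositeSymbol M N m) (i : Fin c.r) (h : c.y i = 0) : mk c = 0 := by
  have := mk_smul_right c i 0 c.y c.hy (by simp [h]) (fun _ _ => rfl)
  rwa [zero_smul] at this

/-- Linear maps out of `(M ∘ N)(m)`. -/
def lift {A : Type*} [AddCommGroup A] [Module K A] (f : CompositeSymbol M N m → A)
    (hf : ∀ z, CompositeRel M N m z → Finsupp.linearCombination K f z = 0) : CompositeModule M N m →ₗ[K] A :=
  Submodule.liftQ _ (Finsupp.linearCombination K f) (by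
    rw [Submodule.span_le]
    intro z hz
    exact hf z hz)

theorem lift_mk {A : Type*} [AddCommGroup A] [Module K A] (f : CompositeSymbol M N m → A)
    (hf : ∀ z, CompositeRel M N m z → Finsupp.linearCombination K f z = 0) (c : CompositeSymbol M N m) :
    lift f hf (mk c) = f c := by
  simp only [lift, mk]
  rw [Submodule.liftQ_apply, Finsupp.linearCombination_single, one_smul]

theorem span_mk : Submodule.span K (Set.range (mk : CompositeSymbol M N m → CompositeModule M N m)) = ⊤ := by
  rw [eq_top_iff]
  rintro z -
  obtain ⟨z, rfl⟩ := Submodule.Quotient.mk_surjective _ z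
  induction z using Finsupp.induction_linear with
  | zero => exact zero_mem _
  | add f g hf hg => exact add_mem hf hg
  | single c t =>
    have : (Finsupp.single c t : CompositeSymbol M N m →₀ K) = t • Finsupp.single c 1 := by simp
    rw [this, Submodule.Quotient.mk_smul]
    exact Submodule.smul_mem _ _ (Submodule.subset_span ⟨c, rfl⟩)

theorem hom_ext {A : Type*} [AddCommGroup A] [Module K A] {f g : CompositeModule M N m →ₗ[K] A}
    (h : ∀ c, f (mk c) = g (mk c)) : f = g :=
  LinearMap.ext_on span_mk (by rintro _ ⟨c, rfl⟩; exact h c)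

/-- The component of degree `k`, generated by the composite elements of total degree `k`. -/
def gr (M : DGSymModule.{u, v} K) (N : DGSymModule.{u, w} K) (m k : ℕ) :
    Submodule K (CompositeModule M N m) :=
  Submodule.span K {z | ∃ c : CompositeSymbol M N m, c.deg = k ∧ mk c = z}

/-- The projection onto the component of degree `k`. -/
def proj (M : DGSymModule.{u, v} K) (N : DGSymModule.{u, w} K) (m k : ℕ) :
    CompositeModule M N m →ₗ[K] CompositeModule M N m :=
  lift (fun c => if c.deg = k then mk c else 0) (by
    intro z hz
    cases hz with
    | add_left c x' hx' =>
      have h := mk_add_left c x' hx'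
      obtain ⟨r, n, e, a, x, hx, b, y, hy⟩ := c
      simp only [map_sub, map_smul, Finsupp.linearCombination_single, one_smul,
        CompositeSymbol.deg] at h ⊢
      by_cases hk : a + ∑ i, b i = k
      · simp only [hk, if_true]
        rw [h]
        abel
      · simp only [hk, if_false, sub_self, smul_zero]
    | smul_left c t =>
      have h := mk_smul_left c t
      obtain ⟨r, n, e, a, x, hx, b, y, hy⟩ := c
      simp only [map_sub, map_smul, Finsupp.linearCombination_single, one_smul,
        CompositeSymbol.deg] at h ⊢
      by_cases hk : a + ∑ i, b i = k
      · simp only [hk, if_true]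
        rw [h]
        abel
      · simp only [hk, if_false, sub_self, smul_zero]
    | add_right c i y' y'' hy' hy'' h1 h2 h3 =>
      have h := mk_add_right c i y' y'' hy' hy'' h1 h2 h3
      obtain ⟨r, n, e, a, x, hx, b, y, hy⟩ := c
      simp only [map_sub, map_smul, Finsupp.linearCombination_single, one_smul,
        CompositeSymbol.deg] at h ⊢
      by_cases hk : a + ∑ i, b i = k
      · simp only [hk, if_true]
        rw [h]
        abel
      · simp only [hk, if_false, sub_self, smul_zero]
    | smul_right c i t y' hy' h1 h2 =>
      have h := mk_smul_right c i t y' hy' h1 h2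
      obtain ⟨r, n, e, a, x, hx, b, y, hy⟩ := c
      simp only [map_sub, map_smul, Finsupp.linearCombination_single, one_smul,
        CompositeSymbol.deg] at h ⊢
      by_cases hk : a + ∑ i, b i = k
      · simp only [hk, if_true]
        rw [h]
        abel
      · simp only [hk, if_false, sub_self, smul_zero]
    | inner c σ =>
      have h := mk_inner c σ
      have h' : (c.inner σ).deg = (c.innerLabel σ).deg := rfl
      simp only [map_sub, Finsupp.linearCombination_single, one_smul, h, h', sub_self]
    | outer c s =>
      have h := mk_outer c s
      have h' : (c.outerPerm s).deg = (c.outer s).deg := by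
        exact congrArg (c.a + ·) (Equiv.sum_comp s c.b)
      simp only [map_sub, map_smul, Finsupp.linearCombination_single, one_smul, h, h', smul_ite,
        smul_zero, sub_self])

theorem isInternal_gr (M : DGSymModule.{u, v} K) (N : DGSymModule.{u, w} K) (m : ℕ) :
    DirectSum.IsInternal (gr M N m) := by
  refine isInternal_of_projections _ (proj M N m) ?_ ?_ ?_
  · intro k x hx
    induction hx using Submodule.span_induction with
    | mem x h => obtain ⟨c, rfl, rfl⟩ := h; simp [proj, lift_mk]
    | zero => simp
    | add x y _ _ hx hy => rw [map_add, hx, hy]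
    | smul t x _ hx => rw [map_smul, hx]
  · intro k l x hx hl
    induction hx using Submodule.span_induction with
    | mem x h => obtain ⟨c, rfl, rfl⟩ := h; simp [proj, lift_mk, Ne.symm hl]
    | zero => simp
    | add x y _ _ hx hy => rw [map_add, hx, hy, add_zero]
    | smul t x _ hx => rw [map_smul, hx, smul_zero]
  · rw [eq_top_iff, ← span_mk, Submodule.span_le]
    rintro _ ⟨c, rfl⟩
    exact (le_iSup (gr M N m) c.deg) (Submodule.subset_span ⟨c, rfl, rfl⟩)

theorem mk_mem_gr (c : CompositeSymbol M N m) : mk c ∈ gr M N m c.deg :=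
  Submodule.subset_span ⟨c, rfl, rfl⟩

theorem mk_congr (c : CompositeSymbol M N m) {a' : ℕ} {x' : M c.r} {hx' : x' ∈ M.gr c.r a'}
    {b' : Fin c.r → ℕ} {y' : ∀ i, N (c.n i)} {hy' : ∀ i, y' i ∈ N.gr (c.n i) (b' i)}
    (ha : a' = c.a) (hx : x' = c.x) (hb : b' = c.b) (hy : y' = c.y) :
    mk { c with a := a', x := x', hx := hx', b := b', y := y', hy := hy' } = mk c := by
  subst ha hx hb hy
  rfl

/-- The action of a permutation on `(M ∘ N)(m)`. -/
def repHom (s : Equiv.Perm (Fin m)) : CompositeModule M N m →ₗ[K] CompositeModule M N m :=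
  lift (fun c => mk (c.relabel s)) (by
    intro z hz
    cases hz with
    | add_left c x' hx' =>
      simp only [map_sub, Finsupp.linearCombination_single, one_smul]
      rw [sub_sub, sub_eq_zero]
      exact mk_add_left (c.relabel s) x' hx'
    | smul_left c t =>
      simp only [map_sub, map_smul, Finsupp.linearCombination_single, one_smul]
      rw [sub_eq_zero]
      exact mk_smul_left (c.relabel s) t
    | add_right c i y' y'' hy' hy'' h1 h2 h3 =>
      simp only [map_sub, Finsupp.linearCombination_single, one_smul]
      rw [sub_sub, sub_eq_zero]
      exact mk_add_right (c.relabel s) i y' y'' hy' hy'' h1 h2 h3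
    | smul_right c i t y' hy' h1 h2 =>
      simp only [map_sub, map_smul, Finsupp.linearCombination_single, one_smul]
      rw [sub_eq_zero]
      exact mk_smul_right (c.relabel s) i t y' hy' h1 h2
    | inner c σ =>
      simp only [map_sub, Finsupp.linearCombination_single, one_smul]
      rw [sub_eq_zero]
      exact mk_inner (c.relabel s) σ
    | outer c w =>
      simp only [map_sub, map_smul, Finsupp.linearCombination_single, one_smul]
      rw [sub_eq_zero]
      exact mk_outer (c.relabel s) w)

@[simp] theorem repHom_mk (s : Equiv.Perm (Fin m)) (c : CompositeSymbol M N m) :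
    repHom s (mk c) = mk (c.relabel s) := lift_mk _ _ _

/-- The differential of a composite element:
`δ(x)(y_1,…,y_r) + ∑_i (-1)^{|x|+|y_1|+…+|y_{i-1}|} x(y_1,…,δ(y_i),…,y_r)`. -/
def dMk (c : CompositeSymbol M N m) : CompositeModule M N m :=
  mk c.dLeft + ∑ i, (-1 : K) ^ c.dExp i • mk (c.dRight i)

theorem dMk_add_left (c : CompositeSymbol M N m) (x' : M c.r) (hx' : x' ∈ M.gr c.r c.a) :
    dMk { c with x := c.x + x', hx := add_mem c.hx hx' }
      = dMk c + dMk { c with x := x', hx := hx' } := by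
  have h1 : mk (CompositeSymbol.dLeft { c with x := c.x + x', hx := add_mem c.hx hx' })
      = mk c.dLeft + mk (CompositeSymbol.dLeft { c with x := x', hx := hx' }) := by
    refine Eq.trans ?_ (mk_add_left c.dLeft (M.d c.r x') (M.d_mem_pred _ _ _ hx'))
    exact mk_congr { c.dLeft with x := _, hx := add_mem c.dLeft.hx (M.d_mem_pred _ _ _ hx') }
      rfl (map_add (M.d c.r) _ _) rfl rfl
  have h2 : ∀ i, mk (CompositeSymbol.dRight { c with x := c.x + x', hx := add_mem c.hx hx' } i)
      = mk (c.dRight i) + mk (CompositeSymbol.dRight { c with x := x', hx := hx' } i) :=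
    fun i => mk_add_left (c.dRight i) x' hx'
  simp only [dMk]
  rw [h1, add_add_add_comm, ← Finset.sum_add_distrib]
  congr 1
  refine Finset.sum_congr rfl fun i _ => ?_
  rw [h2, smul_add]

theorem dMk_smul_left (c : CompositeSymbol M N m) (t : K) :
    dMk { c with x := t • c.x, hx := Submodule.smul_mem _ t c.hx } = t • dMk c := by
  have h1 : mk (CompositeSymbol.dLeft { c with x := t • c.x, hx := Submodule.smul_mem _ t c.hx })
      = t • mk c.dLeft := by
    refine Eq.trans ?_ (mk_smul_left c.dLeft t)
    exact mk_congr { c.dLeft with x := _, hx := Submodule.smul_mem _ t c.dLeft.hx }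
      rfl (map_smul (M.d c.r) _ _) rfl rfl
  have h2 : ∀ i, mk (CompositeSymbol.dRight
      { c with x := t • c.x, hx := Submodule.smul_mem _ t c.hx } i) = t • mk (c.dRight i) :=
    fun i => mk_smul_left (c.dRight i) t
  simp only [dMk]
  rw [h1, smul_add, Finset.smul_sum]
  congr 1
  refine Finset.sum_congr rfl fun i _ => ?_
  rw [h2, smul_comm]

theorem dMk_add_right (c : CompositeSymbol M N m) (i : Fin c.r) (y' y'' : ∀ j, N (c.n j))
      (hy' : ∀ j, y' j ∈ N.gr (c.n j) (c.b j)) (hy'' : ∀ j, y'' j ∈ N.gr (c.n j) (c.b j))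
      (h : c.y i = y' i + y'' i) (h' : ∀ j, j ≠ i → y' j = c.y j)
      (h'' : ∀ j, j ≠ i → y'' j = c.y j) :
    dMk c = dMk { c with y := y', hy := hy' } + dMk { c with y := y'', hy := hy'' } := by
  have h1 : mk c.dLeft = mk (CompositeSymbol.dLeft { c with y := y', hy := hy' })
      + mk (CompositeSymbol.dLeft { c with y := y'', hy := hy'' }) :=
    mk_add_right c.dLeft i y' y'' hy' hy'' h h' h''
  have h2 : ∀ k, mk (c.dRight k) = mk (CompositeSymbol.dRight { c with y := y', hy := hy' } k)
      + mk (CompositeSymbol.dRight { c with y := y'', hy := hy'' } k) := by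
    intro k
    refine mk_add_right (c.dRight k) i _ _ (CompositeSymbol.dRight { c with y := y', hy := hy' } k).hy
      (CompositeSymbol.dRight { c with y := y'', hy := hy'' } k).hy ?_ ?_ ?_
    · rcases eq_or_ne i k with rfl | hk
      · simp [CompositeSymbol.dRight, h]
      · simp [CompositeSymbol.dRight, Function.update_of_ne hk, h]
    · intro (j : Fin c.r) hj
      rcases eq_or_ne j k with rfl | hk
      · simp [CompositeSymbol.dRight, h' _ hj]
      · simp [CompositeSymbol.dRight, Function.update_of_ne hk, h' _ hj]
    · intro (j : Fin c.r) hj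
      rcases eq_or_ne j k with rfl | hk
      · simp [CompositeSymbol.dRight, h'' _ hj]
      · simp [CompositeSymbol.dRight, Function.update_of_ne hk, h'' _ hj]
  simp only [dMk]
  rw [h1, add_add_add_comm, ← Finset.sum_add_distrib]
  congr 1
  refine Finset.sum_congr rfl fun k _ => ?_
  rw [h2, smul_add]

theorem dMk_smul_right (c : CompositeSymbol M N m) (i : Fin c.r) (t : K) (y' : ∀ j, N (c.n j))
      (hy' : ∀ j, y' j ∈ N.gr (c.n j) (c.b j))
      (h : c.y i = t • y' i) (h' : ∀ j, j ≠ i → y' j = c.y j) :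
    dMk c = t • dMk { c with y := y', hy := hy' } := by
  have h1 : mk c.dLeft = t • mk (CompositeSymbol.dLeft { c with y := y', hy := hy' }) :=
    mk_smul_right c.dLeft i t y' hy' h h'
  have h2 : ∀ k, mk (c.dRight k)
      = t • mk (CompositeSymbol.dRight { c with y := y', hy := hy' } k) := by
    intro k
    refine mk_smul_right (c.dRight k) i t _
      (CompositeSymbol.dRight { c with y := y', hy := hy' } k).hy ?_ ?_
    · rcases eq_or_ne i k with rfl | hk
      · simp [CompositeSymbol.dRight, h]
      · simp [CompositeSymbol.dRight, Function.update_of_ne hk, h]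
    · intro (j : Fin c.r) hj
      rcases eq_or_ne j k with rfl | hk
      · simp [CompositeSymbol.dRight, h' _ hj]
      · simp [CompositeSymbol.dRight, Function.update_of_ne hk, h' _ hj]
  simp only [dMk]
  rw [h1, smul_add, Finset.smul_sum]
  congr 1
  refine Finset.sum_congr rfl fun k _ => ?_
  rw [h2, smul_comm]

theorem dMk_inner (c : CompositeSymbol M N m) (σ : ∀ i, Equiv.Perm (Fin (c.n i))) :
    dMk (c.inner σ) = dMk (c.innerLabel σ) := by
  have h1 : mk (c.inner σ).dLeft = mk (c.innerLabel σ).dLeft := mk_inner c.dLeft σ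
  have h2 : ∀ k, mk ((c.inner σ).dRight k) = mk ((c.innerLabel σ).dRight k) := by
    intro k
    refine Eq.trans ?_ (mk_inner (c.dRight k) σ)
    refine mk_congr ((c.dRight k).inner σ) rfl rfl rfl ?_
    funext j
    rcases eq_or_ne j k with rfl | hk
    · simp [CompositeSymbol.dRight, CompositeSymbol.inner, N.d_rep]
    · simp [CompositeSymbol.dRight, CompositeSymbol.inner, Function.update_of_ne hk]
  simp only [dMk]
  rw [h1]
  congr 1
  refine Finset.sum_congr rfl fun k _ => ?_
  rw [h2]

/-- Compatibility of the Koszul signs with the lowering of one degree. -/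
theorem koszul_sign {r : ℕ} (s : Equiv.Perm (Fin r)) (b : Fin r → ℕ) (i : Fin r)
    (hb : b (s i) ≠ 0) :
    (-1 : K) ^ (∑ j, if j < s i then b j else 0)
        * (-1) ^ koszulExp s (Function.update b (s i) (b (s i) - 1))
      = (-1 : K) ^ koszulExp s b * (-1) ^ (∑ j, if j < i then b (s j) else 0) := by
  obtain ⟨k, hk⟩ := Nat.exists_eq_succ_of_ne_zero hb
  -- the part of the Koszul exponent which involves the index `i`
  have key : koszulExp s b = koszulExp s (Function.update b (s i) k)
      + ((∑ j, if i < j ∧ s j < s i then b (s j) else 0)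
        + ∑ j, if j < i ∧ s i < s j then b (s j) else 0) := by
    have e1 : (∑ j, if i < j ∧ s j < s i then b (s j) else 0)
        = ∑ p, ∑ q, if p = i then (if i < q ∧ s q < s i then b (s q) else 0) else 0 := by
      rw [Finset.sum_comm]
      simp
    have e2 : (∑ j, if j < i ∧ s i < s j then b (s j) else 0)
        = ∑ p, ∑ q, if q = i then (if p < i ∧ s i < s p then b (s p) else 0) else 0 := by
      simp
    rw [e1, e2, koszulExp, koszulExp, ← Finset.sum_add_distrib, ← Finset.sum_add_distrib]
    refine Finset.sum_congr rfl fun p _ => ?_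
    rw [← Finset.sum_add_distrib, ← Finset.sum_add_distrib]
    refine Finset.sum_congr rfl fun q _ => ?_
    by_cases hp : p = i
    · subst hp
      by_cases hq : q = p
      · subst hq; simp
      · have : s q ≠ s p := fun h => hq (s.injective h)
        simp [hq, Function.update_of_ne this, hk]
        split_ifs <;> ring
    · have hp' : s p ≠ s i := fun h => hp (s.injective h)
      by_cases hq : q = i
      · subst hq
        simp [hp, Function.update_of_ne hp', hk]
        split_ifs <;> ring
      · have hq' : s q ≠ s i := fun h => hq (s.injective h)
        simp [hp, hq, Function.update_of_ne hp', Function.update_of_ne hq']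
  have e3 : (∑ j, if j < s i then b j else 0) = (∑ j, if s j < s i then b (s j) else 0) :=
    (Equiv.sum_comp s (fun j => if j < s i then b j else 0)).symm
  have e4 : (∑ j, if s j < s i then b (s j) else 0)
      = (∑ j, if j < i ∧ s j < s i then b (s j) else 0)
        + ∑ j, if i < j ∧ s j < s i then b (s j) else 0 := by
    rw [← Finset.sum_add_distrib]
    refine Finset.sum_congr rfl fun j _ => ?_
    rcases lt_trichotomy j i with h | h | h
    · simp [h, h.not_gt]
    · subst h; simp
    · simp [h, h.not_gt]
  have e5 : (∑ j, if j < i then b (s j) else 0)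
      = (∑ j, if j < i ∧ s j < s i then b (s j) else 0)
        + ∑ j, if j < i ∧ s i < s j then b (s j) else 0 := by
    rw [← Finset.sum_add_distrib]
    refine Finset.sum_congr rfl fun j _ => ?_
    by_cases h : j < i
    · have : s j ≠ s i := fun h' => h.ne (s.injective h')
      rcases lt_or_gt_of_ne this with h1 | h1
      · simp [h, h1, h1.not_gt]
      · simp [h, h1, h1.not_gt]
    · simp [h]
  have hk' : b (s i) - 1 = k := by omega
  rw [hk', key, e3, e4, e5]
  generalize (∑ j, if i < j ∧ s j < s i then b (s j) else 0) = A
  generalize (∑ j, if j < i ∧ s i < s j then b (s j) else 0) = B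
  generalize (∑ j, if j < i ∧ s j < s i then b (s j) else 0) = C
  generalize koszulExp s (Function.update b (s i) k) = D
  have hB : (-1 : K) ^ B * (-1) ^ B = 1 := by rw [← mul_pow]; simp
  simp only [pow_add]
  linear_combination (-(-1 : K) ^ A * (-1) ^ C * (-1) ^ D) * hB

theorem dMk_outer (c : CompositeSymbol M N m) (s : Equiv.Perm (Fin c.r)) :
    dMk (c.outer s) = (-1 : K) ^ koszulExp s c.b • dMk (c.outerPerm s) := by
  have h1 : mk (c.outer s).dLeft = (-1 : K) ^ koszulExp s c.b • mk (c.outerPerm s).dLeft := by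
    refine Eq.trans ?_ (mk_outer c.dLeft s)
    exact mk_congr (c.dLeft.outer s) rfl (M.d_rep _ _ _) rfl rfl
  have h2 : ∀ i : Fin c.r, (-1 : K) ^ (c.outer s).dExp (s i) • mk ((c.outer s).dRight (s i))
      = (-1 : K) ^ koszulExp s c.b •
        ((-1 : K) ^ (c.outerPerm s).dExp i • mk ((c.outerPerm s).dRight i)) := by
    intro i
    by_cases hb : c.b (s i) = 0
    · have hd : N.d (c.n (s i)) (c.y (s i)) = 0 := N.d_zero _ _ (hb ▸ c.hy (s i))
      rw [mk_eq_zero_of_right ((c.outer s).dRight (s i)) (s i),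
        mk_eq_zero_of_right ((c.outerPerm s).dRight i) i]
      · simp
      · simpa [CompositeSymbol.dRight, CompositeSymbol.outerPerm] using hd
      · simpa [CompositeSymbol.dRight, CompositeSymbol.outer] using hd
    · have e1 : mk ((c.outer s).dRight (s i))
          = (-1 : K) ^ koszulExp s (c.dRight (s i)).b • mk ((c.dRight (s i)).outerPerm s) :=
        mk_outer (c.dRight (s i)) s
      have e2 : mk ((c.outerPerm s).dRight i) = mk ((c.dRight (s i)).outerPerm s) := by
        refine mk_congr ((c.dRight (s i)).outerPerm s) rfl rfl ?_ ?_
        · funext j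
          rcases eq_or_ne j i with rfl | hj
          · simp [CompositeSymbol.dRight, CompositeSymbol.outerPerm]
          · have : s j ≠ s i := fun h => hj (s.injective h)
            simp [CompositeSymbol.dRight, CompositeSymbol.outerPerm, Function.update_of_ne hj,
              Function.update_of_ne this]
        · funext j
          rcases eq_or_ne j i with rfl | hj
          · simp [CompositeSymbol.dRight, CompositeSymbol.outerPerm]
          · have : s j ≠ s i := fun h => hj (s.injective h)
            simp [CompositeSymbol.dRight, CompositeSymbol.outerPerm, Function.update_of_ne hj,
              Function.update_of_ne this]
      rw [e1, e2, smul_smul, smul_smul]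
      congr 1
      have := koszul_sign (K := K) s c.b i hb
      simp only [CompositeSymbol.dExp, pow_add]
      change (-1 : K) ^ c.a * (-1) ^ (∑ j, if j < s i then c.b j else 0)
          * (-1) ^ koszulExp s (Function.update c.b (s i) (c.b (s i) - 1))
        = (-1) ^ koszulExp s c.b * ((-1) ^ c.a * (-1) ^ (∑ j, if j < i then c.b (s j) else 0))
      linear_combination (-1 : K) ^ c.a * this
  have h3 : ∑ i, (-1 : K) ^ (c.outer s).dExp i • mk ((c.outer s).dRight i)
      = ∑ i, (-1 : K) ^ (c.outer s).dExp (s i) • mk ((c.outer s).dRight (s i)) :=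
    (Equiv.sum_comp s (fun i => (-1 : K) ^ (c.outer s).dExp i • mk ((c.outer s).dRight i))).symm
  simp only [dMk]
  rw [h1, smul_add, Finset.smul_sum]
  congr 1
  rw [h3]
  exact Finset.sum_congr rfl fun i _ => h2 i

/-- The differential of `(M ∘ N)(m)`. -/
def dHom (M : DGSymModule.{u, v} K) (N : DGSymModule.{u, w} K) (m : ℕ) :
    CompositeModule M N m →ₗ[K] CompositeModule M N m :=
  lift dMk (by
    intro z hz
    cases hz with
    | add_left c x' hx' =>
      simp only [map_sub, Finsupp.linearCombination_single, one_smul]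
      rw [dMk_add_left c x' hx', sub_sub, sub_self]
    | smul_left c t =>
      simp only [map_sub, map_smul, Finsupp.linearCombination_single, one_smul]
      rw [dMk_smul_left c t, sub_self]
    | add_right c i y' y'' hy' hy'' h1 h2 h3 =>
      simp only [map_sub, Finsupp.linearCombination_single, one_smul]
      rw [dMk_add_right c i y' y'' hy' hy'' h1 h2 h3, sub_sub, sub_self]
    | smul_right c i t y' hy' h1 h2 =>
      simp only [map_sub, map_smul, Finsupp.linearCombination_single, one_smul]
      rw [dMk_smul_right c i t y' hy' h1 h2, sub_self]
    | inner c σ =>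
      simp only [map_sub, Finsupp.linearCombination_single, one_smul]
      rw [dMk_inner c σ, sub_self]
    | outer c s =>
      simp only [map_sub, map_smul, Finsupp.linearCombination_single, one_smul]
      rw [dMk_outer c s, sub_self])

@[simp] theorem dHom_mk (c : CompositeSymbol M N m) : dHom M N m (mk c) = dMk c := lift_mk _ _ _

theorem dRight_dRight_eq_zero (c : CompositeSymbol M N m) (i : Fin c.r) :
    mk ((c.dRight i).dRight i) = 0 := by
  refine mk_eq_zero_of_right _ i ?_
  simp [CompositeSymbol.dRight, N.d_d]

theorem mk_dRight_of_b_eq_zero (c : CompositeSymbol M N m) (i : Fin c.r) (h : c.b i = 0) :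
    mk (c.dRight i) = 0 := by
  refine mk_eq_zero_of_right _ i ?_
  simpa [CompositeSymbol.dRight] using N.d_zero _ _ (h ▸ c.hy i)

theorem mk_dRight_comm (c : CompositeSymbol M N m) (i j : Fin c.r) (h : i ≠ j) :
    mk ((c.dRight i).dRight j) = mk ((c.dRight j).dRight i) := by
  refine mk_congr ((c.dRight j).dRight i) rfl rfl ?_ ?_
  · simp only [CompositeSymbol.dRight]
    rw [Function.update_of_ne h.symm, Function.update_of_ne h, Function.update_comm h]
  · simp only [CompositeSymbol.dRight]
    rw [Function.update_of_ne h.symm, Function.update_of_ne h, Function.update_comm h]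

theorem sum_update_of_not_lt {r : ℕ} (b : Fin r → ℕ) (i j : Fin r) (h : ¬ i < j) (v : ℕ) :
    (∑ l, if l < j then Function.update b i v l else 0) = ∑ l, if l < j then b l else 0 := by
  refine Finset.sum_congr rfl fun l _ => ?_
  split_ifs with hl
  · rw [Function.update_of_ne (by rintro rfl; exact h hl)]
  · rfl

theorem sum_update_of_lt {r : ℕ} (b : Fin r → ℕ) (i j : Fin r) (h : i < j) (hb : b i ≠ 0) :
    (∑ l, if l < j then Function.update b i (b i - 1) l else 0) + 1
      = ∑ l, if l < j then b l else 0 := by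
  have h1 : (1 : ℕ) = ∑ l, if l = i then 1 else 0 := by simp
  rw [h1, ← Finset.sum_add_distrib]
  refine Finset.sum_congr rfl fun l _ => ?_
  rcases eq_or_ne l i with rfl | hl
  · simp [h]; omega
  · simp [hl, Function.update_of_ne hl]

theorem dRight_anticomm (c : CompositeSymbol M N m) (i j : Fin c.r) (h : i < j)
    (hi : c.b i ≠ 0) :
    (-1 : K) ^ c.dExp i * (-1) ^ (c.dRight i).dExp j
      = - ((-1) ^ c.dExp j * (-1) ^ (c.dRight j).dExp i) := by
  have h1 := sum_update_of_lt c.b i j h hi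
  have h2 := sum_update_of_not_lt c.b j i h.not_gt (c.b j - 1)
  have e1 : (c.dRight i).dExp j + 1 = c.dExp j := by
    simp only [CompositeSymbol.dExp, CompositeSymbol.dRight]
    rw [← h1]; ring_nf
  have e2 : (c.dRight j).dExp i = c.dExp i := by
    simp only [CompositeSymbol.dExp, CompositeSymbol.dRight]
    rw [← h2]
  rw [e2, ← e1, pow_succ]
  ring

theorem dHom_dMk (c : CompositeSymbol M N m) : dHom M N m (dMk c) = 0 := by
  have h0 : mk c.dLeft.dLeft = 0 := mk_eq_zero_of_left _ (M.d_d _ _)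
  have h1 : ∀ i, (-1 : K) ^ c.dLeft.dExp i • mk (c.dLeft.dRight i)
      + (-1 : K) ^ c.dExp i • mk (c.dRight i).dLeft = 0 := by
    intro i
    have e : mk (c.dRight i).dLeft = mk (c.dLeft.dRight i) := rfl
    by_cases ha : c.a = 0
    · have : mk (c.dLeft.dRight i) = 0 :=
        mk_eq_zero_of_left _ (M.d_zero _ _ (ha ▸ c.hx))
      rw [e, this, smul_zero, smul_zero, add_zero]
    · have e1 : c.dExp i = c.dLeft.dExp i + 1 := by
        simp only [CompositeSymbol.dExp, CompositeSymbol.dLeft]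
        omega
      rw [e, e1, ← add_smul, pow_succ]
      simp
  have h2 : ∑ i : Fin c.r, ∑ j : Fin c.r, ((-1 : K) ^ c.dExp i * (-1) ^ (c.dRight i).dExp j) •
      mk ((c.dRight i).dRight j) = 0 := by
    rw [← Finset.sum_product']
    refine Finset.sum_involution (fun p _ => (p.2, p.1)) ?_ ?_ ?_ ?_
    · rintro ⟨i, j⟩ -
      have key : ∀ i j : Fin c.r, i < j →
          ((-1 : K) ^ c.dExp i * (-1) ^ (c.dRight i).dExp j) • mk ((c.dRight i).dRight j)
          + ((-1 : K) ^ c.dExp j * (-1) ^ (c.dRight j).dExp i) • mk ((c.dRight j).dRight i)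
            = 0 := by
        intro i j hij
        by_cases hi : c.b i = 0
        · have e : mk ((c.dRight j).dRight i) = 0 := by
            refine mk_dRight_of_b_eq_zero _ _ ?_
            simpa [CompositeSymbol.dRight, Function.update_of_ne hij.ne] using hi
          rw [mk_dRight_comm c i j hij.ne, e, smul_zero, smul_zero, add_zero]
        · rw [dRight_anticomm c i j hij hi, mk_dRight_comm c i j hij.ne, neg_smul, neg_add_cancel]
      rcases lt_trichotomy i j with h | h | h
      · exact key i j h
      · subst h
        simp only [dRight_dRight_eq_zero, smul_zero, add_zero]
      · rw [add_comm]; exact key j i h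
    · rintro ⟨i, j⟩ - h h'
      simp only [Prod.mk.injEq] at h'
      obtain ⟨rfl, -⟩ := h'
      exact h (by rw [dRight_dRight_eq_zero, smul_zero])
    · intro _ _; simp
    · intro _ _; rfl
  have e1 : dHom M N m (mk c.dLeft) = mk c.dLeft.dLeft
      + ∑ i, (-1 : K) ^ c.dLeft.dExp i • mk (c.dLeft.dRight i) := dHom_mk _
  have e2 : ∀ i, dHom M N m (mk (c.dRight i)) = mk (c.dRight i).dLeft
      + ∑ j, (-1 : K) ^ (c.dRight i).dExp j • mk ((c.dRight i).dRight j) := fun i => dHom_mk _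
  rw [dMk, map_add, map_sum, e1, h0, zero_add]
  simp only [map_smul, e2, smul_add, Finset.smul_sum, smul_smul]
  rw [Finset.sum_add_distrib, ← add_assoc, h2, add_zero]
  exact (Finset.sum_add_distrib (f := fun i : Fin c.r => (-1 : K) ^ c.dLeft.dExp i •
    mk (c.dLeft.dRight i))).symm.trans (Finset.sum_eq_zero fun i _ => h1 i)

theorem dMk_mem (c : CompositeSymbol M N m) (k : ℕ) (h : c.deg = k + 1) :
    dMk c ∈ gr M N m k := by
  refine add_mem ?_ (Submodule.sum_mem _ fun i _ => Submodule.smul_mem _ _ ?_)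
  · by_cases ha : c.a = 0
    · rw [mk_eq_zero_of_left c.dLeft (M.d_zero _ _ (ha ▸ c.hx))]
      exact zero_mem _
    · refine Submodule.subset_span ⟨c.dLeft, ?_, rfl⟩
      simp only [CompositeSymbol.deg, CompositeSymbol.dLeft] at h ⊢
      omega
  · by_cases hb : c.b i = 0
    · rw [mk_dRight_of_b_eq_zero c i hb]
      exact zero_mem _
    · refine Submodule.subset_span ⟨c.dRight i, ?_, rfl⟩
      simp only [CompositeSymbol.deg, CompositeSymbol.dRight] at h ⊢
      have h1 := Finset.sum_update_of_mem (Finset.mem_univ i) c.b (c.b i - 1)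
      have h2 := Finset.add_sum_erase Finset.univ c.b (Finset.mem_univ i)
      rw [Finset.sdiff_singleton_eq_erase] at h1
      omega

theorem dMk_eq_zero (c : CompositeSymbol M N m) (h : c.deg = 0) : dMk c = 0 := by
  simp only [CompositeSymbol.deg, Nat.add_eq_zero_iff, Finset.sum_eq_zero_iff] at h
  rw [dMk, mk_eq_zero_of_left c.dLeft (M.d_zero _ _ (h.1 ▸ c.hx)), zero_add]
  refine Finset.sum_eq_zero fun i hi => ?_
  rw [mk_dRight_of_b_eq_zero c i (h.2 i hi), smul_zero]

end CompositeModule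

/-- The composition product `M ∘ N` of dg-`Σ_*`-modules. -/
abbrev compose (M : DGSymModule.{u, v} K) (N : DGSymModule.{u, w} K) :
    DGSymModule.{u, max u v w} K where
  carrier := CompositeModule M N
  addCommGroup m := Submodule.Quotient.addCommGroup _
  module m := Submodule.Quotient.module _
  gr := CompositeModule.gr M N
  isInternal := CompositeModule.isInternal_gr M N
  rep m :=
    { toFun := CompositeModule.repHom
      map_one' := CompositeModule.hom_ext fun c => by
        rw [CompositeModule.repHom_mk]
        rfl
      map_mul' := fun s t => CompositeModule.hom_ext fun c => by
        rw [CompositeModule.repHom_mk, Module.End.mul_apply, CompositeModule.repHom_mk,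
          CompositeModule.repHom_mk]
        rfl }
  rep_mem m s k x hx := by
    change CompositeModule.repHom s x ∈ _
    induction hx using Submodule.span_induction with
    | mem x h =>
      obtain ⟨c, rfl, rfl⟩ := h
      rw [CompositeModule.repHom_mk]
      exact Submodule.subset_span ⟨c.relabel s, rfl, rfl⟩
    | zero => rw [map_zero]; exact zero_mem _
    | add x y _ _ hx hy => rw [map_add]; exact add_mem hx hy
    | smul t x _ hx => rw [map_smul]; exact Submodule.smul_mem _ _ hx
  d := CompositeModule.dHom M N
  d_mem m k x hx := by
    induction hx using Submodule.span_induction with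
    | mem x h =>
      obtain ⟨c, hc, rfl⟩ := h
      rw [CompositeModule.dHom_mk]
      exact CompositeModule.dMk_mem c k hc
    | zero => rw [map_zero]; exact zero_mem _
    | add x y _ _ hx hy => rw [map_add]; exact add_mem hx hy
    | smul t x _ hx => rw [map_smul]; exact Submodule.smul_mem _ _ hx
  d_zero m x hx := by
    induction hx using Submodule.span_induction with
    | mem x h =>
      obtain ⟨c, hc, rfl⟩ := h
      rw [CompositeModule.dHom_mk]
      exact CompositeModule.dMk_eq_zero c hc
    | zero => rw [map_zero]
    | add x y _ _ hx hy => rw [map_add, hx, hy, add_zero]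
    | smul t x _ hx => rw [map_smul, hx, smul_zero]
  d_d m x := by
    have : (CompositeModule.dHom M N m).comp (CompositeModule.dHom M N m) = 0 :=
      CompositeModule.hom_ext fun c => by
        rw [LinearMap.comp_apply, CompositeModule.dHom_mk, CompositeModule.dHom_dMk]
        rfl
    exact LinearMap.congr_fun this x
  d_rep m s x := by
    have : (CompositeModule.dHom M N m).comp (CompositeModule.repHom s)
        = (CompositeModule.repHom s).comp (CompositeModule.dHom M N m) :=
      CompositeModule.hom_ext fun c => by
        rw [LinearMap.comp_apply, LinearMap.comp_apply, CompositeModule.repHom_mk,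
          CompositeModule.dHom_mk, CompositeModule.dHom_mk, CompositeModule.dMk,
          CompositeModule.dMk, map_add, map_sum, CompositeModule.repHom_mk]
        simp only [map_smul, CompositeModule.repHom_mk]
    exact LinearMap.congr_fun this x

namespace compose

variable {M : DGSymModule.{u, v₁} K} {M' : DGSymModule.{u, v₂} K}
  {N : DGSymModule.{u, v₃} K} {N' : DGSymModule.{u, v₄} K}

/-- The composite element `x(y_1,…,y_r)`, as an element of the dg-`Σ_*`-module `M ∘ N`. -/
def mk {m : ℕ} (c : CompositeSymbol M N m) : (compose M N) m := CompositeModule.mk c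

/-- `(f, g)` applied to the data of a composite element. -/
abbrev mapSymbol (f : GrHom M M') (g : GrHom N N') {m : ℕ} (c : CompositeSymbol M N m) :
    CompositeSymbol M' N' m where
  r := c.r
  n := c.n
  e := c.e
  a := c.a
  x := f.toFun _ c.x
  hx := f.map_mem _ _ _ c.hx
  b := c.b
  y := fun i => g.toFun _ (c.y i)
  hy := fun i => g.map_mem _ _ _ (c.hy i)

/-- The map `x(y_1,…,y_r) ↦ f(x)(g(y_1),…,g(y_r))`. -/
def mapHom (f : GrHom M M') (g : GrHom N N') (m : ℕ) :
    CompositeModule M N m →ₗ[K] CompositeModule M' N' m :=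
  CompositeModule.lift (fun c => CompositeModule.mk (mapSymbol f g c)) (by
    intro z hz
    cases hz with
    | add_left c x' hx' =>
      simp only [map_sub, Finsupp.linearCombination_single, one_smul]
      rw [sub_sub, sub_eq_zero]
      refine Eq.trans ?_ (CompositeModule.mk_add_left (mapSymbol f g c) (f.toFun _ x')
        (f.map_mem _ _ _ hx'))
      exact CompositeModule.mk_congr
        { mapSymbol f g c with x := _, hx := add_mem (mapSymbol f g c).hx (f.map_mem _ _ _ hx') }
        rfl (map_add _ _ _) rfl rfl
    | smul_left c t =>
      simp only [map_sub, map_smul, Finsupp.linearCombination_single, one_smul]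
      rw [sub_eq_zero]
      refine Eq.trans ?_ (CompositeModule.mk_smul_left (mapSymbol f g c) t)
      exact CompositeModule.mk_congr
        { mapSymbol f g c with x := _, hx := Submodule.smul_mem _ t (mapSymbol f g c).hx }
        rfl (map_smul _ _ _) rfl rfl
    | add_right c i y' y'' hy' hy'' h1 h2 h3 =>
      simp only [map_sub, Finsupp.linearCombination_single, one_smul]
      rw [sub_sub, sub_eq_zero]
      exact CompositeModule.mk_add_right (mapSymbol f g c) i _ _
        (fun j => g.map_mem _ _ _ (hy' j)) (fun j => g.map_mem _ _ _ (hy'' j))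
        (by simp only [h1, map_add]) (fun j hj => by simp only [h2 j hj])
        (fun j hj => by simp only [h3 j hj])
    | smul_right c i t y' hy' h1 h2 =>
      simp only [map_sub, map_smul, Finsupp.linearCombination_single, one_smul]
      rw [sub_eq_zero]
      exact CompositeModule.mk_smul_right (mapSymbol f g c) i t _
        (fun j => g.map_mem _ _ _ (hy' j))
        (by simp only [h1, map_smul]) (fun j hj => by simp only [h2 j hj])
    | inner c σ =>
      simp only [map_sub, Finsupp.linearCombination_single, one_smul]
      rw [sub_eq_zero]
      refine Eq.trans ?_ (CompositeModule.mk_inner (mapSymbol f g c) σ)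
      exact CompositeModule.mk_congr ((mapSymbol f g c).inner σ) rfl rfl rfl
        (funext fun j => g.map_rep _ _ _)
    | outer c w =>
      simp only [map_sub, map_smul, Finsupp.linearCombination_single, one_smul]
      rw [sub_eq_zero]
      refine Eq.trans ?_ (CompositeModule.mk_outer (mapSymbol f g c) w)
      exact CompositeModule.mk_congr ((mapSymbol f g c).outer w) rfl (f.map_rep _ _ _) rfl rfl)

theorem mapHom_mk (f : GrHom M M') (g : GrHom N N') {m : ℕ} (c : CompositeSymbol M N m) :
    mapHom f g m (CompositeModule.mk c) = CompositeModule.mk (mapSymbol f g c) :=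
  CompositeModule.lift_mk _ _ _

/-- Functoriality of the composition product with respect to morphisms of graded
`Σ_*`-modules. -/
def grMap (f : GrHom M M') (g : GrHom N N') : GrHom (compose M N) (compose M' N') where
  toFun := mapHom f g
  map_mem m k x hx := by
    induction hx using Submodule.span_induction with
    | mem x h =>
      obtain ⟨c, rfl, rfl⟩ := h
      rw [mapHom_mk]
      exact Submodule.subset_span ⟨mapSymbol f g c, rfl, rfl⟩
    | zero => rw [map_zero]; exact zero_mem _
    | add x y _ _ hx hy => rw [map_add]; exact add_mem hx hy
    | smul t x _ hx => rw [map_smul]; exact Submodule.smul_mem _ _ hx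
  map_rep m s x := by
    have : (mapHom f g m).comp (CompositeModule.repHom s)
        = (CompositeModule.repHom s).comp (mapHom f g m) :=
      CompositeModule.hom_ext fun c => by
        rw [LinearMap.comp_apply, LinearMap.comp_apply, CompositeModule.repHom_mk,
          mapHom_mk, mapHom_mk, CompositeModule.repHom_mk]
    exact LinearMap.congr_fun this x

/-- Functoriality of the composition product with respect to morphisms of dg-`Σ_*`-modules. -/
def map (f : DGHom M M') (g : DGHom N N') : DGHom (compose M N) (compose M' N') where
  toGrHom := grMap f.toGrHom g.toGrHom
  map_d m x := by
    have : (mapHom f.toGrHom g.toGrHom m).comp (CompositeModule.dHom M N m)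
        = (CompositeModule.dHom M' N' m).comp (mapHom f.toGrHom g.toGrHom m) :=
      CompositeModule.hom_ext fun c => by
        rw [LinearMap.comp_apply, LinearMap.comp_apply, CompositeModule.dHom_mk,
          mapHom_mk, CompositeModule.dHom_mk, CompositeModule.dMk, CompositeModule.dMk, map_add,
          map_sum, mapHom_mk]
        congr 1
        · exact CompositeModule.mk_congr (mapSymbol f.toGrHom g.toGrHom c).dLeft rfl
            (f.map_d _ _) rfl rfl
        · refine Finset.sum_congr rfl fun i _ => ?_
          rw [map_smul, mapHom_mk]
          congr 1
          refine CompositeModule.mk_congr ((mapSymbol f.toGrHom g.toGrHom c).dRight i) rfl rfl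
            rfl ?_
          funext (j : Fin c.r)
          rcases eq_or_ne j i with rfl | hj
          · simp only [Function.update_self]
            exact g.map_d _ _
          · simp only [Function.update_of_ne hj]
    exact LinearMap.congr_fun this x

theorem map_mk (f : DGHom M M') (g : DGHom N N') {m : ℕ} (c : CompositeSymbol M N m) :
    (map f g).toFun m (mk c) = mk (mapSymbol f.toGrHom g.toGrHom c) :=
  mapHom_mk _ _ _

end compose

/-- The data of a homogeneous composite element `x(q_1,…,q_r)(s_{11},…,s_{1n_1},…,s_{rn_r})` of
`(L ∘ P ∘ R)(m)`, where `x ∈ L(r)_a`, `q_i ∈ P(n_i)_{b_i}`, `s_{ik} ∈ R(l_{ik})_{c_{ik}}`, together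
with a labelling `e` of the inputs of the `s_{ik}` by `1,…,m`. -/
structure TripleSymbol (L : DGSymModule.{u, v₁} K) (P : DGSymModule.{u, v₂} K)
    (R : DGSymModule.{u, v₃} K) (m : ℕ) where
  r : ℕ
  n : Fin r → ℕ
  l : ∀ i, Fin (n i) → ℕ
  e : (Σ p : (Σ i, Fin (n i)), Fin (l p.1 p.2)) ≃ Fin m
  a : ℕ
  x : L r
  hx : x ∈ L.gr r a
  b : Fin r → ℕ
  q : ∀ i, P (n i)
  hq : ∀ i, q i ∈ P.gr (n i) (b i)
  c : ∀ i, Fin (n i) → ℕ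
  s : ∀ i k, R (l i k)
  hs : ∀ i k, s i k ∈ R.gr (l i k) (c i k)

namespace TripleSymbol

variable {L : DGSymModule.{u, v₁} K} {P : DGSymModule.{u, v₂} K} {R : DGSymModule.{u, v₃} K}
  {m : ℕ}

/-- The composite element `x(q_1,…,q_r)` of `(L ∘ P)(n_1 + ⋯ + n_r)`, whose inputs are labelled in
the lexicographic order. -/
abbrev xq (t : TripleSymbol L P R m) : CompositeSymbol L P (∑ i, t.n i) where
  r := t.r
  n := t.n
  e := finSigmaFinEquiv
  a := t.a
  x := t.x
  hx := t.hx
  b := t.b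
  y := t.q
  hy := t.hq

/-- The composite element `q_i(s_{i1},…,s_{in_i})` of `(P ∘ R)(l_{i1} + ⋯ + l_{in_i})`. -/
abbrev qs (t : TripleSymbol L P R m) (i : Fin t.r) : CompositeSymbol P R (∑ k, t.l i k) where
  r := t.n i
  n := t.l i
  e := finSigmaFinEquiv
  a := t.b i
  x := t.q i
  hx := t.hq i
  b := t.c i
  y := t.s i
  hy := t.hs i

/-- The composite element `λ(x(q_1,…,q_r))(s_{11},…,s_{rn_r})` of `A ∘ R`, for a morphism
`λ : L ∘ P → A`. -/
abbrev left {A : DGSymModule.{u, v₄} K} (act : GrHom (compose L P) A) (t : TripleSymbol L P R m) :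
    CompositeSymbol A R m where
  r := ∑ i, t.n i
  n := fun j => t.l (finSigmaFinEquiv.symm j).1 (finSigmaFinEquiv.symm j).2
  e := (Equiv.sigmaCongrLeft (β := fun p : (Σ i, Fin (t.n i)) => Fin (t.l p.1 p.2))
    finSigmaFinEquiv.symm).trans t.e
  a := t.xq.deg
  x := act.toFun _ (compose.mk t.xq)
  hx := act.map_mem _ _ _ (CompositeModule.mk_mem_gr t.xq)
  b := fun j => t.c (finSigmaFinEquiv.symm j).1 (finSigmaFinEquiv.symm j).2
  y := fun j => t.s (finSigmaFinEquiv.symm j).1 (finSigmaFinEquiv.symm j).2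
  hy := fun j => t.hs (finSigmaFinEquiv.symm j).1 (finSigmaFinEquiv.symm j).2

/-- The composite element `x(ρ(q_1(s_{11},…)),…,ρ(q_r(s_{r1},…)))` of `L ∘ A`, for a morphism
`ρ : P ∘ R → A`. -/
abbrev right {A : DGSymModule.{u, v₄} K} (act : GrHom (compose P R) A) (t : TripleSymbol L P R m) :
    CompositeSymbol L A m where
  r := t.r
  n := fun i => ∑ k, t.l i k
  e := ((Equiv.sigmaCongrRight fun _ => finSigmaFinEquiv.symm).trans
    (Equiv.sigmaAssoc fun i k => Fin (t.l i k)).symm).trans t.e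
  a := t.a
  x := t.x
  hx := t.hx
  b := fun i => (t.qs i).deg
  y := fun i => act.toFun _ (compose.mk (t.qs i))
  hy := fun i => act.map_mem _ _ _ (CompositeModule.mk_mem_gr (t.qs i))

/-- The exponent of the Koszul sign of the permutation of tensors
`q_1 ⊗ … ⊗ q_r ⊗ s_{11} ⊗ … ⊗ s_{rn_r} ↦ q_1 ⊗ s_{11} ⊗ … ⊗ s_{1n_1} ⊗ q_2 ⊗ s_{21} ⊗ …`. -/
def signExp (t : TripleSymbol L P R m) : ℕ :=
  ∑ i, ∑ j, if i < j then (∑ k, t.c i k) * t.b j else 0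

/-- Relabelling of the inputs. -/
abbrev relabel (w : Equiv.Perm (Fin m)) (t : TripleSymbol L P R m) : TripleSymbol L P R m :=
  { t with e := t.e.trans w }

theorem deg_left_eq_deg_right {A : DGSymModule.{u, v₄} K} {B : DGSymModule.{u, w} K}
    (f : GrHom (compose L P) A) (g : GrHom (compose P R) B) (t : TripleSymbol L P R m) :
    (t.left f).deg = (t.right g).deg := by
  simp only [CompositeSymbol.deg, Finset.sum_add_distrib]
  rw [Equiv.sum_comp finSigmaFinEquiv.symm (fun p : (Σ i, Fin (t.n i)) => t.c p.1 p.2),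
    Fintype.sum_sigma, add_assoc]

end TripleSymbol

/-- The composite element `1(y)` of `(M ∘ N)(n)`. -/
abbrev CompositeSymbol.unitLeft {M : DGSymModule.{u, v} K} {N : DGSymModule.{u, w} K}
    {u₁ : M 1} (hu : u₁ ∈ M.gr 1 0) {n b : ℕ} {y : N n} (hy : y ∈ N.gr n b) :
    CompositeSymbol M N n where
  r := 1
  n := fun _ => n
  e := Equiv.uniqueSigma fun _ => Fin n
  a := 0
  x := u₁
  hx := hu
  b := fun _ => b
  y := fun _ => y
  hy := fun _ => hy

/-- The composite element `x(1,…,1)` of `(M ∘ N)(r)`. -/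
abbrev CompositeSymbol.unitRight {M : DGSymModule.{u, v} K} {N : DGSymModule.{u, w} K}
    {r a : ℕ} {x : M r} (hx : x ∈ M.gr r a) {u₁ : N 1} (hu : u₁ ∈ N.gr 1 0) :
    CompositeSymbol M N r where
  r := r
  n := fun _ => 1
  e := Equiv.sigmaUnique (Fin r) fun _ => Fin 1
  a := a
  x := x
  hx := hx
  b := fun _ => 0
  y := fun _ => u₁
  hy := fun _ => hu

end Composition

/-- A dg-operad: a dg-`Σ_*`-module `P` with a product `P ∘ P → P`, a morphism of dg-`Σ_*`-modules,
and a unit `1 ∈ P(1)_0`, which satisfy the unit and associativity relations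
`1(p) = p`, `p(1,…,1) = p` and `(p(q_*))(s_{**}) = ± p(q_1(s_{1*}),…,q_r(s_{r*}))`. -/
structure DGOperad (K : Type u) [CommRing K] extends DGSymModule.{u, v} K where
  mul : DGHom (compose toDGSymModule toDGSymModule) toDGSymModule
  one : carrier 1
  one_mem : one ∈ gr 1 0
  one_mul : ∀ (n b : ℕ) (p : carrier n) (hp : p ∈ gr n b),
    mul.toFun n (compose.mk (CompositeSymbol.unitLeft one_mem hp)) = p
  mul_one : ∀ (r a : ℕ) (p : carrier r) (hp : p ∈ gr r a),
    mul.toFun r (compose.mk (CompositeSymbol.unitRight hp one_mem)) = p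
  assoc : ∀ (m : ℕ) (t : TripleSymbol toDGSymModule toDGSymModule toDGSymModule m),
    mul.toFun m (compose.mk (t.left mul.toGrHom))
      = (-1 : K) ^ t.signExp • mul.toFun m (compose.mk (t.right mul.toGrHom))

/-- An operad is connected if `P(0) = 0` and `P(1) = K 1` (that is, the unit morphism
`K → P(1)`, `t ↦ t 1`, is an isomorphism). -/
def DGOperad.IsConnected {K : Type u} [CommRing K] (P : DGOperad.{u, v} K) : Prop :=
  Subsingleton (P.carrier 0) ∧ Function.Bijective (fun t : K => t • P.one)

/-- A (dg-)right module over a dg-operad `P`. -/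
structure DGRightModule {K : Type u} [CommRing K] (P : DGOperad.{u, v} K) extends
    DGSymModule.{u, w} K where
  action : DGHom (compose toDGSymModule P.toDGSymModule) toDGSymModule
  action_one : ∀ (r a : ℕ) (x : carrier r) (hx : x ∈ gr r a),
    action.toFun r (compose.mk (CompositeSymbol.unitRight hx P.one_mem)) = x
  assoc : ∀ (m : ℕ) (t : TripleSymbol toDGSymModule P.toDGSymModule P.toDGSymModule m),
    action.toFun m (compose.mk (t.left action.toGrHom))
      = (-1 : K) ^ t.signExp • action.toFun m (compose.mk (t.right P.mul.toGrHom))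

/-- A (dg-)left module over a dg-operad `P`. -/
structure DGLeftModule {K : Type u} [CommRing K] (P : DGOperad.{u, v} K) extends
    DGSymModule.{u, w} K where
  action : DGHom (compose P.toDGSymModule toDGSymModule) toDGSymModule
  one_action : ∀ (n b : ℕ) (y : carrier n) (hy : y ∈ gr n b),
    action.toFun n (compose.mk (CompositeSymbol.unitLeft P.one_mem hy)) = y
  assoc : ∀ (m : ℕ) (t : TripleSymbol P.toDGSymModule P.toDGSymModule toDGSymModule m),
    action.toFun m (compose.mk (t.left P.mul.toGrHom))
      = (-1 : K) ^ t.signExp • action.toFun m (compose.mk (t.right action.toGrHom))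

noncomputable section Modules

variable {K : Type u} [CommRing K] {P : DGOperad.{u, v} K}

/-- A morphism of dg-right `P`-modules. -/
structure DGRightModule.Hom (L : DGRightModule.{u, v, v₁} P) (L' : DGRightModule.{u, v, v₂} P)
    extends DGHom L.toDGSymModule L'.toDGSymModule where
  map_action : ∀ m z, toFun m (L.action.toFun m z)
    = L'.action.toFun m ((compose.map toDGHom (DGHom.id P.toDGSymModule)).toFun m z)

/-- A morphism of dg-left `P`-modules. -/
structure DGLeftModule.Hom (R : DGLeftModule.{u, v, v₁} P) (R' : DGLeftModule.{u, v, v₂} P)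
    extends DGHom R.toDGSymModule R'.toDGSymModule where
  map_action : ∀ m z, toFun m (R.action.toFun m z)
    = R'.action.toFun m ((compose.map (DGHom.id P.toDGSymModule) toDGHom).toFun m z)

/-- The identity morphism. -/
def DGRightModule.Hom.id (L : DGRightModule.{u, v, v₁} P) : L.Hom L where
  toDGHom := DGHom.id L.toDGSymModule
  map_action m z := by
    have : (compose.mapHom (GrHom.id L.toDGSymModule) (GrHom.id P.toDGSymModule) m)
        = LinearMap.id := CompositeModule.hom_ext fun c => by
      rw [compose.mapHom_mk]; rfl
    exact congrArg (L.action.toFun m) (LinearMap.congr_fun this z).symm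

/-- The identity morphism. -/
def DGLeftModule.Hom.id (R : DGLeftModule.{u, v, v₁} P) : R.Hom R where
  toDGHom := DGHom.id R.toDGSymModule
  map_action m z := by
    have : (compose.mapHom (GrHom.id P.toDGSymModule) (GrHom.id R.toDGSymModule) m)
        = LinearMap.id := CompositeModule.hom_ext fun c => by
      rw [compose.mapHom_mk]; rfl
    exact congrArg (R.action.toFun m) (LinearMap.congr_fun this z).symm

end Modules

noncomputable section Quotients

variable {K : Type u} [CommRing K]

theorem exists_projections {A : Type v} [AddCommGroup A] [Module K A] (gr : ℕ → Submodule K A)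
    (h : DirectSum.IsInternal gr) : ∃ p : ℕ → A →ₗ[K] A,
      (∀ k x, x ∈ gr k → p k x = x) ∧ ∀ k l x, x ∈ gr k → l ≠ k → p l x = 0 := by
  let _ := h.chooseDecomposition
  refine ⟨fun k => (gr k).subtype ∘ₗ DirectSum.component K ℕ (fun i => gr i) k ∘ₗ
    (DirectSum.decomposeLinearEquiv gr).toLinearMap, ?_, ?_⟩
  · intro k x hx
    exact DirectSum.decompose_of_mem_same gr hx
  · intro k l x hx hl
    exact DirectSum.decompose_of_mem_ne gr hx hl.symm

namespace DGSymModule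

/-- The submodule generated by a set of elements and by their differentials. -/
abbrev dgSpan (A : DGSymModule.{u, v} K) (S : ∀ m, Set (A m)) (m : ℕ) : Submodule K (A m) :=
  Submodule.span K (S m ∪ A.d m '' S m)

theorem dgSpan_le_comap (A : DGSymModule.{u, v} K) (B : DGSymModule.{u, w} K)
    (S : ∀ m, Set (A m)) (T : ∀ m, Set (B m)) (m : ℕ) (f : A m →ₗ[K] B m)
    (hf : ∀ z ∈ S m, f z ∈ B.dgSpan T m)
    (hf' : ∀ z ∈ S m, f (A.d m z) ∈ B.dgSpan T m) :
    A.dgSpan S m ≤ (B.dgSpan T m).comap f := by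
  rw [Submodule.span_le]
  rintro _ (hz | ⟨z, hz, rfl⟩)
  · exact hf _ hz
  · exact hf' _ hz

/-- The quotient of a dg-`Σ_*`-module `A` by the sub-dg-`Σ_*`-module generated by a `Σ_*`-stable
family of sets of homogeneous elements. -/
def quotient (A : DGSymModule.{u, v} K) (S : ∀ m, Set (A m))
    (hrep : ∀ m (s : Equiv.Perm (Fin m)) z, z ∈ S m → A.rep m s z ∈ S m)
    (hhom : ∀ m z, z ∈ S m → ∃ k, z ∈ A.gr m k) : DGSymModule.{u, v} K where
  carrier m := A m ⧸ A.dgSpan S m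
  gr m k := (A.gr m k).map (A.dgSpan S m).mkQ
  isInternal m := by
    obtain ⟨p, hp, hp'⟩ := exists_projections (A.gr m) (A.isInternal m)
    have hmem : ∀ k l x, x ∈ A.gr m l → x ∈ A.dgSpan S m → p k x ∈ A.dgSpan S m := by
      intro k l x hx hx'
      rcases eq_or_ne k l with rfl | hk
      · rwa [hp _ _ hx]
      · rw [hp' _ _ _ hx hk]; exact zero_mem _
    have hle : ∀ k, A.dgSpan S m ≤ (A.dgSpan S m).comap (p k) := fun k =>
      dgSpan_le_comap A A S S m (p k)
        (fun z hz => by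
          obtain ⟨l, hl⟩ := hhom m z hz
          exact hmem k l z hl (Submodule.subset_span (Or.inl hz)))
        (fun z hz => by
          obtain ⟨l, hl⟩ := hhom m z hz
          exact hmem k (l - 1) _ (A.d_mem_pred _ _ _ hl)
            (Submodule.subset_span (Or.inr ⟨z, hz, rfl⟩)))
    refine isInternal_of_projections _ (fun k => Submodule.mapQ _ _ (p k) (hle k)) ?_ ?_ ?_
    · rintro k _ ⟨x, hx, rfl⟩
      rw [Submodule.mkQ_apply, Submodule.mapQ_apply, hp k x hx]
    · rintro k l _ ⟨x, hx, rfl⟩ hl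
      rw [Submodule.mkQ_apply, Submodule.mapQ_apply, hp' k l x hx hl, Submodule.Quotient.mk_zero]
    · rw [← Submodule.map_iSup, (A.isInternal m).submodule_iSup_eq_top, Submodule.map_top,
        Submodule.range_mkQ]
  rep m :=
    { toFun := fun s => Submodule.mapQ _ _ (A.rep m s) (dgSpan_le_comap A A S S m (A.rep m s)
        (fun z hz => Submodule.subset_span (Or.inl (hrep m s z hz)))
        (fun z hz => Submodule.subset_span
          (Or.inr ⟨A.rep m s z, hrep m s z hz, A.d_rep m s z⟩)))
      map_one' := by
        refine Submodule.linearMap_qext _ (LinearMap.ext fun x => ?_)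
        simp
      map_mul' := fun s t => by
        refine Submodule.linearMap_qext _ (LinearMap.ext fun x => ?_)
        simp }
  rep_mem := by
    rintro m s k _ ⟨x, hx, rfl⟩
    exact ⟨A.rep m s x, A.rep_mem m s k x hx, rfl⟩
  d m := Submodule.mapQ _ _ (A.d m) (dgSpan_le_comap A A S S m (A.d m)
    (fun z hz => Submodule.subset_span (Or.inr ⟨z, hz, rfl⟩))
    (fun z _ => by rw [A.d_d]; exact zero_mem _))
  d_mem := by
    rintro m k _ ⟨x, hx, rfl⟩
    exact ⟨A.d m x, A.d_mem m k x hx, rfl⟩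
  d_zero := by
    rintro m _ ⟨x, hx, rfl⟩
    rw [Submodule.mkQ_apply, Submodule.mapQ_apply, A.d_zero m x hx, Submodule.Quotient.mk_zero]
  d_d m x := by
    obtain ⟨x, rfl⟩ := Submodule.Quotient.mk_surjective _ x
    rw [Submodule.mapQ_apply, Submodule.mapQ_apply, A.d_d, Submodule.Quotient.mk_zero]
  d_rep m s x := by
    obtain ⟨x, rfl⟩ := Submodule.Quotient.mk_surjective _ x
    exact congrArg Submodule.Quotient.mk (A.d_rep m s x)

/-- The morphism induced on quotients. -/
def quotientMap {A : DGSymModule.{u, v} K} {B : DGSymModule.{u, w} K} (f : DGHom A B)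
    (S : ∀ m, Set (A m)) (hrep : ∀ m (s : Equiv.Perm (Fin m)) z, z ∈ S m → A.rep m s z ∈ S m)
    (hhom : ∀ m z, z ∈ S m → ∃ k, z ∈ A.gr m k)
    (T : ∀ m, Set (B m)) (hrep' : ∀ m (s : Equiv.Perm (Fin m)) z, z ∈ T m → B.rep m s z ∈ T m)
    (hhom' : ∀ m z, z ∈ T m → ∃ k, z ∈ B.gr m k)
    (hf : ∀ m z, z ∈ S m → f.toFun m z ∈ T m) :
    DGHom (A.quotient S hrep hhom) (B.quotient T hrep' hhom') where
  toFun m := Submodule.mapQ _ _ (f.toFun m) (dgSpan_le_comap A B S T m (f.toFun m)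
    (fun z hz => Submodule.subset_span (Or.inl (hf m z hz)))
    (fun z hz => Submodule.subset_span
      (Or.inr ⟨f.toFun m z, hf m z hz, (f.map_d m z).symm⟩)))
  map_mem := by
    rintro m k _ ⟨x, hx, rfl⟩
    exact ⟨f.toFun m x, f.map_mem m k x hx, rfl⟩
  map_rep m s x := by
    obtain ⟨x, rfl⟩ := Submodule.Quotient.mk_surjective _ x
    exact congrArg Submodule.Quotient.mk (f.map_rep m s x)
  map_d m x := by
    obtain ⟨x, rfl⟩ := Submodule.Quotient.mk_surjective _ x
    exact congrArg Submodule.Quotient.mk (f.map_d m x)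

end DGSymModule

end Quotients

noncomputable section RelativeComposition

variable {K : Type u} [CommRing K] {P : DGOperad.{u, v} K}

/-- The elements `λ(x(q_1,…,q_r))(s_{11},…) - ± x(ρ(q_1(s_{11},…)),…,ρ(q_r(s_{r1},…)))` of `L ∘ R`,
that is, the differences of the images of the composite elements of `L ∘ P ∘ R` under the
morphisms `λ ∘ R` and `L ∘ ρ`. -/
def relCompRel (L : DGRightModule.{u, v, v₁} P) (R : DGLeftModule.{u, v, v₂} P) (m : ℕ) :
    Set ((compose L.toDGSymModule R.toDGSymModule) m) :=
  {z | ∃ t : TripleSymbol L.toDGSymModule P.toDGSymModule R.toDGSymModule m,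
    z = compose.mk (t.left L.action.toGrHom)
      - (-1 : K) ^ t.signExp • compose.mk (t.right R.action.toGrHom)}

theorem relCompRel_rep (L : DGRightModule.{u, v, v₁} P) (R : DGLeftModule.{u, v, v₂} P) (m : ℕ)
    (s : Equiv.Perm (Fin m)) (z : (compose L.toDGSymModule R.toDGSymModule) m)
    (hz : z ∈ relCompRel L R m) :
    (compose L.toDGSymModule R.toDGSymModule).rep m s z ∈ relCompRel L R m := by
  obtain ⟨t, rfl⟩ := hz
  refine ⟨t.relabel s, ?_⟩
  rw [map_sub, map_smul]
  congr 1
  · exact CompositeModule.repHom_mk s _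
  · exact congrArg _ (CompositeModule.repHom_mk s _)

theorem relCompRel_hom (L : DGRightModule.{u, v, v₁} P) (R : DGLeftModule.{u, v, v₂} P) (m : ℕ)
    (z : (compose L.toDGSymModule R.toDGSymModule) m) (hz : z ∈ relCompRel L R m) :
    ∃ k, z ∈ (compose L.toDGSymModule R.toDGSymModule).gr m k := by
  obtain ⟨t, rfl⟩ := hz
  refine ⟨(t.left L.action.toGrHom).deg, sub_mem (CompositeModule.mk_mem_gr _)
    (Submodule.smul_mem _ _ ?_)⟩
  rw [t.deg_left_eq_deg_right L.action.toGrHom R.action.toGrHom]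
  exact CompositeModule.mk_mem_gr _

/-- The relative composition product `L ∘_P R`: the cokernel, in dg-`Σ_*`-modules, of the parallel
pair `λ ∘ R, L ∘ ρ : L ∘ P ∘ R ⇉ L ∘ R`. -/
def relComp (L : DGRightModule.{u, v, v₁} P) (R : DGLeftModule.{u, v, v₂} P) :
    DGSymModule.{u, max u v₁ v₂} K :=
  (compose L.toDGSymModule R.toDGSymModule).quotient (relCompRel L R) (relCompRel_rep L R)
    (relCompRel_hom L R)

/-- The morphism `φ ∘_P ψ : L ∘_P R → L' ∘_P R'`. -/
def relComp.map {L : DGRightModule.{u, v, v₁} P} {L' : DGRightModule.{u, v, v₂} P}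
    {R : DGLeftModule.{u, v, v₃} P} {R' : DGLeftModule.{u, v, v₄} P} (φ : L.Hom L')
    (ψ : R.Hom R') : DGHom (relComp L R) (relComp L' R') :=
  DGSymModule.quotientMap (compose.map φ.toDGHom ψ.toDGHom) _ _ _ _ _ _ (by
    rintro m _ ⟨t, rfl⟩
    refine ⟨⟨t.r, t.n, t.l, t.e, t.a, φ.toFun _ t.x, φ.map_mem _ _ _ t.hx, t.b, t.q, t.hq, t.c,
      fun i k => ψ.toFun _ (t.s i k), fun i k => ψ.map_mem _ _ _ (t.hs i k)⟩, ?_⟩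
    rw [map_sub, map_smul]
    congr 1
    · refine (compose.mapHom_mk _ _ _).trans ?_
      refine CompositeModule.mk_congr (compose.mapSymbol φ.toGrHom ψ.toGrHom
        (t.left L.action.toGrHom)) rfl ?_ rfl rfl |>.symm
      refine Eq.trans ?_ (φ.map_action _ _).symm
      exact congrArg (L'.action.toFun _)
        (compose.map_mk φ.toDGHom (DGHom.id P.toDGSymModule) t.xq).symm
    · congr 1
      refine (compose.mapHom_mk _ _ _).trans ?_
      refine CompositeModule.mk_congr (compose.mapSymbol φ.toGrHom ψ.toGrHom
        (t.right R.action.toGrHom)) rfl rfl rfl ?_ |>.symm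
      funext i
      refine Eq.trans ?_ (ψ.map_action _ _).symm
      exact congrArg (R'.action.toFun _)
        (compose.map_mk (DGHom.id P.toDGSymModule) ψ.toDGHom (t.qs i)).symm)

end RelativeComposition

noncomputable section QuasiFree

variable {K : Type u} [CommRing K] {P : DGOperad.{u, v} K}

/-- The extension `M ∘ P → L`, `x(q_1,…,q_r) ↦ ι(x)(q_1,…,q_r)`, of a morphism of graded
`Σ_*`-modules `ι : M → L` to the free (graded) right `P`-module `M ∘ P`. -/
def DGRightModule.extend (L : DGRightModule.{u, v, v₁} P) {M : DGSymModule.{u, v₂} K}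
    (ι : GrHom M L.toDGSymModule) (m : ℕ) : (compose M P.toDGSymModule) m →ₗ[K] L.carrier m :=
  L.action.toFun m ∘ₗ (compose.grMap ι (GrHom.id P.toDGSymModule)).toFun m

/-- The extension `P ∘ N → R`, `p(y_1,…,y_r) ↦ p(ι(y_1),…,ι(y_r))`, of a morphism of graded
`Σ_*`-modules `ι : N → R` to the free (graded) left `P`-module `P ∘ N`. -/
def DGLeftModule.extend (R : DGLeftModule.{u, v, v₁} P) {N : DGSymModule.{u, v₂} K}
    (ι : GrHom N R.toDGSymModule) (m : ℕ) : (compose P.toDGSymModule N) m →ₗ[K] R.carrier m :=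
  R.action.toFun m ∘ₗ (compose.grMap (GrHom.id P.toDGSymModule) ι).toFun m

/-- A structure of quasi-free right `P`-module `L = M ∘ P`: an identification of `L` with `M ∘ P` as
graded right `P`-modules (equivalently, a morphism of graded `Σ_*`-modules `M → L` whose extension
`M ∘ P → L` is bijective).  The differential of `L` is `δ + d_θ`, where `δ` is the canonical
differential of `M ∘ P`; the last condition says that `d_θ` maps `M(m)` into
`⨁_{r < m} (M(r) ⊗ P^{⊗ r}(m))_{Σ_r}`, i.e., for a connected operad, that the composite of `d_θ`
with the projection `M ∘ P → M` vanishes, so that `M` is the indecomposable quotient of `L`. -/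
structure DGRightModule.QuasiFree (L : DGRightModule.{u, v, v₁} P) (M : DGSymModule.{u, v₂} K) where
  ι : GrHom M L.toDGSymModule
  bijective : ∀ m, Function.Bijective (L.extend ι m)
  decomposable : ∀ (m : ℕ) (x : M m),
    L.d m (ι.toFun m x) - ι.toFun m (M.d m x) ∈ Submodule.span K
      {z | ∃ c : CompositeSymbol M P.toDGSymModule m, c.r < m ∧ z = L.extend ι m (compose.mk c)}

/-- A structure of quasi-free left `P`-module `R = P ∘ N`: an identification of `R` with `P ∘ N` as
graded left `P`-modules (equivalently, a morphism of graded `Σ_*`-modules `N → R` whose extension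
`P ∘ N → R` is bijective).  The differential of `R` is `δ + d_θ`, where `δ` is the canonical
differential of `P ∘ N`; the last condition says that `d_θ` maps `N(m)` into
`⨁_{r ≥ 2} (P(r) ⊗ N^{⊗ r}(m))_{Σ_r}`, i.e., for a connected operad, that the composite of `d_θ`
with the projection `P ∘ N → N` vanishes, so that `N` is the indecomposable quotient of `R`. -/
structure DGLeftModule.QuasiFree (R : DGLeftModule.{u, v, v₁} P) (N : DGSymModule.{u, v₂} K) where
  ι : GrHom N R.toDGSymModule
  bijective : ∀ m, Function.Bijective (R.extend ι m)
  decomposable : ∀ (m : ℕ) (y : N m),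
    R.d m (ι.toFun m y) - ι.toFun m (N.d m y) ∈ Submodule.span K
      {z | ∃ c : CompositeSymbol P.toDGSymModule N m, 2 ≤ c.r ∧ z = R.extend ι m (compose.mk c)}

end QuasiFree

/-! ### Signs -/

/-! Call r the weight of a composite element x(y_1,…,y_r). For a quasi-free right module L = M ∘ P
the map M ∘ R → L ∘_P R is bijective. The twisting part of the differential sends M(r) into
composites whose root has arity < r, so the differential carried over to M ∘ R is the canonical one
plus terms of strictly lower weight. In the same way φ ∘_P R becomes f ∘ R plus terms of lower
weight, where f : M → M' is the morphism induced by φ on indecomposables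
(`DGRightModule.QuasiFree.indec`). Since R(0) = 0, only the weights 0,…,m occur in arity m. The
filtration is finite and no spectral sequence is needed: a cycle is bounded by killing its leading
components one after the other (`WeightPerturbation.acyclic`). This is applied to mapping cones,
whose acyclicity expresses that a morphism is a quasi-isomorphism.

Two facts about f are needed. (a) Its cone is acyclic in every arity
(`DGRightModule.QuasiFree.indec_coneAcyclic`). By induction on the arity m, one runs the same
comparison with L(m) ≅ (M ∘ P)(m). The total cone is acyclic by hypothesis and the parts of weight <
m are acyclic by induction, hence so is the part of top weight m
(`WeightPerturbation.weightAcyclic_top`), of which the cone of f in arity m is a retract, through x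
↦ x(1,…,1) and the counit. (b) The cone of f ∘ R is acyclic in each weight
(`weightAcyclic_mapHom_left`). Bounded below complexes of projectives give homotopy inverses of f
arity by arity (`DGHom.hasHomotopyInverse`), but these are not equivariant. They still act on M ∘ R:
as R(0) = 0 all blocks are nonempty, the symmetric group permutes them freely, and the maps can be
applied once the blocks are sorted by their minima.

For quasi-free left modules R = P ∘ N the scheme is the same, with L ∘_P R ≅ L ∘ N. Now the
perturbation replaces a factor by a composite of weight at least 2, so it raises the weight, and the
weights are numbered downwards. Since P(0) = 0, the lowest weight in (P ∘ N)(m) is 1 and this part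
is N(m), while in weight s ≥ 2 a block has at most m + 1 - s < m inputs, which makes the induction
on arity work. The Künneth statement (`weightAcyclic_mapHom_right`) uses homotopies on one block at
a time, a block being recognized by its least label.

The isomorphisms M ∘ R ≅ L ∘_P R and L ∘ N ≅ L ∘_P R have as inverses the substitution maps
`leftSubst` and `rightSubst`, which write elements of a quasi-free module in coordinates and
evaluate the products that appear. That these coequalize the two actions (`leftSubst_eval`,
`rightSubst_eval`) is associativity together with an identity of Koszul signs. All signs are
compared modulo 2 as weighted inversion numbers, which satisfy a cocycle identity. -/

theorem neg_one_pow_congr_zmod {K : Type u} [CommRing K] {a b : ℕ} (h : (a : ZMod 2) = b) :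
    (-1 : K) ^ a = (-1) ^ b := by
  have h' := (ZMod.natCast_eq_natCast_iff' a b 2).1 h
  rw [neg_one_pow_eq_pow_mod_two, h', ← neg_one_pow_eq_pow_mod_two]

theorem neg_one_pow_mul_self {K : Type u} [CommRing K] (a : ℕ) :
    (-1 : K) ^ a * (-1) ^ a = 1 := by
  rw [← mul_pow]; simp

theorem eq_neg_one_pow_smul {K : Type u} [CommRing K] {A : Type*} [AddCommGroup A] [Module K A]
    {a : ℕ} {x y : A} (h : (-1 : K) ^ a • x = y) : x = (-1 : K) ^ a • y := by
  rw [← h, smul_smul, neg_one_pow_mul_self, one_smul]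

/-- `ring` does not know that 2 = 0 in `ZMod 2`; instances of this identity supply the cancellation
to `linear_combination` in the sign computations. -/
theorem ZMod.two_add_self (a : ZMod 2) : a + a = 0 := CharTwo.add_self_eq_zero a

/-- A double sum of antisymmetric terms vanishes modulo `2`. -/
theorem sum_sum_eq_zero_of_symm {I : Type*} [Fintype I] (T : I → I → ZMod 2)
    (h : ∀ i j, T i j = T j i) (h' : ∀ i, T i i = 0) : ∑ i, ∑ j, T i j = 0 := by
  classical
  rw [← Finset.sum_product']
  refine Finset.sum_involution (fun p _ => (p.2, p.1)) ?_ ?_ ?_ ?_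
  · rintro ⟨i, j⟩ -
    change T i j + T j i = 0
    rw [h i j, CharTwo.add_self_eq_zero]
  · rintro ⟨i, j⟩ - h1 h2
    simp only [Prod.mk.injEq] at h2
    obtain ⟨rfl, -⟩ := h2
    exact h1 (h' _)
  · intro _ _; simp
  · intro _ _; rfl

/-- Two double sums agree modulo `2` if their symmetrizations agree. -/
theorem sum_sum_eq_of_symm {I : Type*} [Fintype I] (S T : I → I → ZMod 2)
    (h : ∀ i j, S i j + S j i = T i j + T j i) (h' : ∀ i, S i i = T i i) :
    ∑ i, ∑ j, S i j = ∑ i, ∑ j, T i j := by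
  -- Modulo 2, equality of S and T is vanishing of S + T, and the hypotheses say that S + T is
  -- symmetric with zero diagonal.
  have : ∑ i, ∑ j, (S i j + T i j) = 0 := by
    refine sum_sum_eq_zero_of_symm _ (fun i j => ?_) (fun i => ?_)
    · have e := h i j
      have h1 := ZMod.two_add_self (S j i)
      have h2 := ZMod.two_add_self (T i j)
      linear_combination e - h1 + h2
    · rw [h' i, ZMod.two_add_self]
  simp only [Finset.sum_add_distrib] at this
  linear_combination this - ZMod.two_add_self (∑ i, ∑ j, T i j)

/-- The weighted number of the inversions between two orderings of a finite set. -/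
def invExp {I A B : Type*} [Fintype I] [LinearOrder A] [LinearOrder B] (f : I → A) (g : I → B)
    (w : I → ℕ) : ℕ :=
  ∑ i, ∑ j, if f i < f j ∧ g j < g i then w i * w j else 0

section invExp

variable {I A B C : Type*} [Fintype I] [LinearOrder A] [LinearOrder B] [LinearOrder C]

theorem invExp_symm (f : I → A) (g : I → B) (w : I → ℕ) : invExp f g w = invExp g f w := by
  rw [invExp, invExp, Finset.sum_comm]
  refine Finset.sum_congr rfl fun i _ => Finset.sum_congr rfl fun j _ => ?_
  simp only [and_comm, mul_comm]

theorem invExp_eq_zero (f : I → A) (g : I → B) (w : I → ℕ) (h : ∀ i j, f i < f j → g i < g j) :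
    invExp f g w = 0 := by
  refine Finset.sum_eq_zero fun i _ => Finset.sum_eq_zero fun j _ => ?_
  rw [if_neg]
  rintro ⟨h1, h2⟩
  exact (h i j h1).not_gt h2

theorem invExp_comp {J : Type*} [Fintype J] (γ : J ≃ I) (f : I → A) (g : I → B) (w : I → ℕ) :
    invExp (f ∘ γ) (g ∘ γ) (w ∘ γ) = invExp f g w := by
  simp only [invExp]
  rw [← Equiv.sum_comp γ]
  refine Finset.sum_congr rfl fun i _ => ?_
  rw [← Equiv.sum_comp γ]
  rfl

/-- For a fixed pair i ≠ j, the orders f and h disagree exactly when one, but not both, of the pairs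
(f, g) and (g, h) disagree. Every comparison of two enumerations of the same factors below rests on
this. -/
theorem invExp_cocycle (f : I → A) (g : I → B) (h : I → C) (w : I → ℕ)
    (hf : Function.Injective f) (hg : Function.Injective g) (hh : Function.Injective h) :
    (invExp f g w : ZMod 2) + invExp g h w = invExp f h w := by
  simp only [invExp, Nat.cast_sum, ← Finset.sum_add_distrib]
  refine sum_sum_eq_of_symm _ _ (fun i j => ?_) (fun i => by simp)
  rcases eq_or_ne i j with rfl | hij
  · simp
  have h2 := ZMod.two_add_self ((w i : ZMod 2) * w j)
  rcases lt_or_gt_of_ne (hf.ne hij) with h3 | h3 <;>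
  rcases lt_or_gt_of_ne (hg.ne hij) with h4 | h4 <;>
  rcases lt_or_gt_of_ne (hh.ne hij) with h5 | h5 <;>
  simp [h3, h4, h5, h3.not_gt, h4.not_gt, h5.not_gt, mul_comm (w j : ZMod 2)] <;>
  linear_combination h2

/-- Reads a Koszul sign as a comparison of two orders on the same index set, so that the cocycle
identity applies to it. -/
theorem koszulExp_eq {r : ℕ} (s : Equiv.Perm (Fin r)) (b : Fin r → ℕ) :
    koszulExp s b = invExp id s (b ∘ s) := rfl

theorem koszulExp_eq_zero {r : ℕ} (s : Equiv.Perm (Fin r)) (b : Fin r → ℕ) (h : ∀ i, b i = 0) :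
    koszulExp s b = 0 := by simp [koszulExp, h]

end invExp

theorem sum_castLE_eq {m : ℕ} (n : Fin m → ℕ) (k : Fin m) :
    ∑ i : Fin k, n (Fin.castLE k.2.le i) = ∑ j, if j < k then n j else 0 := by
  rw [← Finset.sum_filter]
  refine Finset.sum_bij (fun i _ => Fin.castLE k.2.le i) ?_ ?_ ?_ ?_
  · intro i _; exact Finset.mem_filter.2 ⟨Finset.mem_univ _, i.2⟩
  · intro i _ j _ h; simpa using h
  · intro j hj
    have : j < k := by simpa using hj
    exact ⟨⟨j, this⟩, Finset.mem_univ _, rfl⟩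
  · intro _ _; rfl

theorem finSigmaFinEquiv_lt {m : ℕ} {n : Fin m → ℕ} (p q : Σ i, Fin (n i))
    (h : p.1 < q.1 ∨ p.1 = q.1 ∧ (p.2 : ℕ) < q.2) :
    finSigmaFinEquiv p < finSigmaFinEquiv q := by
  rw [Fin.lt_def, finSigmaFinEquiv_apply, finSigmaFinEquiv_apply, sum_castLE_eq, sum_castLE_eq]
  obtain ⟨i, k⟩ := p
  obtain ⟨j, l⟩ := q
  rcases h with h | ⟨h, h'⟩
  · simp only at h ⊢
    have : (∑ x, if x < i then n x else 0) + n i ≤ ∑ x, if x < j then n x else 0 := by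
      have e : n i = ∑ x, if x = i then n x else 0 := by simp
      refine (congrArg (_ + ·) e).trans_le ?_
      rw [← Finset.sum_add_distrib]
      refine Finset.sum_le_sum fun x _ => ?_
      rcases lt_trichotomy x i with hx | hx | hx
      · simp [hx, hx.trans h, hx.ne]
      · simp [hx, h]
      · simp [hx.not_gt, hx.ne']
    have := k.2
    omega
  · simp only at h
    subst h
    simp only at h' ⊢
    omega

/-- The standard enumeration of a disjoint union of blocks is lexicographic; inversion numbers of
nested families are computed through this criterion. -/
theorem finSigmaFinEquiv_lt_iff {m : ℕ} {n : Fin m → ℕ} (p q : Σ i, Fin (n i)) :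
    finSigmaFinEquiv p < finSigmaFinEquiv q ↔ p.1 < q.1 ∨ p.1 = q.1 ∧ (p.2 : ℕ) < q.2 := by
  refine ⟨fun h => ?_, finSigmaFinEquiv_lt p q⟩
  by_contra hc
  push Not at hc
  obtain ⟨h1, h2⟩ := hc
  rcases h1.lt_or_eq with h3 | h3
  · exact (finSigmaFinEquiv_lt q p (Or.inl h3)).not_gt h
  · rcases (h2 h3.symm).lt_or_eq with h4 | h4
    · exact (finSigmaFinEquiv_lt q p (Or.inr ⟨h3, h4⟩)).not_gt h
    · refine h.ne (congrArg _ ?_)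
      obtain ⟨i, k⟩ := p
      obtain ⟨j, l⟩ := q
      simp only at h3 h4
      subst h3
      rw [Fin.ext h4.symm]

/-! ### Composite elements -/

noncomputable section Kit

variable {K : Type u} [CommRing K]

theorem DGSymModule.eq_zero_of_mem_gr (M : DGSymModule.{u, v} K) {r k l : ℕ} {x : M r}
    (hk : x ∈ M.gr r k) (hl : x ∈ M.gr r l) (h : k ≠ l) : x = 0 := by
  obtain ⟨p, hp, hp'⟩ := exists_projections (M.gr r) (M.isInternal r)
  rw [← hp k x hk, hp' l k x hl h]

/-- The isomorphism `M(n) ≅ M(n')` associated with a bijection. -/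
def DGSymModule.tr (M : DGSymModule.{u, v} K) {n n' : ℕ} (τ : Fin n ≃ Fin n') :
    M n →ₗ[K] M n' :=
  have h : n = n' := by simpa using Fintype.card_congr τ
  M.rep n' ((finCongr h).symm.trans τ) ∘ₗ (h ▸ LinearMap.id)

theorem DGSymModule.tr_perm (M : DGSymModule.{u, v} K) {n : ℕ} (τ : Equiv.Perm (Fin n)) (x : M n) :
    M.tr τ x = M.rep n τ x := rfl

namespace CompositeModule

variable {M : DGSymModule.{u, v} K} {N : DGSymModule.{u, w} K} {m : ℕ}

/-- Composite elements do not depend on the degrees chosen for their factors. -/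
theorem mk_congr' (c : CompositeSymbol M N m) {e' : (Σ i, Fin (c.n i)) ≃ Fin m} {a' : ℕ}
    {x' : M c.r} {hx' : x' ∈ M.gr c.r a'}
    {b' : Fin c.r → ℕ} {y' : ∀ i, N (c.n i)} {hy' : ∀ i, y' i ∈ N.gr (c.n i) (b' i)}
    (he : ∀ p, e' p = c.e p) (hx : x' = c.x) (hy : ∀ i, y' i = c.y i) :
    mk { c with e := e', a := a', x := x', hx := hx', b := b', y := y', hy := hy' } = mk c := by
  obtain rfl : e' = c.e := Equiv.ext he
  obtain rfl : y' = c.y := funext hy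
  subst hx
  -- An element with two different degrees is zero, so if the recorded degrees disagree both
  -- composite elements vanish.
  by_cases ha : a' = c.a
  · by_cases hb : b' = c.b
    · subst ha hb; rfl
    · obtain ⟨i, hi⟩ := Function.ne_iff.1 hb
      have h0 := N.eq_zero_of_mem_gr (hy' i) (c.hy i) hi
      exact (mk_eq_zero_of_right { c with a := a', x := _, hx := hx', b := b', hy := hy' } i h0).trans (mk_eq_zero_of_right c i h0).symm
  · have h0 := M.eq_zero_of_mem_gr hx' c.hx ha
    exact (mk_eq_zero_of_left { c with a := a', x := _, hx := hx', b := b', hy := hy' } h0).trans (mk_eq_zero_of_left c h0).symm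

/-- The recorded degrees on the two sides are unrelated. Symbols whose degrees agree only
propositionally, or only when a factor is nonzero, can therefore be identified without transport. -/
theorem mk_eq_mk {r : ℕ} {n : Fin r → ℕ} {e e' : (Σ i, Fin (n i)) ≃ Fin m} {a a' : ℕ} {x x' : M r}
    {hx : x ∈ M.gr r a} {hx' : x' ∈ M.gr r a'} {b b' : Fin r → ℕ} {y y' : ∀ i, N (n i)}
    {hy : ∀ i, y i ∈ N.gr (n i) (b i)} {hy' : ∀ i, y' i ∈ N.gr (n i) (b' i)}
    (he : ∀ p, e p = e' p) (h : x = x') (h' : ∀ i, y i = y' i) :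
    mk (⟨r, n, e, a, x, hx, b, y, hy⟩ : CompositeSymbol M N m) = mk ⟨r, n, e', a', x', hx', b', y', hy'⟩ :=
  mk_congr' ⟨r, n, e', a', x', hx', b', y', hy'⟩ he h h'

/-- Change of the presentation of the blocks. -/
theorem mk_relabel_blocks {r : ℕ} {n n' : Fin r → ℕ} (e : (Σ i, Fin (n i)) ≃ Fin m)
    (e' : (Σ i, Fin (n' i)) ≃ Fin m) {a a' : ℕ} {x : M r} (hx : x ∈ M.gr r a)
    (hx' : x ∈ M.gr r a') {b b' : Fin r → ℕ}
    {y : ∀ i, N (n i)} (hy : ∀ i, y i ∈ N.gr (n i) (b i)) {y' : ∀ i, N (n' i)}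
    (hy' : ∀ i, y' i ∈ N.gr (n' i) (b' i)) (τ : ∀ i, Fin (n i) ≃ Fin (n' i))
    (he : ∀ i k, e ⟨i, k⟩ = e' ⟨i, τ i k⟩)
    (h : ∀ i, N.tr (τ i) (y i) = y' i) :
    mk (⟨r, n, e, a, x, hx, b, y, hy⟩ : CompositeSymbol M N m)
      = mk ⟨r, n', e', a', x, hx', b', y', hy'⟩ := by
  obtain rfl : n = n' := funext fun i => by simpa using Fintype.card_congr (τ i)
  have h1 := mk_inner (⟨r, n, e', a, x, hx, b, y, hy⟩ : CompositeSymbol M N m) τ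
  refine Eq.trans ?_ (h1.symm.trans ?_)
  · exact mk_congr' ((⟨r, n, e', a, x, hx, b, y, hy⟩ : CompositeSymbol M N m).innerLabel τ)
      (fun p => he p.1 p.2) rfl (fun _ => rfl)
  · refine mk_congr' ⟨r, n, e', a', x, hx', b', y', hy'⟩ (fun _ => rfl) rfl fun i => ?_
    exact (N.tr_perm (τ i) (y i)).symm.trans (h i)

theorem mk_smul_right_all (c : CompositeSymbol M N m) (t : Fin c.r → K) (y' : ∀ j, N (c.n j))
    (hy' : ∀ j, y' j ∈ N.gr (c.n j) (c.b j)) (h : ∀ i, c.y i = t i • y' i) :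
    mk c = (∏ i, t i) • mk { c with y := y', hy := hy' } := by
  classical
  suffices H : ∀ S : Finset (Fin c.r), mk c = (∏ i ∈ S, t i) •
      mk { c with
        y := fun i => if i ∈ S then y' i else c.y i
        hy := fun i => by split_ifs; exacts [hy' i, c.hy i] } by
    refine (H Finset.univ).trans ?_
    congr 1
    exact mk_congr' { c with y := y', hy := hy' } (fun _ => rfl) rfl (fun i => by simp)
  intro S
  induction S using Finset.induction_on with
  | empty => simp
  | insert i S hi ih =>
    rw [ih, Finset.prod_insert hi, mul_comm, mul_smul]
    congr 1
    refine mk_smul_right { c with y := fun i => if i ∈ S then y' i else c.y i, hy := _ } i (t i)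
      _ (fun i => by split_ifs; exacts [hy' i, c.hy i]) ?_ ?_
    · simp [hi, h]
    · intro j hj
      simp [hj]

end CompositeModule

namespace CompositeSymbol

variable {M : DGSymModule.{u, v} K} {N : DGSymModule.{u, w} K} {m : ℕ}

/-- The composite element `x(y_i)_{i ∈ I}`, whose factors are indexed by a set `I` enumerated
by `α`. -/
abbrev ofIndex {I : Type} {r : ℕ} (α : Fin r ≃ I) {a : ℕ} {x : M r} (hx : x ∈ M.gr r a)
    (n : I → ℕ) (b : I → ℕ) {y : ∀ i, N (n i)} (hy : ∀ i, y i ∈ N.gr (n i) (b i))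
    (e : (Σ i, Fin (n i)) ≃ Fin m) : CompositeSymbol M N m where
  r := r
  n := fun i => n (α i)
  e := (Equiv.sigmaCongrLeft (β := fun i => Fin (n i)) α).trans e
  a := a
  x := x
  hx := hx
  b := fun i => b (α i)
  y := fun i => y (α i)
  hy := fun i => hy (α i)

end CompositeSymbol

namespace CompositeModule

open CompositeSymbol

variable {M : DGSymModule.{u, v} K} {N : DGSymModule.{u, w} K} {m : ℕ}

/-- There is no sign because only the names of the factors change, not their order. -/
theorem mk_ofIndex_reindex {I J : Type} {r : ℕ} (γ : J ≃ I) (β : Fin r ≃ J) (α : Fin r ≃ I)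
    (hβ : ∀ k, γ (β k) = α k) {a : ℕ} {x : M r} (hx : x ∈ M.gr r a)
    (n : I → ℕ) (b : I → ℕ) {y : ∀ i, N (n i)} (hy : ∀ i, y i ∈ N.gr (n i) (b i))
    (e : (Σ i, Fin (n i)) ≃ Fin m) :
    mk (ofIndex α hx n b hy e) = mk (ofIndex β hx (n ∘ γ) (b ∘ γ) (fun j => hy (γ j))
      ((Equiv.sigmaCongrLeft (β := fun i => Fin (n i)) γ).trans e)) := by
  obtain rfl : β.trans γ = α := Equiv.ext hβ
  exact mk_congr' (ofIndex β hx (n ∘ γ) (b ∘ γ) (fun j => hy (γ j))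
      ((Equiv.sigmaCongrLeft (β := fun i => Fin (n i)) γ).trans e)) (fun _ => rfl) rfl
        (fun _ => rfl)

/-- The coinvariance relation for factors indexed by an arbitrary set. The Koszul sign becomes the
inversion number between the two enumerations of that set, a form in which signs can be composed. -/
theorem mk_ofIndex_outer {I : Type} [Fintype I] {r : ℕ} (α : Fin r ≃ I) (s : Equiv.Perm (Fin r))
    {a : ℕ} {x : M r} (hx : x ∈ M.gr r a)
    (n : I → ℕ) (b : I → ℕ) {y : ∀ i, N (n i)} (hy : ∀ i, y i ∈ N.gr (n i) (b i))
    (e : (Σ i, Fin (n i)) ≃ Fin m) :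
    mk (ofIndex α (M.rep_mem _ s _ _ hx) n b hy e)
      = (-1 : K) ^ invExp α.symm (s.trans α).symm b • mk (ofIndex (s.trans α) hx n b hy e) := by
  refine (mk_outer (ofIndex α hx n b hy e) s).trans ?_
  congr 1
  · congr 1
    rw [koszulExp_eq, invExp_symm, ← invExp_comp (s.trans α)]
    refine congrArg₂ (fun f g => invExp f g _) ?_ ?_
    · funext k; simp
    · funext k; simp
  · exact mk_congr' (ofIndex (s.trans α) hx n b hy e) (fun _ => rfl) rfl (fun _ => rfl)

end CompositeModule

end Kit


/-! ### Two-step composites x(q_*)(s_{**}), their two evaluations and the symmetric group actions.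
-/

noncomputable section Triple

variable {K : Type u} [CommRing K]

theorem smul_lin_comb {A : Type*} [AddCommGroup A] [Module K A] (ε : K) {α β : K} {x y z : A}
    (h : x = α • y + β • z) : ε • x = α • ε • y + β • ε • z := by
  rw [h, smul_add, smul_comm α, smul_comm β]

theorem GrHom.tr_mk {M : DGSymModule.{u, v₁} K} {N : DGSymModule.{u, v₂} K}
    {A : DGSymModule.{u, v₄} K} (act : GrHom (compose M N) A)
    {n n' : ℕ} (τ : Fin n ≃ Fin n') (c : CompositeSymbol M N n) :
    A.tr τ (act.toFun n (compose.mk c)) = act.toFun n' (compose.mk { c with e := c.e.trans τ }) := by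
  obtain rfl : n = n' := by simpa using Fintype.card_congr τ
  rw [A.tr_perm, ← act.map_rep]
  exact congrArg _ (CompositeModule.repHom_mk τ c)

namespace CompositeModule

variable {M : DGSymModule.{u, v} K} {N : DGSymModule.{u, w} K} {m : ℕ}

theorem mk_lin_left (c : CompositeSymbol M N m) (α β : K) (x' x'' : M c.r)
    (hx' : x' ∈ M.gr c.r c.a) (hx'' : x'' ∈ M.gr c.r c.a) (h : c.x = α • x' + β • x'') :
    mk c = α • mk { c with x := x', hx := hx' } + β • mk { c with x := x'', hx := hx'' } := by
  rw [← mk_smul_left { c with x := x', hx := hx' }, ← mk_smul_left { c with x := x'', hx := hx'' }]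
  refine Eq.trans ?_ (mk_add_left { c with x := α • x', hx := Submodule.smul_mem _ _ hx' }
    (β • x'') (Submodule.smul_mem _ _ hx''))
  exact (mk_congr' c (fun _ => rfl) h.symm (fun _ => rfl)).symm

theorem mk_lin_right (c : CompositeSymbol M N m) (i : Fin c.r) (α β : K)
    (y' y'' : ∀ j, N (c.n j))
    (hy' : ∀ j, y' j ∈ N.gr (c.n j) (c.b j)) (hy'' : ∀ j, y'' j ∈ N.gr (c.n j) (c.b j))
    (h : c.y i = α • y' i + β • y'' i) (h' : ∀ j, j ≠ i → y' j = c.y j)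
    (h'' : ∀ j, j ≠ i → y'' j = c.y j) :
    mk c = α • mk { c with y := y', hy := hy' } + β • mk { c with y := y'', hy := hy'' } := by
  classical
  have key : ∀ (t : K) (z : ∀ j, N (c.n j)), (∀ j, z j ∈ N.gr (c.n j) (c.b j)) →
      ∀ j, Function.update z i (t • z i) j ∈ N.gr (c.n j) (c.b j) := by
    intro t z hz j
    rcases eq_or_ne j i with rfl | hj
    · simpa using Submodule.smul_mem _ _ (hz j)
    · simpa [hj] using hz j
  have e1 := mk_smul_right { c with y := _, hy := key α y' hy' } i α y' hy' (by simp)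
    (fun j hj => by simp [hj])
  have e2 := mk_smul_right { c with y := _, hy := key β y'' hy'' } i β y'' hy'' (by simp)
    (fun j hj => by simp [hj])
  have e3 := mk_add_right c i _ _ (key α y' hy') (key β y'' hy'') (by simp [h])
    (fun j hj => by simp [hj, h' j hj]) (fun j hj => by simp [hj, h'' j hj])
  rw [e3, e1, e2]

end CompositeModule

namespace TripleSymbol

open CompositeModule CompositeSymbol

variable {L : DGSymModule.{u, v₁} K} {P : DGSymModule.{u, v₂} K} {R : DGSymModule.{u, v₃} K}
  {A : DGSymModule.{u, v₄} K} {m : ℕ}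

/-- The composite element `x(q_1,…,q_r)` with its inputs labelled by `ε`. -/
abbrev xqAt (t : TripleSymbol L P R m) {r' : ℕ} (ε : (Σ i, Fin (t.n i)) ≃ Fin r') :
    CompositeSymbol L P r' where
  r := t.r
  n := t.n
  e := ε
  a := t.a
  x := t.x
  hx := t.hx
  b := t.b
  y := t.q
  hy := t.hq

/-- The composite element `q_i(s_{i1},…,s_{in_i})` with its inputs labelled by `ε`. -/
abbrev qsAt (t : TripleSymbol L P R m) (i : Fin t.r) {l' : ℕ}
    (ε : (Σ k, Fin (t.l i k)) ≃ Fin l') : CompositeSymbol P R l' where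
  r := t.n i
  n := t.l i
  e := ε
  a := t.b i
  x := t.q i
  hx := t.hq i
  b := t.c i
  y := t.s i
  hy := t.hs i

/-- `t.left` for an arbitrary enumeration of the inputs of the `q_i`. -/
abbrev leftAt (act : GrHom (compose L P) A) (t : TripleSymbol L P R m) {r' : ℕ}
    (ε : (Σ i, Fin (t.n i)) ≃ Fin r') : CompositeSymbol A R m :=
  ofIndex ε.symm (x := act.toFun _ (compose.mk (t.xqAt ε)))
    (act.map_mem _ _ _ (CompositeModule.mk_mem_gr _)) (fun p => t.l p.1 p.2)
    (fun p => t.c p.1 p.2) (fun p => t.hs p.1 p.2) t.e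

/-- `t.right` for arbitrary enumerations of the inputs of the `q_i(s_{i*})`. -/
abbrev rightAt (act : GrHom (compose P R) A) (t : TripleSymbol L P R m) (n' : Fin t.r → ℕ)
    (ε : ∀ i, (Σ k, Fin (t.l i k)) ≃ Fin (n' i)) : CompositeSymbol L A m where
  r := t.r
  n := n'
  e := ((Equiv.sigmaCongrRight fun i => (ε i).symm).trans
    (Equiv.sigmaAssoc fun i k => Fin (t.l i k)).symm).trans t.e
  a := t.a
  x := t.x
  hx := t.hx
  b := fun i => t.b i + ∑ k, t.c i k
  y := fun i => act.toFun _ (compose.mk (t.qsAt i (ε i)))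
  hy := fun i => act.map_mem _ _ _ (CompositeModule.mk_mem_gr (t.qsAt i (ε i)))

/-- The sign exponent of the change of enumeration. -/
abbrev lexExp (t : TripleSymbol L P R m) {B : Type*} [LinearOrder B]
    (g : (Σ i, Fin (t.n i)) → B) : ℕ :=
  invExp (fun p => finSigmaFinEquiv p) g (fun p => t.c p.1 p.2)

/-- Another enumeration of the inputs of the q_i permutes the inputs of the root λ(x(q_*)), by
equivariance of `act`. In the coinvariants this permutation moves to the factors s_{ik}, whose
Koszul sign is the only one to appear. -/
theorem mk_leftAt (act : GrHom (compose L P) A) (t : TripleSymbol L P R m) {r' r'' : ℕ}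
    (ε : (Σ i, Fin (t.n i)) ≃ Fin r') (ε' : (Σ i, Fin (t.n i)) ≃ Fin r'') :
    CompositeModule.mk (t.leftAt act ε') = (-1 : K) ^ invExp ε' ε (fun p => t.c p.1 p.2) •
      CompositeModule.mk (t.leftAt act ε) := by
  obtain rfl : r' = r'' := by simpa using Fintype.card_congr (ε.symm.trans ε')
  obtain ⟨s, rfl⟩ : ∃ s : Equiv.Perm (Fin r'), ε' = ε.trans s :=
    ⟨ε.symm.trans ε', Equiv.ext fun p => by simp⟩
  have h1 := mk_ofIndex_outer (m := m) (ε.trans s).symm s (x := act.toFun _ (compose.mk (t.xqAt ε)))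
    (act.map_mem _ _ _ (CompositeModule.mk_mem_gr _)) (fun p => t.l p.1 p.2)
    (fun p => t.c p.1 p.2) (fun p => t.hs p.1 p.2) t.e
  have h2 : s.trans (ε.trans s).symm = ε.symm := Equiv.ext fun p => by simp
  rw [h2] at h1
  refine Eq.trans ?_ h1
  refine mk_congr' (ofIndex (ε.trans s).symm (x := A.rep _ s (act.toFun _ (compose.mk (t.xqAt ε))))
    (A.rep_mem _ _ _ _ (act.map_mem _ _ _ (CompositeModule.mk_mem_gr _))) (fun p => t.l p.1 p.2)
    (fun p => t.c p.1 p.2) (fun p => t.hs p.1 p.2) t.e) (fun _ => rfl) ?_ (fun _ => rfl)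
  exact (act.tr_mk s (t.xqAt ε)).symm

/-- Here the enumeration only renames inputs inside each block, so no factor moves and no sign
appears. -/
theorem mk_rightAt (act : GrHom (compose P R) A) (t : TripleSymbol L P R m) (n' n'' : Fin t.r → ℕ)
    (ε : ∀ i, (Σ k, Fin (t.l i k)) ≃ Fin (n' i)) (ε' : ∀ i, (Σ k, Fin (t.l i k)) ≃ Fin (n'' i)) :
    CompositeModule.mk (t.rightAt act n' ε) = CompositeModule.mk (t.rightAt act n'' ε') := by
  refine mk_relabel_blocks _ _ _ _ _ _ (fun i => (ε i).symm.trans (ε' i)) ?_ ?_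
  · intro i k
    simp
  · intro i
    rw [act.tr_mk]
    congr 2
    simp only [CompositeSymbol.mk.injEq, heq_eq_eq, true_and, and_true]
    exact Equiv.ext fun p => by simp

/-! #### Permutations of the factors -/

/-- `x ↦ w x` -/
abbrev outer (t : TripleSymbol L P R m) (w : Equiv.Perm (Fin t.r)) : TripleSymbol L P R m :=
  { t with
    x := L.rep _ w t.x
    hx := L.rep_mem _ _ _ _ t.hx }

/-- The permutation of the factors `q_i(s_{i*})`. -/
abbrev outerPerm (t : TripleSymbol L P R m) (w : Equiv.Perm (Fin t.r)) : TripleSymbol L P R m where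
  r := t.r
  n := fun i => t.n (w i)
  l := fun i => t.l (w i)
  e := (Equiv.sigmaCongrLeft (β := fun p : (Σ i, Fin (t.n i)) => Fin (t.l p.1 p.2))
    (Equiv.sigmaCongrLeft (β := fun i => Fin (t.n i)) w)).trans t.e
  a := t.a
  x := t.x
  hx := t.hx
  b := fun i => t.b (w i)
  q := fun i => t.q (w i)
  hq := fun i => t.hq (w i)
  c := fun i => t.c (w i)
  s := fun i => t.s (w i)
  hs := fun i => t.hs (w i)

/-- `q_i ↦ σ_i q_i` -/
abbrev mid (t : TripleSymbol L P R m) (σ : ∀ i, Equiv.Perm (Fin (t.n i))) : TripleSymbol L P R m :=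
  { t with
    q := fun i => P.rep _ (σ i) (t.q i)
    hq := fun i => P.rep_mem _ _ _ _ (t.hq i) }

/-- The permutation of the factors `s_{i*}` for each `i`. -/
abbrev midPerm (t : TripleSymbol L P R m) (σ : ∀ i, Equiv.Perm (Fin (t.n i))) :
    TripleSymbol L P R m where
  r := t.r
  n := t.n
  l := fun i k => t.l i (σ i k)
  e := (Equiv.sigmaCongrLeft (β := fun p : (Σ i, Fin (t.n i)) => Fin (t.l p.1 p.2))
    (Equiv.sigmaCongrRight σ)).trans t.e
  a := t.a
  x := t.x
  hx := t.hx
  b := t.b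
  q := t.q
  hq := t.hq
  c := fun i k => t.c i (σ i k)
  s := fun i k => t.s i (σ i k)
  hs := fun i k => t.hs i (σ i k)

/-- `s_{ik} ↦ τ_{ik} s_{ik}` -/
abbrev inner (t : TripleSymbol L P R m) (τ : ∀ i k, Equiv.Perm (Fin (t.l i k))) :
    TripleSymbol L P R m :=
  { t with
    s := fun i k => R.rep _ (τ i k) (t.s i k)
    hs := fun i k => R.rep_mem _ _ _ _ (t.hs i k) }

/-- Relabelling of the inputs of the `s_{ik}`. -/
abbrev innerLabel (t : TripleSymbol L P R m) (τ : ∀ i k, Equiv.Perm (Fin (t.l i k))) :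
    TripleSymbol L P R m :=
  { t with e := (Equiv.sigmaCongrRight fun p : (Σ i, Fin (t.n i)) => τ p.1 p.2).trans t.e }

/-- The value of `λ(x(q_*))(s_{**})`. -/
def evalLeft (act : GrHom (compose L P) A) (t : TripleSymbol L P R m) : CompositeModule A R m :=
  CompositeModule.mk (t.left act)

/-- The value of `± x(ρ(q_*(s_{**})))`. -/
def evalRight (act : GrHom (compose P R) A) (t : TripleSymbol L P R m) : CompositeModule L A m :=
  (-1 : K) ^ t.signExp • CompositeModule.mk (t.right act)

theorem evalLeft_eq (act : GrHom (compose L P) A) (t : TripleSymbol L P R m) {r' : ℕ}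
    (ε : (Σ i, Fin (t.n i)) ≃ Fin r') :
    t.evalLeft act = (-1 : K) ^ t.lexExp ε • CompositeModule.mk (t.leftAt act ε) :=
  mk_leftAt act t ε finSigmaFinEquiv

theorem evalRight_eq (act : GrHom (compose P R) A) (t : TripleSymbol L P R m) (n' : Fin t.r → ℕ)
    (ε : ∀ i, (Σ k, Fin (t.l i k)) ≃ Fin (n' i)) :
    t.evalRight act = (-1 : K) ^ t.signExp • CompositeModule.mk (t.rightAt act n' ε) :=
  congrArg _ (mk_rightAt act t (fun i => ∑ k, t.l i k) n' (fun _ => finSigmaFinEquiv) ε)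

/-- The sign exponent of `outerPerm`. -/
abbrev outerExp (t : TripleSymbol L P R m) (w : Equiv.Perm (Fin t.r)) : ℕ :=
  koszulExp w t.b + (t.outerPerm w).lexExp fun p =>
    finSigmaFinEquiv (Equiv.sigmaCongrLeft (β := fun i => Fin (t.n i)) w p)

/-- The sign exponent of `midPerm`. -/
abbrev midExp (t : TripleSymbol L P R m) (σ : ∀ i, Equiv.Perm (Fin (t.n i))) : ℕ :=
  (t.midPerm σ).lexExp fun p => finSigmaFinEquiv (Equiv.sigmaCongrRight σ p)

/-- Two signs contribute: that of permuting the q_i inside L ∘ P, and that of moving the groups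
s_{i*} along, because the permuted symbol lists its leaves in another lexicographic order. -/
theorem evalLeft_outer (act : GrHom (compose L P) A) (t : TripleSymbol L P R m)
    (w : Equiv.Perm (Fin t.r)) :
    (t.outer w).evalLeft act = (-1 : K) ^ t.outerExp w • (t.outerPerm w).evalLeft act := by
  rw [evalLeft_eq act (t.outerPerm w)
    ((Equiv.sigmaCongrLeft (β := fun i => Fin (t.n i)) w).trans finSigmaFinEquiv), pow_add,
    smul_smul, mul_assoc]
  have : ∀ a : ℕ, (-1 : K) ^ koszulExp w t.b * ((-1) ^ a * (-1) ^ a) = (-1) ^ koszulExp w t.b :=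
    fun a => by rw [neg_one_pow_mul_self, mul_one]
  refine Eq.trans ?_ (congrArg (· • _) (this _).symm)
  have h1 : act.toFun _ (compose.mk ((t.outer w).xqAt finSigmaFinEquiv))
      = (-1 : K) ^ koszulExp w t.b • act.toFun _ (compose.mk ((t.outerPerm w).xqAt
        ((Equiv.sigmaCongrLeft (β := fun i => Fin (t.n i)) w).trans finSigmaFinEquiv))) := by
    rw [← map_smul]
    exact congrArg _ (mk_outer (t.xqAt finSigmaFinEquiv) w)
  have h2 := mk_ofIndex_reindex (m := m) (Equiv.sigmaCongrLeft (β := fun i => Fin (t.n i)) w)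
    ((Equiv.sigmaCongrLeft (β := fun i => Fin (t.n i)) w).trans finSigmaFinEquiv).symm
    finSigmaFinEquiv.symm (fun k => by simp)
    (x := act.toFun _ (compose.mk ((t.outerPerm w).xqAt
        ((Equiv.sigmaCongrLeft (β := fun i => Fin (t.n i)) w).trans finSigmaFinEquiv))))
    (act.map_mem _ _ _ (CompositeModule.mk_mem_gr _)) (fun p => t.l p.1 p.2)
    (fun p => t.c p.1 p.2) (fun p => t.hs p.1 p.2) t.e
  refine Eq.trans ?_ (congrArg _ h2)
  rw [← mk_smul_left]
  exact mk_eq_mk (fun _ => rfl) h1 (fun _ => rfl)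

theorem evalLeft_mid (act : GrHom (compose L P) A) (t : TripleSymbol L P R m)
    (σ : ∀ i, Equiv.Perm (Fin (t.n i))) :
    (t.mid σ).evalLeft act = (-1 : K) ^ t.midExp σ • (t.midPerm σ).evalLeft act := by
  rw [evalLeft_eq act (t.midPerm σ) ((Equiv.sigmaCongrRight σ).trans finSigmaFinEquiv),
    smul_smul]
  refine Eq.trans ?_ (congrArg (· • _) (neg_one_pow_mul_self _).symm)
  rw [one_smul]
  have h1 : act.toFun _ (compose.mk ((t.mid σ).xqAt finSigmaFinEquiv))
      = act.toFun _ (compose.mk ((t.midPerm σ).xqAt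
        ((Equiv.sigmaCongrRight σ).trans finSigmaFinEquiv))) :=
    congrArg _ (mk_inner (t.xqAt finSigmaFinEquiv) σ)
  have h2 := mk_ofIndex_reindex (m := m) (Equiv.sigmaCongrRight σ)
    ((Equiv.sigmaCongrRight σ).trans finSigmaFinEquiv).symm
    finSigmaFinEquiv.symm (fun k => by simp)
    (x := act.toFun _ (compose.mk ((t.midPerm σ).xqAt
        ((Equiv.sigmaCongrRight σ).trans finSigmaFinEquiv))))
    (act.map_mem _ _ _ (CompositeModule.mk_mem_gr _)) (fun p => t.l p.1 p.2)
    (fun p => t.c p.1 p.2) (fun p => t.hs p.1 p.2) t.e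
  refine Eq.trans ?_ h2
  exact mk_eq_mk (fun _ => rfl) h1 (fun _ => rfl)

theorem evalLeft_inner (act : GrHom (compose L P) A) (t : TripleSymbol L P R m)
    (τ : ∀ i k, Equiv.Perm (Fin (t.l i k))) :
    (t.inner τ).evalLeft act = (t.innerLabel τ).evalLeft act := by
  refine (mk_inner (t.left act) fun j => τ _ _).trans ?_
  exact mk_eq_mk (fun _ => rfl) rfl (fun _ => rfl)

/-- Blocks move rigidly, so no pair inside a block is inverted, and an inverted pair of blocks
contributes the product of their total degrees. -/
theorem koszulExp_block {r : ℕ} (n : Fin r → ℕ) (w : Equiv.Perm (Fin r)) (c : ∀ i, Fin (n i) → ℕ) :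
    (invExp (fun p : (Σ i, Fin (n (w i))) => finSigmaFinEquiv p)
      (fun p => finSigmaFinEquiv (Equiv.sigmaCongrLeft (β := fun i => Fin (n i)) w p))
      (fun p => c (w p.1) p.2)) = koszulExp w (fun i => ∑ k, c i k) := by
  simp only [invExp, finSigmaFinEquiv_lt_iff, koszulExp, Fintype.sum_sigma]
  refine Finset.sum_congr rfl fun i _ => ?_
  rw [Finset.sum_comm]
  refine Finset.sum_congr rfl fun j _ => ?_
  change (∑ x : Fin (n (w i)), ∑ y : Fin (n (w j)),
    if (i < j ∨ i = j ∧ (x : ℕ) < y) ∧ (w j < w i ∨ w j = w i ∧ (y : ℕ) < x) then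
      c (w i) x * c (w j) y else 0) = _
  have : ∀ (x : Fin (n (w i))) (y : Fin (n (w j))),
      ((i < j ∨ i = j ∧ (x : ℕ) < y) ∧ (w j < w i ∨ w j = w i ∧ (y : ℕ) < x)) ↔
        (i < j ∧ w j < w i) := by
    intro x y
    constructor
    · rintro ⟨h1 | ⟨rfl, h1⟩, h2 | ⟨h2, h3⟩⟩
      · exact ⟨h1, h2⟩
      · exact absurd (w.injective h2) h1.ne'
      · exact absurd h2 (lt_irrefl _)
      · exact absurd h1 h3.not_gt
    · rintro ⟨h1, h2⟩
      exact ⟨Or.inl h1, Or.inl h2⟩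
  simp only [this]
  split_ifs
  · rw [Finset.sum_mul_sum]
  · simp

/-- Blocks keep their positions, so only pairs inside one block can be inverted. -/
theorem koszulExp_sum {r : ℕ} (n : Fin r → ℕ) (σ : ∀ i, Equiv.Perm (Fin (n i)))
    (c : ∀ i, Fin (n i) → ℕ) :
    (invExp (fun p : (Σ i, Fin (n i)) => finSigmaFinEquiv p)
      (fun p => finSigmaFinEquiv (Equiv.sigmaCongrRight σ p))
      (fun p => c p.1 (σ p.1 p.2))) = ∑ i, koszulExp (σ i) (c i) := by
  simp only [invExp, finSigmaFinEquiv_lt_iff, koszulExp, Fintype.sum_sigma]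
  refine Finset.sum_congr rfl fun i _ => ?_
  refine Finset.sum_congr rfl fun x _ => ?_
  rw [Finset.sum_eq_single i]
  · refine Finset.sum_congr rfl fun y _ => if_congr ?_ rfl rfl
    simp only [lt_irrefl, false_or, true_and]
    exact and_congr Iff.rfl (by simp [Equiv.sigmaCongrRight])
  · intro j _ hj
    refine Finset.sum_eq_zero fun y _ => if_neg ?_
    rintro ⟨h1 | ⟨h1, -⟩, h2 | ⟨h2, -⟩⟩
    · exact h1.not_gt h2
    · exact hj h2
    · exact hj h1.symm
    · exact hj h2
  · simp

/-- Permuting the branches q_i(s_{i*}) as units and then separating the q's from the s's is the same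
rearrangement as separating first and permuting the q's and the groups of s's afterwards. Checked on
each pair of branches, what is left are the products |s_{i*}||q_j|, which occur twice. -/
theorem signExp_outerPerm (t : TripleSymbol L P R m) (w : Equiv.Perm (Fin t.r)) :
    ((t.signExp + koszulExp w (fun i => t.b i + ∑ k, t.c i k) : ℕ) : ZMod 2)
      = (t.outerExp w + (t.outerPerm w).signExp : ℕ) := by
  rw [outerExp, lexExp, koszulExp_block t.n w t.c]
  have h1 : t.signExp = ∑ i, ∑ j, if w i < w j then (∑ k, t.c (w i) k) * t.b (w j) else 0 := by
    rw [signExp, ← Equiv.sum_comp w]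
    refine Finset.sum_congr rfl fun i _ => ?_
    rw [← Equiv.sum_comp w]
  have h2 : (t.outerPerm w).signExp
      = ∑ i, ∑ j, if i < j then (∑ k, t.c (w i) k) * t.b (w j) else 0 := rfl
  rw [h1, h2]
  simp only [koszulExp]
  generalize hC : (fun i => ∑ k, t.c (w i) k) = C
  have hC' : ∀ i, (∑ k, t.c (w i) k) = C i := fun i => congrFun hC i
  simp only [hC', Nat.cast_add, Nat.cast_sum, ← Finset.sum_add_distrib]
  refine sum_sum_eq_of_symm _ _ (fun i j => ?_) (fun i => by simp)
  rcases eq_or_ne i j with rfl | hij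
  · simp
  have e1 := ZMod.two_add_self ((C i : ZMod 2) * t.b (w j))
  have e2 := ZMod.two_add_self ((C j : ZMod 2) * t.b (w i))
  rcases lt_or_gt_of_ne hij with h3 | h3 <;>
  rcases lt_or_gt_of_ne (w.injective.ne hij) with h4 | h4 <;>
  simp [h3, h4, h3.not_gt, h4.not_gt] <;>
  first
  | linear_combination e1
  | linear_combination e2

theorem signExp_midPerm (t : TripleSymbol L P R m) (σ : ∀ i, Equiv.Perm (Fin (t.n i))) :
    (t.midPerm σ).signExp = t.signExp := by
  simp only [signExp]
  refine Finset.sum_congr rfl fun i _ => Finset.sum_congr rfl fun j _ => ?_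
  rw [Equiv.sum_comp (σ i) (t.c i)]

theorem evalRight_outer (act : GrHom (compose P R) A) (t : TripleSymbol L P R m)
    (w : Equiv.Perm (Fin t.r)) :
    (t.outer w).evalRight act = (-1 : K) ^ t.outerExp w • (t.outerPerm w).evalRight act := by
  have h1 := mk_outer (t.right act) w
  have h2 := neg_one_pow_congr_zmod (K := K) (signExp_outerPerm t w)
  have h3 : CompositeModule.mk ((t.right act).outerPerm w)
      = CompositeModule.mk ((t.outerPerm w).right act) := mk_eq_mk (fun _ => rfl) rfl (fun _ => rfl)
  rw [evalRight, evalRight, smul_smul, ← pow_add, ← h2, pow_add, mul_smul, ← h3]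
  exact congrArg _ h1

theorem evalRight_mid (act : GrHom (compose P R) A) (t : TripleSymbol L P R m)
    (σ : ∀ i, Equiv.Perm (Fin (t.n i))) :
    (t.mid σ).evalRight act = (-1 : K) ^ t.midExp σ • (t.midPerm σ).evalRight act := by
  rw [evalRight_eq act (t.midPerm σ) (fun i => ∑ k, t.l i k)
    (fun i => (Equiv.sigmaCongrLeft (β := fun k => Fin (t.l i k)) (σ i)).trans finSigmaFinEquiv),
    signExp_midPerm, smul_comm]
  change (-1 : K) ^ t.signExp • CompositeModule.mk ((t.mid σ).right act) = _
  congr 1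
  -- The total sign is a product of one sign per branch, so it can be produced by applying the
  -- coinvariance relation of P ∘ R in every branch.
  rw [midExp, lexExp, koszulExp_sum t.n σ t.c, ← Finset.prod_pow_eq_pow_sum]
  refine mk_smul_right_all ((t.mid σ).right act) (fun i => (-1 : K) ^ koszulExp (σ i) (t.c i))
    (fun i => act.toFun _ (compose.mk ((t.midPerm σ).qsAt i
      ((Equiv.sigmaCongrLeft (β := fun k => Fin (t.l i k)) (σ i)).trans finSigmaFinEquiv))))
    (fun i => ?_) (fun i => ?_) |>.trans ?_
  · have h := act.map_mem _ _ _ (CompositeModule.mk_mem_gr ((t.midPerm σ).qsAt i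
      ((Equiv.sigmaCongrLeft (β := fun k => Fin (t.l i k)) (σ i)).trans finSigmaFinEquiv)))
    rw [deg, Equiv.sum_comp (σ i) (t.c i)] at h
    exact h
  · rw [← map_smul]
    exact congrArg _ (mk_outer (t.qs i) (σ i))
  · refine congrArg _ (mk_eq_mk (fun p => ?_) rfl (fun i => rfl))
    obtain ⟨i, k⟩ := p
    obtain ⟨z, rfl⟩ := ((Equiv.sigmaCongrLeft (β := fun k => Fin (t.l i k)) (σ i)).trans
      finSigmaFinEquiv).surjective k
    simp [Equiv.sigmaAssoc, Equiv.sigmaCongrRight, Equiv.sigmaCongrLeft]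
    rw [Equiv.symm_apply_apply]

theorem evalRight_inner (act : GrHom (compose P R) A) (t : TripleSymbol L P R m)
    (τ : ∀ i k, Equiv.Perm (Fin (t.l i k))) :
    (t.inner τ).evalRight act = (t.innerLabel τ).evalRight act := by
  rw [evalRight_eq act (t.innerLabel τ) (fun i => ∑ k, t.l i k)
    (fun i => (Equiv.sigmaCongrRight (τ i)).trans finSigmaFinEquiv)]
  refine congrArg _ (mk_eq_mk (fun p => ?_) rfl (fun i => ?_))
  · refine congrArg t.e ?_
    obtain ⟨i, k⟩ := p
    simp [Equiv.sigmaAssoc]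
  · exact congrArg _ (mk_inner (t.qs i) (τ i))

/-! #### Multilinearity -/

theorem evalLeft_lin_x (act : GrHom (compose L P) A) (t : TripleSymbol L P R m) (α β : K)
    (x' x'' : L t.r) (hx' : x' ∈ L.gr t.r t.a) (hx'' : x'' ∈ L.gr t.r t.a)
    (h : t.x = α • x' + β • x'') :
    t.evalLeft act = α • evalLeft act { t with x := x', hx := hx' }
      + β • evalLeft act { t with x := x'', hx := hx'' } := by
  refine mk_lin_left (t.left act) α β _ _ (left act { t with x := x', hx := hx' }).hx
    (left act { t with x := x'', hx := hx'' }).hx ?_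
  rw [← map_smul, ← map_smul, ← map_add]
  exact congrArg _ (mk_lin_left t.xq α β x' x'' hx' hx'' h)

theorem evalLeft_lin_q (act : GrHom (compose L P) A) (t : TripleSymbol L P R m) (i : Fin t.r)
    (α β : K) (q' q'' : ∀ j, P (t.n j)) (hq' : ∀ j, q' j ∈ P.gr (t.n j) (t.b j))
    (hq'' : ∀ j, q'' j ∈ P.gr (t.n j) (t.b j)) (h : t.q i = α • q' i + β • q'' i)
    (h' : ∀ j, j ≠ i → q' j = t.q j) (h'' : ∀ j, j ≠ i → q'' j = t.q j) :
    t.evalLeft act = α • evalLeft act { t with q := q', hq := hq' }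
      + β • evalLeft act { t with q := q'', hq := hq'' } := by
  refine mk_lin_left (t.left act) α β _ _ (left act { t with q := q', hq := hq' }).hx
    (left act { t with q := q'', hq := hq'' }).hx ?_
  rw [← map_smul, ← map_smul, ← map_add]
  exact congrArg _ (mk_lin_right t.xq i α β q' q'' hq' hq'' h h' h'')

theorem evalLeft_lin_s (act : GrHom (compose L P) A) (t : TripleSymbol L P R m) (i : Fin t.r)
    (k : Fin (t.n i)) (α β : K) (s' s'' : ∀ j l, R (t.l j l))
    (hs' : ∀ j l, s' j l ∈ R.gr (t.l j l) (t.c j l))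
    (hs'' : ∀ j l, s'' j l ∈ R.gr (t.l j l) (t.c j l)) (h : t.s i k = α • s' i k + β • s'' i k)
    (h' : ∀ j l, (⟨j, l⟩ : Σ i, Fin (t.n i)) ≠ ⟨i, k⟩ → s' j l = t.s j l)
    (h'' : ∀ j l, (⟨j, l⟩ : Σ i, Fin (t.n i)) ≠ ⟨i, k⟩ → s'' j l = t.s j l) :
    t.evalLeft act = α • evalLeft act { t with s := s', hs := hs' }
      + β • evalLeft act { t with s := s'', hs := hs'' } := by
  have key : ∀ j, j ≠ finSigmaFinEquiv ⟨i, k⟩ →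
      (finSigmaFinEquiv.symm j : Σ i, Fin (t.n i)) ≠ ⟨i, k⟩ := by
    rintro j hj h
    exact hj (by rw [← h, Equiv.apply_symm_apply])
  refine mk_lin_right (t.left act) (finSigmaFinEquiv ⟨i, k⟩) α β _ _
    (left act { t with s := s', hs := hs' }).hy (left act { t with s := s'', hs := hs'' }).hy ?_
    (fun j hj => h' _ _ (key j hj)) (fun j hj => h'' _ _ (key j hj))
  have : ∀ p : Σ i, Fin (t.n i), p = ⟨i, k⟩ →
      t.s p.1 p.2 = α • s' p.1 p.2 + β • s'' p.1 p.2 := by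
    rintro _ rfl
    exact h
  exact this _ (Equiv.symm_apply_apply _ _)

theorem evalRight_lin_x (act : GrHom (compose P R) A) (t : TripleSymbol L P R m) (α β : K)
    (x' x'' : L t.r) (hx' : x' ∈ L.gr t.r t.a) (hx'' : x'' ∈ L.gr t.r t.a)
    (h : t.x = α • x' + β • x'') :
    t.evalRight act = α • evalRight act { t with x := x', hx := hx' }
      + β • evalRight act { t with x := x'', hx := hx'' } := by
  exact smul_lin_comb _ (mk_lin_left (t.right act) α β x' x'' hx' hx'' h)

theorem evalRight_lin_q (act : GrHom (compose P R) A) (t : TripleSymbol L P R m) (i : Fin t.r)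
    (α β : K) (q' q'' : ∀ j, P (t.n j)) (hq' : ∀ j, q' j ∈ P.gr (t.n j) (t.b j))
    (hq'' : ∀ j, q'' j ∈ P.gr (t.n j) (t.b j)) (h : t.q i = α • q' i + β • q'' i)
    (h' : ∀ j, j ≠ i → q' j = t.q j) (h'' : ∀ j, j ≠ i → q'' j = t.q j) :
    t.evalRight act = α • evalRight act { t with q := q', hq := hq' }
      + β • evalRight act { t with q := q'', hq := hq'' } := by
  refine smul_lin_comb _ (mk_lin_right (t.right act) i α β _ _
    (right act { t with q := q', hq := hq' }).hy (right act { t with q := q'', hq := hq'' }).hy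
    ?_ (fun j hj => ?_) (fun j hj => ?_))
  · rw [← map_smul, ← map_smul, ← map_add]
    exact congrArg _ (mk_lin_left (t.qs i) α β _ _ (hq' i) (hq'' i) h)
  · exact congrArg _ (mk_eq_mk (fun _ => rfl) (h' j hj) (fun _ => rfl))
  · exact congrArg _ (mk_eq_mk (fun _ => rfl) (h'' j hj) (fun _ => rfl))

theorem evalRight_lin_s (act : GrHom (compose P R) A) (t : TripleSymbol L P R m) (i : Fin t.r)
    (k : Fin (t.n i)) (α β : K) (s' s'' : ∀ j l, R (t.l j l))
    (hs' : ∀ j l, s' j l ∈ R.gr (t.l j l) (t.c j l))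
    (hs'' : ∀ j l, s'' j l ∈ R.gr (t.l j l) (t.c j l)) (h : t.s i k = α • s' i k + β • s'' i k)
    (h' : ∀ j l, (⟨j, l⟩ : Σ i, Fin (t.n i)) ≠ ⟨i, k⟩ → s' j l = t.s j l)
    (h'' : ∀ j l, (⟨j, l⟩ : Σ i, Fin (t.n i)) ≠ ⟨i, k⟩ → s'' j l = t.s j l) :
    t.evalRight act = α • evalRight act { t with s := s', hs := hs' }
      + β • evalRight act { t with s := s'', hs := hs'' } := by
  have key : ∀ j (l : Fin (t.n j)), j ≠ i → (⟨j, l⟩ : Σ i, Fin (t.n i)) ≠ ⟨i, k⟩ := by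
    rintro j l hj h
    exact hj (congrArg Sigma.fst h)
  refine smul_lin_comb _ (mk_lin_right (t.right act) i α β _ _
    (right act { t with s := s', hs := hs' }).hy (right act { t with s := s'', hs := hs'' }).hy
    ?_ (fun j hj => ?_) (fun j hj => ?_))
  · rw [← map_smul, ← map_smul, ← map_add]
    exact congrArg _ (mk_lin_right (t.qs i) k α β _ _ (hs' i) (hs'' i) h
      (fun l hl => h' _ _ (by simpa using hl)) (fun l hl => h'' _ _ (by simpa using hl)))
  · exact congrArg _ (mk_eq_mk (fun _ => rfl) rfl (fun l => h' _ _ (key j l hj)))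
  · exact congrArg _ (mk_eq_mk (fun _ => rfl) rfl (fun l => h'' _ _ (key j l hj)))

end TripleSymbol
end Triple


/-! ### Leibniz rule for two-step composites; the relations are stable under the differential. -/

noncomputable section Leibniz

variable {K : Type u} [CommRing K]

namespace CompositeModule

variable {M : DGSymModule.{u, v} K} {N : DGSymModule.{u, w} K} {m : ℕ}

/-- A composite element, as a function of its root. -/
def mkLeft (c : CompositeSymbol M N m) : M.gr c.r c.a →ₗ[K] CompositeModule M N m where
  toFun z := mk { c with x := z.1, hx := z.2 }
  map_add' z z' := mk_add_left { c with x := z.1, hx := z.2 } z'.1 z'.2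
  map_smul' t z := mk_smul_left { c with x := z.1, hx := z.2 } t

/-- A composite element, as a function of its `i`-th branch. -/
def mkRight (c : CompositeSymbol M N m) (i : Fin c.r) :
    N.gr (c.n i) (c.b i) →ₗ[K] CompositeModule M N m :=
  have hu : ∀ (z : N.gr (c.n i) (c.b i)) j,
      Function.update c.y i z.1 j ∈ N.gr (c.n j) (c.b j) := fun z j => by
    rcases eq_or_ne j i with rfl | hj
    · simp [z.2]
    · simpa [hj] using c.hy j
  { toFun z := mk { c with y := Function.update c.y i z.1, hy := hu z }
    map_add' z z' := by
      refine mk_add_right { c with y := _, hy := hu (z + z') } i _ _ (hu z) (hu z') ?_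
        (fun j hj => ?_) (fun j hj => ?_) <;> simp_all
    map_smul' t z := by
      refine mk_smul_right { c with y := _, hy := hu (t • z) } i t _ (hu z) ?_
        (fun j hj => ?_) <;> simp_all }

theorem mkRight_eq (c : CompositeSymbol M N m) (i : Fin c.r)
    (z : N.gr (c.n i) (c.b i)) {a : ℕ} {b : Fin c.r → ℕ} {y : ∀ i, N (c.n i)}
    {hx : c.x ∈ M.gr c.r a} {hy : ∀ i, y i ∈ N.gr (c.n i) (b i)} (h : y i = z.1)
    (h' : ∀ j, j ≠ i → y j = c.y j) :
    mkRight c i z = mk { c with a := a, hx := hx, b := b, y := y, hy := hy } := by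
  refine mk_eq_mk (fun _ => rfl) rfl fun j => ?_
  rcases eq_or_ne j i with rfl | hj
  · simp [h]
  · simp [hj, h' j hj]

/-- The degree of `c.dLeft` uses truncated subtraction and is off by one when `c.a = 0`; in that
case the element is zero. -/
theorem mk_dLeft_mem (c : CompositeSymbol M N m) : mk c.dLeft ∈ gr M N m (c.deg - 1) := by
  by_cases ha : c.a = 0
  · rw [mk_eq_zero_of_left c.dLeft (M.d_zero _ _ (ha ▸ c.hx))]
    exact zero_mem _
  · refine Submodule.subset_span ⟨c.dLeft, ?_, rfl⟩
    simp only [CompositeSymbol.deg]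
    omega

theorem mk_dRight_mem (c : CompositeSymbol M N m) (i : Fin c.r) :
    mk (c.dRight i) ∈ gr M N m (c.deg - 1) := by
  by_cases hb : c.b i = 0
  · rw [mk_dRight_of_b_eq_zero c i hb]
    exact zero_mem _
  · refine Submodule.subset_span ⟨c.dRight i, ?_, rfl⟩
    simp only [CompositeSymbol.deg]
    have h1 := Finset.sum_update_of_mem (Finset.mem_univ i) c.b (c.b i - 1)
    have h2 := Finset.add_sum_erase Finset.univ c.b (Finset.mem_univ i)
    rw [Finset.sdiff_singleton_eq_erase] at h1
    omega

end CompositeModule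

theorem DGHom.d_mk {L : DGSymModule.{u, v₁} K} {P : DGSymModule.{u, v₂} K}
    {A : DGSymModule.{u, v₄} K} (f : DGHom (compose L P) A) {m : ℕ} (c : CompositeSymbol L P m) :
    A.d m (f.toFun m (compose.mk c)) = f.toFun m (compose.mk c.dLeft)
      + ∑ i, (-1 : K) ^ c.dExp i • f.toFun m (compose.mk (c.dRight i)) := by
  rw [← f.map_d]
  refine (congrArg _ (CompositeModule.dHom_mk c)).trans ?_
  rw [CompositeModule.dMk, map_add, map_sum]
  simp only [map_smul]
  rfl

namespace TripleSymbol

open CompositeModule CompositeSymbol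

variable {L : DGSymModule.{u, v₁} K} {P : DGSymModule.{u, v₂} K} {R : DGSymModule.{u, v₃} K}
  {A : DGSymModule.{u, v₄} K} {m : ℕ}

theorem evalRight_eq_zero_of_q (act : GrHom (compose P R) A) (t : TripleSymbol L P R m)
    (i : Fin t.r) (h : t.q i = 0) : t.evalRight act = 0 := by
  have := evalRight_lin_q act t i 0 0 t.q t.q t.hq t.hq (by simp [h]) (fun _ _ => rfl)
    (fun _ _ => rfl)
  simpa only [zero_smul, add_zero] using this

theorem evalRight_eq_zero_of_s (act : GrHom (compose P R) A) (t : TripleSymbol L P R m)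
    (i : Fin t.r) (k : Fin (t.n i)) (h : t.s i k = 0) : t.evalRight act = 0 := by
  have := evalRight_lin_s act t i k 0 0 t.s t.s t.hs t.hs (by simp [h]) (fun _ _ _ => rfl)
    (fun _ _ _ => rfl)
  simpa only [zero_smul, add_zero] using this

/-- `δ(x)(q_*)(s_{**})` -/
abbrev dx (t : TripleSymbol L P R m) : TripleSymbol L P R m :=
  { t with a := t.a - 1, x := L.d _ t.x, hx := L.d_mem_pred _ _ _ t.hx }

/-- `x(…,δ(q_i),…)(s_{**})` -/
abbrev dq (t : TripleSymbol L P R m) (i : Fin t.r) : TripleSymbol L P R m :=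
  { t with
    b := Function.update t.b i (t.b i - 1)
    q := Function.update t.q i (P.d (t.n i) (t.q i))
    hq := (t.xq.dRight i).hy }

/-- `x(q_*)(…,δ(s_{ik}),…)` -/
abbrev ds (t : TripleSymbol L P R m) (p : Σ i, Fin (t.n i)) : TripleSymbol L P R m :=
  { t with
    c := fun i k => if (⟨i, k⟩ : Σ i, Fin (t.n i)) = p then t.c i k - 1 else t.c i k
    s := fun i k => if (⟨i, k⟩ : Σ i, Fin (t.n i)) = p then R.d _ (t.s i k) else t.s i k
    hs := fun i k => by
      split_ifs
      · exact R.d_mem_pred _ _ _ (t.hs i k)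
      · exact t.hs i k }

/-- The sign exponent of `dq`. -/
abbrev dqExp (t : TripleSymbol L P R m) (i : Fin t.r) : ℕ :=
  t.a + ∑ j, if j < i then t.b j else 0

/-- The sign exponent of `ds`. -/
abbrev dsExp (t : TripleSymbol L P R m) (p : Σ i, Fin (t.n i)) : ℕ :=
  t.a + ∑ j, t.b j + ∑ p', if finSigmaFinEquiv p' < finSigmaFinEquiv p then t.c p'.1 p'.2 else 0

/-- The Leibniz rule in A ∘ R, followed by the one in L ∘ P for the root, since `act` commutes with
the differential. The differential meets x, then all the q_i, then all the s_{ik}. -/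
theorem evalLeft_d (act : DGHom (compose L P) A) (t : TripleSymbol L P R m) :
    dHom A R m (t.evalLeft act.toGrHom) = t.dx.evalLeft act.toGrHom
      + ∑ i, (-1 : K) ^ t.dqExp i • (t.dq i).evalLeft act.toGrHom
      + ∑ p, (-1 : K) ^ t.dsExp p • (t.ds p).evalLeft act.toGrHom := by
  rw [evalLeft, dHom_mk, dMk]
  congr 1
  · have h0 : act.toFun _ (compose.mk t.xq.dLeft) ∈ A.gr _ (t.xq.deg - 1) :=
      act.map_mem _ _ _ (mk_dLeft_mem t.xq)
    have h1 : ∀ i, act.toFun _ (compose.mk (t.xq.dRight i)) ∈ A.gr _ (t.xq.deg - 1) := fun i =>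
      act.map_mem _ _ _ (mk_dRight_mem t.xq i)
    have h2 : CompositeModule.mk (t.left act.toGrHom).dLeft
        = mkLeft (t.left act.toGrHom).dLeft (⟨_, h0⟩ + ∑ i, (-1 : K) ^ t.dqExp i • ⟨_, h1 i⟩) := by
      refine mk_eq_mk (fun _ => rfl) ?_ (fun _ => rfl)
      refine (act.d_mk t.xq).trans ?_
      simp only [Submodule.coe_add, Submodule.coe_sum, Submodule.coe_smul]
    rw [h2, map_add, map_sum]
    congr 1
    · exact mk_eq_mk (fun _ => rfl) rfl (fun _ => rfl)
    · refine Finset.sum_congr rfl fun i _ => ?_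
      rw [map_smul]
      exact congrArg _ (mk_eq_mk (fun _ => rfl) rfl (fun _ => rfl))
  · rw [← Equiv.sum_comp finSigmaFinEquiv]
    refine Finset.sum_congr rfl fun p _ => ?_
    congr 1
    · refine congrArg _ ?_
      simp only [CompositeSymbol.dExp, dsExp]
      congr 1
      rw [← Equiv.sum_comp finSigmaFinEquiv]
      refine Finset.sum_congr rfl fun p' _ => ?_
      have : ∀ q : (Σ i, Fin (t.n i)), q = p' → t.c q.1 q.2 = t.c p'.1 p'.2 := by
        rintro _ rfl; rfl
      exact if_congr Iff.rfl (this _ (Equiv.symm_apply_apply _ _)) rfl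
    · refine mk_eq_mk (fun _ => rfl) rfl (fun j => ?_)
      rcases eq_or_ne j (finSigmaFinEquiv p) with rfl | hj
      · simp
      · rw [Function.update_of_ne hj]
        refine (if_neg ?_).symm
        intro h
        exact hj (by rw [← h]; exact (Equiv.apply_symm_apply _ _).symm)

/-- In the unshuffling sign q_i crosses the s_{j*} with j < i. The hypothesis on the degree is there
because the degree is lowered by truncated subtraction. -/
theorem signExp_dq (t : TripleSymbol L P R m) (i : Fin t.r) (h : t.b i ≠ 0) :
    t.signExp = (t.dq i).signExp + ∑ j, if j < i then ∑ k, t.c j k else 0 := by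
  have e1 : (∑ j, if j < i then ∑ k, t.c j k else 0)
      = ∑ j, ∑ j', if j' = i then (if j < i then ∑ k, t.c j k else 0) else 0 := by simp
  rw [e1, signExp, signExp, ← Finset.sum_add_distrib]
  refine Finset.sum_congr rfl fun j _ => ?_
  rw [← Finset.sum_add_distrib]
  refine Finset.sum_congr rfl fun j' _ => ?_
  rcases eq_or_ne j' i with rfl | hj
  · obtain ⟨b, hb⟩ := Nat.exists_eq_succ_of_ne_zero h
    simp only [Function.update_self, hb, if_true]
    split_ifs
    · simp [Nat.mul_succ]
    · simp
  · simp [Function.update_of_ne hj, hj]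

/-- In the unshuffling sign s_{ik} crosses the q_j with j > i. -/
theorem signExp_ds (t : TripleSymbol L P R m) (i : Fin t.r) (k : Fin (t.n i)) (h : t.c i k ≠ 0) :
    t.signExp = (t.ds ⟨i, k⟩).signExp + ∑ j, if i < j then t.b j else 0 := by
  have e1 : (∑ j, if i < j then t.b j else 0)
      = ∑ j', ∑ j, if j' = i then (if i < j then t.b j else 0) else 0 := by
    rw [Finset.sum_comm]; simp
  rw [e1, signExp, signExp, ← Finset.sum_add_distrib]
  refine Finset.sum_congr rfl fun j _ => ?_
  rw [← Finset.sum_add_distrib]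
  refine Finset.sum_congr rfl fun j' _ => ?_
  have e2 : (∑ l, t.c j l) = (∑ l, (t.ds ⟨i, k⟩).c j l) + if j = i then 1 else 0 := by
    rcases eq_or_ne j i with rfl | hj
    · have : (if j = j then 1 else 0) = ∑ l, if l = k then 1 else 0 := by simp
      rw [this, ← Finset.sum_add_distrib]
      refine Finset.sum_congr rfl fun l _ => ?_
      rcases eq_or_ne l k with rfl | hl
      · simp; omega
      · simp [hl]
    · simp [hj]
  rw [e2]
  rcases eq_or_ne j i with rfl | hj
  · simp only [if_true]
    split_ifs
    · ring
    · simp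
  · simp [hj]

/-- The same formula, with the same signs, as for the left evaluation. Here the differential meets
the factors in the order x, q_1, s_{1*}, q_2, s_{2*}, …, and the discrepancy is compensated by the
change of `signExp` when one degree drops by 1. -/
theorem evalRight_d (act : DGHom (compose P R) A) (t : TripleSymbol L P R m) :
    dHom L A m (t.evalRight act.toGrHom) = t.dx.evalRight act.toGrHom
      + ∑ i, (-1 : K) ^ t.dqExp i • (t.dq i).evalRight act.toGrHom
      + ∑ p, (-1 : K) ^ t.dsExp p • (t.ds p).evalRight act.toGrHom := by
  rw [evalRight, map_smul, dHom_mk, dMk, smul_add, add_assoc]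
  congr 1
  rw [Fintype.sum_sigma, ← Finset.sum_add_distrib, Finset.smul_sum]
  refine Finset.sum_congr rfl fun i _ => ?_
  have hy0 : ∀ j, j ≠ i → ((t.right act.toGrHom).dRight i).y j
      = act.toFun _ (compose.mk (t.qs j)) := fun j hj => by
    exact Function.update_of_ne hj _ (t.right act.toGrHom).y
  have hb : ((t.right act.toGrHom).dRight i).b i = (t.qs i).deg - 1 := by simp
  have h0 : act.toFun _ (compose.mk (t.qs i).dLeft)
      ∈ A.gr _ (((t.right act.toGrHom).dRight i).b i) := by
    rw [hb]; exact act.map_mem _ _ _ (mk_dLeft_mem (t.qs i))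
  have h1 : ∀ k, act.toFun _ (compose.mk ((t.qs i).dRight k))
      ∈ A.gr _ (((t.right act.toGrHom).dRight i).b i) := fun k => by
    rw [hb]; exact act.map_mem _ _ _ (mk_dRight_mem (t.qs i) k)
  have h2 : CompositeModule.mk ((t.right act.toGrHom).dRight i)
      = mkRight ((t.right act.toGrHom).dRight i) i
        (⟨_, h0⟩ + ∑ k, (-1 : K) ^ (t.qs i).dExp k • ⟨_, h1 k⟩) := by
    refine (mkRight_eq ((t.right act.toGrHom).dRight i) i _ ?_ (fun _ _ => rfl)).symm
    refine (Function.update_self ..).trans ?_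
    refine (act.d_mk (t.qs i)).trans ?_
    simp only [Submodule.coe_add, Submodule.coe_sum, Submodule.coe_smul]
  have h3 : mkRight ((t.right act.toGrHom).dRight i) i ⟨_, h0⟩
      = CompositeModule.mk ((t.dq i).right act.toGrHom) := by
    refine mkRight_eq ((t.right act.toGrHom).dRight i) i _ ?_ (fun j hj => ?_)
    · exact congrArg _ (mk_eq_mk (fun _ => rfl) (by simp) (fun _ => rfl))
    · refine Eq.trans ?_ (hy0 j hj).symm
      exact congrArg _ (mk_eq_mk (fun _ => rfl) (by simp [hj]) (fun _ => rfl))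
  have h4 : ∀ k, mkRight ((t.right act.toGrHom).dRight i) i ⟨_, h1 k⟩
      = CompositeModule.mk ((t.ds ⟨i, k⟩).right act.toGrHom) := by
    intro k
    refine mkRight_eq ((t.right act.toGrHom).dRight i) i _ ?_ (fun j hj => ?_)
    · refine congrArg _ (mk_eq_mk (fun _ => rfl) rfl (fun l => ?_))
      by_cases hl : l = k
      · have : ∀ l : Fin (t.n i), l = k →
            R.d _ (t.s i l) = Function.update (t.s i) k (R.d _ (t.s i k)) l := by
          rintro _ rfl
          rw [Function.update_self]
        exact (if_pos (congrArg (Sigma.mk i) hl)).trans (this l hl)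
      · simp [hl]
    · refine Eq.trans ?_ (hy0 j hj).symm
      exact congrArg _ (mk_eq_mk (fun _ => rfl) rfl (fun l => by simp [hj]))
  rw [h2, map_add, map_sum, h3, smul_add, smul_add]
  have e3 : (∑ j, if j < i then (t.right act.toGrHom).b j else 0)
      = (∑ j, if j < i then t.b j else 0) + ∑ j, if j < i then ∑ k, t.c j k else 0 := by
    rw [← Finset.sum_add_distrib]
    refine Finset.sum_congr rfl fun j _ => ?_
    split_ifs <;> rfl
  congr 1
  -- In degree 0 the truncated degree makes the sign formula meaningless, but the term itself is
  -- zero.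
  · by_cases hb : t.b i = 0
    · have hz := evalRight_eq_zero_of_q (act.toGrHom) (t.dq i) i
        (by simpa using P.d_zero _ _ (hb ▸ t.hq i))
      rw [hz]
      have hz' := eq_neg_one_pow_smul hz
      rw [hz']; simp
    · rw [evalRight, smul_smul, smul_smul, ← pow_add, ← pow_add]
      refine congrArg (· • _) (neg_one_pow_congr_zmod ?_)
      rw [signExp_dq t i hb]
      simp only [CompositeSymbol.dExp, dqExp]
      rw [e3]
      push_cast
      have := ZMod.two_add_self (∑ j, if j < i then ∑ k, (t.c j k : ZMod 2) else 0)
      linear_combination this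
  · rw [Finset.smul_sum, Finset.smul_sum]
    refine Finset.sum_congr rfl fun k _ => ?_
    rw [map_smul, h4]
    by_cases hc : t.c i k = 0
    · have hz := evalRight_eq_zero_of_s (act.toGrHom) (t.ds ⟨i, k⟩) i k
        (by simpa using R.d_zero _ _ (hc ▸ t.hs i k))
      rw [hz]
      have hz' := eq_neg_one_pow_smul hz
      rw [hz']; simp
    · rw [evalRight, smul_smul, smul_smul, smul_smul, ← pow_add, ← pow_add, ← pow_add]
      refine congrArg (· • _) (neg_one_pow_congr_zmod ?_)
      rw [signExp_ds t i k hc]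
      simp only [CompositeSymbol.dExp, dsExp]
      rw [e3]
      have e4 : (∑ j, t.b j) = (∑ j, if j < i then t.b j else 0) + t.b i
          + ∑ j, if i < j then t.b j else 0 := by
        have : t.b i = ∑ j, if j = i then t.b j else 0 := by simp
        rw [this, ← Finset.sum_add_distrib, ← Finset.sum_add_distrib]
        refine Finset.sum_congr rfl fun j _ => ?_
        rcases lt_trichotomy j i with h | h | h
        · simp [h, h.ne, h.not_gt]
        · simp [h]
        · simp [h, h.ne', h.not_gt]
      have e5 : (∑ p' : (Σ i, Fin (t.n i)), if finSigmaFinEquiv p' < finSigmaFinEquiv ⟨i, k⟩ then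
          t.c p'.1 p'.2 else 0) = (∑ j, if j < i then ∑ k, t.c j k else 0)
            + ∑ l, if l < k then t.c i l else 0 := by
        simp only [finSigmaFinEquiv_lt_iff]
        have : (∑ l, if l < k then t.c i l else 0)
            = ∑ j, if h : j = i then (∑ l : Fin (t.n j), if (l : ℕ) < k then t.c j l else 0)
              else 0 := by
          rw [Finset.sum_eq_single i]
          · simp
          · intro j _ hj; simp [hj]
          · simp
        rw [this, Fintype.sum_sigma, ← Finset.sum_add_distrib]
        refine Finset.sum_congr rfl fun j _ => ?_
        rcases lt_trichotomy j i with h | h | h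
        · simp [h, h.ne]
        · subst h; simp
        · simp [h.ne', h.not_gt]
      rw [e4, e5]
      push_cast
      ring_nf

end TripleSymbol

variable {P : DGOperad.{u, v} K}

/-- Both evaluations satisfy the same Leibniz formula, so the differential of a relation is a
combination of relations. -/
theorem d_mem_span_relCompRel (L : DGRightModule.{u, v, v₁} P) (R : DGLeftModule.{u, v, v₂} P)
    (m : ℕ) (z : (compose L.toDGSymModule R.toDGSymModule) m) (hz : z ∈ relCompRel L R m) :
    (compose L.toDGSymModule R.toDGSymModule).d m z ∈ Submodule.span K (relCompRel L R m) := by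
  obtain ⟨t, rfl⟩ := hz
  have key : ∀ t : TripleSymbol L.toDGSymModule P.toDGSymModule R.toDGSymModule m,
      t.evalLeft L.action.toGrHom - t.evalRight R.action.toGrHom
        ∈ Submodule.span K (relCompRel L R m) := fun t => Submodule.subset_span ⟨t, rfl⟩
  have e : (compose L.toDGSymModule R.toDGSymModule).d m (compose.mk (t.left L.action.toGrHom)
      - (-1 : K) ^ t.signExp • compose.mk (t.right R.action.toGrHom))
      = (t.dx.evalLeft L.action.toGrHom - t.dx.evalRight R.action.toGrHom)
      + ∑ i, (-1 : K) ^ t.dqExp i •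
        ((t.dq i).evalLeft L.action.toGrHom - (t.dq i).evalRight R.action.toGrHom)
      + ∑ p, (-1 : K) ^ t.dsExp p •
        ((t.ds p).evalLeft L.action.toGrHom - (t.ds p).evalRight R.action.toGrHom) := by
    rw [map_sub]
    refine (congrArg₂ (· - ·) (t.evalLeft_d L.action) (t.evalRight_d R.action)).trans ?_
    simp only [smul_sub, Finset.sum_sub_distrib]
    abel
  rw [e]
  exact add_mem (add_mem (key _) (Submodule.sum_mem _ fun i _ => Submodule.smul_mem _ _ (key _)))
    (Submodule.sum_mem _ fun i _ => Submodule.smul_mem _ _ (key _))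

/-- The cokernel in dg-modules is therefore the cokernel of the underlying modules: a linear map out
of L ∘_P R is just a linear map on L ∘ R which identifies the two evaluations, whether or not it
commutes with differentials. -/
theorem dgSpan_relCompRel (L : DGRightModule.{u, v, v₁} P) (R : DGLeftModule.{u, v, v₂} P) (m : ℕ) :
    (compose L.toDGSymModule R.toDGSymModule).dgSpan (relCompRel L R) m
      = Submodule.span K (relCompRel L R m) := by
  refine le_antisymm (Submodule.span_le.2 ?_) (Submodule.span_mono Set.subset_union_left)
  rintro _ (hz | ⟨z, hz, rfl⟩)
  · exact Submodule.subset_span hz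
  · exact d_mem_span_relCompRel L R m z hz

end Leibniz


/-! ### Substitution of a composite element for the root. -/

noncomputable section Expand

variable {K : Type u} [CommRing K]

/-- The inverse of a bijective morphism of graded `Σ_*`-modules. -/
def GrHom.inverse {A : DGSymModule.{u, v₁} K} {B : DGSymModule.{u, v₂} K} (f : GrHom A B)
    (hf : ∀ m, Function.Bijective (f.toFun m)) : GrHom B A where
  toFun m := (LinearEquiv.ofBijective (f.toFun m) (hf m)).symm
  map_mem m k x hx := by
    obtain ⟨z, rfl⟩ := (hf m).2 x
    obtain ⟨p, hp, hp'⟩ := exists_projections (A.gr m) (A.isInternal m)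
    obtain ⟨p₂, hp₂, hp₂'⟩ := exists_projections (B.gr m) (B.isInternal m)
    have hmem : ∀ k z, p k z ∈ A.gr m k := by
      intro k z
      have : z ∈ ⨆ k, A.gr m k := by
        rw [(A.isInternal m).submodule_iSup_eq_top]; trivial
      induction this using Submodule.iSup_induction' with
      | mem l z hz =>
        rcases eq_or_ne k l with rfl | h
        · rwa [hp _ _ hz]
        · rw [hp' _ _ _ hz h]; exact zero_mem _
      | zero => rw [map_zero]; exact zero_mem _
      | add y z _ _ hy hz => rw [map_add]; exact add_mem hy hz
    -- A graded map commutes with the projections onto homogeneous components; with injectivity this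
    -- forces the preimage of a homogeneous element to be homogeneous.
    have hcomm : f.toFun m (p k z) = p₂ k (f.toFun m z) := by
      have : z ∈ ⨆ k, A.gr m k := by
        rw [(A.isInternal m).submodule_iSup_eq_top]; trivial
      clear hx
      induction this using Submodule.iSup_induction' with
      | mem l z hz =>
        rcases eq_or_ne k l with rfl | h
        · rw [hp _ _ hz, hp₂ _ _ (f.map_mem _ _ _ hz)]
        · rw [hp' _ _ _ hz h, hp₂' _ _ _ (f.map_mem _ _ _ hz) h, map_zero]
      | zero => simp
      | add y z _ _ hy hz => rw [map_add, map_add, map_add, map_add, hy, hz]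
    rw [hp₂ k _ hx] at hcomm
    have e : (LinearEquiv.ofBijective (f.toFun m) (hf m)).symm (f.toFun m z) = z :=
      (LinearEquiv.ofBijective (f.toFun m) (hf m)).symm_apply_apply z
    rw [LinearEquiv.coe_coe, e, ← (hf m).1 hcomm]
    exact hmem k z
  map_rep m s x := by
    apply (hf m).1
    have e : ∀ y, f.toFun m ((LinearEquiv.ofBijective (f.toFun m) (hf m)).symm y) = y :=
      (LinearEquiv.ofBijective (f.toFun m) (hf m)).apply_symm_apply
    rw [f.map_rep, LinearEquiv.coe_coe, e, e]

theorem GrHom.apply_inverse {A : DGSymModule.{u, v₁} K} {B : DGSymModule.{u, v₂} K} (f : GrHom A B)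
    (hf : ∀ m, Function.Bijective (f.toFun m)) (m : ℕ) (x : B m) :
    f.toFun m ((f.inverse hf).toFun m x) = x :=
  (LinearEquiv.ofBijective (f.toFun m) (hf m)).apply_symm_apply x

theorem GrHom.inverse_apply {A : DGSymModule.{u, v₁} K} {B : DGSymModule.{u, v₂} K} (f : GrHom A B)
    (hf : ∀ m, Function.Bijective (f.toFun m)) (m : ℕ) (x : A m) :
    (f.inverse hf).toFun m (f.toFun m x) = x :=
  (LinearEquiv.ofBijective (f.toFun m) (hf m)).symm_apply_apply x

/-- The composite of morphisms of graded `Σ_*`-modules. -/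
def GrHom.comp {A : DGSymModule.{u, v₁} K} {B : DGSymModule.{u, v₂} K} {C : DGSymModule.{u, v₃} K}
    (g : GrHom B C) (f : GrHom A B) : GrHom A C where
  toFun m := g.toFun m ∘ₗ f.toFun m
  map_mem m k x hx := g.map_mem m k _ (f.map_mem m k x hx)
  map_rep m s x := by rw [LinearMap.comp_apply, f.map_rep, g.map_rep]; rfl

open CompositeModule CompositeSymbol TripleSymbol

variable {A : DGSymModule.{u, v₁} K} {P : DGSymModule.{u, v₂} K} {R : DGSymModule.{u, v₃} K}
  {B : DGSymModule.{u, v₄} K} {M : DGSymModule.{u, v} K} {m : ℕ}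

/-- The composite element `x'(q_*)(y_*)`, where the root of `c` is replaced by the composite
element `c' = x'(q_*)`. -/
abbrev CompositeSymbol.expandLeft (c : CompositeSymbol A R m) (c' : CompositeSymbol M P c.r) :
    TripleSymbol M P R m where
  r := c'.r
  n := c'.n
  l := fun i k => c.n (c'.e ⟨i, k⟩)
  e := (Equiv.sigmaCongrLeft (β := fun j => Fin (c.n j)) c'.e).trans c.e
  a := c'.a
  x := c'.x
  hx := c'.hx
  b := c'.b
  q := c'.y
  hq := c'.hy
  c := fun i k => c.b (c'.e ⟨i, k⟩)
  s := fun i k => c.y (c'.e ⟨i, k⟩)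
  hs := fun i k => c.hy (c'.e ⟨i, k⟩)

theorem TripleSymbol.mk_eq_of_label {r : ℕ} {n : Fin r → ℕ} {l : ∀ i, Fin (n i) → ℕ}
    {e e' : (Σ p : (Σ i, Fin (n i)), Fin (l p.1 p.2)) ≃ Fin m} {a : ℕ} {x : M r}
    {hx : x ∈ M.gr r a} {b : Fin r → ℕ} {q : ∀ i, P (n i)} {hq : ∀ i, q i ∈ P.gr (n i) (b i)}
    {c : ∀ i, Fin (n i) → ℕ} {s : ∀ i k, R (l i k)} {hs : ∀ i k, s i k ∈ R.gr (l i k) (c i k)}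
    (h : ∀ p, e p = e' p) :
    (⟨r, n, l, e, a, x, hx, b, q, hq, c, s, hs⟩ : TripleSymbol M P R m)
      = ⟨r, n, l, e', a, x, hx, b, q, hq, c, s, hs⟩ := by
  obtain rfl : e = e' := Equiv.ext h
  rfl

/-- The value of `± x'(ρ(q_*(y_*)))`. -/
def CompositeSymbol.substSymbol (g : GrHom (compose P R) B) (c : CompositeSymbol A R m)
    (c' : CompositeSymbol M P c.r) : CompositeModule M B m :=
  (-1 : K) ^ (c.expandLeft c').lexExp c'.e • (c.expandLeft c').evalRight g

/-- The cocycle identity read through the change of index γ: the sign between the lexicographic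
order and e passes through a third order f. With f the lexicographic order after a permutation, it
measures how `lexExp` changes. -/
theorem lexExp_comp {t : TripleSymbol M P R m} {J : Type} [Fintype J] {X Y : Type*} [LinearOrder X]
    [LinearOrder Y] (γ : J ≃ (Σ i, Fin (t.n i))) (e : (Σ i, Fin (t.n i)) → X)
    (he : Function.Injective e) (f : J → Y) (hf : Function.Injective f) :
    (t.lexExp e : ZMod 2) = invExp f (fun p => finSigmaFinEquiv (γ p))
      (fun p => t.c (γ p).1 (γ p).2) + invExp f (e ∘ γ) (fun p => t.c (γ p).1 (γ p).2) := by
  have h := invExp_cocycle f (fun p => finSigmaFinEquiv (γ p)) (e ∘ γ)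
    (fun p => t.c (γ p).1 (γ p).2) hf (finSigmaFinEquiv.injective.comp γ.injective)
    (he.comp γ.injective)
  have h2 : t.lexExp e = invExp (fun p => finSigmaFinEquiv (γ p)) (e ∘ γ)
      (fun p => t.c (γ p).1 (γ p).2) := (invExp_comp γ _ _ _).symm
  have h3 := ZMod.two_add_self (invExp f (fun p => finSigmaFinEquiv (γ p))
      (fun p => t.c (γ p).1 (γ p).2) : ZMod 2)
  rw [h2, ← h]
  linear_combination - h3

/-- By the cocycle identity, permuting the leaves changes `lexExp` by `midExp`, which is the sign
produced by `evalRight_mid`, so the two cancel. Invariance under outer permutations works alike,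
with the Koszul sign of the q's left over. -/
theorem substSymbol_inner (g : GrHom (compose P R) B) (c : CompositeSymbol A R m)
    (c' : CompositeSymbol M P c.r) (σ : ∀ i, Equiv.Perm (Fin (c'.n i))) :
    c.substSymbol g (c'.inner σ) = c.substSymbol g (c'.innerLabel σ) := by
  have h1 : ((c.expandLeft c').midPerm σ).evalRight g
      = (c.expandLeft (c'.innerLabel σ)).evalRight g :=
    congrArg (evalRight g) (TripleSymbol.mk_eq_of_label fun _ => rfl)
  have h2 : (c.expandLeft (c'.inner σ)).evalRight g = ((c.expandLeft c').mid σ).evalRight g := rfl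
  rw [substSymbol, substSymbol, h2, evalRight_mid, h1, smul_smul, ← pow_add]
  refine congrArg (· • _) (neg_one_pow_congr_zmod ?_)
  have h3 := lexExp_comp (t := c.expandLeft c') (Equiv.sigmaCongrRight σ) c'.e c'.e.injective
    (fun p => finSigmaFinEquiv p) finSigmaFinEquiv.injective
  push_cast
  refine (congrArg (· + _) h3).trans ?_
  have h4 := ZMod.two_add_self ((c.expandLeft c').midExp σ : ZMod 2)
  refine Eq.trans ?_ (add_zero _)
  rw [← h4, ← add_assoc, add_left_inj, add_comm]
  rfl

theorem substSymbol_outer (g : GrHom (compose P R) B) (c : CompositeSymbol A R m)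
    (c' : CompositeSymbol M P c.r) (w : Equiv.Perm (Fin c'.r)) :
    c.substSymbol g (c'.outer w)
      = (-1 : K) ^ koszulExp w c'.b • c.substSymbol g (c'.outerPerm w) := by
  have h1 : ((c.expandLeft c').outerPerm w).evalRight g
      = (c.expandLeft (c'.outerPerm w)).evalRight g :=
    congrArg (evalRight g) (TripleSymbol.mk_eq_of_label fun _ => rfl)
  have h2 : (c.expandLeft (c'.outer w)).evalRight g = ((c.expandLeft c').outer w).evalRight g := rfl
  rw [substSymbol, substSymbol, h2, evalRight_outer, h1, smul_smul, smul_smul, ← pow_add, ← pow_add]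
  refine congrArg (· • _) (neg_one_pow_congr_zmod ?_)
  have h3 := lexExp_comp (t := c.expandLeft c')
    (Equiv.sigmaCongrLeft (β := fun i => Fin (c'.n i)) w) c'.e c'.e.injective
    (fun p => finSigmaFinEquiv p) finSigmaFinEquiv.injective
  rw [outerExp]
  push_cast
  have h4 := ZMod.two_add_self (((c.expandLeft c').outerPerm w).lexExp
    (fun p => finSigmaFinEquiv (Equiv.sigmaCongrLeft (β := fun i => Fin (c'.n i)) w p)) : ZMod 2)
  refine (congrArg (· + _) h3).trans ?_
  refine Eq.trans ?_ (add_zero _)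
  rw [← h4]
  generalize koszulExp w c'.b = X
  change ((((c.expandLeft c').outerPerm w).lexExp
    (fun p => finSigmaFinEquiv (Equiv.sigmaCongrLeft (β := fun i => Fin (c'.n i)) w p)) : ℕ) : ZMod 2)
    + (((c.expandLeft c').outerPerm w).lexExp
      (c'.e ∘ (Equiv.sigmaCongrLeft (β := fun i => Fin (c'.n i)) w)) : ℕ) + _ = _
  change _ = (X : ZMod 2) + (((c.expandLeft c').outerPerm w).lexExp
      (c'.e ∘ (Equiv.sigmaCongrLeft (β := fun i => Fin (c'.n i)) w)) : ℕ) + _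
  abel

theorem substSymbol_lin_x (g : GrHom (compose P R) B) (c : CompositeSymbol A R m)
    (c' : CompositeSymbol M P c.r) (α β : K) (x' x'' : M c'.r) (hx' : x' ∈ M.gr c'.r c'.a)
    (hx'' : x'' ∈ M.gr c'.r c'.a) (h : c'.x = α • x' + β • x'') :
    c.substSymbol g c' = α • c.substSymbol g { c' with x := x', hx := hx' }
      + β • c.substSymbol g { c' with x := x'', hx := hx'' } :=
  smul_lin_comb _ (evalRight_lin_x g (c.expandLeft c') α β x' x'' hx' hx'' h)

theorem substSymbol_lin_q (g : GrHom (compose P R) B) (c : CompositeSymbol A R m)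
    (c' : CompositeSymbol M P c.r) (i : Fin c'.r) (α β : K) (y' y'' : ∀ j, P (c'.n j))
    (hy' : ∀ j, y' j ∈ P.gr (c'.n j) (c'.b j)) (hy'' : ∀ j, y'' j ∈ P.gr (c'.n j) (c'.b j))
    (h : c'.y i = α • y' i + β • y'' i) (h' : ∀ j, j ≠ i → y' j = c'.y j)
    (h'' : ∀ j, j ≠ i → y'' j = c'.y j) :
    c.substSymbol g c' = α • c.substSymbol g { c' with y := y', hy := hy' }
      + β • c.substSymbol g { c' with y := y'', hy := hy'' } :=
  smul_lin_comb _ (evalRight_lin_q g (c.expandLeft c') i α β y' y'' hy' hy'' h h' h'')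

/-- A function on composite elements which respects the relations. -/
structure CompositeSymbol.Respects {N : DGSymModule.{u, w} K} {X : Type*} [AddCommGroup X]
    [Module K X] (f : CompositeSymbol M N m → X) : Prop where
  lin_left : ∀ (c : CompositeSymbol M N m) (α β : K) (x' x'' : M c.r) (hx' : x' ∈ M.gr c.r c.a)
    (hx'' : x'' ∈ M.gr c.r c.a), c.x = α • x' + β • x'' →
    f c = α • f { c with x := x', hx := hx' } + β • f { c with x := x'', hx := hx'' }
  lin_right : ∀ (c : CompositeSymbol M N m) (i : Fin c.r) (α β : K) (y' y'' : ∀ j, N (c.n j))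
    (hy' : ∀ j, y' j ∈ N.gr (c.n j) (c.b j)) (hy'' : ∀ j, y'' j ∈ N.gr (c.n j) (c.b j)),
    c.y i = α • y' i + β • y'' i → (∀ j, j ≠ i → y' j = c.y j) → (∀ j, j ≠ i → y'' j = c.y j) →
    f c = α • f { c with y := y', hy := hy' } + β • f { c with y := y'', hy := hy'' }
  inner : ∀ (c : CompositeSymbol M N m) (σ : ∀ i, Equiv.Perm (Fin (c.n i))),
    f (c.inner σ) = f (c.innerLabel σ)
  outer : ∀ (c : CompositeSymbol M N m) (s : Equiv.Perm (Fin c.r)),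
    f (c.outer s) = (-1 : K) ^ koszulExp s c.b • f (c.outerPerm s)

theorem CompositeSymbol.Respects.rel {N : DGSymModule.{u, w} K} {X : Type*} [AddCommGroup X]
    [Module K X] {f : CompositeSymbol M N m → X} (hf : CompositeSymbol.Respects f)
    (z : CompositeSymbol M N m →₀ K) (hz : CompositeRel M N m z) :
    Finsupp.linearCombination K f z = 0 := by
  cases hz with
  | add_left c x' hx' =>
    simp only [map_sub, Finsupp.linearCombination_single, one_smul]
    rw [sub_sub, sub_eq_zero]
    have := hf.lin_left { c with x := c.x + x', hx := add_mem c.hx hx' } 1 1 c.x x' c.hx hx'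
      (by simp)
    simpa only [one_smul] using this
  | smul_left c t =>
    simp only [map_sub, map_smul, Finsupp.linearCombination_single, one_smul]
    rw [sub_eq_zero]
    have := hf.lin_left { c with x := t • c.x, hx := Submodule.smul_mem _ t c.hx } t 0 c.x c.x c.hx
      c.hx (by simp)
    simpa only [zero_smul, add_zero] using this
  | add_right c i y' y'' hy' hy'' h1 h2 h3 =>
    simp only [map_sub, Finsupp.linearCombination_single, one_smul]
    rw [sub_sub, sub_eq_zero]
    have := hf.lin_right c i 1 1 y' y'' hy' hy'' (by simp [h1]) h2 h3
    simpa only [one_smul] using this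
  | smul_right c i t y' hy' h1 h2 =>
    simp only [map_sub, map_smul, Finsupp.linearCombination_single, one_smul]
    rw [sub_eq_zero]
    have := hf.lin_right c i t 0 y' y' hy' hy' (by simp [h1]) h2 h2
    simpa only [zero_smul, add_zero] using this
  | inner c σ =>
    simp only [map_sub, Finsupp.linearCombination_single, one_smul]
    rw [sub_eq_zero, hf.inner]
  | outer c s =>
    simp only [map_sub, map_smul, Finsupp.linearCombination_single, one_smul]
    rw [sub_eq_zero, hf.outer]

theorem substSymbol_respects (g : GrHom (compose P R) B) (c : CompositeSymbol A R m) :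
    CompositeSymbol.Respects (c.substSymbol g : CompositeSymbol M P c.r → CompositeModule M B m) :=
  ⟨substSymbol_lin_x g c, substSymbol_lin_q g c, substSymbol_inner g c, substSymbol_outer g c⟩

/-- The map `x'(q_*) ↦ ± x'(ρ(q_*(y_*)))`. -/
def CompositeSymbol.subst (g : GrHom (compose P R) B) (c : CompositeSymbol A R m) :
    CompositeModule M P c.r →ₗ[K] CompositeModule M B m :=
  CompositeModule.lift (c.substSymbol g) (substSymbol_respects g c).rel

theorem subst_mk (g : GrHom (compose P R) B) (c : CompositeSymbol A R m)
    (c' : CompositeSymbol M P c.r) : c.subst g (CompositeModule.mk c') = c.substSymbol g c' :=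
  CompositeModule.lift_mk _ _ _

/-- The value of `± θ(x)` composed with `y_*`. -/
theorem leftSubst_respects (θ : GrHom A (compose M P)) (g : GrHom (compose P R) B) :
    CompositeSymbol.Respects
      (fun c : CompositeSymbol A R m => c.subst g (θ.toFun _ c.x)) where
  lin_left c α β x' x'' hx' hx'' h := by
    simp only
    rw [h, map_add, map_smul, map_smul, map_add, map_smul, map_smul]
    rfl
  lin_right c i α β y' y'' hy' hy'' h h' h'' := by
    have : (c.subst g : CompositeModule M P c.r →ₗ[K] CompositeModule M B m)
        = α • CompositeSymbol.subst g { c with y := y', hy := hy' }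
          + β • CompositeSymbol.subst g { c with y := y'', hy := hy'' } := by
      refine CompositeModule.hom_ext fun c' => ?_
      rw [LinearMap.add_apply, LinearMap.smul_apply, LinearMap.smul_apply]
      refine (subst_mk g c c').trans (Eq.trans ?_ (congrArg₂ (fun X Y => α • X + β • Y)
        (subst_mk g { c with y := y', hy := hy' } c').symm
        (subst_mk g { c with y := y'', hy := hy'' } c').symm))
      -- The i-th factor of c occurs exactly once as a leaf of the expanded element, at the position
      -- p labelled i.
      obtain ⟨p, rfl⟩ := c'.e.surjective i
      have hne : ∀ j l, (⟨j, l⟩ : Σ i, Fin (c'.n i)) ≠ ⟨p.1, p.2⟩ → c'.e ⟨j, l⟩ ≠ c'.e p :=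
        fun j l h h' => h (c'.e.injective h')
      exact smul_lin_comb _ (evalRight_lin_s g (c.expandLeft c') p.1 p.2 α β _ _
        (fun _ _ => hy' _) (fun _ _ => hy'' _) h (fun j l hj => h' _ (hne j l hj))
        (fun j l hj => h'' _ (hne j l hj)))
    exact LinearMap.congr_fun this _
  inner c τ := by
    have : (CompositeSymbol.subst g (c.inner τ) : CompositeModule M P c.r →ₗ[K] _)
        = CompositeSymbol.subst g (c.innerLabel τ) := by
      refine CompositeModule.hom_ext fun c' => ?_
      refine (subst_mk g (c.inner τ) c').trans (Eq.trans ?_ (subst_mk g (c.innerLabel τ) c').symm)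
      have h1 : (c.innerLabel τ).expandLeft c'
          = (c.expandLeft c').innerLabel fun i k => τ (c'.e ⟨i, k⟩) :=
        TripleSymbol.mk_eq_of_label fun _ => rfl
      refine congrArg _ (((c.expandLeft c').evalRight_inner g fun i k => τ (c'.e ⟨i, k⟩)).trans ?_)
      rw [h1]
    exact LinearMap.congr_fun this _
  outer c w := by
    have : (CompositeSymbol.subst g (c.outer w) : CompositeModule M P c.r →ₗ[K] _)
          ∘ₗ CompositeModule.repHom w
        = (-1 : K) ^ koszulExp w c.b • CompositeSymbol.subst g (c.outerPerm w) := by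
      refine CompositeModule.hom_ext fun c' => ?_
      rw [LinearMap.comp_apply, LinearMap.smul_apply, repHom_mk]
      refine (subst_mk g (c.outer w) (c'.relabel w)).trans
        (Eq.trans ?_ (congrArg _ (subst_mk g (c.outerPerm w) c').symm))
      have h1 : ((c.outerPerm w).expandLeft c').evalRight g
          = ((c.outer w).expandLeft (c'.relabel w)).evalRight g :=
        congrArg (evalRight g) (TripleSymbol.mk_eq_of_label fun _ => rfl)
      rw [substSymbol, substSymbol, h1, smul_smul, ← pow_add]
      refine congrArg (· • _) (neg_one_pow_congr_zmod ?_)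
      -- The permutation of the root has become a relabelling of the inputs of c' by w. Going from
      -- lexicographic order to `c'.e` and then to w ∘ `c'.e` splits off the Koszul sign of w.
      have h2 := invExp_cocycle (fun p => finSigmaFinEquiv p) c'.e (fun p => w (c'.e p))
        (fun p => c.b (w (c'.e p))) finSigmaFinEquiv.injective c'.e.injective
        (w.injective.comp c'.e.injective)
      have h3 : invExp c'.e (fun p => w (c'.e p)) (fun p => c.b (w (c'.e p))) = koszulExp w c.b := by
        rw [koszulExp_eq]
        exact invExp_comp c'.e id w (c.b ∘ w)
      rw [h3] at h2
      push_cast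
      rw [add_comm]
      exact h2.symm
    have e : θ.toFun c.r (A.rep c.r w c.x) = CompositeModule.repHom w (θ.toFun c.r c.x) :=
      θ.map_rep _ _ _
    refine (congrArg (CompositeSymbol.subst g (c.outer w)) e).trans ?_
    exact LinearMap.congr_fun this _

/-- The map `x(y_*) ↦ ± θ(x)(y_*)`, with the products `q(y_*)` evaluated by `g`. -/
def leftSubst (θ : GrHom A (compose M P)) (g : GrHom (compose P R) B) (m : ℕ) :
    CompositeModule A R m →ₗ[K] CompositeModule M B m :=
  CompositeModule.lift _ (leftSubst_respects θ g).rel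

theorem leftSubst_mk (θ : GrHom A (compose M P)) (g : GrHom (compose P R) B)
    (c : CompositeSymbol A R m) :
    leftSubst θ g m (CompositeModule.mk c) = c.subst g (θ.toFun _ c.x) :=
  CompositeModule.lift_mk _ _ _

end Expand


/-! ### Tools for substitution: blockwise inversion numbers and induction on homogeneous roots. -/

noncomputable section LeftSubst

variable {K : Type u} [CommRing K]

open CompositeModule CompositeSymbol TripleSymbol

open Classical in
/-- The number of inversions between two orders on blocks, when the orders on the elements refine
the orders on the blocks and agree inside each block. -/
theorem invExp_block {I J A B A' B' : Type*} [Fintype I] [Fintype J] [LinearOrder A] [LinearOrder B]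
    [LinearOrder A'] [LinearOrder B'] (π : J → I) (f : I → A) (g : I → B) (f' : J → A') (g' : J → B') (w : J → ℕ) (W : I → ℕ)
    (hf' : ∀ x y, f' x < f' y ↔ f (π x) < f (π y) ∨ π x = π y ∧ f' x < f' y)
    (hg' : ∀ x y, g' x < g' y ↔ g (π x) < g (π y) ∨ π x = π y ∧ f' x < f' y)
    (hW : ∀ i, W i = ∑ x, if π x = i then w x else 0) : invExp f' g' w = invExp f g W := by
  -- Two elements of one block are ordered alike by f' and g', so an inversion always involves two
  -- different blocks, and these are then inverted themselves.
  have key : ∀ x y, (f' x < f' y ∧ g' y < g' x) ↔ (f (π x) < f (π y) ∧ g (π y) < g (π x)) := by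
    intro x y
    constructor
    · rintro ⟨h1, h2⟩
      rcases (hf' x y).1 h1 with h3 | ⟨h3, h3'⟩
      · rcases (hg' y x).1 h2 with h4 | ⟨h4, h4'⟩
        · exact ⟨h3, h4⟩
        · exact absurd h1 h4'.not_gt
      · rcases (hg' y x).1 h2 with h4 | ⟨h4, h4'⟩
        · rw [h3] at h4; exact absurd h4 (lt_irrefl _)
        · exact absurd h1 h4'.not_gt
    · rintro ⟨h1, h2⟩
      exact ⟨(hf' x y).2 (Or.inl h1), (hg' y x).2 (Or.inl h2)⟩
  simp only [invExp, key, hW]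
  have : ∀ i j, (if f i < f j ∧ g j < g i then (∑ x, if π x = i then w x else 0)
      * ∑ y, if π y = j then w y else 0 else 0)
      = ∑ x, ∑ y, if π x = i then if π y = j then
        (if f (π x) < f (π y) ∧ g (π y) < g (π x) then w x * w y else 0) else 0 else 0 := by
    intro i j
    rw [Finset.sum_mul_sum]
    split_ifs with h
    · refine Finset.sum_congr rfl fun x _ => Finset.sum_congr rfl fun y _ => ?_
      by_cases h1 : π x = i
      · by_cases h2 : π y = j
        · simp [h1, h2, h]
        · simp [h1, h2]
      · simp [h1]
    · refine (Finset.sum_eq_zero fun x _ => Finset.sum_eq_zero fun y _ => ?_).symm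
      by_cases h1 : π x = i
      · by_cases h2 : π y = j
        · simp [h1, h2, h]
        · simp [h1, h2]
      · simp [h1]
  simp only [this]
  have e : ∀ F : J → J → I → I → ℕ, ∑ i, ∑ j, ∑ x, ∑ y, F x y i j = ∑ x, ∑ y, ∑ i, ∑ j, F x y i j := by
    intro F
    calc _ = ∑ i, ∑ x, ∑ j, ∑ y, F x y i j := Finset.sum_congr rfl fun i _ => Finset.sum_comm
      _ = ∑ x, ∑ i, ∑ j, ∑ y, F x y i j := Finset.sum_comm
      _ = ∑ x, ∑ i, ∑ y, ∑ j, F x y i j :=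
        Finset.sum_congr rfl fun x _ => Finset.sum_congr rfl fun i _ => Finset.sum_comm
      _ = _ := Finset.sum_congr rfl fun x _ => Finset.sum_comm
  rw [e]
  refine Finset.sum_congr rfl fun x _ => Finset.sum_congr rfl fun y _ => ?_
  simp

variable {A : DGSymModule.{u, v₁} K} {P : DGSymModule.{u, v₂} K} {R : DGSymModule.{u, v₃} K}
  {B : DGSymModule.{u, v₄} K} {M : DGSymModule.{u, v} K} {m : ℕ}

/-- A composite whose root is a product λ(d) is a left evaluation. The sign comes only from
enumerating the inputs by `d.e` rather than lexicographically. -/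
theorem mk_act_left (act : GrHom (compose M P) A) (c : CompositeSymbol A R m)
    (d : CompositeSymbol M P c.r) (h : c.x = act.toFun _ (compose.mk d)) :
    CompositeModule.mk c = (-1 : K) ^ (c.expandLeft d).lexExp d.e • (c.expandLeft d).evalLeft act := by
  rw [evalLeft_eq act (c.expandLeft d) d.e, smul_smul, neg_one_pow_mul_self, one_smul]
  refine Eq.trans ?_ (mk_ofIndex_reindex d.e d.e.symm (Equiv.refl _) (fun k => by simp)
    (act.map_mem _ _ _ (CompositeModule.mk_mem_gr d)) c.n c.b c.hy c.e)
  exact mk_eq_mk (fun _ => rfl) h (fun _ => rfl)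

/-- `subst` for composite elements with factors indexed by a finite set. -/
theorem subst_ofIndex (g : GrHom (compose P R) B) {I : Type} {r : ℕ} (α : Fin r ≃ I) {a : ℕ}
    {x : A r} (hx : x ∈ A.gr r a) (n : I → ℕ) (b : I → ℕ) {y : ∀ i, R (n i)}
    (hy : ∀ i, y i ∈ R.gr (n i) (b i)) (e : (Σ i, Fin (n i)) ≃ Fin m) (c' : CompositeSymbol M P r)
    (e₀ : (Σ i, Fin (c'.n i)) ≃ I) (h : ∀ p, α (c'.e p) = e₀ p) :
    (ofIndex α hx n b hy e).subst g (CompositeModule.mk c')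
      = (-1 : K) ^ invExp (fun p => finSigmaFinEquiv p) c'.e (fun p => b (e₀ p)) •
        TripleSymbol.evalRight g ⟨c'.r, c'.n, fun i k => n (e₀ ⟨i, k⟩),
          (Equiv.sigmaCongrLeft (β := fun i => Fin (n i)) e₀).trans e, c'.a, c'.x, c'.hx, c'.b,
          c'.y, c'.hy, fun i k => b (e₀ ⟨i, k⟩), fun i k => y (e₀ ⟨i, k⟩),
          fun i k => hy (e₀ ⟨i, k⟩)⟩ := by
  obtain rfl : c'.e.trans α = e₀ := Equiv.ext h
  refine (subst_mk g (ofIndex α hx n b hy e) c').trans ?_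
  have h1 : (ofIndex α hx n b hy e).expandLeft c' = ⟨c'.r, c'.n, fun i k => n (α (c'.e ⟨i, k⟩)),
          (Equiv.sigmaCongrLeft (β := fun i => Fin (n i)) (c'.e.trans α)).trans e, c'.a, c'.x,
          c'.hx, c'.b, c'.y, c'.hy, fun i k => b (α (c'.e ⟨i, k⟩)),
          fun i k => y (α (c'.e ⟨i, k⟩)), fun i k => hy (α (c'.e ⟨i, k⟩))⟩ :=
    TripleSymbol.mk_eq_of_label fun p => by obtain ⟨⟨i, k⟩, j⟩ := p; rfl
  have h2 := congrArg (evalRight g) h1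
  rw [substSymbol, h2]
  rfl

/-- Induction on homogeneous elements of a graded `Σ_*`-module isomorphic to `M ∘ P`. -/
theorem act_induction (f : GrHom (compose M P) A) (hf : ∀ r, Function.Bijective (f.toFun r))
    {r a : ℕ} {p : ∀ x, x ∈ A.gr r a → Prop}
    (hmk : ∀ (c : CompositeSymbol M P r) (hc : f.toFun _ (compose.mk c) ∈ A.gr r a),
      p (f.toFun _ (compose.mk c)) hc)
    (hlin : ∀ (α β : K) (x y) (hx : x ∈ A.gr r a) (hy : y ∈ A.gr r a), p x hx → p y hy →
      p (α • x + β • y) (add_mem (Submodule.smul_mem _ _ hx) (Submodule.smul_mem _ _ hy)))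
    (h0 : p 0 (zero_mem _)) {x : A r} (hx : x ∈ A.gr r a) : p x hx := by
  have h1 := (f.inverse hf).map_mem _ _ _ hx
  rw [← f.apply_inverse hf r x] at hx
  suffices H : ∀ z ∈ CompositeModule.gr M P r a, ∀ hz : f.toFun r z ∈ A.gr r a, p _ hz by
    have := H _ h1 hx
    simpa only [f.apply_inverse hf] using this
  intro z hz
  induction hz using Submodule.span_induction with
  | mem z h =>
    obtain ⟨c, -, rfl⟩ := h
    exact hmk c
  | zero =>
    intro h
    simpa only [map_zero] using h0
  | add z z' hz hz' ih ih' =>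
    intro h
    have e1 := f.map_mem _ _ _ hz
    have e2 := f.map_mem _ _ _ hz'
    have := hlin 1 1 _ _ e1 e2 (ih e1) (ih' e2)
    simpa only [map_add, one_smul] using this
  | smul t z hz ih =>
    intro h
    have e1 := f.map_mem _ _ _ hz
    have := hlin t 0 _ _ e1 e1 (ih e1) (ih e1)
    simpa only [map_smul, zero_smul, add_zero] using this

end LeftSubst


/-! ### Quasi-free right modules: coordinates and the substitution map L ∘ N → M ∘ N. -/

noncomputable section RightQuasiFree

variable {K : Type u} [CommRing K] {P : DGOperad.{u, v} K}

open CompositeModule CompositeSymbol TripleSymbol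

theorem TripleSymbol.rightAt_e_apply {A₁ : DGSymModule.{u, v₁} K} {A₂ : DGSymModule.{u, v₂} K}
    {A₃ : DGSymModule.{u, v₃} K} {A₄ : DGSymModule.{u, v₄} K} {m : ℕ}
    (act : GrHom (compose A₂ A₃) A₄) (t : TripleSymbol A₁ A₂ A₃ m) (n' : Fin t.r → ℕ)
    (ε : ∀ i, (Σ k, Fin (t.l i k)) ≃ Fin (n' i)) (i : Fin t.r) (k : Fin (t.n i))
    (j : Fin (t.l i k)) : (t.rightAt act n' ε).e ⟨i, ε i ⟨k, j⟩⟩ = t.e ⟨⟨i, k⟩, j⟩ := by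
  change t.e ((Equiv.sigmaAssoc fun i k => Fin (t.l i k)).symm ⟨i, (ε i).symm (ε i ⟨k, j⟩)⟩) = _
  rw [Equiv.symm_apply_apply]
  rfl

namespace DGRightModule.QuasiFree

variable {L : DGRightModule.{u, v, v₁} P} {M : DGSymModule.{u, v₂} K} (F : L.QuasiFree M)
  (R : DGLeftModule.{u, v, v₃} P)

/-- The isomorphism `M ∘ P ≅ L`. -/
def ext : GrHom (compose M P.toDGSymModule) L.toDGSymModule :=
  L.action.toGrHom.comp (compose.grMap F.ι (GrHom.id P.toDGSymModule))

theorem ext_mk {m : ℕ} (c : CompositeSymbol M P.toDGSymModule m) :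
    F.ext.toFun m (compose.mk c)
      = L.action.toFun m (compose.mk (compose.mapSymbol F.ι (GrHom.id P.toDGSymModule) c)) :=
  congrArg (L.action.toFun m) (compose.mapHom_mk _ _ _)

/-- The isomorphism `L ≅ M ∘ P`. -/
def coord : GrHom L.toDGSymModule (compose M P.toDGSymModule) := F.ext.inverse F.bijective

theorem coord_ext (m : ℕ) (z : CompositeModule M P.toDGSymModule m) :
    F.coord.toFun m (F.ext.toFun m z) = z := GrHom.inverse_apply _ _ _ _

theorem ext_coord (m : ℕ) (x : L.carrier m) :
    F.ext.toFun m (F.coord.toFun m x) = x := GrHom.apply_inverse _ _ _ _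

variable {N : DGSymModule.{u, v₃} K} {B : DGSymModule.{u, v₄} K}

theorem leftSubst_coord (g : GrHom (compose P.toDGSymModule N) B) {m : ℕ}
    (c : CompositeSymbol L.toDGSymModule N m) (c' : CompositeSymbol M P.toDGSymModule c.r)
    (h : c.x = F.ext.toFun _ (compose.mk c')) :
    leftSubst F.coord g m (CompositeModule.mk c) = c.subst g (CompositeModule.mk c') := by
  rw [leftSubst_mk, h]
  exact congrArg _ (F.coord_ext _ _)

/-- A map which coequalizes the actions is determined by its restriction to `M ∘ N`. -/
theorem map_leftSubst (g : GrHom (compose P.toDGSymModule N) N) {X : Type*} [AddCommGroup X]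
    [Module K X] {m : ℕ} (f : CompositeModule L.toDGSymModule N m →ₗ[K] X)
    (hf : ∀ t : TripleSymbol L.toDGSymModule P.toDGSymModule N m,
      f (t.evalLeft L.action.toGrHom) = f (t.evalRight g))
    (z : CompositeModule L.toDGSymModule N m) :
    f (compose.mapHom F.ι (GrHom.id N) m (leftSubst F.coord g m z)) = f z := by
  suffices H : f ∘ₗ compose.mapHom F.ι (GrHom.id N) m ∘ₗ leftSubst F.coord g m = f from
    LinearMap.congr_fun H z
  refine CompositeModule.hom_ext fun c => ?_
  have key : ∀ hx : c.x ∈ L.gr c.r c.a, f (compose.mapHom F.ι (GrHom.id N) m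
      (leftSubst F.coord g m (CompositeModule.mk { c with x := c.x, hx := hx })))
      = f (CompositeModule.mk { c with x := c.x, hx := hx }) := by
    intro hx
    -- By linearity the root may be taken of the form ι(x')(q_*). The composite is then a left
    -- evaluation, while its substitution is the right evaluation of the same tree, and f identifies
    -- the two.
    refine act_induction F.ext F.bijective (p := fun x hx => f (compose.mapHom F.ι (GrHom.id N) m
      (leftSubst F.coord g m (CompositeModule.mk { c with x := x, hx := hx })))
      = f (CompositeModule.mk { c with x := x, hx := hx })) ?_ ?_ ?_ hx
    · intro c' hc
      set d : CompositeSymbol L.toDGSymModule N m := { c with x := _, hx := hc } with hd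
      have h1 := mk_act_left L.action.toGrHom d
        (compose.mapSymbol F.ι (GrHom.id P.toDGSymModule) c') (F.ext_mk c')
      rw [F.leftSubst_coord g d c' rfl, subst_mk, h1, map_smul, substSymbol, map_smul, map_smul, hf]
      refine congrArg (_ • f ·) ?_
      rw [evalRight, evalRight, map_smul, compose.mapHom_mk]
      rfl
    · intro α β x y hx hy ihx ihy
      have h1 := mk_lin_left { c with
        x := α • x + β • y
        hx := add_mem (Submodule.smul_mem _ _ hx) (Submodule.smul_mem _ _ hy) } α β x y hx hy rfl
      simp only [h1, map_add, map_smul, ihx, ihy]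
    · rw [mk_eq_zero_of_left _ rfl]
      simp
  exact key c.hx

/-- `map_leftSubst` applied to the action of L itself, which coequalizes the two evaluations by
associativity. -/
theorem ext_leftSubst {m : ℕ} (z : CompositeModule L.toDGSymModule P.toDGSymModule m) :
    F.ext.toFun m (leftSubst F.coord P.mul.toGrHom m z) = L.action.toFun m z :=
  F.map_leftSubst P.mul.toGrHom (L.action.toFun m)
    (fun t => (L.assoc m t).trans (map_smul (L.action.toFun m) _ _).symm) z

/-- In coordinates the action of P on L is the one of the free module M ∘ P: only the operad
multiplication enters. -/
theorem coord_action {m : ℕ} (z : CompositeModule L.toDGSymModule P.toDGSymModule m) :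
    F.coord.toFun m (L.action.toFun m z) = leftSubst F.coord P.mul.toGrHom m z := by
  rw [← F.ext_leftSubst, F.coord_ext]

variable {R} {m : ℕ}

section Pentagon

variable (t : TripleSymbol L.toDGSymModule P.toDGSymModule R.toDGSymModule m)
  (c' : CompositeSymbol M P.toDGSymModule t.r) (ν : Fin c'.r → ℕ)
  (ε : ∀ i, (Σ p : (Σ κ : Fin (c'.n i), Fin (t.n (c'.e ⟨i, κ⟩))),
      Fin (t.l (c'.e ⟨i, p.1⟩) p.2)) ≃ Fin (ν i))

/-- The composite element `q'_i(q_*)(s_{**})`. -/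
abbrev tripleAt (i : Fin c'.r) : TripleSymbol P.toDGSymModule P.toDGSymModule R.toDGSymModule
    (ν i) where
  r := c'.n i
  n := fun κ => t.n (c'.e ⟨i, κ⟩)
  l := fun κ => t.l (c'.e ⟨i, κ⟩)
  e := ε i
  a := c'.b i
  x := c'.y i
  hx := c'.hy i
  b := fun κ => t.b (c'.e ⟨i, κ⟩)
  q := fun κ => t.q (c'.e ⟨i, κ⟩)
  hq := fun κ => t.hq (c'.e ⟨i, κ⟩)
  c := fun κ => t.c (c'.e ⟨i, κ⟩)
  s := fun κ => t.s (c'.e ⟨i, κ⟩)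
  hs := fun κ => t.hs (c'.e ⟨i, κ⟩)

/-- The indexing of the factors of `x'(μ(q'_*(q_{**})))`. -/
def pairEquiv : (Σ i, Fin (∑ κ, t.n (c'.e ⟨i, κ⟩))) ≃ (Σ j, Fin (t.n j)) :=
  ((Equiv.sigmaCongrRight fun _ => finSigmaFinEquiv.symm).trans
    (Equiv.sigmaAssoc fun _ κ => Fin (t.n (c'.e ⟨_, κ⟩))).symm).trans
      (Equiv.sigmaCongrLeft (β := fun j => Fin (t.n j)) c'.e)

/-- The composite element `x'(μ(q'_*(q_{**})))(s_{***})`. -/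
abbrev tripleMul : TripleSymbol M P.toDGSymModule R.toDGSymModule m where
  r := c'.r
  n := fun i => ∑ κ, t.n (c'.e ⟨i, κ⟩)
  l := fun i k => t.l (pairEquiv t c' ⟨i, k⟩).1 (pairEquiv t c' ⟨i, k⟩).2
  e := (Equiv.sigmaCongrLeft (β := fun p : (Σ j, Fin (t.n j)) => Fin (t.l p.1 p.2))
    (pairEquiv t c')).trans t.e
  a := c'.a
  x := c'.x
  hx := c'.hx
  b := fun i => ((t.xq.expandLeft c').qs i).deg
  q := fun i => P.mul.toFun _ (compose.mk ((t.xq.expandLeft c').qs i))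
  hq := fun i => P.mul.map_mem _ _ _ (CompositeModule.mk_mem_gr _)
  c := fun i k => t.c (pairEquiv t c' ⟨i, k⟩).1 (pairEquiv t c' ⟨i, k⟩).2
  s := fun i k => t.s (pairEquiv t c' ⟨i, k⟩).1 (pairEquiv t c' ⟨i, k⟩).2
  hs := fun i k => t.hs (pairEquiv t c' ⟨i, k⟩).1 (pairEquiv t c' ⟨i, k⟩).2

/-- The product λ(x(q_*)) is first computed in coordinates with `coord_action`, which turns x'(q'_*)
into x'(μ(q'_*(q_{**}))); the s_{ik} are then substituted. The three summands of the exponent are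
the signs of reordering the q's, of interleaving q' with q, and of reordering the s's. -/
theorem leftSubst_evalLeft (h : t.x = F.ext.toFun _ (compose.mk c')) :
    leftSubst F.coord R.action.toGrHom m (t.evalLeft L.action.toGrHom)
      = (-1 : K) ^ (invExp (fun p => finSigmaFinEquiv p) c'.e (fun p => t.b (c'.e p))
          + (t.xq.expandLeft c').signExp
          + invExp (fun p => finSigmaFinEquiv p) (fun p => finSigmaFinEquiv (pairEquiv t c' p))
            (fun p => t.c (pairEquiv t c' p).1 (pairEquiv t c' p).2)) •
        (tripleMul t c').evalRight R.action.toGrHom := by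
  have h1 : F.coord.toFun _ (L.action.toFun _ (compose.mk t.xq))
      = (-1 : K) ^ (invExp (fun p => finSigmaFinEquiv p) c'.e (fun p => t.b (c'.e p))
          + (t.xq.expandLeft c').signExp) •
        CompositeModule.mk ((t.xq.expandLeft c').right P.mul.toGrHom) := by
    refine (F.coord_action (CompositeModule.mk t.xq)).trans ?_
    rw [F.leftSubst_coord _ t.xq c' h, subst_mk, substSymbol, evalRight, smul_smul, ← pow_add]
  refine (leftSubst_mk _ _ (t.left L.action.toGrHom)).trans ?_
  refine (congrArg _ h1).trans ?_
  rw [map_smul, pow_add _ (_ + _), mul_smul]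
  congr 1
  refine (subst_ofIndex R.action.toGrHom finSigmaFinEquiv.symm _
    (fun p : (Σ j, Fin (t.n j)) => t.l p.1 p.2)
    (fun p => t.c p.1 p.2) (fun p => t.hs p.1 p.2) t.e
    ((t.xq.expandLeft c').right P.mul.toGrHom) (pairEquiv t c') ?_).trans ?_
  · rintro ⟨i, k⟩
    obtain ⟨p, rfl⟩ := finSigmaFinEquiv.surjective k
    simp [pairEquiv, Equiv.sigmaAssoc]
  · have h2 : ⇑((t.xq.expandLeft c').right P.mul.toGrHom).e
        = fun p => finSigmaFinEquiv (pairEquiv t c' p) := rfl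
    rw [h2]

/-- The enumeration of the inputs of `q'_i(ρ(q_*(s_{**})))`. -/
abbrev tripleLabel (i : Fin c'.r) :
    (Σ κ, Fin (∑ k, t.l (c'.e ⟨i, κ⟩) k)) ≃ Fin (ν i) :=
  ((tripleAt t c' ν ε i).right R.action.toGrHom).e

/-- Associativity of the left module R, applied in each branch of the root x'; the exponent gains
one sign per branch. -/
theorem evalRight_tripleMul :
    (tripleMul t c').evalRight R.action.toGrHom
      = (-1 : K) ^ ((tripleMul t c').signExp + ∑ i, (tripleAt t c' ν ε i).signExp) •
        CompositeModule.mk (((t.right R.action.toGrHom).expandLeft c').rightAt R.action.toGrHom _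
          (tripleLabel t c' ν ε)) := by
  rw [evalRight_eq R.action.toGrHom (tripleMul t c') _ fun i =>
    (Equiv.sigmaCongrLeft (β := fun p : (Σ κ, Fin (t.n (c'.e ⟨i, κ⟩))) =>
      Fin (t.l (c'.e ⟨i, p.1⟩) p.2)) finSigmaFinEquiv.symm).trans (tripleAt t c' ν ε i).e,
    pow_add, mul_smul]
  congr 1
  rw [← Finset.prod_pow_eq_pow_sum]
  refine (mk_smul_right_all (rightAt R.action.toGrHom (tripleMul t c') _ fun i =>
    (Equiv.sigmaCongrLeft (β := fun p : (Σ κ, Fin (t.n (c'.e ⟨i, κ⟩))) =>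
      Fin (t.l (c'.e ⟨i, p.1⟩) p.2)) finSigmaFinEquiv.symm).trans (tripleAt t c' ν ε i).e)
    (fun i => (-1 : K) ^ (tripleAt t c' ν ε i).signExp)
    (fun i => R.action.toFun _ (compose.mk ((tripleAt t c' ν ε i).right R.action.toGrHom)))
    (fun i => ?_) (fun i => ?_)).trans ?_
  · have h1 := R.action.map_mem _ _ _ (CompositeModule.mk_mem_gr
      ((tripleAt t c' ν ε i).right R.action.toGrHom))
    rw [← deg_left_eq_deg_right P.mul.toGrHom R.action.toGrHom] at h1
    exact h1
  · exact R.assoc _ (tripleAt t c' ν ε i)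
  · congr 1
    refine mk_eq_mk (fun p => ?_) rfl (fun i => rfl)
    obtain ⟨i, k⟩ := p
    obtain ⟨⟨k, j⟩, rfl⟩ := ((Equiv.sigmaCongrLeft
      (β := fun p : (Σ κ, Fin (t.n (c'.e ⟨i, κ⟩))) => Fin (t.l (c'.e ⟨i, p.1⟩) p.2))
        finSigmaFinEquiv.symm).trans (tripleAt t c' ν ε i).e).surjective k
    refine (rightAt_e_apply R.action.toGrHom (tripleMul t c') _ _ i k j).trans ?_
    have h1 : ∀ (q : Σ κ, Fin (t.n (c'.e ⟨i, κ⟩))) (j : Fin (t.l (c'.e ⟨i, q.1⟩) q.2)),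
        (tripleAt t c' ν ε i).e ⟨q, j⟩ = tripleLabel t c' ν ε i ⟨q.1, finSigmaFinEquiv ⟨q.2, j⟩⟩ :=
      fun q j => (rightAt_e_apply R.action.toGrHom (tripleAt t c' ν ε i) _
        (fun _ => finSigmaFinEquiv) q.1 q.2 j).symm
    have h2 := rightAt_e_apply R.action.toGrHom ((t.right R.action.toGrHom).expandLeft c') _
      (tripleLabel t c' ν ε) i (finSigmaFinEquiv.symm k).1
      (finSigmaFinEquiv ⟨(finSigmaFinEquiv.symm k).2, j⟩)
    have h3 := rightAt_e_apply R.action.toGrHom t _ (fun _ => finSigmaFinEquiv)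
      (c'.e ⟨i, (finSigmaFinEquiv.symm k).1⟩) (finSigmaFinEquiv.symm k).2 j
    refine Eq.trans ?_ (h3.symm.trans (h2.symm.trans
      (congrArg (fun z => (((t.right R.action.toGrHom).expandLeft c').rightAt R.action.toGrHom _
          (tripleLabel t c' ν ε)).e ⟨i, z⟩) (h1 (finSigmaFinEquiv.symm k) j).symm)))
    rfl

end Pentagon

end DGRightModule.QuasiFree

end RightQuasiFree


/-! ### The sign identity behind the coequalizing property of the substitution map. -/

noncomputable section RightQuasiFree

variable {K : Type u} [CommRing K] {P : DGOperad.{u, v} K}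

open CompositeModule CompositeSymbol TripleSymbol

/-- The inversion number is quadratic in the weights. Its cross terms in Q and S are, modulo 2, the
difference between the sums of S p * Q p' over the pairs p before p' for the two orders. -/
theorem invExp_add {I A B : Type*} [Fintype I] [LinearOrder A] [LinearOrder B] (f : I → A)
    (g : I → B) (hf : Function.Injective f) (hg : Function.Injective g) (Q S : I → ℕ) :
    (invExp f g Q : ZMod 2) + invExp f g S
        + ((∑ p, ∑ p', if f p < f p' then S p * Q p' else 0 : ℕ) : ZMod 2)
      = ((∑ p, ∑ p', if g p < g p' then S p * Q p' else 0 : ℕ) : ZMod 2)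
        + invExp f g (fun p => Q p + S p) := by
  simp only [invExp, Nat.cast_sum, ← Finset.sum_add_distrib]
  refine sum_sum_eq_of_symm _ _ (fun i j => ?_) (fun i => by simp)
  rcases eq_or_ne i j with rfl | hij
  · simp
  have h1 := ZMod.two_add_self ((S i : ZMod 2) * Q j)
  have h2 := ZMod.two_add_self ((S j : ZMod 2) * Q i)
  rcases lt_or_gt_of_ne (hf.ne hij) with h3 | h3 <;>
  rcases lt_or_gt_of_ne (hg.ne hij) with h4 | h4 <;>
  simp [h3, h4, h3.not_gt, h4.not_gt]
  · linear_combination - h2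
  · linear_combination - h1

/-- Lexicographically ordered pairs lie either in two ordered blocks or in a single block. -/
theorem sum_lex_lt {r : ℕ} {n : Fin r → ℕ} (Q S : (Σ i, Fin (n i)) → ℕ) :
    (∑ i, ∑ j, if i < j then (∑ k, S ⟨i, k⟩) * ∑ k, Q ⟨j, k⟩ else 0)
      + ∑ i, ∑ k, ∑ l, (if k < l then S ⟨i, k⟩ * Q ⟨i, l⟩ else 0)
      = ∑ p, ∑ p', if finSigmaFinEquiv p < finSigmaFinEquiv p' then S p * Q p' else 0 := by
  simp only [finSigmaFinEquiv_lt_iff, Fintype.sum_sigma]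
  rw [← Finset.sum_add_distrib]
  refine Finset.sum_congr rfl fun i _ => ?_
  have h : ∀ k : Fin (n i), ∑ x : Fin r, ∑ x_1 : Fin (n x),
      (if i < x ∨ i = x ∧ (k : ℕ) < x_1 then S ⟨i, k⟩ * Q ⟨x, x_1⟩ else 0)
      = (∑ j, if i < j then S ⟨i, k⟩ * ∑ l, Q ⟨j, l⟩ else 0)
        + ∑ l, if k < l then S ⟨i, k⟩ * Q ⟨i, l⟩ else 0 := by
    intro k
    have h1 : ∀ x : Fin r, ∑ x_1 : Fin (n x),
      (if i < x ∨ i = x ∧ (k : ℕ) < x_1 then S ⟨i, k⟩ * Q ⟨x, x_1⟩ else 0)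
      = (if i < x then S ⟨i, k⟩ * ∑ l, Q ⟨x, l⟩ else 0)
        + (if i = x then ∑ l : Fin (n x), (if (k : ℕ) < l then S ⟨i, k⟩ * Q ⟨x, l⟩ else 0) else 0) := by
      intro x
      rcases lt_trichotomy i x with h2 | rfl | h2
      · simp [h2, h2.ne, Finset.mul_sum]
      · simp
      · simp [h2.not_gt, h2.ne']
    simp only [h1, Finset.sum_add_distrib, Finset.sum_ite_eq, Finset.mem_univ, if_true]
    rfl
  simp only [h, Finset.sum_add_distrib]
  rw [add_left_inj, Finset.sum_comm]
  refine Finset.sum_congr rfl fun j _ => ?_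
  by_cases hij : i < j
  · simp [hij, Finset.sum_mul]
  · simp [hij]

namespace DGRightModule.QuasiFree

variable {L : DGRightModule.{u, v, v₁} P} {M : DGSymModule.{u, v₂} K} (F : L.QuasiFree M)
  {R : DGLeftModule.{u, v, v₃} P} {m : ℕ}

section Pentagon

variable (t : TripleSymbol L.toDGSymModule P.toDGSymModule R.toDGSymModule m)
  (c' : CompositeSymbol M P.toDGSymModule t.r) (ν : Fin c'.r → ℕ)
  (ε : ∀ i, (Σ p : (Σ κ : Fin (c'.n i), Fin (t.n (c'.e ⟨i, κ⟩))),
      Fin (t.l (c'.e ⟨i, p.1⟩) p.2)) ≃ Fin (ν i))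

/-- Both orders on the leaves refine orders on the q's and agree among the leaves over one q, so
`invExp_block` applies, with the total degree of the leaves over a q as weight. -/
theorem invExp_pairEquiv :
    invExp (fun p => finSigmaFinEquiv p) (fun p => finSigmaFinEquiv (pairEquiv t c' p))
      (fun p => t.c (pairEquiv t c' p).1 (pairEquiv t c' p).2)
      = invExp (fun p => finSigmaFinEquiv p) c'.e (fun p => ∑ k, t.c (c'.e p) k) := by
  classical
  set ρ : (Σ p : (Σ i, Fin (c'.n i)), Fin (t.n (c'.e p))) ≃ Σ i, Fin (∑ κ, t.n (c'.e ⟨i, κ⟩)) :=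
    (Equiv.sigmaAssoc fun i κ => Fin (t.n (c'.e ⟨i, κ⟩))).trans
      (Equiv.sigmaCongrRight fun _ => finSigmaFinEquiv) with hρ
  have h1 : ∀ p k, pairEquiv t c' (ρ ⟨p, k⟩) = ⟨c'.e p, k⟩ := by
    rintro ⟨i, κ⟩ k
    change Equiv.sigmaCongrLeft (β := fun j => Fin (t.n j)) c'.e
      ((Equiv.sigmaAssoc fun i κ => Fin (t.n (c'.e ⟨i, κ⟩))).symm
        ⟨i, finSigmaFinEquiv.symm (finSigmaFinEquiv ⟨κ, k⟩)⟩) = _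
    rw [Equiv.symm_apply_apply]
    rfl
  rw [← invExp_comp ρ]
  refine invExp_block (fun p => p.1) _ _ _ _ _ _ ?_ ?_ ?_
  · rintro ⟨⟨i, κ⟩, k⟩ ⟨⟨j, l⟩, k'⟩
    have h2 : ∀ i κ k, ρ ⟨⟨i, κ⟩, k⟩ = ⟨i, finSigmaFinEquiv ⟨κ, k⟩⟩ := fun _ _ _ => rfl
    simp only [Function.comp, h2, finSigmaFinEquiv_lt_iff]
    rcases eq_or_ne i j with rfl | hij
    · simp only [lt_irrefl, false_or, true_and, Fin.val_fin_lt, finSigmaFinEquiv_lt_iff,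
        Sigma.mk.injEq, heq_eq_eq]
      rcases eq_or_ne κ l with rfl | hkl
      · simp
      · simp [hkl]
    · simp [hij]
  · rintro ⟨⟨i, κ⟩, k⟩ ⟨⟨j, l⟩, k'⟩
    simp only [Function.comp, h1, finSigmaFinEquiv_lt_iff, EmbeddingLike.apply_eq_iff_eq]
    refine or_congr Iff.rfl (and_congr_right fun h => ?_)
    obtain ⟨rfl, h⟩ := Sigma.mk.inj_iff.1 h
    obtain rfl := eq_of_heq h
    have h3 : finSigmaFinEquiv (⟨κ, k⟩ : Σ κ, Fin (t.n (c'.e ⟨i, κ⟩)))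
      < finSigmaFinEquiv (⟨κ, k'⟩ : Σ κ, Fin (t.n (c'.e ⟨i, κ⟩))) ↔ (k : ℕ) < k' := by
      simp [finSigmaFinEquiv_lt_iff]
    exact h3.symm.trans ⟨fun h => Or.inr ⟨rfl, h⟩,
      fun h => h.elim (fun h => absurd h (lt_irrefl _)) And.right⟩
  · rintro p
    have h2 : ∀ p k, t.c (pairEquiv t c' (ρ ⟨p, k⟩)).1 (pairEquiv t c' (ρ ⟨p, k⟩)).2
      = t.c (c'.e p) k := fun p k => by rw [h1]
    simp only [Function.comp]
    rw [Fintype.sum_sigma, Finset.sum_eq_single p]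
    · simp [h2]
    · intro q _ hq
      simp [hq]
    · simp

theorem sum_pairEquiv (i : Fin c'.r) :
    ∑ k, t.c (pairEquiv t c' ⟨i, k⟩).1 (pairEquiv t c' ⟨i, k⟩).2
      = ∑ κ, ∑ k, t.c (c'.e ⟨i, κ⟩) k := by
  rw [← Equiv.sum_comp finSigmaFinEquiv, Fintype.sum_sigma]
  refine Finset.sum_congr rfl fun κ _ => Finset.sum_congr rfl fun k _ => ?_
  have : pairEquiv t c' ⟨i, finSigmaFinEquiv ⟨κ, k⟩⟩ = ⟨c'.e ⟨i, κ⟩, k⟩ := by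
    change Equiv.sigmaCongrLeft (β := fun j => Fin (t.n j)) c'.e
      ((Equiv.sigmaAssoc fun i κ => Fin (t.n (c'.e ⟨i, κ⟩))).symm
        ⟨i, finSigmaFinEquiv.symm (finSigmaFinEquiv ⟨κ, k⟩)⟩) = _
    rw [Equiv.symm_apply_apply]
    rfl
  rw [this]

/-- The two sides are the signs of two routes to the same arrangement of the q', q and s. With Q the
degrees of the q's and S the total degrees of the leaves over them, all terms involving q' match
directly, and what remains is `invExp_add` for the lexicographic order and `c'.e`. -/
theorem pentagon_sign :
    ((invExp (fun p => finSigmaFinEquiv p) c'.e (fun p => t.b (c'.e p))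
          + (t.xq.expandLeft c').signExp
          + invExp (fun p => finSigmaFinEquiv p) (fun p => finSigmaFinEquiv (pairEquiv t c' p))
            (fun p => t.c (pairEquiv t c' p).1 (pairEquiv t c' p).2)
          + ((tripleMul t c').signExp + ∑ i, (tripleAt t c' ν ε i).signExp) : ℕ) : ZMod 2)
      = (t.signExp + (((t.right R.action.toGrHom).expandLeft c').lexExp c'.e
          + ((t.right R.action.toGrHom).expandLeft c').signExp) : ℕ) := by
  rw [invExp_pairEquiv]
  have h1 : (t.xq.expandLeft c').signExp
      = ∑ i, ∑ j, if i < j then (∑ κ, t.b (c'.e ⟨i, κ⟩)) * c'.b j else 0 := rfl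
  have h2 : (tripleMul t c').signExp = ∑ i, ∑ j, if i < j then
      (∑ κ, ∑ k, t.c (c'.e ⟨i, κ⟩) k) * (c'.b j + ∑ κ, t.b (c'.e ⟨j, κ⟩)) else 0 := by
    refine Finset.sum_congr rfl fun i _ => Finset.sum_congr rfl fun j _ => ?_
    exact if_congr Iff.rfl (congrArg (· * _) (sum_pairEquiv t c' i)) rfl
  have h3 : ∀ i, (tripleAt t c' ν ε i).signExp = ∑ κ, ∑ l, if κ < l then
      (∑ k, t.c (c'.e ⟨i, κ⟩) k) * t.b (c'.e ⟨i, l⟩) else 0 := fun i => rfl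
  have h4 : t.signExp = ∑ p, ∑ p', if c'.e p < c'.e p' then
      (∑ k, t.c (c'.e p) k) * t.b (c'.e p') else 0 := by
    rw [signExp, ← Equiv.sum_comp c'.e]
    refine Finset.sum_congr rfl fun p _ => ?_
    rw [← Equiv.sum_comp c'.e]
  have h5 : ((t.right R.action.toGrHom).expandLeft c').signExp = ∑ i, ∑ j, if i < j then
      (∑ κ, (t.b (c'.e ⟨i, κ⟩) + ∑ k, t.c (c'.e ⟨i, κ⟩) k)) * c'.b j else 0 := rfl
  have h6 : ((t.right R.action.toGrHom).expandLeft c').lexExp c'.e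
      = invExp (fun p => finSigmaFinEquiv p) c'.e
        (fun p => t.b (c'.e p) + ∑ k, t.c (c'.e p) k) := rfl
  have h7 := invExp_add (fun p => finSigmaFinEquiv p) c'.e finSigmaFinEquiv.injective
    c'.e.injective (fun p => t.b (c'.e p)) (fun p => ∑ k, t.c (c'.e p) k)
  have h8 := sum_lex_lt (fun p => t.b (c'.e p)) (fun p => ∑ k, t.c (c'.e p) k)
  have h9 : (t.xq.expandLeft c').signExp + (tripleMul t c').signExp
      = ((t.right R.action.toGrHom).expandLeft c').signExp +
        ∑ i, ∑ j, if i < j then (∑ κ, ∑ k, t.c (c'.e ⟨i, κ⟩) k) * ∑ κ, t.b (c'.e ⟨j, κ⟩) else 0 := by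
    rw [h1, h2, h5]
    simp only [← Finset.sum_add_distrib]
    refine Finset.sum_congr rfl fun i _ => Finset.sum_congr rfl fun j _ => ?_
    split_ifs
    · rw [Finset.sum_add_distrib]; ring
    · rfl
  simp only [h3]
  rw [← h4] at h7
  rw [← h8] at h7
  have h9' := congrArg (Nat.cast : ℕ → ZMod 2) h9
  rw [h6]
  push_cast at h7 h9' ⊢
  linear_combination h7 + h9'

/-- Hence the substitution map factors through L ∘_P R, and it provides the inverse of M ∘ R → L ∘_P
R. By linearity the root may be taken in the form x'(q'_*), where the claim is associativity in the
branches together with `pentagon_sign`. -/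
theorem leftSubst_eval (t : TripleSymbol L.toDGSymModule P.toDGSymModule R.toDGSymModule m) :
    leftSubst F.coord R.action.toGrHom m (t.evalLeft L.action.toGrHom)
      = leftSubst F.coord R.action.toGrHom m (t.evalRight R.action.toGrHom) := by
  have key : ∀ hx : t.x ∈ L.gr t.r t.a,
      leftSubst F.coord R.action.toGrHom m (evalLeft L.action.toGrHom { t with x := t.x, hx := hx })
      = leftSubst F.coord R.action.toGrHom m
        (evalRight R.action.toGrHom { t with x := t.x, hx := hx }) := by
    intro hx
    refine act_induction F.ext F.bijective (p := fun x hx => leftSubst F.coord R.action.toGrHom m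
      (evalLeft L.action.toGrHom { t with x := x, hx := hx })
      = leftSubst F.coord R.action.toGrHom m
        (evalRight R.action.toGrHom { t with x := x, hx := hx })) ?_ ?_ ?_ hx
    · intro c' hc
      set d : TripleSymbol L.toDGSymModule P.toDGSymModule R.toDGSymModule m :=
        { t with x := _, hx := hc } with hd
      rw [F.leftSubst_evalLeft d c' rfl, evalRight_tripleMul d c' _ fun i => Fintype.equivFin _,
        smul_smul, ← pow_add, neg_one_pow_congr_zmod (pentagon_sign d c' _ _)]
      rw [evalRight, map_smul, pow_add, mul_smul]
      congr 1
      refine Eq.trans ?_ (F.leftSubst_coord R.action.toGrHom (d.right R.action.toGrHom) c' rfl).symm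
      rw [subst_mk, substSymbol, evalRight_eq R.action.toGrHom _ _ (tripleLabel d c' _ fun i =>
        Fintype.equivFin _), smul_smul, ← pow_add]
    · intro α β x y hx hy ihx ihy
      have h1 := evalLeft_lin_x L.action.toGrHom { t with
        x := α • x + β • y
        hx := add_mem (Submodule.smul_mem _ _ hx) (Submodule.smul_mem _ _ hy) } α β x y hx hy rfl
      have h2 := evalRight_lin_x R.action.toGrHom { t with
        x := α • x + β • y
        hx := add_mem (Submodule.smul_mem _ _ hx) (Submodule.smul_mem _ _ hy) } α β x y hx hy rfl
      simp only [h1, h2, map_add, map_smul, ihx, ihy]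
    · have h1 := evalLeft_lin_x L.action.toGrHom { t with
        x := (0 : L.carrier t.r)
        hx := zero_mem _ } 0 0 0 0 (zero_mem _) (zero_mem _) (by simp)
      have h2 := evalRight_lin_x R.action.toGrHom { t with
        x := (0 : L.carrier t.r)
        hx := zero_mem _ } 0 0 0 0 (zero_mem _) (zero_mem _) (by simp)
      rw [h1, h2]
      simp
  exact key t.hx

end Pentagon

end DGRightModule.QuasiFree

end RightQuasiFree


/-! ### Filtered perturbations and mapping cones. -/

section Filtered

variable {K : Type*} [CommRing K]

/-- A differential `D = D₀ + (terms of lower weight)` on a module with a finite grading by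
weights, given by the projections `p`. -/
structure WeightPerturbation {Z : Type*} [AddCommGroup Z] [Module K Z] (p : ℕ → Z →ₗ[K] Z) (N : ℕ)
    (D₀ D : Z →ₗ[K] Z) : Prop where
  proj_self : ∀ k z, p k (p k z) = p k z
  proj_ne : ∀ j k z, j ≠ k → p j (p k z) = 0
  sum_proj : ∀ z, ∑ k ∈ Finset.range N, p k z = z
  comm : ∀ k z, p k (D₀ z) = D₀ (p k z)
  lower : ∀ j k z, k ≤ j → p j (D (p k z)) = p j (D₀ (p k z))
  sq : ∀ z, D (D z) = 0

/-- Acyclicity of the part of weight `k`. -/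
def WeightAcyclic {Z : Type*} [AddCommGroup Z] [Module K Z] (p D₀ : Z →ₗ[K] Z) : Prop :=
  ∀ z, p z = z → D₀ z = 0 → ∃ y, p y = y ∧ D₀ y = z

namespace WeightPerturbation

variable {Z : Type*} [AddCommGroup Z] [Module K Z] {p : ℕ → Z →ₗ[K] Z} {N : ℕ}
  {D₀ D : Z →ₗ[K] Z} (h : WeightPerturbation p N D₀ D)

include h

/-- On elements supported in weights ≤ k the perturbation D - D₀ only reaches weights < k, so
leading components see D₀ alone. -/
theorem proj_map {k : ℕ} {z : Z} (hz : ∀ j, k < j → p j z = 0) {i : ℕ} (hi : k ≤ i) :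
    p i (D z) = D₀ (p i z) := by
  conv_lhs => rw [← h.sum_proj z]
  rw [map_sum, map_sum, ← h.comm]
  conv_rhs => rw [← h.sum_proj z]
  rw [map_sum, map_sum]
  refine Finset.sum_congr rfl fun j _ => ?_
  rcases le_or_gt j i with hj | hj
  · exact h.lower i j z hj
  · simp [hz j (hi.trans_lt hj)]

theorem eq_zero {z : Z} (hz : ∀ j, p j z = 0) : z = 0 := by
  rw [← h.sum_proj z]
  exact Finset.sum_eq_zero fun j _ => hz j

theorem proj_eq_zero {j : ℕ} (hj : N ≤ j) (z : Z) : p j z = 0 := by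
  rw [← h.sum_proj z, map_sum]
  refine Finset.sum_eq_zero fun i hi => h.proj_ne _ _ _ ?_
  have := Finset.mem_range.1 hi
  omega

/-- The leading component of a D-cycle is a D₀-cycle; subtracting D of a D₀-primitive of it lowers
the weight. The bound on the weights of y, which plain acyclicity would not need, is what the
statement on the top weight uses. -/
theorem exists_of_lower (k : ℕ) (hk : ∀ i < k, WeightAcyclic (p i) D₀) (z : Z)
    (hz : ∀ j, k ≤ j → p j z = 0) (hD : D z = 0) : ∃ y, (∀ j, k ≤ j → p j y = 0) ∧ D y = z := by
  induction k generalizing z with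
  | zero => exact ⟨0, by simp, by rw [map_zero, h.eq_zero fun j => hz j (Nat.zero_le j)]⟩
  | succ k ih =>
    have h1 : D₀ (p k z) = 0 := by
      rw [← h.proj_map (k := k) hz le_rfl, hD, map_zero]
    obtain ⟨y₀, hy₀, hy₀'⟩ := hk k k.lt_succ_self _ (h.proj_self k z) h1
    have hlow : ∀ j, k < j → p j y₀ = 0 := fun j hj => by rw [← hy₀, h.proj_ne _ _ _ hj.ne']
    obtain ⟨y, hy, hy'⟩ := ih (fun i hi => hk i (hi.trans k.lt_succ_self)) (z - D y₀) (fun j hj => by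
      rw [map_sub, h.proj_map hlow hj, ← h.comm, hy₀']
      rcases hj.eq_or_lt with rfl | hj
      · rw [h.proj_self, sub_self]
      · rw [hz j hj, h.proj_ne _ _ _ hj.ne', sub_self]) (by rw [map_sub, hD, h.sq, sub_self])
    refine ⟨y + y₀, fun j hj => ?_, by rw [map_add, hy', sub_add_cancel]⟩
    rw [map_add, hy j (by omega), hlow j (by omega), add_zero]

/-- If `D₀` is acyclic in each weight, then `D` is acyclic. -/
theorem acyclic (hk : ∀ i < N, WeightAcyclic (p i) D₀) (z : Z) (hD : D z = 0) : ∃ y, D y = z := by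
  obtain ⟨y, -, hy⟩ := h.exists_of_lower N hk z (fun j hj => h.proj_eq_zero hj z) hD
  exact ⟨y, hy⟩

/-- If `D` is acyclic and `D₀` is acyclic in each weight but the highest one, then `D₀` is acyclic
in the highest weight as well. -/
theorem weightAcyclic_top {n : ℕ} (hn : N = n + 1) (hD : ∀ z, D z = 0 → ∃ y, D y = z)
    (hk : ∀ i < n, WeightAcyclic (p i) D₀) : WeightAcyclic (p n) D₀ := by
  intro z hz hz'
  have htop : ∀ x j, n < j → p j x = 0 := fun x j hj => h.proj_eq_zero (by omega) x
  have h1 : ∀ j, n ≤ j → p j (D z) = 0 := fun j hj => by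
    rcases hj.eq_or_lt with rfl | hj
    · rw [h.proj_map (htop z) le_rfl, hz, hz']
    · exact htop _ j hj
  -- As z is a D₀-cycle of top weight, D z is a D-cycle of lower weight, hence D y for some y of
  -- lower weight. Then z - y is a D-cycle with the same top component as z, and the top component
  -- of a D-primitive of it is a D₀-primitive of z.
  obtain ⟨y, hy, hy'⟩ := h.exists_of_lower n hk (D z) h1 (h.sq z)
  obtain ⟨x, hx⟩ := hD (z - y) (by rw [map_sub, hy', sub_self])
  refine ⟨p n x, h.proj_self n x, ?_⟩
  rw [← h.proj_map (htop x) le_rfl, hx, map_sub, hz, hy n le_rfl, sub_zero]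

end WeightPerturbation

section Cone

variable {X X' : Type*} [AddCommGroup X] [Module K X] [AddCommGroup X'] [Module K X']

/-- The differential of the cone of `F`. -/
def coneD (d : X →ₗ[K] X) (d' : X' →ₗ[K] X') (F : X →ₗ[K] X') : X × X' →ₗ[K] X × X' :=
  (d ∘ₗ LinearMap.fst K X X').prod (F ∘ₗ LinearMap.fst K X X' - d' ∘ₗ LinearMap.snd K X X')

@[simp] theorem coneD_apply (d : X →ₗ[K] X) (d' : X' →ₗ[K] X') (F : X →ₗ[K] X') (z : X × X') :
    coneD d d' F z = (d z.1, F z.1 - d' z.2) := rfl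

theorem coneD_coneD {d : X →ₗ[K] X} {d' : X' →ₗ[K] X'} {F : X →ₗ[K] X'} (hd : ∀ x, d (d x) = 0)
    (hd' : ∀ x, d' (d' x) = 0) (hF : ∀ x, F (d x) = d' (F x)) (z : X × X') :
    coneD d d' F (coneD d d' F z) = 0 := by
  simp [hd, hd', hF]

/-- Acyclicity of the cone of `F`. -/
def ConeAcyclic (d : X →ₗ[K] X) (d' : X' →ₗ[K] X') (F : X →ₗ[K] X') : Prop :=
  ∀ z, coneD d d' F z = 0 → ∃ y, coneD d d' F y = z

end Cone

end Filtered

/-! ### Quasi-isomorphisms and acyclic cones. -/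

section QuasiIsoCone

variable {K : Type u} [CommRing K] {M : DGSymModule.{u, v} K} {N : DGSymModule.{u, w} K}

/-- The usual long exact sequence argument, done by hand. Because homology is taken as the sum over
all degrees, an ungraded cone suffices here and no shift has to be recorded. -/
theorem DGHom.bijective_homologyMap_iff (f : DGHom M N) (r : ℕ) :
    Function.Bijective (f.homologyMap r) ↔ ConeAcyclic (M.d r) (N.d r) (f.toFun r) := by
  constructor
  · rintro ⟨hi, hs⟩ ⟨x, x'⟩ hx
    simp only [coneD_apply, Prod.mk_eq_zero, sub_eq_zero] at hx
    obtain ⟨hx, hx'⟩ := hx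
    have h1 : f.homologyMap r (Submodule.Quotient.mk ⟨x, hx⟩) = 0 :=
      (Submodule.Quotient.mk_eq_zero _).2 ⟨x', hx'.symm⟩
    rw [← map_zero (f.homologyMap r)] at h1
    obtain ⟨y, hy⟩ := (Submodule.Quotient.mk_eq_zero _).1 (hi h1)
    simp only [Submodule.coe_subtype] at hy
    have h2 : x' - f.toFun r y ∈ LinearMap.ker (N.d r) := by
      rw [LinearMap.mem_ker, map_sub, ← hx', ← f.map_d, hy, sub_self]
    obtain ⟨z, hz⟩ := hs (Submodule.Quotient.mk ⟨_, h2⟩)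
    obtain ⟨⟨z, hz'⟩, rfl⟩ := Submodule.Quotient.mk_surjective _ z
    obtain ⟨y', hy'⟩ := (Submodule.Quotient.eq _).1 hz
    simp only [Submodule.coe_subtype, AddSubgroupClass.coe_sub] at hy'
    have hy'' : N.d r y' = f.toFun r z - (x' - f.toFun r y) := hy'
    refine ⟨(y + z, y'), ?_⟩
    have hz'' : M.d r z = 0 := hz'
    simp only [coneD_apply, map_add, hy, hz'', add_zero, hy'']
    refine Prod.ext rfl ?_
    dsimp only
    abel
  · intro h
    constructor
    · rw [injective_iff_map_eq_zero]
      intro z hz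
      obtain ⟨⟨z, hz'⟩, rfl⟩ := Submodule.Quotient.mk_surjective _ z
      obtain ⟨y', hy'⟩ := (Submodule.Quotient.mk_eq_zero _).1 hz
      have hy'' : N.d r y' = f.toFun r z := hy'
      have hz'' : M.d r z = 0 := hz'
      obtain ⟨⟨y, y₂⟩, hy⟩ := h (z, y') (by simp [hy'', hz''])
      rw [Submodule.Quotient.mk_eq_zero]
      exact ⟨y, (Prod.ext_iff.1 hy).1⟩
    · intro z
      obtain ⟨⟨z, hz'⟩, rfl⟩ := Submodule.Quotient.mk_surjective _ z
      have hz'' : N.d r z = 0 := hz'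
      obtain ⟨⟨y, y'⟩, hy⟩ := h (0, z) (by simp [hz''])
      simp only [coneD_apply, Prod.mk.injEq] at hy
      refine ⟨Submodule.Quotient.mk ⟨y, hy.1⟩, ?_⟩
      refine (Submodule.Quotient.eq _).2 ⟨y', ?_⟩
      change N.d r y' = f.toFun r y - z
      rw [← hy.2]; abel

end QuasiIsoCone


/-! ### Weights, and non-equivariant maps on the roots when the blocks are nonempty. -/

noncomputable section Twist

variable {K : Type u} [CommRing K]

open CompositeModule CompositeSymbol

section BlockSort

variable {m r : ℕ} (n : Fin r → ℕ) (e : (Σ i, Fin (n i)) ≃ Fin m)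

/-- The minimum of the `i`-th block. -/
def blockMin (i : Fin r) : ℕ := sInf (Set.range fun k => (e ⟨i, k⟩ : ℕ))

/-- The permutation which sorts the blocks by their minima. -/
def blockSort : Equiv.Perm (Fin r) := Tuple.sort (blockMin n e)

theorem blockMin_inner (σ : ∀ i, Equiv.Perm (Fin (n i))) :
    blockMin n ((Equiv.sigmaCongrRight σ).trans e) = blockMin n e := by
  funext i
  refine congrArg sInf ?_
  exact (σ i).surjective.range_comp fun k => (e ⟨i, k⟩ : ℕ)

theorem blockSort_inner (σ : ∀ i, Equiv.Perm (Fin (n i))) :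
    blockSort n ((Equiv.sigmaCongrRight σ).trans e) = blockSort n e := by
  rw [blockSort, blockMin_inner]; rfl

/-- Disjoint nonempty blocks have different minima. For an empty block `sInf` would return the
default value 0, so nonemptiness is essential. -/
theorem blockMin_injective (hn : ∀ i, n i ≠ 0) : Function.Injective (blockMin n e) := by
  have h : ∀ i, ∃ k, (e ⟨i, k⟩ : ℕ) = blockMin n e i := fun i => by
    have : Nonempty (Fin (n i)) := ⟨⟨0, Nat.pos_of_ne_zero (hn i)⟩⟩
    exact Nat.sInf_mem (Set.range_nonempty fun k => (e ⟨i, k⟩ : ℕ))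
  intro i j hij
  obtain ⟨k, hk⟩ := h i
  obtain ⟨l, hl⟩ := h j
  have : e ⟨i, k⟩ = e ⟨j, l⟩ := Fin.ext (by rw [hk, hl, hij])
  exact congrArg Sigma.fst (e.injective this)

/-- With distinct minima the sorting permutation is unique, hence compatible with permutations of
the blocks. This is the freeness of the action of the symmetric group on ordered partitions into
nonempty blocks. -/
theorem blockSort_outer (hn : ∀ i, n i ≠ 0) (s : Equiv.Perm (Fin r)) :
    s * blockSort (fun i => n (s i)) ((Equiv.sigmaCongrLeft (β := fun i => Fin (n i)) s).trans e)
      = blockSort n e := by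
  have h1 : blockMin (fun i => n (s i))
      ((Equiv.sigmaCongrLeft (β := fun i => Fin (n i)) s).trans e) = blockMin n e ∘ s := rfl
  rw [blockSort, h1, blockSort, Tuple.eq_sort_iff]
  refine ⟨Tuple.monotone_sort (blockMin n e ∘ s), fun i j hij h => ?_⟩
  exact absurd (Equiv.injective _ (blockMin_injective n e hn h)) hij.ne

end BlockSort

variable {M : DGSymModule.{u, v} K} {N : DGSymModule.{u, w} K} {m : ℕ}

theorem CompositeModule.mk_eq_zero_of_n (hN : N.Connected) (c : CompositeSymbol M N m) {i : Fin c.r}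
    (hi : c.n i = 0) : CompositeModule.mk c = 0 := by
  refine mk_eq_zero_of_right c i ?_
  have : Subsingleton (N (c.n i)) := by rw [hi]; exact hN
  exact Subsingleton.elim _ _

/-- There are not enough labels for more than m nonempty blocks. This is why the weight filtration
is finite in each arity. -/
theorem CompositeModule.mk_eq_zero_of_lt (hN : N.Connected) (c : CompositeSymbol M N m) (h : m < c.r) :
    CompositeModule.mk c = 0 := by
  by_cases hn : ∃ i, c.n i = 0
  · exact mk_eq_zero_of_n hN c hn.choose_spec
  · push Not at hn
    have h1 := Fintype.card_congr c.e
    simp only [Fintype.card_sigma, Fintype.card_fin] at h1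
    have h2 : ∑ i : Fin c.r, 1 ≤ ∑ i, c.n i :=
      Finset.sum_le_sum fun i _ => Nat.one_le_iff_ne_zero.2 (hn i)
    simp at h2
    omega

/-- The projection onto the part of weight `s`, generated by the elements `x(y_1,…,y_s)`. -/
def weightProj (M : DGSymModule.{u, v} K) (N : DGSymModule.{u, w} K) (m s : ℕ) :
    CompositeModule M N m →ₗ[K] CompositeModule M N m :=
  CompositeModule.lift (fun c => if c.r = s then CompositeModule.mk c else 0)
    (CompositeSymbol.Respects.rel
      { lin_left := fun c α β x' x'' hx' hx'' h => by
          dsimp only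
          split_ifs
          · exact mk_lin_left c α β x' x'' hx' hx'' h
          · simp
        lin_right := fun c i α β y' y'' hy' hy'' h h' h'' => by
          dsimp only
          split_ifs
          · exact mk_lin_right c i α β y' y'' hy' hy'' h h' h''
          · simp
        inner := fun c σ => by rw [mk_inner c σ]
        outer := fun c s => by rw [mk_outer c s, smul_ite, smul_zero] })

theorem weightProj_mk (c : CompositeSymbol M N m) (s : ℕ) :
    weightProj M N m s (CompositeModule.mk c) = if c.r = s then CompositeModule.mk c else 0 :=
  CompositeModule.lift_mk _ _ _

theorem weightProj_self (s : ℕ) (z : CompositeModule M N m) :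
    weightProj M N m s (weightProj M N m s z) = weightProj M N m s z := by
  refine LinearMap.congr_fun (f := weightProj M N m s ∘ₗ weightProj M N m s)
    (CompositeModule.hom_ext fun c => ?_) z
  rw [LinearMap.comp_apply, weightProj_mk]
  split_ifs with h
  · rw [weightProj_mk, if_pos h]
  · rw [map_zero]

theorem weightProj_ne {s t : ℕ} (h : s ≠ t) (z : CompositeModule M N m) :
    weightProj M N m s (weightProj M N m t z) = 0 := by
  refine LinearMap.congr_fun (f := weightProj M N m s ∘ₗ weightProj M N m t) (g := 0)
    (CompositeModule.hom_ext fun c => ?_) z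
  rw [LinearMap.comp_apply, weightProj_mk]
  split_ifs with h'
  · rw [weightProj_mk, if_neg (by omega)]; rfl
  · rw [map_zero]; rfl

theorem sum_weightProj (hN : N.Connected) (z : CompositeModule M N m) :
    ∑ s ∈ Finset.range (m + 1), weightProj M N m s z = z := by
  have : ∑ s ∈ Finset.range (m + 1), weightProj M N m s = LinearMap.id :=
    CompositeModule.hom_ext fun c => by
      rw [LinearMap.sum_apply]
      simp only [weightProj_mk, Finset.sum_ite_eq, LinearMap.id_apply]
      split_ifs with h
      · rfl
      · rw [mk_eq_zero_of_lt hN c (by simpa [Nat.lt_succ_iff] using h)]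
  rw [← LinearMap.sum_apply, this, LinearMap.id_apply]

theorem weightProj_dHom (s : ℕ) (z : CompositeModule M N m) :
    weightProj M N m s (dHom M N m z) = dHom M N m (weightProj M N m s z) := by
  refine LinearMap.congr_fun (f := weightProj M N m s ∘ₗ dHom M N m)
    (g := dHom M N m ∘ₗ weightProj M N m s) (CompositeModule.hom_ext fun c => ?_) z
  rw [LinearMap.comp_apply, LinearMap.comp_apply, weightProj_mk, dHom_mk, dMk, map_add, map_sum,
    weightProj_mk]
  simp only [map_smul, weightProj_mk]
  split_ifs with h
  · rw [dHom_mk, dMk]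
  · simp

theorem weightProj_mapHom {M' : DGSymModule.{u, v₁} K} {N' : DGSymModule.{u, v₂} K}
    (f : GrHom M M') (g : GrHom N N') (s : ℕ) (z : CompositeModule M N m) :
    weightProj M' N' m s (compose.mapHom f g m z) = compose.mapHom f g m (weightProj M N m s z) := by
  refine LinearMap.congr_fun (f := weightProj M' N' m s ∘ₗ compose.mapHom f g m)
    (g := compose.mapHom f g m ∘ₗ weightProj M N m s) (CompositeModule.hom_ext fun c => ?_) z
  rw [LinearMap.comp_apply, LinearMap.comp_apply, weightProj_mk, compose.mapHom_mk, weightProj_mk]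
  split_ifs with h
  · rw [compose.mapHom_mk]
  · simp

/-- A family of linear maps, compatible with the gradings (but not with the actions of the
symmetric groups). -/
structure GrFam (M : DGSymModule.{u, v} K) (M' : DGSymModule.{u, v₁} K) where
  toFun : ∀ r, M r →ₗ[K] M' r
  deg : ℕ → ℕ
  map_mem : ∀ r a x, x ∈ M.gr r a → toFun r x ∈ M'.gr r (deg a)

section TwistLeft

variable {M' : DGSymModule.{u, v₁} K} {M'' : DGSymModule.{u, v₂} K}

/-- The composite element `f(x)(y_1,…,y_r)`, when the blocks are sorted. -/
abbrev twistSymbol (f : GrFam M M') (c : CompositeSymbol M N m) : CompositeSymbol M' N m :=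
  { c with
    a := f.deg c.a
    x := M'.rep _ (blockSort c.n c.e) (f.toFun _ (M.rep _ (blockSort c.n c.e)⁻¹ c.x))
    hx := M'.rep_mem _ _ _ _ (f.map_mem _ _ _ (M.rep_mem _ _ _ _ c.hx)) }

/-- The map f need not be equivariant: it is applied to the root only after the blocks have been
sorted, and the result is permuted back. Conjugation by the sorting permutation absorbs the
coinvariance relation; if a block is empty, both sides of that relation vanish. -/
theorem twist_respects (f : GrFam M M') (hN : N.Connected) :
    CompositeSymbol.Respects fun c : CompositeSymbol M N m => CompositeModule.mk (twistSymbol f c) where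
  lin_left c α β x' x'' hx' hx'' h := by
    refine mk_lin_left (twistSymbol f c) α β _ _
      (twistSymbol f { c with x := x', hx := hx' }).hx
      (twistSymbol f { c with x := x'', hx := hx'' }).hx ?_
    simp only [h, map_add, map_smul]
  lin_right c i α β y' y'' hy' hy'' h h' h'' :=
    mk_lin_right (twistSymbol f c) i α β y' y'' hy' hy'' h h' h''
  inner c σ := by
    refine (mk_inner (twistSymbol f c) σ).trans ?_
    refine mk_eq_mk (fun _ => rfl) ?_ (fun _ => rfl)
    dsimp only
    rw [blockSort_inner]
  outer c s := by
    by_cases hn : ∃ i, c.n i = 0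
    · obtain ⟨i, hi⟩ := hn
      have h1 : CompositeModule.mk (twistSymbol f (c.outer s)) = 0 :=
        mk_eq_zero_of_n hN _ (i := i) hi
      have h2 : CompositeModule.mk (twistSymbol f (c.outerPerm s)) = 0 :=
        mk_eq_zero_of_n hN _ (i := s.symm i) (by simp [hi])
      rw [h1, h2, smul_zero]
    · push Not at hn
      refine Eq.trans ?_ (mk_outer { c with
        a := f.deg c.a
        x := (twistSymbol f (c.outerPerm s)).x
        hx := (twistSymbol f (c.outerPerm s)).hx } s)
      refine mk_eq_mk (fun _ => rfl) ?_ (fun _ => rfl)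
      dsimp only
      rw [← blockSort_outer c.n c.e hn s]
      simp only [map_mul, mul_inv_rev, Module.End.mul_apply]
      congr 3
      rw [← Module.End.mul_apply, ← map_mul]
      simp

/-- The map `x(y_1,…,y_r) ↦ f(x)(y_1,…,y_r)`, for sorted blocks. -/
def twistLeft (f : GrFam M M') (hN : N.Connected) (m : ℕ) :
    CompositeModule M N m →ₗ[K] CompositeModule M' N m :=
  CompositeModule.lift _ (twist_respects f hN).rel

variable (hN : N.Connected)

theorem twistLeft_mk (f : GrFam M M') (c : CompositeSymbol M N m) :
    twistLeft f hN m (CompositeModule.mk c) = CompositeModule.mk (twistSymbol f c) :=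
  CompositeModule.lift_mk _ _ _

theorem twistLeft_mapHom (f : GrHom M M') (g : GrFam M' M'') (gf : GrFam M M'')
    (h : ∀ r x, gf.toFun r x = g.toFun r (f.toFun r x)) (z : CompositeModule M N m) :
    twistLeft g hN m (compose.mapHom f (GrHom.id N) m z) = twistLeft gf hN m z := by
  refine LinearMap.congr_fun (f := twistLeft g hN m ∘ₗ compose.mapHom f (GrHom.id N) m)
    (CompositeModule.hom_ext fun c => ?_) z
  rw [LinearMap.comp_apply, compose.mapHom_mk, twistLeft_mk, twistLeft_mk]
  refine mk_eq_mk (fun _ => rfl) ?_ (fun _ => rfl)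
  simp only [h, f.map_rep]

theorem mapHom_twistLeft (f : GrFam M M') (g : GrHom M' M'') (gf : GrFam M M'')
    (h : ∀ r x, gf.toFun r x = g.toFun r (f.toFun r x)) (z : CompositeModule M N m) :
    compose.mapHom g (GrHom.id N) m (twistLeft f hN m z) = twistLeft gf hN m z := by
  refine LinearMap.congr_fun (f := compose.mapHom g (GrHom.id N) m ∘ₗ twistLeft f hN m)
    (CompositeModule.hom_ext fun c => ?_) z
  rw [LinearMap.comp_apply, twistLeft_mk, compose.mapHom_mk, twistLeft_mk]
  refine mk_eq_mk (fun _ => rfl) ?_ (fun _ => rfl)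
  simp only [h, g.map_rep]

theorem twistLeft_sub_id (f k : GrFam M M) (hf : f.deg = id) (hk : k.deg = id) (s : ℕ)
    (h : ∀ x, f.toFun s x = x + k.toFun s x) (z : CompositeModule M N m)
    (hz : weightProj M N m s z = z) :
    twistLeft f hN m z = z + twistLeft k hN m z := by
  rw [← hz]
  refine LinearMap.congr_fun (f := twistLeft f hN m ∘ₗ weightProj M N m s)
    (g := (LinearMap.id + twistLeft k hN m) ∘ₗ weightProj M N m s)
    (CompositeModule.hom_ext fun c => ?_) z
  rw [LinearMap.comp_apply, LinearMap.comp_apply, weightProj_mk]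
  split_ifs with hc
  · subst hc
    rw [LinearMap.add_apply, LinearMap.id_apply, twistLeft_mk, twistLeft_mk]
    have ef : (twistSymbol f c).a = c.a := congrFun hf c.a
    have ek : (twistSymbol k c).a = c.a := congrFun hk c.a
    have h1 : (twistSymbol k c).x ∈ M.gr c.r (twistSymbol f c).a := by
      rw [ef, ← ek]; exact (twistSymbol k c).hx
    have h2 : c.x ∈ M.gr c.r (twistSymbol f c).a := by rw [ef]; exact c.hx
    refine (mk_lin_left (twistSymbol f c) 1 1 c.x (twistSymbol k c).x h2 h1 ?_).trans ?_
    · dsimp only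
      rw [h, map_add, ← Module.End.mul_apply, ← map_mul]
      simp
    · rw [one_smul, one_smul]
      exact congrArg₂ (· + ·) (mk_eq_mk (fun _ => rfl) rfl (fun _ => rfl))
        (mk_eq_mk (fun _ => rfl) rfl (fun _ => rfl))
  · simp

theorem dHom_twistLeft (f : GrFam M M') (hf : f.deg = id) (s : ℕ)
    (h : ∀ x, M'.d s (f.toFun s x) = f.toFun s (M.d s x)) (z : CompositeModule M N m)
    (hz : weightProj M N m s z = z) :
    dHom M' N m (twistLeft f hN m z) = twistLeft f hN m (dHom M N m z) := by
  rw [← hz]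
  refine LinearMap.congr_fun (f := dHom M' N m ∘ₗ twistLeft f hN m ∘ₗ weightProj M N m s)
    (g := twistLeft f hN m ∘ₗ dHom M N m ∘ₗ weightProj M N m s)
    (CompositeModule.hom_ext fun c => ?_) z
  simp only [LinearMap.comp_apply, weightProj_mk]
  split_ifs with hc
  · subst hc
    rw [twistLeft_mk, dHom_mk, dHom_mk, dMk, dMk, map_add, map_sum, twistLeft_mk]
    congr 1
    · refine mk_eq_mk (fun _ => rfl) ?_ (fun _ => rfl)
      dsimp only
      rw [M'.d_rep, h, M.d_rep]
    · refine Finset.sum_congr rfl fun i _ => ?_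
      rw [map_smul, twistLeft_mk]
      refine congrArg₂ (· • ·) ?_ (mk_eq_mk (fun _ => rfl) rfl (fun _ => rfl))
      simp only [CompositeSymbol.dExp, hf, id]
  · simp

/-- Since f raises the degree of the root by one, each term with the differential on a factor
appears twice with opposite signs. Only the commutator on the root survives. -/
theorem dHom_twistLeft_add (f k : GrFam M M) (hf : f.deg = Nat.succ) (hk : k.deg = id) (s : ℕ)
    (h : ∀ x, k.toFun s x = M.d s (f.toFun s x) + f.toFun s (M.d s x)) (z : CompositeModule M N m)
    (hz : weightProj M N m s z = z) :
    dHom M N m (twistLeft f hN m z) + twistLeft f hN m (dHom M N m z) = twistLeft k hN m z := by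
  rw [← hz]
  refine LinearMap.congr_fun (f := (dHom M N m ∘ₗ twistLeft f hN m + twistLeft f hN m ∘ₗ dHom M N m)
      ∘ₗ weightProj M N m s)
    (g := twistLeft k hN m ∘ₗ weightProj M N m s)
    (CompositeModule.hom_ext fun c => ?_) z
  simp only [LinearMap.comp_apply, weightProj_mk, LinearMap.add_apply]
  split_ifs with hc
  · subst hc
    rw [twistLeft_mk, dHom_mk, dHom_mk, dMk, dMk, map_add, map_sum, twistLeft_mk, add_add_add_comm,
      ← Finset.sum_add_distrib, Finset.sum_eq_zero, add_zero, twistLeft_mk]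
    · have ek : (twistSymbol k c).a = c.a := congrFun hk c.a
      have ef : (twistSymbol f c).dLeft.a = c.a := congrArg (· - 1) (congrFun hf c.a)
      have h1 : (twistSymbol f c).dLeft.x ∈ M.gr c.r (twistSymbol k c).a := by
        rw [ek, ← ef]; exact (twistSymbol f c).dLeft.hx
      have h2 : (twistSymbol f c.dLeft).x ∈ M.gr c.r (twistSymbol k c).a := by
        rw [ek]
        -- In degree 0 the recorded degree of the root after `dLeft` is again 0 by truncation, so
        -- after f it would be 1; but the root is then zero.
        by_cases ha : c.a = 0
        · have : M.d c.r c.x = 0 := M.d_zero _ _ (ha ▸ c.hx)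
          simp [this]
        · have e : (twistSymbol f c.dLeft).a = c.a :=
            (congrFun hf (c.a - 1)).trans (Nat.succ_pred_eq_of_ne_zero ha)
          rw [← e]; exact (twistSymbol f c.dLeft).hx
      refine Eq.trans ?_ (mk_lin_left (twistSymbol k c) 1 1 _ _ h1 h2 ?_).symm
      · rw [one_smul, one_smul]
        exact congrArg₂ (· + ·) (mk_eq_mk (fun _ => rfl) rfl (fun _ => rfl))
          (mk_eq_mk (fun _ => rfl) rfl (fun _ => rfl))
      · dsimp only
        rw [h, M.d_rep, map_add, one_smul, one_smul, M.d_rep]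
    · intro i _
      rw [map_smul, twistLeft_mk]
      have h3 : CompositeModule.mk ((twistSymbol f c).dRight i)
          = CompositeModule.mk (twistSymbol f (c.dRight i)) :=
        mk_eq_mk (fun _ => rfl) rfl (fun _ => rfl)
      rw [h3, ← add_smul]
      -- The differential has to cross a root whose degree has gone up by one.
      have h4 : (twistSymbol f c).dExp i = c.dExp i + 1 := by
        simp only [CompositeSymbol.dExp, hf]
        exact Nat.succ_add _ _
      rw [h4, pow_succ]
      simp
  · simp

end TwistLeft

end Twist

/-! ### Homotopy inverses and acyclicity in one weight, for maps on the roots. -/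

section Homotopy

variable {K : Type u} [CommRing K]

/-- The morphism `φ` has a homotopy inverse in arity `s`, which does not have to be compatible
with the action of `Σ_s`. -/
def DGHom.HasHomotopyInverse {M : DGSymModule.{u, v} K} {M' : DGSymModule.{u, w} K} (φ : DGHom M M')
    (s : ℕ) : Prop :=
  ∃ (g : M' s →ₗ[K] M s) (h : M s →ₗ[K] M s) (h' : M' s →ₗ[K] M' s),
    (∀ a, ∀ x ∈ M'.gr s a, g x ∈ M.gr s a) ∧ (∀ a, ∀ x ∈ M.gr s a, h x ∈ M.gr s (a + 1)) ∧
    (∀ a, ∀ x ∈ M'.gr s a, h' x ∈ M'.gr s (a + 1)) ∧ (∀ x, M.d s (g x) = g (M'.d s x)) ∧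
    (∀ x, g (φ.toFun s x) = x + (M.d s (h x) + h (M.d s x))) ∧
    ∀ x, φ.toFun s (g x) = x + (M'.d s (h' x) + h' (M'.d s x))

/-- The cone of a homotopy equivalence is acyclic. The homotopy identities are only assumed on the
part cut out by p and p', and G, H, H' are not assumed to preserve it; the projections are therefore
applied to their values. -/
theorem weightAcyclic_of_homotopy {C C' : Type*} [AddCommGroup C] [Module K C] [AddCommGroup C']
    [Module K C'] (p d H : C →ₗ[K] C) (p' d' H' : C' →ₗ[K] C') (F : C →ₗ[K] C') (G : C' →ₗ[K] C)
    (hp : ∀ z, p (p z) = p z) (hp' : ∀ z, p' (p' z) = p' z) (hpd : ∀ z, p (d z) = d (p z))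
    (hpd' : ∀ z, p' (d' z) = d' (p' z)) (hpF : ∀ z, p' (F z) = F (p z))
    (hFd : ∀ z, F (d z) = d' (F z))
    (hGd : ∀ z, p' z = z → d (G z) = G (d' z))
    (hGF : ∀ z, p z = z → G (F z) = z + (d (H z) + H (d z)))
    (hFG : ∀ z, p' z = z → F (G z) = z + (d' (H' z) + H' (d' z))) :
    WeightAcyclic (p.prodMap p') (coneD d d' F) := by
  rintro ⟨x, x'⟩ hz h
  simp only [coneD_apply, Prod.mk_eq_zero, sub_eq_zero, LinearMap.prodMap_apply,
    Prod.mk.injEq] at h hz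
  obtain ⟨hx, hx'⟩ := hz
  obtain ⟨hd, hF⟩ := h
  have e1 := hGF x hx
  rw [hF, ← hGd x' hx', hd, map_zero, add_zero] at e1
  -- For a cone cycle, d x = 0 and F x = d' x', so the first homotopy gives d (G x' - H x) = x. The
  -- remaining error x' - F y is a cycle and is corrected with the second homotopy.
  set y := p (G x' - H x) with hy
  have hdy : d y = x := by rw [hy, ← hpd, map_sub, e1, add_sub_cancel_right, hx]
  have hpy : p y = y := hp _
  have hc : p' (x' - F y) = x' - F y := by rw [map_sub, hx', hpF, hpy]
  have hdc : d' (x' - F y) = 0 := by rw [map_sub, ← hF, ← hFd, hdy, sub_self]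
  have e2 := hFG _ hc
  rw [hdc, map_zero, add_zero] at e2
  refine ⟨(y + p (G (x' - F y)), p' (H' (x' - F y))), ?_, ?_⟩
  · simp [hp, hp', hpy]
  · have e3 := congrArg p' e2
    rw [map_add, hc, hpF, hpd'] at e3
    refine Prod.ext ?_ ?_
    · simp only [coneD_apply, map_add, hdy, ← hpd, hGd _ hc, hdc, map_zero, add_zero]
    · simp only [coneD_apply, map_add, e3]
      abel

variable {M : DGSymModule.{u, v} K} {M' : DGSymModule.{u, v₁} K} {N : DGSymModule.{u, w} K}

/-- The family of maps which consists of a single map in arity `s`. -/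
noncomputable def GrFam.single (s : ℕ) (f : M s →ₗ[K] M' s) (D : ℕ → ℕ)
    (hf : ∀ a, ∀ x ∈ M.gr s a, f x ∈ M'.gr s (D a)) : GrFam M M' where
  toFun := Pi.single s f
  deg := D
  map_mem r a x hx := by
    rcases eq_or_ne r s with rfl | h
    · rw [Pi.single_eq_same]; exact hf a x hx
    · rw [Pi.single_eq_of_ne h]; exact zero_mem _

theorem DGSymModule.homotopy_mem (A : DGSymModule.{u, v} K) {s : ℕ} (h : A s →ₗ[K] A s)
    (hh : ∀ a, ∀ x ∈ A.gr s a, h x ∈ A.gr s (a + 1)) :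
    ∀ a, ∀ x ∈ A.gr s a, (A.d s ∘ₗ h + h ∘ₗ A.d s) x ∈ A.gr s a := by
  intro a x hx
  refine add_mem (A.d_mem _ _ _ (hh a x hx)) ?_
  cases a with
  | zero => simp [A.d_zero _ _ hx]
  | succ a => exact hh _ _ (A.d_mem _ _ _ hx)

/-- A homotopy inverse in arity s, extended by zero to the other arities, is twisted into maps
between the compositions. Only elements of weight s matter, and on these the homotopy identities
carry over from the root. -/
theorem weightAcyclic_mapHom_left (φ : DGHom M M') (hN : N.Connected) (m s : ℕ)
    (hφ : φ.HasHomotopyInverse s) :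
    WeightAcyclic ((weightProj M N m s).prodMap (weightProj M' N m s))
      (coneD (CompositeModule.dHom M N m) (CompositeModule.dHom M' N m)
        (compose.mapHom φ.toGrHom (GrHom.id N) m)) := by
  obtain ⟨g, h, h', hg, hh, hh', hgd, hgf, hfg⟩ := hφ
  have hgf' : ∀ a, ∀ x ∈ M.gr s a, (g ∘ₗ φ.toFun s) x ∈ M.gr s a :=
    fun a x hx => hg _ _ (φ.map_mem _ _ _ hx)
  have hfg' : ∀ a, ∀ x ∈ M'.gr s a, (φ.toFun s ∘ₗ g) x ∈ M'.gr s a :=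
    fun a x hx => φ.map_mem _ _ _ (hg _ _ hx)
  refine weightAcyclic_of_homotopy _ _ (twistLeft (GrFam.single s h Nat.succ hh) hN m) _ _
    (twistLeft (GrFam.single s h' Nat.succ hh') hN m) _ (twistLeft (GrFam.single s g id hg) hN m)
    (weightProj_self s) (weightProj_self s) (weightProj_dHom s) (weightProj_dHom s)
    (weightProj_mapHom _ _ s) (fun z => (compose.map φ (DGHom.id N)).map_d m z)
    (fun z hz => dHom_twistLeft hN _ rfl s (by simpa [GrFam.single] using hgd) z hz) ?_ ?_
  · intro z hz
    rw [dHom_twistLeft_add hN _ (GrFam.single s _ id (M.homotopy_mem h hh)) rfl rfl s (by simp [GrFam.single])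
      z hz, twistLeft_mapHom hN φ.toGrHom _ (GrFam.single s _ id hgf'),
      twistLeft_sub_id hN _ (GrFam.single s _ id (M.homotopy_mem h hh)) rfl rfl s
        (by simpa [GrFam.single] using hgf) z hz]
    intro r x
    rcases eq_or_ne r s with rfl | hr
    · simp [GrFam.single]
    · simp [GrFam.single, Pi.single_eq_of_ne hr]
  · intro z hz
    rw [dHom_twistLeft_add hN _ (GrFam.single s _ id (M'.homotopy_mem h' hh')) rfl rfl s
      (by simp [GrFam.single]) z hz, mapHom_twistLeft hN _ φ.toGrHom (GrFam.single s _ id hfg'),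
      twistLeft_sub_id hN _ (GrFam.single s _ id (M'.homotopy_mem h' hh')) rfl rfl s
        (by simpa [GrFam.single] using hfg) z hz]
    intro r x
    rcases eq_or_ne r s with rfl | hr
    · simp [GrFam.single]
    · simp [GrFam.single, Pi.single_eq_of_ne hr]

end Homotopy


/-! ### Bounded below complexes of projective modules. -/

section Contraction

variable {K : Type u} [CommRing K]

theorem exists_projections_iSup {Z : Type*} [AddCommGroup Z] [Module K Z] (gr : ℕ → Submodule K Z)
    (h : DirectSum.IsInternal gr) {p : Z → Prop} (hmem : ∀ k, ∀ z ∈ gr k, p z) (h0 : p 0)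
    (hadd : ∀ x y, p x → p y → p (x + y)) (z : Z) : p z := by
  have : z ∈ ⨆ k, gr k := by rw [h.submodule_iSup_eq_top]; trivial
  exact Submodule.iSup_induction gr (motive := p) this hmem h0 hadd

/-- Gluing of a family of maps defined on the homogeneous components. -/
theorem exists_linearMap_of_graded {Z : Type v} [AddCommGroup Z] [Module K Z]
    (gr : ℕ → Submodule K Z) (h : DirectSum.IsInternal gr) (G : ℕ → Z →ₗ[K] Z) :
    ∃ H : Z →ₗ[K] Z, ∀ k, ∀ z ∈ gr k, H z = G k z := by
  let _ := h.chooseDecomposition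
  refine ⟨DirectSum.toModule K ℕ Z (fun k => G k ∘ₗ (gr k).subtype) ∘ₗ
    (DirectSum.decomposeLinearEquiv gr).toLinearMap, fun k z hz => ?_⟩
  rw [LinearMap.comp_apply, LinearEquiv.coe_coe, DirectSum.decomposeLinearEquiv_apply,
    DirectSum.decompose_of_mem gr hz]
  exact DirectSum.toModule_lof K k _

/-- A bounded below acyclic complex of projective modules is contractible. -/
theorem exists_contraction {Z : Type v} [AddCommGroup Z] [Module K Z] [Module.Projective K Z]
    (gr : ℕ → Submodule K Z) (h : DirectSum.IsInternal gr) (D : Z →ₗ[K] Z)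
    (hD : ∀ k, ∀ z ∈ gr (k + 1), D z ∈ gr k) (hD0 : ∀ z ∈ gr 0, D z = 0) (hDD : ∀ z, D (D z) = 0)
    (hac : ∀ z, D z = 0 → ∃ y, D y = z) :
    ∃ H : Z →ₗ[K] Z, (∀ k, ∀ z ∈ gr k, H z ∈ gr (k + 1)) ∧ ∀ z, D (H z) + H (D z) = z := by
  obtain ⟨p, hp, hp'⟩ := exists_projections gr h
  have hmem : ∀ k z, p k z ∈ gr k := fun k z => by
    refine exists_projections_iSup gr h (p := fun z => p k z ∈ gr k) (fun l z hz => ?_) (by simp)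
      (fun x y hx hy => by rw [map_add]; exact add_mem hx hy) z
    rcases eq_or_ne k l with rfl | hk
    · rwa [hp _ _ hz]
    · rw [hp' _ _ _ hz hk]; exact zero_mem _
  have hcomm : ∀ k z, D (p (k + 1) z) = p k (D z) := fun k z => by
    refine exists_projections_iSup gr h (p := fun z => D (p (k + 1) z) = p k (D z))
      (fun l z hz => ?_) (by simp)
      (fun x y hx hy => by rw [map_add, map_add, map_add, map_add, hx, hy]) z
    cases l with
    | zero => rw [hp' _ _ _ hz (by omega), hD0 z hz, map_zero, map_zero]
    | succ l =>
      rcases eq_or_ne k l with rfl | hk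
      · rw [hp _ _ hz, hp _ _ (hD _ _ hz)]
      · rw [hp' _ _ _ hz (by omega), hp' _ _ _ (hD _ _ hz) hk, map_zero]
  -- A map with values in cycles of degree k lifts through D restricted to degree k + 1, which maps
  -- onto its image. The lift is defined on all of Z, so projectivity of Z itself is enough and the
  -- homogeneous components need not be treated as projectives.
  have hlift : ∀ k (f : Z →ₗ[K] Z), (∀ z, f z ∈ gr k) → (∀ z, D (f z) = 0) →
      ∃ G : Z →ₗ[K] Z, (∀ z, G z ∈ gr (k + 1)) ∧ ∀ z, D (G z) = f z := by
    intro k f hf hf'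
    have h1 : ∀ z, f z ∈ (gr (k + 1)).map D := fun z => by
      obtain ⟨y, hy⟩ := hac (f z) (hf' z)
      exact ⟨p (k + 1) y, hmem _ _, by rw [hcomm, hy, hp _ _ (hf z)]⟩
    obtain ⟨ℓ, hℓ⟩ := Module.projective_lifting_property
      (D.submoduleMap (gr (k + 1))) (f.codRestrict _ h1) (D.submoduleMap_surjective _)
    refine ⟨(gr (k + 1)).subtype ∘ₗ ℓ, fun z => (ℓ z).2, fun z => ?_⟩
    exact congrArg Subtype.val (LinearMap.congr_fun hℓ z)
  -- The second clause says that z - G (D z) is a cycle for z in degree k + 1; this is the map to be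
  -- lifted in the next step.
  let Good (k : ℕ) (G : Z →ₗ[K] Z) : Prop :=
    (∀ z, G z ∈ gr (k + 1)) ∧ ∀ z ∈ gr (k + 1), D (G (D z)) = D z
  have base : ∃ G, Good 0 G ∧ ∀ z ∈ gr 0, D (G z) = z := by
    obtain ⟨G, hG, hG'⟩ := hlift 0 (p 0) (hmem 0) (fun z => hD0 _ (hmem 0 z))
    have : ∀ z ∈ gr 0, D (G z) = z := fun z hz => by rw [hG', hp _ _ hz]
    exact ⟨G, ⟨hG, fun z hz => this _ (hD _ _ hz)⟩, this⟩
  have step : ∀ k (G : { G // Good k G }), ∃ G' : { G // Good (k + 1) G },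
      ∀ z ∈ gr (k + 1), D (G'.1 z) = z - G.1 (D z) := by
    rintro k ⟨G, hG, hG'⟩
    obtain ⟨G', h1, h2⟩ := hlift (k + 1) ((LinearMap.id - G ∘ₗ D) ∘ₗ p (k + 1))
      (fun z => sub_mem (hmem _ _) (hG _)) (fun z => by
        rw [LinearMap.comp_apply, LinearMap.sub_apply, map_sub, LinearMap.comp_apply,
          hG' _ (hmem _ _), LinearMap.id_apply, sub_self])
    have h3 : ∀ z ∈ gr (k + 1), D (G' z) = z - G (D z) := fun z hz => by
      rw [h2, LinearMap.comp_apply, hp _ _ hz]; rfl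
    refine ⟨⟨G', h1, fun z hz => ?_⟩, h3⟩
    rw [h3 _ (hD _ _ hz), hDD, map_zero, sub_zero]
  obtain ⟨G₀, hG₀, hG₀'⟩ := base
  choose F hF using step
  let G : ∀ k, { G // Good k G } := fun k => Nat.rec ⟨G₀, hG₀⟩ (fun k G => F k G) k
  obtain ⟨H, hH⟩ := exists_linearMap_of_graded gr h fun k => (G k).1
  refine ⟨H, fun k z hz => ?_, fun z => ?_⟩
  · rw [hH k z hz]
    exact (G k).2.1 z
  · refine exists_projections_iSup gr h (p := fun z => D (H z) + H (D z) = z) (fun k z hz => ?_)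
      (by simp) (fun x y hx hy => ?_) z
    · cases k with
      | zero => rw [hD0 z hz, map_zero, add_zero, hH 0 z hz]; exact hG₀' z hz
      | succ k =>
        rw [hH _ z hz, hH k _ (hD _ _ hz)]
        have : D ((G (k + 1)).1 z) = z - (G k).1 (D z) := hF k (G k) z hz
        rw [this, sub_add_cancel]
    · rw [map_add, map_add, map_add, map_add, add_add_add_comm, hx, hy]

/-- A quasi-isomorphism between bounded below complexes of projective modules is a homotopy
equivalence. -/
theorem DGHom.hasHomotopyInverse {M : DGSymModule.{u, v} K} {M' : DGSymModule.{u, w} K}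
    (φ : DGHom M M') (s : ℕ) [Module.Projective K (M s)] [Module.Projective K (M' s)]
    (hφ : ConeAcyclic (M.d s) (M'.d s) (φ.toFun s)) : φ.HasHomotopyInverse s := by
  obtain ⟨p, hp, hp'⟩ := exists_projections (M.gr s) (M.isInternal s)
  obtain ⟨q, hq, hq'⟩ := exists_projections (M'.gr s) (M'.isInternal s)
  -- Degree k of the cone is M_{k-1} ⊕ M'_k, with nothing from M in degree 0.
  let g : ℕ → Submodule K (M s) := fun k => Nat.casesOn k ⊥ (M.gr s)
  let gr : ℕ → Submodule K (M s × M' s) := fun k => (g k).prod (M'.gr s k)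
  have hint : DirectSum.IsInternal gr := by
    refine isInternal_of_projections gr
      (fun k => (Nat.casesOn k 0 p : M s →ₗ[K] M s).prodMap (q k)) ?_ ?_ ?_
    · rintro (_ | k) ⟨x, x'⟩ ⟨hx, hx'⟩
      · have : x = 0 := hx
        exact Prod.ext (by simp [this]) (hq _ _ hx')
      · exact Prod.ext (hp _ _ hx) (hq _ _ hx')
    · rintro (_ | k) (_ | l) ⟨x, x'⟩ ⟨hx, hx'⟩ hl
      · exact absurd rfl hl
      · have : x = 0 := hx
        exact Prod.ext (by simp [this]) (hq' _ _ _ hx' hl)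
      · exact Prod.ext rfl (hq' _ _ _ hx' hl)
      · exact Prod.ext (hp' _ _ _ hx (by omega)) (hq' _ _ _ hx' hl)
    · rw [eq_top_iff]
      rintro ⟨x, x'⟩ -
      have h1 : ((x, 0) : M s × M' s) ∈ ⨆ k, gr k := by
        refine exists_projections_iSup _ (M.isInternal s)
          (p := fun x => ((x, 0) : M s × M' s) ∈ ⨆ k, gr k) (fun k x hx => ?_) (zero_mem _)
          (fun x y hx hy => ?_) x
        · exact (le_iSup gr (k + 1)) ⟨hx, zero_mem _⟩
        · simpa using add_mem hx hy
      have h2 : ((0, x') : M s × M' s) ∈ ⨆ k, gr k := by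
        refine exists_projections_iSup _ (M'.isInternal s)
          (p := fun x' => ((0, x') : M s × M' s) ∈ ⨆ k, gr k) (fun k x hx => ?_) (zero_mem _)
          (fun x y hx hy => ?_) x'
        · exact (le_iSup gr k) ⟨zero_mem _, hx⟩
        · simpa using add_mem hx hy
      simpa using add_mem h1 h2
  obtain ⟨H, hH, hH'⟩ := exists_contraction gr hint (coneD (M.d s) (M'.d s) (φ.toFun s))
    (by
      rintro (_ | k) ⟨x, x'⟩ ⟨hx, hx'⟩
      · exact ⟨M.d_zero _ _ hx, sub_mem (φ.map_mem _ _ _ hx) (M'.d_mem _ _ _ hx')⟩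
      · exact ⟨M.d_mem _ _ _ hx, sub_mem (φ.map_mem _ _ _ hx) (M'.d_mem _ _ _ hx')⟩)
    (by
      rintro ⟨x, x'⟩ ⟨hx, hx'⟩
      have hx0 : x = 0 := hx
      have hx1 : M'.d s x' = 0 := M'.d_zero _ _ hx'
      simp [hx0, hx1])
    (coneD_coneD (M.d_d s) (M'.d_d s) (φ.map_d s)) hφ
  -- The data are matrix entries of the contraction of the cone. The first diagonal entry gives g ∘
  -- φ = 1 - (d h₀ + h₀ d), hence the minus sign in the second witness.
  refine ⟨LinearMap.fst K _ _ ∘ₗ H ∘ₗ LinearMap.inr K _ _,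
    -(LinearMap.fst K _ _ ∘ₗ H ∘ₗ LinearMap.inl K _ _),
    LinearMap.snd K _ _ ∘ₗ H ∘ₗ LinearMap.inr K _ _, fun a x hx => ?_, fun a x hx => ?_,
    fun a x hx => ?_, fun x => ?_, fun x => ?_, fun x => ?_⟩
  · exact (hH a (0, x) ⟨zero_mem _, hx⟩).1
  · exact neg_mem (hH (a + 1) (x, 0) ⟨hx, zero_mem _⟩).1
  · exact (hH a (0, x) ⟨zero_mem _, hx⟩).2
  · have h1 := (Prod.ext_iff.1 (hH' (0, x))).1
    have h2 : H (0, - M'.d s x) = - H (0, M'.d s x) := by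
      rw [← map_neg H]; congr 1; simp
    simp [h2] at h1
    simpa [sub_eq_zero, add_neg_eq_zero] using h1
  · have h1 := (Prod.ext_iff.1 (hH' (x, 0))).1
    have h2 : H (M.d s x, φ.toFun s x) = H (M.d s x, 0) + H (0, φ.toFun s x) := by
      rw [← map_add]; simp
    simp [h2] at h1
    simp only [LinearMap.comp_apply, LinearMap.fst_apply, LinearMap.inr_apply, LinearMap.inl_apply,
      LinearMap.neg_apply, map_neg]
    nth_rewrite 2 [← h1]
    abel
  · have h1 := (Prod.ext_iff.1 (hH' (0, x))).2
    have h2 : H (0, - M'.d s x) = - H (0, M'.d s x) := by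
      rw [← map_neg H]; congr 1; simp
    simp [h2] at h1
    simp only [LinearMap.comp_apply, LinearMap.snd_apply, LinearMap.fst_apply, LinearMap.inr_apply]
    nth_rewrite 2 [← h1]
    abel

end Contraction


/-! ### The differential of a quasi-free right module, up to lower weight. -/

noncomputable section RightLeading

variable {K : Type u} [CommRing K] {P : DGOperad.{u, v} K}

open CompositeModule CompositeSymbol TripleSymbol

/-- The submodule generated by the composite elements of weight `< k`. -/
def lowerSpan (M : DGSymModule.{u, v₁} K) (N : DGSymModule.{u, v₂} K) (m k : ℕ) :
    Submodule K (CompositeModule M N m) :=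
  Submodule.span K {z | ∃ c : CompositeSymbol M N m, c.r < k ∧ z = CompositeModule.mk c}

theorem weightProj_of_mem_lowerSpan {M : DGSymModule.{u, v₁} K} {N : DGSymModule.{u, v₂} K}
    {m k j : ℕ} (hj : k ≤ j) {z : CompositeModule M N m} (hz : z ∈ lowerSpan M N m k) :
    weightProj M N m j z = 0 := by
  have : lowerSpan M N m k ≤ LinearMap.ker (weightProj M N m j) := by
    refine Submodule.span_le.2 ?_
    rintro _ ⟨c, hc, rfl⟩
    change weightProj M N m j (CompositeModule.mk c) = 0
    rw [weightProj_mk, if_neg (by omega)]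
  exact this hz

theorem unitRight_lexExp {A : DGSymModule.{u, v₁} K} {P : DGSymModule.{u, v₂} K}
    {R : DGSymModule.{u, v₃} K} {M : DGSymModule.{u, v₄} K} {m a : ℕ} (c : CompositeSymbol A R m)
    {x : M c.r} (hx : x ∈ M.gr c.r a) {o : P 1} (ho : o ∈ P.gr 1 0) :
    (c.expandLeft (unitRight hx ho)).lexExp (unitRight hx ho).e = 0 := by
  refine invExp_eq_zero _ _ _ fun p q h => ?_
  rw [finSigmaFinEquiv_lt_iff] at h
  rcases h with h | ⟨h, h'⟩
  · exact h
  · obtain ⟨i, k⟩ := p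
    obtain ⟨j, l⟩ := q
    have h1 := Subsingleton.elim (α := Fin 1) k l
    simp only at h h'
    subst h
    subst h1
    exact absurd h' (lt_irrefl _)

namespace DGRightModule.QuasiFree

variable {L : DGRightModule.{u, v, v₁} P} {M : DGSymModule.{u, v₂} K} (F : L.QuasiFree M)
  {N : DGSymModule.{u, v₃} K} (g : GrHom (compose P.toDGSymModule N) N) {m : ℕ}

theorem coord_ι {r a : ℕ} {x : M r} (hx : x ∈ M.gr r a) :
    F.coord.toFun r (F.ι.toFun r x) = CompositeModule.mk (unitRight hx P.one_mem) := by
  rw [← F.coord_ext r (CompositeModule.mk _)]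
  refine congrArg _ ((F.ext_mk _).trans ?_).symm
  exact L.action_one r a _ (F.ι.map_mem _ _ _ hx)

/-- In coordinates ι(x) is x(1,…,1), and substitution gives x(1(y_1),…,1(y_r)). So substitution is a
retraction onto M ∘ N, from which injectivity of M ∘ R → L ∘_P R will follow. -/
theorem leftSubst_mapHom_ι (hg : ∀ (n b : ℕ) (y : N n) (hy : y ∈ N.gr n b),
      g.toFun n (compose.mk (unitLeft P.one_mem hy)) = y) (z : CompositeModule M N m) :
    leftSubst F.coord g m (compose.mapHom F.ι (GrHom.id N) m z) = z := by
  refine LinearMap.congr_fun (f := leftSubst F.coord g m ∘ₗ compose.mapHom F.ι (GrHom.id N) m)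
    (g := LinearMap.id) (CompositeModule.hom_ext fun c => ?_) z
  rw [LinearMap.comp_apply, compose.mapHom_mk, leftSubst_mk, LinearMap.id_apply]
  refine (congrArg _ (F.coord_ι c.hx)).trans ?_
  rw [subst_mk, substSymbol, unitRight_lexExp, pow_zero, one_smul,
    evalRight_eq g _ c.n fun i => Equiv.uniqueSigma fun _ => Fin (c.n i)]
  have h1 : ((compose.mapSymbol F.ι (GrHom.id N) c).expandLeft
      (unitRight c.hx P.one_mem)).signExp = 0 :=
    Finset.sum_eq_zero fun i _ => Finset.sum_eq_zero fun j _ => by simp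
  rw [h1, pow_zero, one_smul]
  exact mk_eq_mk (fun _ => rfl) rfl (fun i => hg (c.n i) (c.b i) (c.y i) (c.hy i))

variable {X : Type*} [AddCommGroup X] [Module K X]

/-- The map `M ∘ N → L ∘ N → X`. -/
def lead (f : CompositeModule L.toDGSymModule N m →ₗ[K] X) : CompositeModule M N m →ₗ[K] X :=
  f ∘ₗ compose.mapHom F.ι (GrHom.id N) m

theorem lead_mk (f : CompositeModule L.toDGSymModule N m →ₗ[K] X) (c : CompositeSymbol M N m) :
    F.lead f (CompositeModule.mk c)
      = f (CompositeModule.mk (compose.mapSymbol F.ι (GrHom.id N) c)) :=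
  congrArg f (compose.mapHom_mk _ _ _)

/-- The terms of lower weight for a perturbation of the root by a decomposable element. -/
theorem lead_perturbation (f : CompositeModule L.toDGSymModule N m →ₗ[K] X)
    (hf : ∀ t : TripleSymbol L.toDGSymModule P.toDGSymModule N m,
      f (t.evalLeft L.action.toGrHom) = f (t.evalRight g))
    (c : CompositeSymbol M N m) {a : ℕ} {x : L.carrier c.r} (hx : x ∈ L.gr c.r a)
    (h : x - F.ι.toFun _ c.x ∈ Submodule.span K
      {z | ∃ d : CompositeSymbol M P.toDGSymModule c.r, d.r < c.r ∧
        z = L.extend F.ι c.r (compose.mk d)}) :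
    ∃ z ∈ lowerSpan M N m c.r, f (CompositeModule.mk { compose.mapSymbol F.ι (GrHom.id N) c with
      a := a, x := x, hx := hx }) = F.lead f (CompositeModule.mk c + z) := by
  set C : CompositeSymbol L.toDGSymModule N m := { compose.mapSymbol F.ι (GrHom.id N) c with
      a := a, x := x, hx := hx } with hC
  refine ⟨CompositeSymbol.subst g C (F.coord.toFun _ (x - F.ι.toFun _ c.x)), ?_, ?_⟩
  -- Substitution keeps the root of the composite element d, hence its weight, so decomposable
  -- perturbations of the root stay in weight < `c.r`.
  · refine Submodule.span_induction (p := fun y _ => CompositeSymbol.subst g C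
      (F.coord.toFun _ y) ∈ lowerSpan M N m c.r) ?_ ?_ ?_ ?_ h
    · rintro _ ⟨d, hd, rfl⟩
      have h1 : F.coord.toFun _ (L.extend F.ι c.r (compose.mk d)) = CompositeModule.mk d :=
        F.coord_ext _ _
      rw [h1]
      have h2 := subst_mk (M := M) g C d
      rw [h2, substSymbol, evalRight]
      exact Submodule.smul_mem _ _ (Submodule.smul_mem _ _ (Submodule.subset_span ⟨_, hd, rfl⟩))
    · rw [map_zero, map_zero]; exact zero_mem _
    · intro y y' _ _ hy hy'
      rw [map_add, map_add]; exact add_mem hy hy'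
    · intro t y _ hy
      rw [map_smul, map_smul]; exact Submodule.smul_mem _ _ hy
  · have h1 : CompositeSymbol.subst g C (F.coord.toFun _ (F.ι.toFun _ c.x))
        = leftSubst F.coord g m (CompositeModule.mk (compose.mapSymbol F.ι (GrHom.id N) c)) :=
      (leftSubst_mk F.coord g (compose.mapSymbol F.ι (GrHom.id N) c)).symm
    rw [map_sub, map_sub, h1, map_add, map_sub, lead_mk]
    have h2 := F.map_leftSubst g f hf (CompositeModule.mk (compose.mapSymbol F.ι (GrHom.id N) c))
    have h3 := F.map_leftSubst g f hf (CompositeModule.mk C)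
    rw [leftSubst_mk] at h3
    refine h3.symm.trans ?_
    refine Eq.trans ?_ (add_sub_cancel _ _).symm |>.trans (congrArg (_ + ·) (congrArg (_ - ·) h2.symm))
    rfl

/-- Only the root is perturbed, because the factors carry the honest differential of N. The target X
is left abstract so that this covers both L itself, with N = P, and L ∘_P R. -/
theorem lead_d (f : CompositeModule L.toDGSymModule N m →ₗ[K] X)
    (hf : ∀ t : TripleSymbol L.toDGSymModule P.toDGSymModule N m,
      f (t.evalLeft L.action.toGrHom) = f (t.evalRight g)) (d : X →ₗ[K] X)
    (hd : ∀ z, d (f z) = f (dHom L.toDGSymModule N m z)) (c : CompositeSymbol M N m) :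
    ∃ z ∈ lowerSpan M N m c.r,
      d (F.lead f (CompositeModule.mk c)) = F.lead f (dHom M N m (CompositeModule.mk c) + z) := by
  obtain ⟨z, hz, h⟩ := F.lead_perturbation g f hf c.dLeft
    (L.d_mem_pred _ _ _ (F.ι.map_mem _ _ _ c.hx)) (F.decomposable c.r c.x)
  refine ⟨z, hz, ?_⟩
  rw [lead_mk, hd, dHom_mk, dHom_mk, dMk, dMk, map_add, map_sum, add_right_comm, map_add, ← h,
    map_sum]
  refine congrArg₂ (· + ·) rfl (Finset.sum_congr rfl fun i _ => ?_)
  rw [map_smul, map_smul, lead_mk]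
  refine congrArg (_ • f ·) (mk_eq_mk (fun _ => rfl) rfl fun j => ?_)
  rcases eq_or_ne j i with rfl | hj
  · simp [GrHom.id]
  · simp [GrHom.id, hj]

end DGRightModule.QuasiFree

end RightLeading


/-! ### The augmentation of a connected operad and the counit M ∘ P → M. -/

noncomputable section Counit

variable {K : Type u} [CommRing K]

open CompositeModule CompositeSymbol TripleSymbol

section Tr

variable (M : DGSymModule.{u, v} K) {n n' n'' : ℕ}

theorem DGSymModule.tr_mem (τ : Fin n ≃ Fin n') {a : ℕ} {x : M n} (hx : x ∈ M.gr n a) :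
    M.tr τ x ∈ M.gr n' a := by
  obtain rfl : n = n' := by simpa using Fintype.card_congr τ
  exact M.rep_mem _ _ _ _ hx

theorem DGSymModule.tr_d (τ : Fin n ≃ Fin n') (x : M n) : M.tr τ (M.d n x) = M.d n' (M.tr τ x) := by
  obtain rfl : n = n' := by simpa using Fintype.card_congr τ
  exact (M.d_rep _ _ _).symm

theorem DGSymModule.tr_trans (τ : Fin n ≃ Fin n') (τ' : Fin n' ≃ Fin n'') (x : M n) :
    M.tr (τ.trans τ') x = M.tr τ' (M.tr τ x) := by
  obtain rfl : n = n' := by simpa using Fintype.card_congr τ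
  obtain rfl : n = n'' := by simpa using Fintype.card_congr τ'
  rw [tr_perm, tr_perm, tr_perm, ← Module.End.mul_apply, ← map_mul]
  rfl

theorem DGSymModule.tr_refl (τ : Fin n ≃ Fin n) (hτ : ∀ i, τ i = i) (x : M n) : M.tr τ x = x := by
  obtain rfl : τ = 1 := Equiv.ext hτ
  rw [tr_perm, map_one]; rfl

theorem GrHom.map_tr {M : DGSymModule.{u, v} K} {N : DGSymModule.{u, w} K} (f : GrHom M N)
    (τ : Fin n ≃ Fin n') (x : M n) : f.toFun n' (M.tr τ x) = N.tr τ (f.toFun n x) := by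
  obtain rfl : n = n' := by simpa using Fintype.card_congr τ
  exact f.map_rep _ _ _

end Tr

section Augmentation

variable {P : DGOperad.{u, v} K} (hP : P.IsConnected)

/-- The augmentation of a connected operad. -/
def DGOperad.aug (n : ℕ) : P.carrier n →ₗ[K] K :=
  Pi.single (M := fun n => P.carrier n →ₗ[K] K) 1
    (LinearEquiv.ofBijective (LinearMap.toSpanSingleton K _ P.one) hP.2).symm.toLinearMap n

theorem DGOperad.aug_smul_one (y : P.carrier 1) : P.aug hP 1 y • P.one = y := by
  rw [DGOperad.aug, Pi.single_eq_same]
  exact (LinearEquiv.ofBijective (LinearMap.toSpanSingleton K _ P.one) hP.2).apply_symm_apply y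

theorem DGOperad.aug_one : P.aug hP 1 P.one = 1 := by
  apply hP.2.1
  simp only [P.aug_smul_one hP, one_smul]

theorem DGOperad.aug_of_ne {n : ℕ} (hn : n ≠ 1) (y : P.carrier n) : P.aug hP n y = 0 := by
  rw [DGOperad.aug, Pi.single_eq_of_ne hn]; rfl

theorem DGOperad.aug_rep (n : ℕ) (σ : Equiv.Perm (Fin n)) (y : P.carrier n) :
    P.aug hP n (P.rep n σ y) = P.aug hP n y := by
  by_cases hn : n = 1
  · subst hn
    obtain rfl := Subsingleton.elim σ 1
    rw [map_one]; rfl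
  · rw [P.aug_of_ne hP hn, P.aug_of_ne hP hn]

theorem DGOperad.aug_of_mem {n b : ℕ} (hb : b ≠ 0) {y : P.carrier n} (hy : y ∈ P.gr n b) :
    P.aug hP n y = 0 := by
  by_cases hn : n = 1
  · subst hn
    have : y ∈ P.gr 1 0 := by
      rw [← P.aug_smul_one hP y]
      exact Submodule.smul_mem _ _ P.one_mem
    rw [P.eq_zero_of_mem_gr hy this hb, map_zero]
  · exact P.aug_of_ne hP hn _

theorem DGOperad.aug_d (n : ℕ) (y : P.carrier n) : P.aug hP n (P.d n y) = 0 := by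
  by_cases hn : n = 1
  · subst hn
    rw [← P.aug_smul_one hP y, map_smul, P.d_zero _ _ P.one_mem, smul_zero, map_zero]
  · exact P.aug_of_ne hP hn _

end Augmentation

/-- The enumeration of blocks with one element. -/
def onesEquiv {r : ℕ} (n : Fin r → ℕ) (h : ∀ i, n i = 1) : Fin r ≃ Σ i, Fin (n i) where
  toFun i := ⟨i, ⟨0, by rw [h]; exact Nat.one_pos⟩⟩
  invFun p := p.1
  left_inv _ := rfl
  right_inv := by
    rintro ⟨i, k⟩
    have : Subsingleton (Fin (n i)) := by rw [h]; infer_instance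
    exact congrArg _ (Subsingleton.elim _ _)

variable {P : DGOperad.{u, v} K} (hP : P.IsConnected) {M : DGSymModule.{u, v₁} K} {m : ℕ}

open Classical in
/-- The value of the counit `M ∘ P → M` on a composite element. -/
def counitSymbol (c : CompositeSymbol M P.toDGSymModule m) : M m :=
  if h : ∀ i, c.n i = 1 then
    (∏ i, P.aug hP _ (c.y i)) • M.tr ((onesEquiv c.n h).trans c.e) c.x else 0

theorem prod_lin {r : ℕ} (f g h : Fin r → K) (i : Fin r) (α β : K) (hi : f i = α * g i + β * h i)
    (hg : ∀ j, j ≠ i → g j = f j) (hh : ∀ j, j ≠ i → h j = f j) :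
    ∏ j, f j = α * ∏ j, g j + β * ∏ j, h j := by
  rw [Fintype.prod_eq_mul_prod_compl i, Fintype.prod_eq_mul_prod_compl i g,
    Fintype.prod_eq_mul_prod_compl i h, hi]
  have h1 : ∏ j ∈ {i}ᶜ, g j = ∏ j ∈ {i}ᶜ, f j :=
    Finset.prod_congr rfl fun j hj => hg j (by simpa using hj)
  have h2 : ∏ j ∈ {i}ᶜ, h j = ∏ j ∈ {i}ᶜ, f j :=
    Finset.prod_congr rfl fun j hj => hh j (by simpa using hj)
  rw [h1, h2]
  ring

theorem counitSymbol_respects :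
    CompositeSymbol.Respects (counitSymbol hP : CompositeSymbol M P.toDGSymModule m → M m) where
  lin_left c α β x' x'' hx' hx'' h := by
    simp only [counitSymbol]
    split_ifs with hn
    · rw [h, map_add, map_smul, map_smul, smul_add, smul_comm _ α, smul_comm _ β]
    · simp
  lin_right c i α β y' y'' hy' hy'' h h' h'' := by
    simp only [counitSymbol]
    split_ifs with hn
    · rw [prod_lin (fun j => P.aug hP _ (c.y j)) (fun j => P.aug hP _ (y' j))
        (fun j => P.aug hP _ (y'' j)) i α β (by simp [h]) (fun j hj => by rw [h' j hj])
        (fun j hj => by rw [h'' j hj]), add_smul, mul_smul, mul_smul]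
    · simp
  inner c σ := by
    simp only [counitSymbol]
    split_ifs with hn
    · simp only [P.aug_rep hP]
      congr 2
      refine congrArg M.tr (Equiv.ext fun i => ?_)
      refine congrArg c.e ?_
      have : Subsingleton (Fin (c.n i)) := by rw [hn]; infer_instance
      exact congrArg (Sigma.mk i) (Subsingleton.elim _ _)
    · rfl
  outer c s := by
    simp only [counitSymbol]
    by_cases hn : ∀ i, c.n i = 1
    · have hn' : ∀ i, c.n (s i) = 1 := fun i => hn _
      rw [dif_pos hn, dif_pos hn']
      rw [Equiv.prod_comp s fun i => P.aug hP _ (c.y i)]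
      -- If all factors have degree 0 the Koszul sign is trivial; otherwise the augmentation of some
      -- factor vanishes, and with it both sides.
      by_cases hb : ∀ i, c.b i = 0
      · rw [koszulExp_eq_zero s c.b hb, pow_zero, one_smul]
        congr 1
        exact (M.tr_trans s ((onesEquiv c.n hn).trans c.e) c.x).symm
      · push Not at hb
        obtain ⟨i, hi⟩ := hb
        rw [Finset.prod_eq_zero (Finset.mem_univ i) (P.aug_of_mem hP hi (c.hy i)), zero_smul,
          zero_smul, smul_zero]
    · have hn' : ¬ ∀ i, c.n (s i) = 1 := fun h => hn fun i => by
        have := h (s.symm i)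
        rwa [Equiv.apply_symm_apply] at this
      rw [dif_neg hn, dif_neg hn', smul_zero]

/-- The counit `M ∘ P → M`. -/
def counitHom (M : DGSymModule.{u, v₁} K) (m : ℕ) : CompositeModule M P.toDGSymModule m →ₗ[K] M m :=
  CompositeModule.lift _ (counitSymbol_respects hP).rel

theorem counitHom_mk (c : CompositeSymbol M P.toDGSymModule m) :
    counitHom hP M m (CompositeModule.mk c) = counitSymbol hP c := CompositeModule.lift_mk _ _ _

/-- The counit `M ∘ P → M`. -/
def counit (M : DGSymModule.{u, v₁} K) : DGHom (compose M P.toDGSymModule) M where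
  toFun := counitHom hP M
  map_mem m k z hz := by
    induction hz using Submodule.span_induction with
    | mem z h =>
      obtain ⟨c, rfl, rfl⟩ := h
      rw [counitHom_mk, counitSymbol]
      split_ifs with hn
      · by_cases hb : ∀ i, c.b i = 0
        · have : c.deg = c.a := by simp [CompositeSymbol.deg, hb]
          rw [this]
          exact Submodule.smul_mem _ _ (M.tr_mem _ c.hx)
        · push Not at hb
          obtain ⟨i, hi⟩ := hb
          rw [Finset.prod_eq_zero (Finset.mem_univ i) (P.aug_of_mem hP hi (c.hy i)), zero_smul]
          exact zero_mem _
      · exact zero_mem _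
    | zero => rw [map_zero]; exact zero_mem _
    | add x y _ _ hx hy => rw [map_add]; exact add_mem hx hy
    | smul t x _ hx => rw [map_smul]; exact Submodule.smul_mem _ _ hx
  map_rep m s z := by
    refine LinearMap.congr_fun (f := counitHom hP M m ∘ₗ CompositeModule.repHom s)
      (g := M.rep m s ∘ₗ counitHom hP M m) (CompositeModule.hom_ext fun c => ?_) z
    rw [LinearMap.comp_apply, LinearMap.comp_apply, repHom_mk, counitHom_mk, counitHom_mk,
      counitSymbol, counitSymbol]
    split_ifs with hn
    · rw [map_smul]
      congr 1
      exact M.tr_trans ((onesEquiv c.n hn).trans c.e) s c.x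
    · rw [map_zero]
  map_d m z := by
    refine LinearMap.congr_fun (f := counitHom hP M m ∘ₗ dHom M P.toDGSymModule m)
      (g := M.d m ∘ₗ counitHom hP M m) (CompositeModule.hom_ext fun c => ?_) z
    rw [LinearMap.comp_apply, LinearMap.comp_apply, dHom_mk, dMk, map_add, map_sum, counitHom_mk,
      counitHom_mk, Finset.sum_eq_zero, add_zero, counitSymbol, counitSymbol]
    · split_ifs with hn
      · rw [map_smul]
        exact congrArg _ (M.tr_d _ _)
      · rw [map_zero]
    · intro i _
      rw [map_smul, counitHom_mk, counitSymbol]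
      split_ifs with hn
      · rw [Finset.prod_eq_zero (Finset.mem_univ i), zero_smul, smul_zero]
        exact (congrArg (P.aug hP _) (Function.update_self (f := c.y) i _)).trans (P.aug_d hP _ _)
      · rw [smul_zero]

theorem counitHom_mk_of_ne (c : CompositeSymbol M P.toDGSymModule m) (h : c.r ≠ m) :
    counitHom hP M m (CompositeModule.mk c) = 0 := by
  rw [counitHom_mk, counitSymbol, dif_neg]
  intro hn
  refine h ?_
  simpa using Fintype.card_congr ((onesEquiv c.n hn).trans c.e)

theorem counitHom_of_mem_lowerSpan {k : ℕ} (hk : k ≤ m) {z : CompositeModule M P.toDGSymModule m}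
    (hz : z ∈ lowerSpan M P.toDGSymModule m k) : counitHom hP M m z = 0 := by
  have : lowerSpan M P.toDGSymModule m k ≤ LinearMap.ker (counitHom hP M m) := by
    refine Submodule.span_le.2 ?_
    rintro _ ⟨c, hc, rfl⟩
    exact counitHom_mk_of_ne hP c (by omega)
  exact this hz

theorem counitHom_unitRight {a : ℕ} {x : M m} (hx : x ∈ M.gr m a) :
    counitHom hP M m (CompositeModule.mk (unitRight hx P.one_mem)) = x := by
  rw [counitHom_mk, counitSymbol, dif_pos fun _ => rfl]
  simp only [P.aug_one hP, Finset.prod_const_one, one_smul]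
  exact M.tr_refl _ (fun _ => rfl) _

variable {L : DGRightModule.{u, v, v₂} P} (F : L.QuasiFree M)

include hP in
/-- Indecomposability of the generators. -/
theorem DGRightModule.QuasiFree.ext_sub_ι_counit (z : CompositeModule M P.toDGSymModule m) :
    F.ext.toFun m z - F.ι.toFun m (counitHom hP M m z) ∈ Submodule.span K
      {z | ∃ d : CompositeSymbol M P.toDGSymModule m, d.r < m ∧
        z = L.extend F.ι m (compose.mk d)} := by
  set S := Submodule.span K {z | ∃ d : CompositeSymbol M P.toDGSymModule m, d.r < m ∧
        z = L.extend F.ι m (compose.mk d)} with hS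
  suffices H : S.mkQ ∘ₗ (F.ext.toFun m - F.ι.toFun m ∘ₗ counitHom hP M m) = 0 by
    exact (Submodule.Quotient.mk_eq_zero S).1 (LinearMap.congr_fun H z)
  refine CompositeModule.hom_ext fun c => (Submodule.Quotient.mk_eq_zero S).2 ?_
  change F.ext.toFun m (CompositeModule.mk c)
    - F.ι.toFun m (counitHom hP M m (CompositeModule.mk c)) ∈ S
  by_cases hr : c.r < m
  · rw [counitHom_mk_of_ne hP c hr.ne, map_zero, sub_zero]
    exact Submodule.subset_span ⟨c, hr, rfl⟩
  by_cases h0 : CompositeModule.mk c = 0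
  · rw [h0]; simp
  -- A nonzero composite with at least m nonempty blocks on m labels has all its blocks of size one;
  -- its factors are then multiples of the unit.
  have hn : ∀ i, c.n i = 1 := by
    have h1 : ∀ i, c.n i ≠ 0 := fun i hi => h0 (mk_eq_zero_of_n (N := P.toDGSymModule) hP.1 c hi)
    have h2 := Fintype.card_congr c.e
    simp only [Fintype.card_sigma, Fintype.card_fin] at h2
    intro i
    by_contra hi
    have h3 : ∑ i : Fin c.r, 1 < ∑ i, c.n i :=
      Finset.sum_lt_sum (fun i _ => Nat.one_le_iff_ne_zero.2 (h1 i))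
        ⟨i, Finset.mem_univ _, by have := h1 i; omega⟩
    simp at h3
    omega
  have hb : ∀ i, c.b i = 0 := by
    intro i
    by_contra hi
    refine h0 (mk_eq_zero_of_right c i ?_)
    have hy := c.hy i
    generalize c.y i = y at hy
    have := hn i
    generalize c.n i = n at y hy this
    subst this
    rw [← P.aug_smul_one hP y, P.aug_of_mem hP hi hy, zero_smul]
  obtain ⟨r, n, e, a, x, hx, b, y, hy⟩ := c
  obtain rfl : n = fun _ => 1 := funext hn
  obtain rfl : b = fun _ => 0 := funext hb
  rw [mk_smul_right_all _ (fun i => P.aug hP _ (y i)) (fun _ => P.one) (fun _ => P.one_mem)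
    (fun i => (P.aug_smul_one hP _).symm), map_smul, map_smul, map_smul, ← smul_sub]
  refine Submodule.smul_mem _ _ ?_
  set τ : Fin r ≃ Fin m := (onesEquiv (fun _ => 1) hn).trans e with hτ
  have h1 : (F.ext.toFun m) (CompositeModule.mk ⟨r, fun _ => 1, e, a, x, hx, fun _ => 0,
      fun _ => P.one, fun _ => P.one_mem⟩) = L.tr τ (F.ι.toFun r x) := by
    have h2 := L.action_one r a _ (F.ι.map_mem _ _ _ hx)
    rw [← h2, L.action.tr_mk]
    refine (F.ext_mk _).trans (congrArg (L.action.toFun m) ?_)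
    refine mk_eq_mk (fun p => ?_) rfl (fun _ => rfl)
    exact congrArg e ((onesEquiv (fun _ => 1) hn).apply_symm_apply p).symm
  have h2 : counitHom hP M m (CompositeModule.mk ⟨r, fun _ => 1, e, a, x, hx, fun _ => 0,
      fun _ => P.one, fun _ => P.one_mem⟩) = M.tr τ x := by
    rw [counitHom_mk, counitSymbol, dif_pos hn]
    simp only [P.aug_one hP, Finset.prod_const_one, one_smul]
    rfl
  refine (congrArg₂ (· - ·) h1 ((congrArg _ h2).trans (F.ι.map_tr τ x))).symm ▸ ?_
  rw [sub_self]
  exact zero_mem _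

end Counit


/-! ### Perturbed cones, conjugation and retracts. -/

section ConePerturbation

variable {K : Type*} [CommRing K]

/-- A finite grading by weights, given by the projections `p`. -/
structure WeightGrading {Z : Type*} [AddCommGroup Z] [Module K Z] (p : ℕ → Z →ₗ[K] Z) (N : ℕ) :
    Prop where
  proj_self : ∀ k z, p k (p k z) = p k z
  proj_ne : ∀ j k z, j ≠ k → p j (p k z) = 0
  sum_proj : ∀ z, ∑ k ∈ Finset.range N, p k z = z

variable {C C' X X' : Type*} [AddCommGroup C] [Module K C] [AddCommGroup C'] [Module K C']
  [AddCommGroup X] [Module K X] [AddCommGroup X'] [Module K X']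

theorem WeightGrading.cone {p : ℕ → C →ₗ[K] C} {p' : ℕ → C' →ₗ[K] C'} {N : ℕ}
    (hp : WeightGrading p N) (hp' : WeightGrading p' N) {d₀ d : C →ₗ[K] C} {d₀' d' : C' →ₗ[K] C'}
    {F₀ F : C →ₗ[K] C'} (hd₀ : ∀ k z, p k (d₀ z) = d₀ (p k z))
    (hd₀' : ∀ k z, p' k (d₀' z) = d₀' (p' k z)) (hF₀ : ∀ k z, p' k (F₀ z) = F₀ (p k z))
    (hd : ∀ j k z, k ≤ j → p j (d (p k z)) = p j (d₀ (p k z)))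
    (hd' : ∀ j k z, k ≤ j → p' j (d' (p' k z)) = p' j (d₀' (p' k z)))
    (hF : ∀ j k z, k ≤ j → p' j (F (p k z)) = p' j (F₀ (p k z)))
    (hdd : ∀ z, d (d z) = 0) (hdd' : ∀ z, d' (d' z) = 0) (hFd : ∀ z, F (d z) = d' (F z)) :
    WeightPerturbation (fun k => (p k).prodMap (p' k)) N (coneD d₀ d₀' F₀) (coneD d d' F) where
  proj_self k z := Prod.ext (hp.proj_self k z.1) (hp'.proj_self k z.2)
  proj_ne j k z h := Prod.ext (hp.proj_ne j k z.1 h) (hp'.proj_ne j k z.2 h)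
  sum_proj z := by
    refine Prod.ext ?_ ?_
    · rw [Prod.fst_sum]; exact hp.sum_proj z.1
    · rw [Prod.snd_sum]; exact hp'.sum_proj z.2
  comm k z := by simp [hd₀, hd₀', hF₀]
  lower j k z h := by simp [hd j k z.1 h, hd' j k z.2 h, hF j k z.1 h]
  sq := coneD_coneD hdd hdd' hFd

theorem coneAcyclic_conj (e : C ≃ₗ[K] X) (e' : C' ≃ₗ[K] X') {d : X →ₗ[K] X} {d' : X' →ₗ[K] X'}
    {F : X →ₗ[K] X'} : ConeAcyclic (e.symm ∘ₗ d ∘ₗ e : C →ₗ[K] C)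
      (e'.symm ∘ₗ d' ∘ₗ e' : C' →ₗ[K] C') (e'.symm ∘ₗ F ∘ₗ e : C →ₗ[K] C') ↔ ConeAcyclic d d' F := by
  have h : ∀ z : C × C', e.prodCongr e' (coneD (e.symm ∘ₗ d ∘ₗ e : C →ₗ[K] C)
      (e'.symm ∘ₗ d' ∘ₗ e' : C' →ₗ[K] C') (e'.symm ∘ₗ F ∘ₗ e : C →ₗ[K] C') z)
      = coneD d d' F (e.prodCongr e' z) := fun z => by simp
  constructor
  · intro H z hz
    obtain ⟨y, hy⟩ := H ((e.prodCongr e').symm z) ((e.prodCongr e').injective (by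
      rw [h, LinearEquiv.apply_symm_apply, hz, map_zero]))
    exact ⟨e.prodCongr e' y, by rw [← h, hy, LinearEquiv.apply_symm_apply]⟩
  · intro H z hz
    obtain ⟨y, hy⟩ := H (e.prodCongr e' z) (by rw [← h, hz, map_zero])
    exact ⟨(e.prodCongr e').symm y, (e.prodCongr e').injective (by
      rw [h, LinearEquiv.apply_symm_apply, hy])⟩

/-- A retract of an acyclic weight component is acyclic. -/
theorem WeightAcyclic.retract {p d : C →ₗ[K] C} {p' d' : C' →ₗ[K] C'} {F : C →ₗ[K] C'}
    (H : WeightAcyclic (p.prodMap p') (coneD d d' F)) {δ : X →ₗ[K] X} {δ' : X' →ₗ[K] X'}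
    {f : X →ₗ[K] X'} (u : X →ₗ[K] C) (u' : X' →ₗ[K] C') (ε : C →ₗ[K] X) (ε' : C' →ₗ[K] X')
    (hu : ∀ x, p (u x) = u x) (hu' : ∀ x, p' (u' x) = u' x) (hud : ∀ x, d (u x) = u (δ x))
    (hud' : ∀ x, d' (u' x) = u' (δ' x)) (huF : ∀ x, F (u x) = u' (f x))
    (hε : ∀ x, ε (u x) = x) (hε' : ∀ x, ε' (u' x) = x)
    (hεd : ∀ z, ε (d z) = δ (ε z)) (hεd' : ∀ z, ε' (d' z) = δ' (ε' z))
    (hεF : ∀ z, ε' (F z) = f (ε z)) : ConeAcyclic δ δ' f := by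
  rintro ⟨x, x'⟩ hx
  simp only [coneD_apply, Prod.mk_eq_zero, sub_eq_zero] at hx
  obtain ⟨⟨y, y'⟩, -, hy⟩ := H (u x, u' x') (by simp [hu, hu'])
    (by simp [hud, hud', huF, hx.1, hx.2])
  simp only [coneD_apply, Prod.mk.injEq] at hy
  refine ⟨(ε y, ε' y'), ?_⟩
  simp only [coneD_apply, Prod.mk.injEq]
  rw [← hεd, ← hεd', ← hεF, ← map_sub, hy.1, hy.2]
  exact ⟨hε x, hε' x'⟩

end ConePerturbation

/-! ### The morphism induced on indecomposables of quasi-free right modules. -/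

noncomputable section RightComparison

variable {K : Type u} [CommRing K] {P : DGOperad.{u, v} K}

open CompositeModule CompositeSymbol TripleSymbol

theorem DGSymModule.hom_ext_of_mem (M : DGSymModule.{u, v} K) {r : ℕ} {X : Type*} [AddCommGroup X]
    [Module K X] {f g : M r →ₗ[K] X} (h : ∀ a, ∀ x ∈ M.gr r a, f x = g x) : f = g := by
  rw [← sub_eq_zero, ← LinearMap.ker_eq_top, eq_top_iff, ← (M.isInternal r).submodule_iSup_eq_top]
  refine iSup_le fun a x hx => ?_
  rw [LinearMap.mem_ker, LinearMap.sub_apply, h a x hx, sub_self]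

theorem weightGrading_weightProj (M : DGSymModule.{u, v₁} K) {N : DGSymModule.{u, v₂} K}
    (hN : N.Connected) (m : ℕ) : WeightGrading (weightProj M N m) (m + 1) :=
  ⟨weightProj_self, fun _ _ z h => weightProj_ne h z, sum_weightProj hN⟩

/-- Turns a statement on generators, that T and T₀ agree modulo lower weight, into the form required
by `WeightPerturbation`. -/
theorem weightProj_congr_of_lower {M : DGSymModule.{u, v₁} K} {N : DGSymModule.{u, v₂} K}
    {M' : DGSymModule.{u, v₃} K} {N' : DGSymModule.{u, v₄} K} {m : ℕ}
    {T T₀ : CompositeModule M N m →ₗ[K] CompositeModule M' N' m}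
    (h : ∀ c, ∃ z ∈ lowerSpan M' N' m c.r, T (CompositeModule.mk c) = T₀ (CompositeModule.mk c) + z)
    (j k : ℕ) (z : CompositeModule M N m) (hk : k ≤ j) :
    weightProj M' N' m j (T (weightProj M N m k z))
      = weightProj M' N' m j (T₀ (weightProj M N m k z)) := by
  refine LinearMap.congr_fun (f := weightProj M' N' m j ∘ₗ T ∘ₗ weightProj M N m k)
    (g := weightProj M' N' m j ∘ₗ T₀ ∘ₗ weightProj M N m k) (CompositeModule.hom_ext fun c => ?_) z
  simp only [LinearMap.comp_apply, weightProj_mk]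
  split_ifs with hc
  · obtain ⟨z, hz, e⟩ := h c
    rw [e, map_add, weightProj_of_mem_lowerSpan (hc.le.trans hk) hz, add_zero]
  · simp only [map_zero]

/-- As Q(0) = 0, a composite in (M ∘ Q)(r) has weight at most r, so substituting for a root of arity
r never raises the weight. -/
theorem subst_mem_lowerSpan {A : DGSymModule.{u, v₁} K} {Q : DGSymModule.{u, v₂} K}
    {N : DGSymModule.{u, v₃} K} {M : DGSymModule.{u, v₄} K} (hQ : Q.Connected)
    (g : GrHom (compose Q N) N) {m : ℕ} (c : CompositeSymbol A N m) (z : CompositeModule M Q c.r) :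
    (CompositeSymbol.subst g c z : CompositeModule M N m) ∈ lowerSpan M N m (c.r + 1) := by
  have : (⊤ : Submodule K (CompositeModule M Q c.r))
      ≤ (lowerSpan M N m (c.r + 1)).comap (CompositeSymbol.subst g c) := by
    rw [← span_mk, Submodule.span_le]
    rintro _ ⟨d, rfl⟩
    change (CompositeSymbol.subst g c (CompositeModule.mk d) : CompositeModule M N m)
      ∈ lowerSpan M N m (c.r + 1)
    rcases lt_or_ge c.r d.r with h | h
    · rw [mk_eq_zero_of_lt hQ d h, map_zero]; exact zero_mem _
    · rw [subst_mk, substSymbol, evalRight]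
      exact Submodule.smul_mem _ _ (Submodule.smul_mem _ _
        (Submodule.subset_span ⟨_, Nat.lt_succ_of_le h, rfl⟩))
  exact this trivial

namespace DGRightModule.QuasiFree

variable {L : DGRightModule.{u, v, v₁} P} {M : DGSymModule.{u, v₂} K} (F : L.QuasiFree M)
  {L' : DGRightModule.{u, v, v₃} P} {M' : DGSymModule.{u, v₄} K} (F' : L'.QuasiFree M')
  (hP : P.IsConnected)

include hP in
-- The counit only sees weight m, and there the differential of L is the canonical one, with which
-- the counit commutes.
theorem counit_coord_d {m : ℕ} (z : CompositeModule M P.toDGSymModule m) :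
    counitHom hP M m (F.coord.toFun m (L.d m (F.ext.toFun m z))) = M.d m (counitHom hP M m z) := by
  refine LinearMap.congr_fun (f := counitHom hP M m ∘ₗ F.coord.toFun m ∘ₗ L.d m ∘ₗ F.ext.toFun m)
    (g := M.d m ∘ₗ counitHom hP M m) (CompositeModule.hom_ext fun c => ?_) z
  simp only [LinearMap.comp_apply]
  rcases lt_or_ge m c.r with h | h
  · rw [mk_eq_zero_of_lt hP.1 c h]; simp only [map_zero]
  · obtain ⟨z, hz, e⟩ := F.lead_d P.mul.toGrHom (L.action.toFun m)
      (fun t => (L.assoc m t).trans (map_smul (L.action.toFun m) _ _).symm) (L.d m)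
      (fun z => (L.action.map_d m z).symm) c
    have e' : L.d m (F.ext.toFun m (CompositeModule.mk c))
        = F.ext.toFun m (dHom M P.toDGSymModule m (CompositeModule.mk c) + z) := e
    rw [e', coord_ext, map_add, counitHom_of_mem_lowerSpan hP h hz, add_zero]
    exact (counit hP M).map_d m _

variable (φ : L.Hom L')

include hP in
-- By P-linearity φ(ι(x)(q_*)) = φ(ι(x))(q_*). In coordinates this has weight at most the arity of
-- x, which is < m, so decomposables go to decomposables.
theorem counit_coord_map_eq_zero {m : ℕ} {x : L.carrier m} (hx : x ∈ Submodule.span K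
      {z | ∃ c : CompositeSymbol M P.toDGSymModule m, c.r < m ∧
        z = L.extend F.ι m (compose.mk c)}) :
    counitHom hP M' m (F'.coord.toFun m (φ.toFun m x)) = 0 := by
  suffices H : Submodule.span K {z | ∃ c : CompositeSymbol M P.toDGSymModule m, c.r < m ∧
        z = L.extend F.ι m (compose.mk c)}
      ≤ LinearMap.ker (counitHom hP M' m ∘ₗ F'.coord.toFun m ∘ₗ φ.toFun m) from H hx
  refine Submodule.span_le.2 ?_
  rintro _ ⟨c, hc, rfl⟩
  change counitHom hP M' m (F'.coord.toFun m (φ.toFun m (F.ext.toFun m (compose.mk c)))) = 0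
  rw [F.ext_mk, φ.map_action]
  have h1 := F'.coord_action ((compose.map φ.toDGHom (DGHom.id P.toDGSymModule)).toFun m
    (compose.mk (compose.mapSymbol F.ι (GrHom.id P.toDGSymModule) c)))
  rw [h1, compose.map_mk]
  refine (congrArg _ (leftSubst_mk F'.coord P.mul.toGrHom _)).trans ?_
  exact counitHom_of_mem_lowerSpan hP (Nat.succ_le_of_lt hc)
    (subst_mem_lowerSpan hP.1 P.mul.toGrHom _ _)

/-- The morphism induced on indecomposable quotients. -/
def indec : DGHom M M' where
  toGrHom := ((counit hP M').toGrHom.comp F'.coord).comp (φ.toGrHom.comp F.ι)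
  map_d m x := by
    change counitHom hP M' m (F'.coord.toFun m (φ.toFun m (F.ι.toFun m (M.d m x))))
      = M'.d m (counitHom hP M' m (F'.coord.toFun m (φ.toFun m (F.ι.toFun m x))))
    have h1 := F.counit_coord_map_eq_zero F' hP φ (F.decomposable m x)
    rw [map_sub, map_sub, map_sub, sub_eq_zero] at h1
    rw [← h1, ← F'.counit_coord_d hP, ext_coord, φ.map_d]

theorem map_ι_sub {m : ℕ} (x : M m) :
    φ.toFun m (F.ι.toFun m x) - F'.ι.toFun m ((F.indec F' hP φ).toFun m x) ∈ Submodule.span K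
      {z | ∃ d : CompositeSymbol M' P.toDGSymModule m, d.r < m ∧
        z = L'.extend F'.ι m (compose.mk d)} := by
  have := F'.ext_sub_ι_counit hP (F'.coord.toFun m (φ.toFun m (F.ι.toFun m x)))
  rwa [ext_coord] at this

section Perturbation

variable {N : DGSymModule.{u, w} K} (hN : N.Connected) (g : GrHom (compose P.toDGSymModule N) N)
  {m : ℕ} {X X' : Type*} [AddCommGroup X] [Module K X] [AddCommGroup X'] [Module K X']
  (f : CompositeModule L.toDGSymModule N m →ₗ[K] X)
  (hf : ∀ t : TripleSymbol L.toDGSymModule P.toDGSymModule N m,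
      f (t.evalLeft L.action.toGrHom) = f (t.evalRight g))
  (f' : CompositeModule L'.toDGSymModule N m →ₗ[K] X')
  (hf' : ∀ t : TripleSymbol L'.toDGSymModule P.toDGSymModule N m,
      f' (t.evalLeft L'.action.toGrHom) = f' (t.evalRight g))
  {d : X →ₗ[K] X} {d' : X' →ₗ[K] X'} {Φ : X →ₗ[K] X'}
  (hd : ∀ z, d (f z) = f (dHom L.toDGSymModule N m z))
  (hd' : ∀ z, d' (f' z) = f' (dHom L'.toDGSymModule N m z))
  (hΦ : ∀ z, Φ (f z) = f' (compose.mapHom φ.toGrHom (GrHom.id N) m z))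
  (hdd : ∀ z, d (d z) = 0) (hdd' : ∀ z, d' (d' z) = 0) (hΦd : ∀ z, Φ (d z) = d' (Φ z))
  (hb : Function.Bijective (F.lead f)) (hb' : Function.Bijective (F'.lead f'))

include hN hf hf' hd hd' hΦ hdd hdd' hΦd hb hb'

/-- The differential D is that of the cone of Φ, conjugated by the bijections from M ∘ N and M' ∘ N;
its leading part is the cone of the map induced on indecomposables, composed with N. Used twice:
with N = P and X = L(m), to learn about indecomposables, and with X = (L ∘_P R)(m), to conclude. -/
theorem weightPerturbation : ∃ D,
    WeightPerturbation (fun k => (weightProj M N m k).prodMap (weightProj M' N m k)) (m + 1)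
      (coneD (dHom M N m) (dHom M' N m)
        (compose.mapHom (F.indec F' hP φ).toGrHom (GrHom.id N) m)) D ∧
      ((∀ z, D z = 0 → ∃ y, D y = z) ↔ ConeAcyclic d d' Φ) := by
  set e := LinearEquiv.ofBijective (F.lead f) hb
  set e' := LinearEquiv.ofBijective (F'.lead f') hb'
  have he : ∀ z, e z = F.lead f z := fun _ => rfl
  have he' : ∀ z, e' z = F'.lead f' z := fun _ => rfl
  refine ⟨_, ?_, coneAcyclic_conj (d := d) (d' := d') (F := Φ) e e'⟩
  refine (weightGrading_weightProj M hN m).cone (weightGrading_weightProj M' hN m)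
    weightProj_dHom weightProj_dHom (weightProj_mapHom _ _) ?_ ?_ ?_ ?_ ?_ ?_
  · refine weightProj_congr_of_lower fun c => ?_
    obtain ⟨z, hz, h⟩ := F.lead_d g f hf d hd c
    exact ⟨z, hz, by simp only [LinearMap.comp_apply, LinearEquiv.coe_coe, he, h]
                     exact e.symm_apply_apply _⟩
  · refine weightProj_congr_of_lower fun c => ?_
    obtain ⟨z, hz, h⟩ := F'.lead_d g f' hf' d' hd' c
    exact ⟨z, hz, by simp only [LinearMap.comp_apply, LinearEquiv.coe_coe, he', h]
                     exact e'.symm_apply_apply _⟩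
  · refine weightProj_congr_of_lower fun c => ?_
    obtain ⟨z, hz, h⟩ := F'.lead_perturbation g f' hf'
      (compose.mapSymbol (F.indec F' hP φ).toGrHom (GrHom.id N) c)
      (φ.map_mem _ _ _ (F.ι.map_mem _ _ _ c.hx)) (F.map_ι_sub F' hP φ c.x)
    refine ⟨z, hz, ?_⟩
    simp only [LinearMap.comp_apply, LinearEquiv.coe_coe, he]
    rw [lead_mk, hΦ, compose.mapHom_mk, compose.mapHom_mk]
    exact (congrArg e'.symm h).trans (e'.symm_apply_apply _)
  · intro z; simp [hdd]
  · intro z; simp [hdd']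
  · intro z; simp [hΦd]

end Perturbation

end DGRightModule.QuasiFree

end RightComparison


/-! ### Proof of the statement on right modules. -/

noncomputable section RightFinal

variable {K : Type u} [CommRing K] {P : DGOperad.{u, v} K}

open CompositeModule CompositeSymbol TripleSymbol

/-- The projection `L ∘ R → L ∘_P R`. -/
def relComp.mkQ (L : DGRightModule.{u, v, v₁} P) (R : DGLeftModule.{u, v, v₂} P) (m : ℕ) :
    CompositeModule L.toDGSymModule R.toDGSymModule m →ₗ[K] (relComp L R) m :=
  ((compose L.toDGSymModule R.toDGSymModule).dgSpan (relCompRel L R) m).mkQ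

theorem relComp.mkQ_surjective (L : DGRightModule.{u, v, v₁} P) (R : DGLeftModule.{u, v, v₂} P)
    (m : ℕ) : Function.Surjective (relComp.mkQ L R m) := Submodule.mkQ_surjective _

theorem relComp.mkQ_eq_zero_iff (L : DGRightModule.{u, v, v₁} P) (R : DGLeftModule.{u, v, v₂} P)
    {m : ℕ} (z : CompositeModule L.toDGSymModule R.toDGSymModule m) :
    relComp.mkQ L R m z = 0 ↔ z ∈ Submodule.span K (relCompRel L R m) := by
  rw [← dgSpan_relCompRel]
  exact Submodule.Quotient.mk_eq_zero _

theorem relComp.mkQ_eval (L : DGRightModule.{u, v, v₁} P) (R : DGLeftModule.{u, v, v₂} P)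
    {m : ℕ} (t : TripleSymbol L.toDGSymModule P.toDGSymModule R.toDGSymModule m) :
    relComp.mkQ L R m (t.evalLeft L.action.toGrHom)
      = relComp.mkQ L R m (t.evalRight R.action.toGrHom) := by
  rw [← sub_eq_zero, ← map_sub, relComp.mkQ_eq_zero_iff]
  exact Submodule.subset_span ⟨t, rfl⟩

theorem lift_relCompRel {L : DGRightModule.{u, v, v₁} P} {R : DGLeftModule.{u, v, v₂} P}
    {m : ℕ} {X : Type*} [AddCommGroup X] [Module K X]
    {f : CompositeModule L.toDGSymModule R.toDGSymModule m →ₗ[K] X}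
    (hf : ∀ t : TripleSymbol L.toDGSymModule P.toDGSymModule R.toDGSymModule m,
      f (t.evalLeft L.action.toGrHom) = f (t.evalRight R.action.toGrHom))
    {z : CompositeModule L.toDGSymModule R.toDGSymModule m} (hz : relComp.mkQ L R m z = 0) :
    f z = 0 := by
  have : Submodule.span K (relCompRel L R m) ≤ LinearMap.ker f := by
    refine Submodule.span_le.2 ?_
    rintro _ ⟨t, rfl⟩
    exact (map_sub f _ _).trans (sub_eq_zero.2 (hf t))
  exact this ((relComp.mkQ_eq_zero_iff L R z).1 hz)

namespace DGRightModule.QuasiFree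

variable {L : DGRightModule.{u, v, v₁} P} {M : DGSymModule.{u, v₂} K} (F : L.QuasiFree M)
  {L' : DGRightModule.{u, v, v₃} P} {M' : DGSymModule.{u, v₄} K} (F' : L'.QuasiFree M')
  (hP : P.IsConnected)

/-- `(M ∘ P) ∘_P R ≅ M ∘ R`. -/
theorem lead_mkQ_bijective (R : DGLeftModule.{u, v, w} P) (m : ℕ) :
    Function.Bijective (F.lead (relComp.mkQ L R m)) := by
  constructor
  · rw [injective_iff_map_eq_zero]
    intro z hz
    rw [← F.leftSubst_mapHom_ι R.action.toGrHom R.one_action z]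
    exact lift_relCompRel F.leftSubst_eval hz
  · intro x
    obtain ⟨z, rfl⟩ := relComp.mkQ_surjective L R m x
    exact ⟨_, F.map_leftSubst R.action.toGrHom (relComp.mkQ L R m) (relComp.mkQ_eval L R) z⟩

/-- The unit `M → M ∘ P`. -/
abbrev unitHom (m : ℕ) : M m →ₗ[K] CompositeModule M P.toDGSymModule m :=
  F.coord.toFun m ∘ₗ F.ι.toFun m

variable {m : ℕ}

theorem weightProj_unitHom (x : M m) :
    weightProj M P.toDGSymModule m m (F.unitHom m x) = F.unitHom m x := by
  refine LinearMap.congr_fun (f := weightProj M P.toDGSymModule m m ∘ₗ F.unitHom m)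
    (M.hom_ext_of_mem fun a x hx => ?_) x
  simp only [LinearMap.comp_apply]
  rw [F.coord_ι hx, weightProj_mk, if_pos rfl]

theorem dHom_unitHom (x : M m) :
    dHom M P.toDGSymModule m (F.unitHom m x) = F.unitHom m (M.d m x) := by
  refine LinearMap.congr_fun (f := dHom M P.toDGSymModule m ∘ₗ F.unitHom m)
    (g := F.unitHom m ∘ₗ M.d m) (M.hom_ext_of_mem fun a x hx => ?_) x
  simp only [LinearMap.comp_apply]
  rw [F.coord_ι hx, F.coord_ι (M.d_mem_pred _ _ _ hx), dHom_mk, dMk, Finset.sum_eq_zero, add_zero]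
  intro i _
  rw [mk_eq_zero_of_right ((unitRight hx P.one_mem).dRight i) i, smul_zero]
  exact (Function.update_self i _ _).trans (P.d_zero _ _ P.one_mem)

theorem mapHom_unitHom (f : GrHom M M') (x : M m) :
    compose.mapHom f (GrHom.id P.toDGSymModule) m (F.unitHom m x) = F'.unitHom m (f.toFun m x) := by
  refine LinearMap.congr_fun (f := compose.mapHom f (GrHom.id P.toDGSymModule) m ∘ₗ F.unitHom m)
    (g := F'.unitHom m ∘ₗ f.toFun m) (M.hom_ext_of_mem fun a x hx => ?_) x
  simp only [LinearMap.comp_apply]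
  rw [F.coord_ι hx, F'.coord_ι (f.map_mem _ _ _ hx), compose.mapHom_mk]
  rfl

theorem counitHom_unitHom (x : M m) : counitHom hP M m (F.unitHom m x) = x := by
  refine LinearMap.congr_fun (f := counitHom hP M m ∘ₗ F.unitHom m) (g := LinearMap.id)
    (M.hom_ext_of_mem fun a x hx => ?_) x
  simp only [LinearMap.comp_apply, LinearMap.id_apply]
  rw [F.coord_ι hx, counitHom_unitRight]

theorem counitHom_mapHom (f : GrHom M M') (z : CompositeModule M P.toDGSymModule m) :
    counitHom hP M' m (compose.mapHom f (GrHom.id P.toDGSymModule) m z)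
      = f.toFun m (counitHom hP M m z) := by
  refine LinearMap.congr_fun
    (f := counitHom hP M' m ∘ₗ compose.mapHom f (GrHom.id P.toDGSymModule) m)
    (g := f.toFun m ∘ₗ counitHom hP M m) (CompositeModule.hom_ext fun c => ?_) z
  simp only [LinearMap.comp_apply]
  rw [compose.mapHom_mk, counitHom_mk, counitHom_mk, counitSymbol, counitSymbol]
  split_ifs with h
  · rw [map_smul, f.map_tr]; rfl
  · rw [map_zero]

variable (φ : L.Hom L')

/-- Strong induction on the arity through L(m) ≅ (M ∘ P)(m): the total cone is acyclic since φ is a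
quasi-isomorphism, and the weights i < m involve the induced map in arity i only. -/
theorem indec_coneAcyclic (hφ : φ.toDGHom.QuasiIso) (hM : M.KProjective) (hM' : M'.KProjective)
    (m : ℕ) : ConeAcyclic (M.d m) (M'.d m) ((F.indec F' hP φ).toFun m) := by
  induction m using Nat.strong_induction_on with
  | _ m ih =>
    obtain ⟨D, hD, hD'⟩ := F.weightPerturbation F' hP φ hP.1 P.mul.toGrHom (L.action.toFun m)
      (fun t => (L.assoc m t).trans (map_smul (L.action.toFun m) _ _).symm) (L'.action.toFun m)
      (fun t => (L'.assoc m t).trans (map_smul (L'.action.toFun m) _ _).symm)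
      (fun z => (L.action.map_d m z).symm) (fun z => (L'.action.map_d m z).symm)
      (φ.map_action m) (L.d_d m) (L'.d_d m) (φ.map_d m) (F.bijective m) (F'.bijective m)
    have h1 := hD.weightAcyclic_top rfl (hD'.2 ((φ.bijective_homologyMap_iff m).1 (hφ m)))
      fun i hi => by
        have := hM i
        have := hM' i
        exact weightAcyclic_mapHom_left _ hP.1 m i ((F.indec F' hP φ).hasHomotopyInverse i (ih i hi))
    -- Via x ↦ x(1,…,1) and the counit, the complex M(m) is a retract of the part of weight m of (M
    -- ∘ P)(m), naturally in M.
    exact h1.retract (F.unitHom m) (F'.unitHom m) (counitHom hP M m) (counitHom hP M' m)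
      F.weightProj_unitHom F'.weightProj_unitHom F.dHom_unitHom F'.dHom_unitHom
      (F.mapHom_unitHom F' _) (F.counitHom_unitHom hP) (F'.counitHom_unitHom hP)
      ((counit hP M).map_d m) ((counit hP M').map_d m) (counitHom_mapHom hP _)

include F F' hP in
-- Now every weight of the leading cone is acyclic, since the induced map has a homotopy inverse in
-- every arity; finiteness of the filtration does the rest.
theorem relComp_map_quasiIso (R : DGLeftModule.{u, v, w} P) (hR : R.toDGSymModule.Connected)
    (hφ : φ.toDGHom.QuasiIso) (hM : M.KProjective) (hM' : M'.KProjective) :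
    (relComp.map φ (DGLeftModule.Hom.id R)).QuasiIso := by
  intro m
  rw [DGHom.bijective_homologyMap_iff]
  obtain ⟨D, hD, hD'⟩ := F.weightPerturbation F' hP φ hR R.action.toGrHom (relComp.mkQ L R m)
    (relComp.mkQ_eval L R) (relComp.mkQ L' R m) (relComp.mkQ_eval L' R)
    (d := (relComp L R).d m) (d' := (relComp L' R).d m)
    (Φ := (relComp.map φ (DGLeftModule.Hom.id R)).toFun m) (fun _ => rfl) (fun _ => rfl)
    (fun _ => rfl) ((relComp L R).d_d m) ((relComp L' R).d_d m)
    ((relComp.map φ (DGLeftModule.Hom.id R)).map_d m) (F.lead_mkQ_bijective R m)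
    (F'.lead_mkQ_bijective R m)
  refine hD'.1 (hD.acyclic fun i _ => ?_)
  have := hM i
  have := hM' i
  exact weightAcyclic_mapHom_left _ hR m i ((F.indec F' hP φ).hasHomotopyInverse i
    (F.indec_coneAcyclic F' hP φ hφ hM hM' i))

end DGRightModule.QuasiFree

theorem DGSymModule.kprojective_of_isField (hK : IsField K) (M : DGSymModule.{u, v} K) :
    M.KProjective := by
  intro r
  let _ := hK.toField
  exact Module.Projective.of_free

end RightFinal


/-! ### Multilinear maps on families of modules given by generators and relations. -/

section Multilinear

variable {K : Type*} [CommRing K] {ι : Type*} [Fintype ι] [DecidableEq ι]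

/-- Span induction in one coordinate at a time; T collects the coordinates not yet reduced to
generators. Span membership is passed to `lin` so that homogeneity of the entries remains available.
-/
theorem pi_span_induction {V : ι → Type*} [∀ i, AddCommGroup (V i)] [∀ i, Module K (V i)]
    (G : ∀ i, Set (V i)) (p : (∀ i, V i) → Prop) (mem : ∀ v, (∀ i, v i ∈ G i) → p v)
    (zero : ∀ v i, v i = 0 → p v)
    (lin : ∀ (v : ∀ i, V i) (i : ι) (α β : K) (x y : V i), (∀ j, v j ∈ Submodule.span K (G j)) → x ∈ Submodule.span K (G i) →
      y ∈ Submodule.span K (G i) → p (Function.update v i x) → p (Function.update v i y) →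
      p (Function.update v i (α • x + β • y)))
    (v : ∀ i, V i) (hv : ∀ i, v i ∈ Submodule.span K (G i)) : p v := by
  suffices H : ∀ T : Finset ι, ∀ v : ∀ i, V i, (∀ i ∉ T, v i ∈ G i) →
      (∀ i, v i ∈ Submodule.span K (G i)) → p v from H Finset.univ v (by simp) hv
  intro T
  induction T using Finset.induction_on with
  | empty => exact fun v h _ => mem v fun i => h i (Finset.notMem_empty i)
  | insert i T hi ih =>
    intro v hT hv
    suffices H : ∀ x ∈ Submodule.span K (G i), p (Function.update v i x) by
      simpa using H (v i) (hv i)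
    intro x hx
    induction hx using Submodule.span_induction with
    | mem x hx =>
      refine ih _ (fun j hj => ?_) fun j => ?_
      · rcases eq_or_ne j i with rfl | hji
        · simpa using hx
        · simpa [hji] using hT j (by simp [hji, hj])
      · rcases eq_or_ne j i with rfl | hji
        · simpa using Submodule.subset_span hx
        · simpa [hji] using hv j
    | zero => exact zero _ i (by simp)
    | add x y hx hy hpx hpy =>
      simpa using lin v i 1 1 x y hv hx hy hpx hpy
    | smul a x hx hpx =>
      simpa using lin v i a 0 x x hv hx hx hpx hpx

variable {X : Type*} [AddCommGroup X] [Module K X]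

theorem exists_multilinearMap_finsupp {S : ι → Type*} (f : (∀ i, S i) → X) :
    ∃ E : MultilinearMap K (fun i => S i →₀ K) X, ∀ s, E (fun i => Finsupp.single (s i) 1) = f s := by
  classical
  refine ⟨((DFinsupp.lsum ℕ fun _ => LinearMap.id :
    (Π₀ _ : ∀ i, S i, X) →ₗ[K] X).compMultilinearMap
      (MultilinearMap.dfinsuppFamily fun s => MultilinearMap.mkPiRing K ι (f s))).compLinearMap
      fun i => (finsuppLequivDFinsupp K (ι := S i) (M := K)).toLinearMap, fun s => ?_⟩
  simp [MultilinearMap.dfinsuppFamily_single]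

/-- The universal property of a tensor product of presented modules. It is needed because
substitution in the factors uses all of y_1,…,y_r at once, each written as a linear combination of
composites. -/
theorem exists_multilinearMap_quotient {S : ι → Type*} (Rel : ∀ i, Submodule K (S i →₀ K))
    (f : (∀ i, S i) → X) (hf : ∀ i s, ∀ ρ ∈ Rel i,
      Finsupp.linearCombination K (fun t => f (Function.update s i t)) ρ = 0) :
    ∃ E : MultilinearMap K (fun i => (S i →₀ K) ⧸ Rel i) X,
      ∀ s, E (fun i => Submodule.Quotient.mk (Finsupp.single (s i) 1)) = f s := by
  obtain ⟨E, hE⟩ := exists_multilinearMap_finsupp (K := K) f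
  have h0 : ∀ i z, ∀ ρ ∈ Rel i, E (Function.update z i ρ) = 0 := by
    intro i z ρ hρ
    -- The coordinate `z i` is overwritten by ρ, so the bare expression is not linear in it. The
    -- factor, the sum of the coefficients of `z i`, makes it multilinear in z and reduces the claim
    -- to basis vectors; it becomes 1 when `z i` is a basis vector.
    have key : ∀ z : ∀ i, S i →₀ K, Finsupp.linearCombination K (fun _ => (1 : K)) (z i) •
        E (Function.update z i ρ) = 0 := by
      intro z
      refine pi_span_induction (K := K) (V := fun i => S i →₀ K)
        (fun j => {x | ∃ t, x = Finsupp.single t 1})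
        (fun z => Finsupp.linearCombination K (fun _ => (1 : K)) (z i) •
          E (Function.update z i ρ) = 0) ?_ ?_ ?_ z ?_
      · intro v hv
        choose s hs using hv
        obtain rfl : v = fun j => Finsupp.single (s j) 1 := funext hs
        have h1 : ∀ t, f (Function.update s i t)
            = E.toLinearMap (fun j => Finsupp.single (s j) 1) i (Finsupp.single t 1) := fun t => by
          rw [← hE, MultilinearMap.toLinearMap_apply]
          congr 1
          funext j
          rcases eq_or_ne j i with rfl | hj
          · simp
          · simp [hj]
        have h2 := hf i s ρ hρ
        have h3 : Finsupp.linearCombination K (fun t => f (Function.update s i t))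
            = E.toLinearMap (fun j => Finsupp.single (s j) 1) i := by
          ext t
          simp [h1]
        rw [h3, MultilinearMap.toLinearMap_apply] at h2
        rw [h2, smul_zero]
      · intro v j hj
        rcases eq_or_ne j i with rfl | hji
        · simp [hj]
        · rw [E.map_coord_zero j (by simp [hji, hj]), smul_zero]
      · intro v j α β x y _ _ _ hx hy
        rcases eq_or_ne j i with rfl | hji
        · simp only [Function.update_self, Function.update_idem, map_add, map_smul] at hx hy ⊢
          rw [add_smul, smul_assoc, smul_assoc, hx, hy, smul_zero, smul_zero, add_zero]
        · simp only [Function.update_of_ne hji.symm] at hx hy ⊢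
          rw [Function.update_comm hji] at hx hy ⊢
          rw [E.map_update_add, E.map_update_smul, E.map_update_smul, smul_add, smul_comm _ α,
            smul_comm _ β, hx, hy, smul_zero, smul_zero, add_zero]
      · intro j
        induction z j using Finsupp.induction_linear with
        | zero => exact zero_mem _
        | add f g hf hg => exact add_mem hf hg
        | single c t =>
          have : (Finsupp.single c t : S j →₀ K) = t • Finsupp.single c 1 := by simp
          rw [this]
          exact Submodule.smul_mem _ _ (Submodule.subset_span ⟨c, rfl⟩)
    by_cases hS : IsEmpty (S i)
    · obtain rfl := Subsingleton.elim ρ 0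
      exact E.map_update_zero _ _
    · obtain ⟨t⟩ := not_isEmpty_iff.1 hS
      simpa using key (Function.update z i (Finsupp.single t 1))
  have h1 : ∀ i z w w', (Submodule.Quotient.mk w : (S i →₀ K) ⧸ Rel i) = Submodule.Quotient.mk w' →
      E (Function.update z i w) = E (Function.update z i w') := by
    intro i z w w' h
    rw [← sub_eq_zero, ← E.map_update_sub]
    exact h0 i z _ ((Submodule.Quotient.eq _).1 h)
  have h2 : ∀ z z' : ∀ i, S i →₀ K, (∀ i, (Submodule.Quotient.mk (z i) : (S i →₀ K) ⧸ Rel i)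
      = Submodule.Quotient.mk (z' i)) → E z = E z' := by
    intro z z' h
    have : ∀ T : Finset ι, E (T.piecewise z z') = E z' := by
      intro T
      induction T using Finset.induction_on with
      | empty => simp
      | insert i T hi ih =>
        rw [Finset.piecewise_insert, h1 i _ _ _ (h i), ← ih]
        congr 1
        refine (Function.update_eq_iff).2 ⟨by simp [hi], fun j _ => rfl⟩
    simpa using this Finset.univ
  -- The chosen representatives are not linear in the class; linearity of the induced map comes from
  -- independence of the representatives.
  choose g hg using fun i => Submodule.Quotient.mk_surjective (Rel i)
  have h3 : ∀ q : ∀ i, (S i →₀ K) ⧸ Rel i, ∀ i x, (fun j => g j (Function.update q i x j))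
      = Function.update (fun j => g j (q j)) i (g i x) := by
    intro q i x
    funext j
    rcases eq_or_ne j i with rfl | hj
    · simp
    · simp [hj]
  refine ⟨MultilinearMap.mk' (fun q => E fun i => g i (q i)) ?_ ?_, fun s => ?_⟩
  · intro q i x y
    rw [h3, h3, h3, ← E.map_update_add]
    exact h1 _ _ _ _ (by rw [Submodule.Quotient.mk_add, hg, hg, hg])
  · intro q i a x
    rw [h3, h3, ← E.map_update_smul]
    exact h1 _ _ _ _ (by rw [Submodule.Quotient.mk_smul, hg, hg])
  · rw [← hE]
    exact h2 _ _ fun i => hg i _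

end Multilinear


/-! ### Substitution of composite elements for the factors. -/

noncomputable section RightSubst

variable {K : Type u} [CommRing K]

open CompositeModule CompositeSymbol TripleSymbol

theorem koszulExp_one {r : ℕ} (b : Fin r → ℕ) : koszulExp 1 b = 0 :=
  Finset.sum_eq_zero fun i _ => Finset.sum_eq_zero fun j _ => if_neg fun h => by
    have := h.1
    have := h.2
    simp only [Equiv.Perm.one_apply] at this
    omega

variable {L : DGSymModule.{u, v₁} K} {P : DGSymModule.{u, v₂} K} {N : DGSymModule.{u, v₃} K}
  {A : DGSymModule.{u, v₄} K} {R : DGSymModule.{u, v} K} {m : ℕ}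

/-- The composite element `x(p_*(z_{**}))`, where the factors of `c` are replaced by composite
elements. -/
abbrev CompositeSymbol.expandRight (c : CompositeSymbol L R m)
    (D : ∀ i, CompositeSymbol P N (c.n i)) : TripleSymbol L P N m where
  r := c.r
  n := fun i => (D i).r
  l := fun i k => (D i).n k
  e := ((Equiv.sigmaAssoc fun i k => Fin ((D i).n k)).trans
    (Equiv.sigmaCongrRight fun i => (D i).e)).trans c.e
  a := c.a
  x := c.x
  hx := c.hx
  b := fun i => (D i).a
  q := fun i => (D i).x
  hq := fun i => (D i).hx
  c := fun i k => (D i).b k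
  s := fun i k => (D i).y k
  hs := fun i k => (D i).hy k

/-- The value of `± λ(x(p_*))(z_{**})`. -/
def CompositeSymbol.multiSymbol (act : GrHom (compose L P) A) (c : CompositeSymbol L R m)
    (D : ∀ i, CompositeSymbol P N (c.n i)) : CompositeModule A N m :=
  (-1 : K) ^ (c.expandRight D).signExp • (c.expandRight D).evalLeft act

variable (act : GrHom (compose L P) A)

theorem multiSymbol_outer (c : CompositeSymbol L R m) (D : ∀ i, CompositeSymbol P N (c.n i))
    (σ : ∀ i, Equiv.Perm (Fin (D i).r)) :
    c.multiSymbol act (fun i => (D i).outer (σ i))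
      = (-1 : K) ^ (∑ i, koszulExp (σ i) (D i).b) •
        c.multiSymbol act fun i => (D i).outerPerm (σ i) := by
  have h1 : c.expandRight (fun i => (D i).outerPerm (σ i)) = (c.expandRight D).midPerm σ :=
    TripleSymbol.mk_eq_of_label fun _ => rfl
  have h2 := (c.expandRight D).evalLeft_mid act σ
  rw [midExp, lexExp, koszulExp_sum (c.expandRight D).n σ (c.expandRight D).c] at h2
  rw [multiSymbol, multiSymbol, h1, signExp_midPerm, smul_comm]
  exact congrArg _ h2

theorem update_family {n : Fin m → ℕ} (D : ∀ i, CompositeSymbol P N (n i)) (i : Fin m)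
    (f : ∀ j, CompositeSymbol P N (n j)) (d : CompositeSymbol P N (n i)) (hd : d = f i)
    (h : ∀ j, j ≠ i → f j = D j) : Function.update D i d = f := by
  subst hd
  exact Function.update_eq_iff.2 ⟨rfl, fun j hj => (h j hj).symm⟩

theorem CompositeSymbol.outer_one (d : CompositeSymbol P N m) : d.outer 1 = d := by
  obtain ⟨r, n, e, a, x, hx, b, y, hy⟩ := d
  simp only [CompositeSymbol.outer, map_one, Module.End.one_apply]

theorem CompositeSymbol.outerPerm_one (d : CompositeSymbol P N m) : d.outerPerm 1 = d := by
  obtain ⟨r, n, e, a, x, hx, b, y, hy⟩ := d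
  rw [CompositeSymbol.mk.injEq]
  refine ⟨rfl, HEq.rfl, heq_of_eq (Equiv.ext fun _ => rfl), rfl, HEq.rfl, HEq.rfl, HEq.rfl⟩

/-- With the other factors fixed, the relations of P ∘ N in the i-th slot become relations between
left evaluations, by the equivariance and linearity of `evalLeft`. -/
theorem multiSymbol_respects (c : CompositeSymbol L R m) (D : ∀ i, CompositeSymbol P N (c.n i))
    (i : Fin c.r) : CompositeSymbol.Respects
      fun d : CompositeSymbol P N (c.n i) => c.multiSymbol act (Function.update D i d) where
  lin_left d α β x' x'' hx' hx'' h := by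
    -- Absorbing d into the family makes it the i-th entry of a family without `Function.update`, so
    -- that the lemmas on triples apply to it.
    obtain ⟨D₁, hD₁⟩ : ∃ D₁, D₁ = Function.update D i d := ⟨_, rfl⟩
    have e : ∀ d', Function.update D i d' = Function.update D₁ i d' := by simp [hD₁]
    obtain rfl : d = D₁ i := by simp [hD₁]
    clear hD₁
    simp only [e, Function.update_eq_self]
    have hmem : ∀ x ∈ P.gr (D₁ i).r (D₁ i).a, ∀ j,
        Function.update (fun j => (D₁ j).x) i x j ∈ P.gr (D₁ j).r (D₁ j).a := by
      intro x hx j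
      rcases eq_or_ne j i with rfl | hj
      · simpa using hx
      · simpa [hj] using (D₁ j).hx
    have key : ∀ (x : P (D₁ i).r) (hx : x ∈ P.gr (D₁ i).r (D₁ i).a),
        Function.update D₁ i { D₁ i with x := x, hx := hx }
          = fun j => { D₁ j with x := _, hx := hmem x hx j } := by
      intro x hx
      refine update_family D₁ i _ _ (by simp) fun j hj => by simp [hj]
    rw [key x' hx', key x'' hx'']
    exact smul_lin_comb _ (evalLeft_lin_q act (c.expandRight D₁) i α β _ _ (hmem x' hx')
      (hmem x'' hx'') (by simpa using h) (fun j hj => by simp [hj]) (fun j hj => by simp [hj]))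
  lin_right d k α β y' y'' hy' hy'' h h' h'' := by
    obtain ⟨D₁, hD₁⟩ : ∃ D₁, D₁ = Function.update D i d := ⟨_, rfl⟩
    have e : ∀ d', Function.update D i d' = Function.update D₁ i d' := by simp [hD₁]
    obtain rfl : d = D₁ i := by simp [hD₁]
    clear hD₁
    simp only [e, Function.update_eq_self]
    have hmem : ∀ y : ∀ l, N ((D₁ i).n l), (∀ l, y l ∈ N.gr ((D₁ i).n l) ((D₁ i).b l)) → ∀ j l,
        Function.update (fun j => (D₁ j).y) i y j l ∈ N.gr ((D₁ j).n l) ((D₁ j).b l) := by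
      intro y hy j l
      rcases eq_or_ne j i with rfl | hj
      · simpa using hy l
      · simpa [hj] using (D₁ j).hy l
    have key : ∀ (y : ∀ l, N ((D₁ i).n l)) (hy : ∀ l, y l ∈ N.gr ((D₁ i).n l) ((D₁ i).b l)),
        Function.update D₁ i { D₁ i with y := y, hy := hy }
          = fun j => { D₁ j with y := _, hy := hmem y hy j } := by
      intro y hy
      refine update_family D₁ i _ _ (by simp) fun j hj => by simp [hj]
    rw [key y' hy', key y'' hy'']
    have hne : ∀ y : ∀ l, N ((D₁ i).n l), (∀ l, l ≠ k → y l = (D₁ i).y l) →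
        ∀ j l, (⟨j, l⟩ : Σ j, Fin (D₁ j).r) ≠ ⟨i, k⟩ →
          Function.update (fun j => (D₁ j).y) i y j l = (D₁ j).y l := by
      intro y hy j l hjl
      rcases eq_or_ne j i with rfl | hj
      · simpa using hy l (fun h => hjl (by rw [h]))
      · simp [hj]
    exact smul_lin_comb _ (evalLeft_lin_s act (c.expandRight D₁) i k α β _ _ (hmem y' hy')
      (hmem y'' hy'') (by simpa using h) (hne y' h') (hne y'' h''))
  inner d τ := by
    obtain ⟨D₁, hD₁⟩ : ∃ D₁, D₁ = Function.update D i d := ⟨_, rfl⟩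
    have e : ∀ d', Function.update D i d' = Function.update D₁ i d' := by simp [hD₁]
    obtain rfl : d = D₁ i := by simp [hD₁]
    clear hD₁
    simp only [e]
    set T := Function.update (fun j k => (1 : Equiv.Perm (Fin ((D₁ j).n k)))) i τ with hT
    have h1 : Function.update D₁ i ((D₁ i).inner τ) = fun j => (D₁ j).inner (T j) := by
      refine update_family D₁ i _ _ (by simp [hT]) fun j hj => ?_
      simp only [hT, Function.update_of_ne hj, CompositeSymbol.inner, map_one,
        Module.End.one_apply]
    have h2 : Function.update D₁ i ((D₁ i).innerLabel τ) = fun j => (D₁ j).innerLabel (T j) := by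
      refine update_family D₁ i _ _ (by simp [hT]) fun j hj => ?_
      simp only [hT, Function.update_of_ne hj]
      obtain ⟨r, n, e, a, x, hx, b, y, hy⟩ := D₁ j
      rw [CompositeSymbol.mk.injEq]
      exact ⟨rfl, HEq.rfl, heq_of_eq (Equiv.ext fun _ => rfl), rfl, HEq.rfl, HEq.rfl, HEq.rfl⟩
    rw [h1, h2]
    have h3 : c.expandRight (fun j => (D₁ j).innerLabel (T j)) = (c.expandRight D₁).innerLabel T :=
      TripleSymbol.mk_eq_of_label fun _ => rfl
    rw [multiSymbol, multiSymbol, h3]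
    exact congrArg _ (evalLeft_inner act (c.expandRight D₁) T)
  outer d s := by
    obtain ⟨D₁, hD₁⟩ : ∃ D₁, D₁ = Function.update D i d := ⟨_, rfl⟩
    have e : ∀ d', Function.update D i d' = Function.update D₁ i d' := by simp [hD₁]
    obtain rfl : d = D₁ i := by simp [hD₁]
    clear hD₁
    simp only [e]
    set σ := Function.update (fun j => (1 : Equiv.Perm (Fin (D₁ j).r))) i s with hσ
    have h1 : Function.update D₁ i ((D₁ i).outer s) = fun j => (D₁ j).outer (σ j) := by
      refine update_family D₁ i _ _ (by simp [hσ]) fun j hj => ?_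
      rw [hσ, Function.update_of_ne hj, outer_one]
    have h2 : Function.update D₁ i ((D₁ i).outerPerm s) = fun j => (D₁ j).outerPerm (σ j) := by
      refine update_family D₁ i _ _ (by simp [hσ]) fun j hj => ?_
      rw [hσ, Function.update_of_ne hj, outerPerm_one]
    rw [h1, h2, multiSymbol_outer, Finset.sum_eq_single i]
    · rw [hσ, Function.update_self]
    · intro j _ hj
      rw [hσ, Function.update_of_ne hj, koszulExp_one]
    · simp

theorem exists_multiEval (c : CompositeSymbol L R m) :
    ∃ E : MultilinearMap K (fun i => CompositeModule P N (c.n i)) (CompositeModule A N m),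
      ∀ D, E (fun i => CompositeModule.mk (D i)) = c.multiSymbol act D :=
  exists_multilinearMap_quotient _ _ fun i D ρ hρ => by
    have : Submodule.span K {z | CompositeRel P N (c.n i) z}
        ≤ LinearMap.ker (Finsupp.linearCombination K fun d =>
          c.multiSymbol act (Function.update D i d)) :=
      Submodule.span_le.2 fun z hz => (multiSymbol_respects act c D i).rel z hz
    exact this hρ

/-- The multilinear extension of `multiSymbol`. -/
def CompositeSymbol.multiEval (N : DGSymModule.{u, v₃} K) (c : CompositeSymbol L R m) :
    MultilinearMap K (fun i => CompositeModule P N (c.n i)) (CompositeModule A N m) :=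
  (exists_multiEval act c).choose

theorem multiEval_mk (c : CompositeSymbol L R m) (D : ∀ i, CompositeSymbol P N (c.n i)) :
    c.multiEval act N (fun i => CompositeModule.mk (D i)) = c.multiSymbol act D :=
  (exists_multiEval act c).choose_spec D

theorem multiEval_ext {X : Type*} [AddCommGroup X] [Module K X] {n : Fin m → ℕ}
    {E E' : MultilinearMap K (fun i => CompositeModule P N (n i)) X}
    (h : ∀ D : ∀ i, CompositeSymbol P N (n i),
      E (fun i => CompositeModule.mk (D i)) = E' fun i => CompositeModule.mk (D i)) : E = E' := by
  refine MultilinearMap.ext fun v => ?_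
  refine pi_span_induction (K := K) (V := fun i => CompositeModule P N (n i))
    (fun i => Set.range CompositeModule.mk) (fun v => E v = E' v) ?_ ?_ ?_ v
    (fun i => by rw [span_mk]; trivial)
  · intro v hv
    choose D hD using hv
    obtain rfl : (fun i => CompositeModule.mk (D i)) = v := funext hD
    exact h D
  · intro v i hi
    rw [E.map_coord_zero i hi, E'.map_coord_zero i hi]
  · intro v i α β x y _ _ _ hx hy
    rw [E.map_update_add, E'.map_update_add, E.map_update_smul, E'.map_update_smul,
      E.map_update_smul, E'.map_update_smul, hx, hy]

/-- The Koszul sign refers to the degrees `c.b`, so the entries must be homogeneous of these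
degrees. On composite elements the identity reduces to `evalLeft_outer` and `signExp_outerPerm`. -/
theorem multiEval_outer (c : CompositeSymbol L R m) (s : Equiv.Perm (Fin c.r))
    (z : ∀ i, CompositeModule P N (c.n i)) (hz : ∀ i, z i ∈ CompositeModule.gr P N (c.n i) (c.b i)) :
    (c.outer s).multiEval act N z
      = (-1 : K) ^ koszulExp s c.b • (c.outerPerm s).multiEval act N fun i => z (s i) := by
  refine pi_span_induction (K := K) (V := fun i => CompositeModule P N (c.n i))
    (fun i => {z | ∃ d : CompositeSymbol P N (c.n i), d.deg = c.b i ∧ CompositeModule.mk d = z})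
    (fun z => (c.outer s).multiEval act N z
      = (-1 : K) ^ koszulExp s c.b • (c.outerPerm s).multiEval act N fun i => z (s i))
    ?_ ?_ ?_ z hz
  · intro v hv
    choose D hdeg hD using hv
    obtain rfl : (fun i => CompositeModule.mk (D i)) = v := funext hD
    refine (multiEval_mk act (c.outer s) D).trans (Eq.trans ?_ (congrArg _
      (multiEval_mk act (c.outerPerm s) fun i => D (s i)).symm))
    have h1 : (c.outerPerm s).expandRight (fun i => D (s i)) = (c.expandRight D).outerPerm s :=
      TripleSymbol.mk_eq_of_label fun _ => rfl
    rw [multiSymbol, multiSymbol, h1]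
    refine (congrArg _ ((c.expandRight D).evalLeft_outer act s)).trans ?_
    rw [smul_smul, smul_smul, ← pow_add, ← pow_add]
    refine congrArg (· • _) (neg_one_pow_congr_zmod ?_)
    have h2 := (c.expandRight D).signExp_outerPerm s
    have h3 : (fun i => (c.expandRight D).b i + ∑ k, (c.expandRight D).c i k) = c.b := funext hdeg
    rw [h3] at h2
    have h4 : ((c.outer s).expandRight D).signExp = (c.expandRight D).signExp := rfl
    rw [h4]
    generalize (c.expandRight D).outerExp s = X at h2 ⊢
    have e1 := ZMod.two_add_self (koszulExp s c.b : ZMod 2)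
    have e2 := ZMod.two_add_self (X : ZMod 2)
    push_cast at h2 ⊢
    linear_combination h2 - e1 + e2
  · intro v i hi
    obtain ⟨j, rfl⟩ := s.surjective i
    rw [((c.outer s).multiEval act N).map_coord_zero (s j) hi,
      ((c.outerPerm s).multiEval act N).map_coord_zero j hi, smul_zero]
  · intro v i α β x y _ _ _ hx hy
    obtain ⟨j, rfl⟩ := s.surjective i
    have key : ∀ x, (fun i => Function.update v (s j) x (s i))
        = Function.update (fun i => v (s i)) j x := by
      intro x
      funext i
      rcases eq_or_ne i j with rfl | hi
      · simp
      · simp [hi]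
    rw [key] at hx hy ⊢
    rw [((c.outer s).multiEval act N).map_update_add, ((c.outer s).multiEval act N).map_update_smul,
      ((c.outer s).multiEval act N).map_update_smul, hx, hy]
    refine Eq.trans ?_ (congrArg _ (((c.outerPerm s).multiEval act N).map_update_add _ j
      (α • x) (β • y)).symm)
    refine Eq.trans ?_ (congrArg _ (congrArg₂ (· + ·)
      (((c.outerPerm s).multiEval act N).map_update_smul _ j α x).symm
      (((c.outerPerm s).multiEval act N).map_update_smul _ j β y).symm))
    exact (smul_lin_comb _ rfl).symm

variable (θ : GrHom R (compose P N))

theorem rightSubst_respects : CompositeSymbol.Respects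
    fun c : CompositeSymbol L R m => c.multiEval act N fun i => θ.toFun _ (c.y i) where
  lin_left c α β x' x'' hx' hx'' h := by
    have : c.multiEval act N = α • CompositeSymbol.multiEval act N { c with x := x', hx := hx' }
        + β • CompositeSymbol.multiEval act N { c with x := x'', hx := hx'' } := by
      refine multiEval_ext fun D => ?_
      rw [add_apply, smul_apply, smul_apply]
      refine (multiEval_mk act c D).trans (Eq.trans ?_ (congrArg₂ (fun a b => α • a + β • b)
        (multiEval_mk act { c with x := x', hx := hx' } D).symm
        (multiEval_mk act { c with x := x'', hx := hx'' } D).symm))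
      exact smul_lin_comb _ (evalLeft_lin_x act (c.expandRight D) α β x' x'' hx' hx'' h)
    exact congrArg (fun E => E fun i => θ.toFun _ (c.y i)) this
  lin_right c i α β y' y'' hy' hy'' h h' h'' := by
    have key : ∀ (y : ∀ j, R (c.n j)) (hy : ∀ j, y j ∈ R.gr (c.n j) (c.b j)), CompositeSymbol.multiEval act N { c with y := y, hy := hy }
        = c.multiEval act N := fun y hy => multiEval_ext fun D =>
      (multiEval_mk act { c with y := y, hy := hy } D).trans (multiEval_mk act c D).symm
    have upd : ∀ y : ∀ j, R (c.n j), (∀ j, j ≠ i → y j = c.y j) → (fun j => θ.toFun _ (y j))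
        = Function.update (fun j => θ.toFun _ (c.y j)) i (θ.toFun _ (y i)) := by
      intro y hy
      refine (Function.update_eq_iff.2 ⟨rfl, fun j hj => ?_⟩).symm
      rw [hy j hj]
    rw [key y' hy', key y'' hy'']
    simp only
    rw [upd y' h', upd y'' h'', upd c.y (fun _ _ => rfl), h, map_add, map_smul, map_smul,
      MultilinearMap.map_update_add, MultilinearMap.map_update_smul,
      MultilinearMap.map_update_smul]
    simp only [Function.update_idem]
  inner c σ := by
    have : (c.multiEval act N).compLinearMap (fun i => repHom (σ i))
        = (c.innerLabel σ).multiEval act N := by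
      refine multiEval_ext fun D => ?_
      rw [MultilinearMap.compLinearMap_apply]
      simp only [repHom_mk]
      refine (multiEval_mk act c _).trans (Eq.trans ?_ (multiEval_mk act (c.innerLabel σ) D).symm)
      have h1 : c.expandRight (fun i => (D i).relabel (σ i)) = (c.innerLabel σ).expandRight D :=
        TripleSymbol.mk_eq_of_label fun _ => rfl
      rw [multiSymbol, multiSymbol, h1]
    refine Eq.trans ?_ (congrArg (fun E => E fun i => θ.toFun _ (c.y i)) this)
    rw [MultilinearMap.compLinearMap_apply]
    have key : (c.inner σ).multiEval act N = c.multiEval act N := multiEval_ext fun D =>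
      (multiEval_mk act (c.inner σ) D).trans (multiEval_mk act c D).symm
    refine (congrArg (fun E => E fun i => θ.toFun _ (R.rep _ (σ i) (c.y i))) key).trans ?_
    simp only [θ.map_rep]
    rfl
  outer c s := multiEval_outer act c s _ fun i => θ.map_mem _ _ _ (c.hy i)

/-- The map `x(y_*) ↦ ± λ(x(p_*))(z_{**})` for `θ(y_i) = p_i(z_{i*})`. -/
def rightSubst (m : ℕ) : CompositeModule L R m →ₗ[K] CompositeModule A N m :=
  CompositeModule.lift _ (rightSubst_respects act θ).rel

theorem rightSubst_mk (c : CompositeSymbol L R m) :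
    rightSubst act θ m (CompositeModule.mk c) = c.multiEval act N fun i => θ.toFun _ (c.y i) :=
  CompositeModule.lift_mk _ _ _

theorem rightSubst_mk_of_eq (c : CompositeSymbol L R m) (D : ∀ i, CompositeSymbol P N (c.n i))
    (h : ∀ i, θ.toFun _ (c.y i) = CompositeModule.mk (D i)) :
    rightSubst act θ m (CompositeModule.mk c) = c.multiSymbol act D := by
  rw [rightSubst_mk, ← multiEval_mk]
  exact congrArg _ (funext h)

end RightSubst


/-! ### Quasi-free left modules: coordinates and the substitution map L ∘ R → A ∘ N. -/

noncomputable section LeftQuasiFree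

variable {K : Type u} [CommRing K] {P : DGOperad.{u, v} K}

open CompositeModule CompositeSymbol TripleSymbol

/-- The counterpart of `mk_act_left` for the factors: a composite whose factors are all products is
a right evaluation up to the unshuffling sign. -/
theorem TripleSymbol.rightAt_eq {L : DGSymModule.{u, v₁} K} {Q : DGSymModule.{u, v₂} K}
    {N : DGSymModule.{u, v₃} K} {A : DGSymModule.{u, v₄} K} {R : DGSymModule.{u, w} K} {m : ℕ}
    (act : GrHom (compose Q N) A) (c : CompositeSymbol L R m)
    (D : ∀ i, CompositeSymbol Q N (c.n i)) (y : ∀ i, A (c.n i))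
    (hy : ∀ i, y i ∈ A.gr (c.n i) (c.b i))
    (h : ∀ i, y i = act.toFun _ (compose.mk (D i))) :
    CompositeModule.mk ⟨c.r, c.n, c.e, c.a, c.x, c.hx, c.b, y, hy⟩
      = (-1 : K) ^ (c.expandRight D).signExp • (c.expandRight D).evalRight act := by
  rw [evalRight_eq act (c.expandRight D) c.n fun i => (D i).e, smul_smul, neg_one_pow_mul_self,
    one_smul]
  refine mk_eq_mk (fun p => ?_) rfl h
  obtain ⟨i, k⟩ := p
  obtain ⟨⟨k, j⟩, rfl⟩ := (D i).e.surjective k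
  exact (rightAt_e_apply act (c.expandRight D) c.n (fun i => (D i).e) i k j).symm

namespace DGLeftModule.QuasiFree

variable {R : DGLeftModule.{u, v, v₁} P} {N : DGSymModule.{u, v₂} K} (F : R.QuasiFree N)

/-- The isomorphism `P ∘ N ≅ R`. -/
def ext : GrHom (compose P.toDGSymModule N) R.toDGSymModule :=
  R.action.toGrHom.comp (compose.grMap (GrHom.id P.toDGSymModule) F.ι)

theorem ext_mk {m : ℕ} (c : CompositeSymbol P.toDGSymModule N m) :
    F.ext.toFun m (compose.mk c)
      = R.action.toFun m (compose.mk (compose.mapSymbol (GrHom.id P.toDGSymModule) F.ι c)) :=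
  congrArg (R.action.toFun m) (compose.mapHom_mk _ _ _)

/-- The isomorphism `R ≅ P ∘ N`. -/
def coord : GrHom R.toDGSymModule (compose P.toDGSymModule N) := F.ext.inverse F.bijective

theorem coord_ext (m : ℕ) (z : CompositeModule P.toDGSymModule N m) :
    F.coord.toFun m (F.ext.toFun m z) = z := GrHom.inverse_apply _ _ _ _

theorem ext_coord (m : ℕ) (x : R.carrier m) :
    F.ext.toFun m (F.coord.toFun m x) = x := GrHom.apply_inverse _ _ _ _

theorem coord_ι {n b : ℕ} {y : N n} (hy : y ∈ N.gr n b) :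
    F.coord.toFun n (F.ι.toFun n y) = CompositeModule.mk (unitLeft P.one_mem hy) := by
  rw [← F.coord_ext n (CompositeModule.mk _)]
  refine congrArg _ ((F.ext_mk _).trans ?_).symm
  exact R.one_action n b _ (F.ι.map_mem _ _ _ hy)

/-- Induction on families of homogeneous elements of `R`. -/
theorem family_induction {J : Type*} [Fintype J] [DecidableEq J] {n b : J → ℕ}
    (p : ∀ y : ∀ j, R.carrier (n j), (∀ j, y j ∈ R.gr (n j) (b j)) → Prop)
    (mk : ∀ D : ∀ j, CompositeSymbol P.toDGSymModule N (n j), (∀ j, (D j).deg = b j) → ∀ hy,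
      p (fun j => F.ext.toFun _ (compose.mk (D j))) hy)
    (zero : ∀ y hy j, y j = 0 → p y hy)
    (lin : ∀ (y : ∀ j, R.carrier (n j)) (j : J) (α β : K) (y' y'' : ∀ j, R.carrier (n j))
      (hy : ∀ j, y j ∈ R.gr (n j) (b j)) (hy' : ∀ j, y' j ∈ R.gr (n j) (b j))
      (hy'' : ∀ j, y'' j ∈ R.gr (n j) (b j)), y j = α • y' j + β • y'' j →
      (∀ i, i ≠ j → y' i = y i) → (∀ i, i ≠ j → y'' i = y i) → p y' hy' → p y'' hy'' → p y hy)
    (y : ∀ j, R.carrier (n j)) (hy : ∀ j, y j ∈ R.gr (n j) (b j)) : p y hy := by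
  suffices H : ∀ v : ∀ j, CompositeModule P.toDGSymModule N (n j),
      (∀ j, v j ∈ CompositeModule.gr P.toDGSymModule N (n j) (b j)) →
      ∀ hv, p (fun j => F.ext.toFun _ (v j)) hv by
    have h1 : (fun j => F.ext.toFun _ (F.coord.toFun _ (y j))) = y := funext fun j => F.ext_coord _ _
    have h2 : ∀ y', y' = y → (∀ hv, p y' hv) → p y hy := by
      rintro _ rfl h
      exact h hy
    exact h2 _ h1 (H (fun j => F.coord.toFun _ (y j)) fun j => F.coord.map_mem _ _ _ (hy j))
  intro v hv
  refine pi_span_induction (K := K) (V := fun j => CompositeModule P.toDGSymModule N (n j))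
    (fun j => {z | ∃ d : CompositeSymbol P.toDGSymModule N (n j), d.deg = b j ∧
      CompositeModule.mk d = z}) (fun v => ∀ hv, p (fun j => F.ext.toFun _ (v j)) hv) ?_ ?_ ?_ v hv
  · intro v hv
    choose D hdeg hD using hv
    obtain rfl : (fun i => CompositeModule.mk (D i)) = v := funext hD
    exact mk D hdeg
  · intro v j hj hv
    exact zero _ _ j (by rw [hj, map_zero])
  · intro v j α β x x' hv hx hx' ih ih' h
    have hm : ∀ x, x ∈ CompositeModule.gr P.toDGSymModule N (n j) (b j) →
        ∀ i, F.ext.toFun _ (Function.update v j x i) ∈ R.gr (n i) (b i) := by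
      intro x hx i
      rcases eq_or_ne i j with rfl | hi
      · simpa using F.ext.map_mem _ _ _ hx
      · simpa [hi] using F.ext.map_mem _ _ _ (hv i)
    exact lin _ j α β _ _ h (hm x hx) (hm x' hx') (by simp) (fun i hi => by simp [hi])
      (fun i hi => by simp [hi]) (ih _) (ih' _)

variable {L : DGSymModule.{u, v₃} K} {A : DGSymModule.{u, v₄} K} {m : ℕ}

/-- The map `L ∘ N → L ∘ R → X`. -/
def lead {X : Type*} [AddCommGroup X] [Module K X]
    (f : CompositeModule L R.toDGSymModule m →ₗ[K] X) : CompositeModule L N m →ₗ[K] X :=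
  f ∘ₗ compose.mapHom (GrHom.id L) F.ι m

theorem lead_mk {X : Type*} [AddCommGroup X] [Module K X]
    (f : CompositeModule L R.toDGSymModule m →ₗ[K] X) (c : CompositeSymbol L N m) :
    F.lead f (CompositeModule.mk c)
      = f (CompositeModule.mk (compose.mapSymbol (GrHom.id L) F.ι c)) :=
  congrArg f (compose.mapHom_mk _ _ _)

/-- A map which coequalizes the actions is determined by its restriction to `L ∘ N`. -/
theorem lead_rightSubst (act : GrHom (compose L P.toDGSymModule) L) {X : Type*} [AddCommGroup X]
    [Module K X] (f : CompositeModule L R.toDGSymModule m →ₗ[K] X)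
    (hf : ∀ t : TripleSymbol L P.toDGSymModule R.toDGSymModule m,
      f (t.evalLeft act) = f (t.evalRight R.action.toGrHom))
    (z : CompositeModule L R.toDGSymModule m) :
    F.lead f (rightSubst act F.coord m z) = f z := by
  suffices H : F.lead f ∘ₗ rightSubst act F.coord m = f from LinearMap.congr_fun H z
  refine CompositeModule.hom_ext fun c => ?_
  refine F.family_induction (n := c.n) (b := c.b) (fun y hy =>
    (F.lead f ∘ₗ rightSubst act F.coord m) (CompositeModule.mk { c with y := y, hy := hy })
      = f (CompositeModule.mk { c with y := y, hy := hy })) ?_ ?_ ?_ c.y c.hy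
  · intro D hdeg hy
    rw [LinearMap.comp_apply, rightSubst_mk_of_eq act F.coord { c with y := _, hy := hy } D fun i => F.coord_ext _ _]
    set t : TripleSymbol L P.toDGSymModule R.toDGSymModule m :=
      c.expandRight fun i => compose.mapSymbol (GrHom.id P.toDGSymModule) F.ι (D i) with ht
    have h1 := TripleSymbol.rightAt_eq R.action.toGrHom c
      (fun i => compose.mapSymbol (GrHom.id P.toDGSymModule) F.ι (D i)) _ hy fun i => F.ext_mk (D i)
    rw [h1, map_smul, ← hf]
    refine (map_smul (F.lead f) _ _).trans (congrArg _ ?_)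
    exact F.lead_mk f _
  · intro y hy j hj
    rw [mk_eq_zero_of_right { c with y := y, hy := hy } j hj, map_zero, map_zero]
  · intro y j α β y' y'' hy hy' hy'' h h' h'' ih ih'
    rw [mk_lin_right { c with y := y, hy := hy } j α β y' y'' hy' hy'' h h' h'', map_add, map_smul,
      map_smul, ih, ih', map_add, map_smul, map_smul]

/-- In coordinates the action of P on R is that of the free left module P ∘ N. This follows from the
coequalizing property of the action map itself, which is associativity. -/
theorem coord_action (z : CompositeModule P.toDGSymModule R.toDGSymModule m) :
    F.coord.toFun m (R.action.toFun m z) = rightSubst P.mul.toGrHom F.coord m z := by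
  rw [← F.lead_rightSubst P.mul.toGrHom (R.action.toFun m)
    (fun t => (R.assoc m t).trans (map_smul (R.action.toFun m) _ _).symm)]
  exact F.coord_ext _ _

/-- `x(1(y_1),…,1(y_r)) ↦ x(y_1,…,y_r)` -/
theorem rightSubst_mapHom_ι (act : GrHom (compose L P.toDGSymModule) A) (f : GrHom L A)
    (hact : ∀ (r a : ℕ) (x : L r) (hx : x ∈ L.gr r a),
      act.toFun r (compose.mk (unitRight hx P.one_mem)) = f.toFun r x)
    (z : CompositeModule L N m) :
    rightSubst act F.coord m (compose.mapHom (GrHom.id L) F.ι m z)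
      = compose.mapHom f (GrHom.id N) m z := by
  refine LinearMap.congr_fun (f := rightSubst act F.coord m ∘ₗ compose.mapHom (GrHom.id L) F.ι m)
    (g := compose.mapHom f (GrHom.id N) m) (CompositeModule.hom_ext fun c => ?_) z
  rw [LinearMap.comp_apply, compose.mapHom_mk, compose.mapHom_mk]
  let D : ∀ i, CompositeSymbol P.toDGSymModule N (c.n i) := fun i => unitLeft P.one_mem (c.hy i)
  have h0 : ∀ i, F.coord.toFun _ (F.ι.toFun _ (c.y i)) = CompositeModule.mk (D i) :=
    fun i => F.coord_ι (c.hy i)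
  refine (rightSubst_mk_of_eq act F.coord (compose.mapSymbol (GrHom.id L) F.ι c) D h0).trans ?_
  set t : TripleSymbol L P.toDGSymModule N m := c.expandRight D with ht
  have h1 : t.signExp = 0 := Finset.sum_eq_zero fun i _ => Finset.sum_eq_zero fun j _ => by
    split_ifs
    exacts [Nat.mul_zero _, rfl]
  have h2 : t.lexExp (Equiv.sigmaUnique (Fin c.r) fun _ => Fin 1) = 0 := by
    refine invExp_eq_zero _ _ _ fun p q h => ?_
    rw [finSigmaFinEquiv_lt_iff] at h
    rcases h with h | ⟨-, h⟩
    · exact h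
    · have h3 := p.2.isLt
      have h4 := q.2.isLt
      change (p.2 : ℕ) < 1 at h3
      change (q.2 : ℕ) < 1 at h4
      omega
  have h3 : multiSymbol act (compose.mapSymbol (GrHom.id L) F.ι c) D = (-1 : K) ^ t.signExp • t.evalLeft act := rfl
  rw [h3, h1, pow_zero, one_smul, evalLeft_eq act t (Equiv.sigmaUnique (Fin c.r) fun _ => Fin 1),
    h2, pow_zero, one_smul]
  refine mk_eq_mk (fun _ => rfl) ?_ fun _ => rfl
  exact hact c.r c.a c.x c.hx

end DGLeftModule.QuasiFree

end LeftQuasiFree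


/-! ### Substitution in the factors coequalizes the two actions. -/

noncomputable section LeftPentagon

variable {K : Type u} [CommRing K] {P : DGOperad.{u, v} K}

open CompositeModule CompositeSymbol TripleSymbol

theorem mk_ofIndex_reindex_of_eq {M : DGSymModule.{u, v} K} {N : DGSymModule.{u, w} K} {m : ℕ}
    {I J : Type} {r : ℕ} (γ : J ≃ I) (β : Fin r ≃ J) (α : Fin r ≃ I)
    (hβ : ∀ k, γ (β k) = α k) {a : ℕ} {x : M r} (hx : x ∈ M.gr r a)
    (n : I → ℕ) (b : I → ℕ) {y : ∀ i, N (n i)} (hy : ∀ i, y i ∈ N.gr (n i) (b i))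
    (e : (Σ i, Fin (n i)) ≃ Fin m) (e' : (Σ j, Fin (n (γ j))) ≃ Fin m)
    (he : ∀ j l, e' ⟨j, l⟩ = e ⟨γ j, l⟩) :
    CompositeModule.mk (ofIndex α hx n b hy e)
      = CompositeModule.mk (ofIndex β hx (n ∘ γ) (b ∘ γ) (fun j => hy (γ j)) e') := by
  obtain rfl : (Equiv.sigmaCongrLeft (β := fun i => Fin (n i)) γ).trans e = e' :=
    Equiv.ext fun p => (he p.1 p.2).symm
  exact mk_ofIndex_reindex γ β α hβ hx n b hy e

namespace TripleSymbol

variable {L : DGRightModule.{u, v, v₁} P} {R : DGSymModule.{u, v₂} K} {N : DGSymModule.{u, v₃} K}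
  {m : ℕ} (t : TripleSymbol L.toDGSymModule P.toDGSymModule R m)
  (D : ∀ p : (Σ i, Fin (t.n i)), CompositeSymbol P.toDGSymModule N (t.l p.1 p.2))

/-- The composite element `λ(x(q_*))(p_{**}(z_{***}))`. -/
abbrev expandLeaves : TripleSymbol L.toDGSymModule P.toDGSymModule N m :=
  (t.left L.action.toGrHom).expandRight fun j => D (finSigmaFinEquiv.symm j)

/-- The enumeration of the inputs of `x(q_*(p_{**}))`. -/
def nodeEquiv : (Σ p : (Σ i, Fin (t.n i)), Fin (D p).r) ≃
    Fin (∑ j, (D (finSigmaFinEquiv.symm j)).r) :=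
  (Equiv.sigmaCongrLeft (β := fun p => Fin (D p).r) finSigmaFinEquiv.symm).symm.trans
    finSigmaFinEquiv

theorem nodeEquiv_apply (p : Σ j, Fin (D (finSigmaFinEquiv.symm j)).r) :
    nodeEquiv t D ⟨finSigmaFinEquiv.symm p.1, p.2⟩ = finSigmaFinEquiv p :=
  congrArg finSigmaFinEquiv ((Equiv.sigmaCongrLeft (β := fun p => Fin (D p).r)
    finSigmaFinEquiv.symm).symm_apply_apply p)

theorem nodeEquiv_lt (p p' : Σ i, Fin (t.n i)) (l : Fin (D p).r) (l' : Fin (D p').r)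
    (h : finSigmaFinEquiv p < finSigmaFinEquiv p' ∨ p = p' ∧ (l : ℕ) < l') :
    nodeEquiv t D ⟨p, l⟩ < nodeEquiv t D ⟨p', l'⟩ := by
  obtain ⟨j, rfl⟩ := finSigmaFinEquiv.symm.surjective p
  obtain ⟨j', rfl⟩ := finSigmaFinEquiv.symm.surjective p'
  have h1 := nodeEquiv_apply t D ⟨j, l⟩
  have h2 := nodeEquiv_apply t D ⟨j', l'⟩
  simp only at h1 h2
  rw [h1, h2, finSigmaFinEquiv_lt_iff]
  simpa only [Equiv.apply_symm_apply, EmbeddingLike.apply_eq_iff_eq] using h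

/-- The composite element `x(q_*(p_{**}))`. -/
abbrev nodes : TripleSymbol L.toDGSymModule P.toDGSymModule P.toDGSymModule
    (∑ j, (D (finSigmaFinEquiv.symm j)).r) where
  r := t.r
  n := t.n
  l := fun i k => (D ⟨i, k⟩).r
  e := nodeEquiv t D
  a := t.a
  x := t.x
  hx := t.hx
  b := t.b
  q := t.q
  hq := t.hq
  c := fun i k => (D ⟨i, k⟩).a
  s := fun i k => (D ⟨i, k⟩).x
  hs := fun i k => (D ⟨i, k⟩).hx

/-- The composite element `q_i(p_{i*}(z_{i**}))`. -/
abbrev branch (i : Fin t.r) :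
    TripleSymbol P.toDGSymModule P.toDGSymModule N (∑ k, t.l i k) :=
  (t.qs i).expandRight fun k => D ⟨i, k⟩

/-- The composite element `x(μ(q_*(p_{**}))(z_{***}))`. -/
abbrev expandBranches {A : DGSymModule.{u, v₄} K} (act : GrHom (compose P.toDGSymModule R) A) :
    TripleSymbol L.toDGSymModule P.toDGSymModule N m :=
  (t.right act).expandRight fun i => (t.branch D i).left P.mul.toGrHom

/-- The labelling of the inputs of the `z_{***}`. -/
def leafLabel : (Σ p : (Σ p : (Σ i, Fin (t.n i)), Fin (D p).r), Fin ((D p.1).n p.2)) ≃ Fin m :=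
  ((Equiv.sigmaAssoc fun p l => Fin ((D p).n l)).trans
    (Equiv.sigmaCongrRight fun p => (D p).e)).trans t.e

/-- The indexing of the factors `z_{***}`. -/
def branchEquiv : (Σ i, Fin (∑ k, (D ⟨i, k⟩).r)) ≃ (Σ p : (Σ i, Fin (t.n i)), Fin (D p).r) :=
  (Equiv.sigmaCongrRight fun _ => finSigmaFinEquiv.symm).trans
    (Equiv.sigmaAssoc fun i k => Fin (D ⟨i, k⟩).r).symm

/-- Associativity of the right module L for x(q_*(p_{**})), applied to the root. -/
theorem evalLeft_expandLeaves :
    (t.expandLeaves D).evalLeft L.action.toGrHom = (-1 : K) ^ (t.nodes D).signExp •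
      CompositeModule.mk (ofIndex (nodeEquiv t D).symm
        (L.action.map_mem _ _ _ (CompositeModule.mk_mem_gr ((t.nodes D).right P.mul.toGrHom)))
        (fun p => (D p.1).n p.2) (fun p => (D p.1).b p.2) (fun p => (D p.1).hy p.2)
        (leafLabel t D)) := by
  have h1 : L.action.toFun _ (compose.mk (t.expandLeaves D).xq)
      = (-1 : K) ^ (t.nodes D).signExp •
        L.action.toFun _ (compose.mk ((t.nodes D).right P.mul.toGrHom)) := by
    rw [← L.assoc]
    refine congrArg (L.action.toFun _) (mk_eq_mk (fun p => ?_) rfl fun _ => rfl)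
    exact (nodeEquiv_apply t D p).symm
  rw [mk_ofIndex_reindex (Equiv.sigmaCongrLeft (β := fun p => Fin (D p).r) finSigmaFinEquiv.symm)
    finSigmaFinEquiv.symm (nodeEquiv t D).symm fun k => by
      obtain ⟨p, rfl⟩ := finSigmaFinEquiv.surjective k
      rw [Equiv.symm_apply_apply, ← nodeEquiv_apply t D p, Equiv.symm_apply_apply]
      rfl]
  rw [← mk_smul_left]
  exact mk_eq_mk (fun p => rfl) h1 fun _ => rfl

/-- No sign occurs: listing the p_{ik} branch by branch, or all together lexicographically, gives
the same order on the inputs. -/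
theorem evalLeft_expandBranches {A : DGSymModule.{u, v₄} K}
    (act : GrHom (compose P.toDGSymModule R) A) :
    (t.expandBranches D act).evalLeft L.action.toGrHom =
      CompositeModule.mk (ofIndex (nodeEquiv t D).symm
        (L.action.map_mem _ _ _ (CompositeModule.mk_mem_gr ((t.nodes D).right P.mul.toGrHom)))
        (fun p => (D p.1).n p.2) (fun p => (D p.1).b p.2) (fun p => (D p.1).hy p.2)
        (leafLabel t D)) := by
  have h1 : (t.expandBranches D act).lexExp ((t.nodes D).right P.mul.toGrHom).e = 0 := by
    refine invExp_eq_zero _ _ _ fun p q h => ?_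
    obtain ⟨i, κ⟩ := p
    obtain ⟨i', κ'⟩ := q
    obtain ⟨⟨k, j⟩, rfl⟩ := finSigmaFinEquiv.surjective κ
    obtain ⟨⟨k', j'⟩, rfl⟩ := finSigmaFinEquiv.surjective κ'
    have h2 : ∀ i k (j : Fin (D ⟨i, k⟩).r), ((t.nodes D).right P.mul.toGrHom).e
        ⟨i, finSigmaFinEquiv ⟨k, j⟩⟩ = nodeEquiv t D ⟨⟨i, k⟩, j⟩ := fun i k j =>
      rightAt_e_apply P.mul.toGrHom (t.nodes D) _ (fun _ => finSigmaFinEquiv) i k j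
    refine (h2 i k j).trans_lt (LT.lt.trans_eq ?_ (h2 i' k' j').symm)
    refine nodeEquiv_lt t D _ _ _ _ ?_
    rw [finSigmaFinEquiv_lt_iff] at h ⊢
    rcases h with h | ⟨rfl, h⟩
    · exact Or.inl (Or.inl h)
    · have h3 := (finSigmaFinEquiv_lt_iff (n := fun k => (D ⟨i, k⟩).r) ⟨k, j⟩ ⟨k', j'⟩).1 h
      rcases h3 with h3 | ⟨rfl, h3⟩
      · exact Or.inl (Or.inr ⟨rfl, h3⟩)
      · exact Or.inr ⟨rfl, h3⟩
  rw [evalLeft_eq L.action.toGrHom (t.expandBranches D act) ((t.nodes D).right P.mul.toGrHom).e, h1,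
    pow_zero, one_smul]
  have h2 : ∀ (q : Σ i, Fin (∑ k, (D ⟨i, k⟩).r))
      (l : Fin ((D ⟨q.1, (finSigmaFinEquiv.symm q.2).1⟩).n (finSigmaFinEquiv.symm q.2).2)),
      (t.expandBranches D act).e ⟨q, l⟩ = leafLabel t D ⟨branchEquiv t D q, l⟩ := fun q l =>
    rightAt_e_apply act t (fun i => ∑ k, t.l i k) (fun _ => finSigmaFinEquiv) q.1
      (finSigmaFinEquiv.symm q.2).1
      ((D ⟨q.1, (finSigmaFinEquiv.symm q.2).1⟩).e ⟨(finSigmaFinEquiv.symm q.2).2, l⟩)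
  exact (mk_ofIndex_reindex_of_eq (branchEquiv t D) ((t.nodes D).right P.mul.toGrHom).e.symm
    (nodeEquiv t D).symm (fun k => (branchEquiv t D).apply_symm_apply _)
    (L.action.map_mem _ _ _ (CompositeModule.mk_mem_gr ((t.nodes D).right P.mul.toGrHom)))
    (fun p => (D p.1).n p.2) (fun p => (D p.1).b p.2) (fun p => (D p.1).hy p.2)
    (leafLabel t D) (t.expandBranches D act).e h2).symm

/-- Let Q and S be the degrees of the p_{ik} and the total degrees of the z's over them. The pairs
of a z before a p split into pairs in different branches and pairs in one branch, by `sum_lex_lt`;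
the remaining terms match since s_{ik} has degree Q + S. -/
theorem signExp_expand {A : DGSymModule.{u, v₄} K} (act : GrHom (compose P.toDGSymModule R) A)
    (hD : ∀ p, (D p).deg = t.c p.1 p.2) :
    ((t.expandLeaves D).signExp + (t.nodes D).signExp : ZMod 2)
      = t.signExp + ∑ i, (t.branch D i).signExp + (t.expandBranches D act).signExp := by
  set S : (Σ i, Fin (t.n i)) → ℕ := fun p => ∑ l, (D p).b l with hS
  set Q : (Σ i, Fin (t.n i)) → ℕ := fun p => (D p).a with hQ
  have h1 : (t.expandLeaves D).signExp
      = (∑ i, ∑ j, if i < j then (∑ k, S ⟨i, k⟩) * ∑ k, Q ⟨j, k⟩ else 0)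
        + ∑ i, (t.branch D i).signExp := by
    refine Eq.trans ?_ (sum_lex_lt Q S).symm
    rw [signExp, ← finSigmaFinEquiv.sum_comp]
    refine Finset.sum_congr rfl fun p _ => ?_
    rw [← finSigmaFinEquiv.sum_comp]
    refine Finset.sum_congr rfl fun p' _ => if_congr Iff.rfl ?_ rfl
    exact congrArg₂ (· * ·) (congrArg S (Equiv.symm_apply_apply _ _))
      (congrArg Q (Equiv.symm_apply_apply _ _))
  have h2 : (t.nodes D).signExp
      = ∑ i, ∑ j, if i < j then (∑ k, Q ⟨i, k⟩) * t.b j else 0 := rfl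
  have h3 : t.signExp
      = ∑ i, ∑ j, if i < j then (∑ k, (Q ⟨i, k⟩ + S ⟨i, k⟩)) * t.b j else 0 := by
    refine Finset.sum_congr rfl fun i _ => Finset.sum_congr rfl fun j _ => if_congr Iff.rfl ?_ rfl
    exact congrArg (· * _) (Finset.sum_congr rfl fun k _ => (hD ⟨i, k⟩).symm)
  have h4 : (t.expandBranches D act).signExp
      = ∑ i, ∑ j, if i < j then (∑ k, S ⟨i, k⟩) * (t.b j + ∑ k, Q ⟨j, k⟩) else 0 := by
    refine Finset.sum_congr rfl fun i _ => Finset.sum_congr rfl fun j _ => if_congr Iff.rfl ?_ rfl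
    refine congrArg₂ (· * ·) ?_ rfl
    refine (finSigmaFinEquiv.symm.sum_comp (fun p : (Σ k, Fin (D ⟨i, k⟩).r) =>
      (D ⟨i, p.1⟩).b p.2)).trans ?_
    rw [Fintype.sum_sigma]
  rw [h1, h2, h3, h4]
  push_cast
  have e : ∀ x y z w : ZMod 2, x + z = y + w → x + ∑ i, ((t.branch D i).signExp : ZMod 2) + z
      = y + ∑ i, ((t.branch D i).signExp : ZMod 2) + w := by
    intro x y z w h
    linear_combination h
  refine e _ _ _ _ ?_
  rw [← Finset.sum_add_distrib, ← Finset.sum_add_distrib]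
  refine Finset.sum_congr rfl fun i _ => ?_
  rw [← Finset.sum_add_distrib, ← Finset.sum_add_distrib]
  refine Finset.sum_congr rfl fun j _ => ?_
  split_ifs
  · rw [Finset.sum_add_distrib]
    have h5 := ZMod.two_add_self ((∑ k, (S ⟨i, k⟩ : ZMod 2)) * t.b j)
    linear_combination - h5
  · simp

end TripleSymbol

namespace DGLeftModule.QuasiFree

variable {L : DGRightModule.{u, v, v₁} P} {R : DGLeftModule.{u, v, v₂} P}
  {N : DGSymModule.{u, v₃} K} (F : R.QuasiFree N) {m : ℕ}

/-- When every leaf is a single composite p_{ik}(z_{ik*}), both sides reduce to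
λ(x(μ(q_*(p_{**}))))(z_{***}): the left one by associativity of L, the right one by writing each
ρ(q_i(s_{i*})) in coordinates. -/
theorem rightSubst_eval_of_eq (t : TripleSymbol L.toDGSymModule P.toDGSymModule R.toDGSymModule m)
    (D : ∀ p : (Σ i, Fin (t.n i)), CompositeSymbol P.toDGSymModule N (t.l p.1 p.2))
    (hD : ∀ p, (D p).deg = t.c p.1 p.2)
    (h : ∀ p : (Σ i, Fin (t.n i)), F.coord.toFun _ (t.s p.1 p.2) = CompositeModule.mk (D p)) :
    rightSubst L.action.toGrHom F.coord m (t.evalLeft L.action.toGrHom)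
      = rightSubst L.action.toGrHom F.coord m (t.evalRight R.action.toGrHom) := by
  let E : ∀ j, CompositeSymbol P.toDGSymModule N ((t.left L.action.toGrHom).n j) :=
    fun j => D (finSigmaFinEquiv.symm j)
  have hE : ∀ j, F.coord.toFun _ ((t.left L.action.toGrHom).y j) = CompositeModule.mk (E j) :=
    fun j => h (finSigmaFinEquiv.symm j)
  have h1 := rightSubst_mk_of_eq L.action.toGrHom F.coord (t.left L.action.toGrHom) E hE
  have h2 : ∀ i, F.coord.toFun _ ((t.right R.action.toGrHom).y i)
      = (-1 : K) ^ (t.branch D i).signExp •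
        CompositeModule.mk ((t.branch D i).left P.mul.toGrHom) := by
    intro i
    let B : ∀ k, CompositeSymbol P.toDGSymModule N ((t.qs i).n k) := fun k => D ⟨i, k⟩
    have hB : ∀ k, F.coord.toFun _ ((t.qs i).y k) = CompositeModule.mk (B k) :=
      fun k => h ⟨i, k⟩
    have h4 : F.coord.toFun _ ((t.right R.action.toGrHom).y i)
        = rightSubst P.mul.toGrHom F.coord _ (CompositeModule.mk (t.qs i)) :=
      F.coord_action (CompositeModule.mk (t.qs i))
    rw [h4, rightSubst_mk_of_eq P.mul.toGrHom F.coord (t.qs i) B hB]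
    rfl
  have h3 := rightSubst_mk L.action.toGrHom F.coord (t.right R.action.toGrHom)
  -- Each branch brings its own unshuffling sign, extracted by multilinearity.
  rw [funext h2, MultilinearMap.map_smul_univ, multiEval_mk, Finset.prod_pow_eq_pow_sum] at h3
  refine h1.trans ?_
  rw [evalRight, map_smul, h3, multiSymbol, multiSymbol]
  have h4 := t.evalLeft_expandLeaves D
  rw [← t.evalLeft_expandBranches D R.action.toGrHom] at h4
  rw [h4, smul_smul, smul_smul, smul_smul, ← pow_add, ← pow_add, ← pow_add]
  refine congrArg (· • _) (neg_one_pow_congr_zmod ?_)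
  rw [Nat.cast_add, t.signExp_expand D R.action.toGrHom hD, Nat.cast_add, Nat.cast_add,
    Nat.cast_sum]

/-- The map `L ∘ R → L ∘ N` coequalizes the actions. -/
theorem rightSubst_eval (t : TripleSymbol L.toDGSymModule P.toDGSymModule R.toDGSymModule m) :
    rightSubst L.action.toGrHom F.coord m (t.evalLeft L.action.toGrHom)
      = rightSubst L.action.toGrHom F.coord m (t.evalRight R.action.toGrHom) := by
  refine F.family_induction (J := Σ i, Fin (t.n i)) (n := fun p => t.l p.1 p.2)
    (b := fun p => t.c p.1 p.2) (fun y hy =>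
      rightSubst L.action.toGrHom F.coord m (evalLeft L.action.toGrHom
        { t with s := fun i k => y ⟨i, k⟩, hs := fun i k => hy ⟨i, k⟩ })
      = rightSubst L.action.toGrHom F.coord m (evalRight R.action.toGrHom
        { t with s := fun i k => y ⟨i, k⟩, hs := fun i k => hy ⟨i, k⟩ }))
    ?_ ?_ ?_ (fun p => t.s p.1 p.2) fun p => t.hs p.1 p.2
  · intro D hdeg hy
    let t' : TripleSymbol L.toDGSymModule P.toDGSymModule R.toDGSymModule m :=
      { t with s := fun i k => F.ext.toFun _ (compose.mk (D ⟨i, k⟩)), hs := fun i k => hy ⟨i, k⟩ }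
    have hD : ∀ p : (Σ i, Fin (t'.n i)), F.coord.toFun _ (t'.s p.1 p.2)
        = CompositeModule.mk (D p) := fun p => F.coord_ext _ _
    exact F.rightSubst_eval_of_eq t' D hdeg hD
  · intro y hy p hp
    set t' : TripleSymbol L.toDGSymModule P.toDGSymModule R.toDGSymModule m :=
      { t with s := fun i k => y ⟨i, k⟩, hs := fun i k => hy ⟨i, k⟩ }
    have e1 := t'.evalLeft_lin_s L.action.toGrHom p.1 p.2 0 0 t'.s t'.s t'.hs t'.hs
      (by simpa using hp) (fun _ _ _ => rfl) fun _ _ _ => rfl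
    have e2 := t'.evalRight_lin_s R.action.toGrHom p.1 p.2 0 0 t'.s t'.s t'.hs t'.hs
      (by simpa using hp) (fun _ _ _ => rfl) fun _ _ _ => rfl
    rw [e1, e2]
    simp
  · intro y p α β y' y'' hy hy' hy'' h h' h'' ih ih'
    set t' : TripleSymbol L.toDGSymModule P.toDGSymModule R.toDGSymModule m :=
      { t with s := fun i k => y ⟨i, k⟩, hs := fun i k => hy ⟨i, k⟩ }
    have e1 := t'.evalLeft_lin_s L.action.toGrHom p.1 p.2 α β (fun i k => y' ⟨i, k⟩)
      (fun i k => y'' ⟨i, k⟩) (fun i k => hy' ⟨i, k⟩) (fun i k => hy'' ⟨i, k⟩) h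
      (fun _ _ hne => h' _ hne) fun _ _ hne => h'' _ hne
    have e2 := t'.evalRight_lin_s R.action.toGrHom p.1 p.2 α β (fun i k => y' ⟨i, k⟩)
      (fun i k => y'' ⟨i, k⟩) (fun i k => hy' ⟨i, k⟩) (fun i k => hy'' ⟨i, k⟩) h
      (fun _ _ hne => h' _ hne) fun _ _ hne => h'' _ hne
    rw [e1, e2, map_add, map_smul, map_smul, map_add, map_smul, map_smul]
    exact congrArg₂ (fun a b => α • a + β • b) ih ih'

/-- `L ∘_P (P ∘ N) ≅ L ∘ N`. -/
theorem lead_mkQ_bijective (L : DGRightModule.{u, v, v₁} P) (m : ℕ) :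
    Function.Bijective (F.lead (relComp.mkQ L R m)) := by
  constructor
  · rw [injective_iff_map_eq_zero]
    intro z hz
    have h1 := F.rightSubst_mapHom_ι L.action.toGrHom (GrHom.id L.toDGSymModule) L.action_one z
    have h2 : compose.mapHom (GrHom.id L.toDGSymModule) (GrHom.id N) m z = z :=
      LinearMap.congr_fun (f := compose.mapHom (GrHom.id L.toDGSymModule) (GrHom.id N) m)
        (g := LinearMap.id) (CompositeModule.hom_ext fun c => compose.mapHom_mk _ _ _) z
    rw [← h2, ← h1]
    exact lift_relCompRel F.rightSubst_eval hz
  · intro x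
    obtain ⟨z, rfl⟩ := relComp.mkQ_surjective L R m x
    exact ⟨_, F.lead_rightSubst L.action.toGrHom (relComp.mkQ L R m) (relComp.mkQ_eval L R) z⟩

end DGLeftModule.QuasiFree

end LeftPentagon


/-! ### Operators on the factors that depend on the labels of their inputs. -/

noncomputable section LabelOperators

variable {K : Type u} [CommRing K]

open CompositeModule CompositeSymbol

/-- A family of operators of degree `ε`, which may depend on the labels of the inputs, and which is
compatible with permutations of the labelled inputs. -/
structure LabelFam (N : DGSymModule.{u, v} K) (N' : DGSymModule.{u, w} K) (m ε : ℕ) where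
  toFun : ∀ {n : ℕ}, (Fin n → Fin m) → N n →ₗ[K] N' n
  map_mem : ∀ {n : ℕ} (f : Fin n → Fin m) (b : ℕ) (y : N n), y ∈ N.gr n b →
    toFun f y ∈ N'.gr n (b + ε)
  map_rep : ∀ {n : ℕ} (f : Fin n → Fin m), Function.Injective f →
    ∀ (σ : Equiv.Perm (Fin n)) (y : N n), N'.rep n σ (toFun (f ∘ σ) y) = toFun f (N.rep n σ y)

variable {M : DGSymModule.{u, v} K} {N : DGSymModule.{u, w} K} {N' : DGSymModule.{u, v₁} K} {m : ℕ}

theorem CompositeSymbol.label_injective (c : CompositeSymbol M N m) (i : Fin c.r) :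
    Function.Injective fun k => c.e ⟨i, k⟩ := fun k l h => by
  simpa using c.e.injective h

section Inner

/-- The composite element `x(v(y_1),…,v(y_r))`. -/
abbrev CompositeSymbol.mapLabel (V : LabelFam N N' m 0) (c : CompositeSymbol M N m) :
    CompositeSymbol M N' m :=
  { c with
    y := fun i => V.toFun (fun k => c.e ⟨i, k⟩) (c.y i)
    hy := fun i => V.map_mem _ _ _ (c.hy i) }

/-- Equivariance of the operators themselves is not required: a permutation of the inputs of y_i
also permutes their labels, and compatibility with this simultaneous change is what `LabelFam`
demands. -/
theorem mapLabel_respects (V : LabelFam N N' m 0) :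
    CompositeSymbol.Respects fun c : CompositeSymbol M N m => CompositeModule.mk (c.mapLabel V) where
  lin_left c α β x' x'' hx' hx'' h := mk_lin_left (c.mapLabel V) α β x' x'' hx' hx'' h
  lin_right c i α β y' y'' hy' hy'' h h' h'' := by
    refine mk_lin_right (c.mapLabel V) i α β _ _
      (CompositeSymbol.mapLabel V { c with y := y', hy := hy' }).hy
      (CompositeSymbol.mapLabel V { c with y := y'', hy := hy'' }).hy ?_ ?_ ?_
    · simp only [h, map_add, map_smul]
    · intro (j : Fin c.r) hj
      simp only [h' j hj]
    · intro (j : Fin c.r) hj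
      simp only [h'' j hj]
  inner c σ := by
    refine Eq.trans ?_ (mk_inner (CompositeSymbol.mk c.r c.n c.e c.a c.x c.hx c.b
      ((c.innerLabel σ).mapLabel V).y ((c.innerLabel σ).mapLabel V).hy) σ)
    exact mk_eq_mk (fun _ => rfl) rfl fun i => (V.map_rep _ (c.label_injective i) (σ i) (c.y i)).symm
  outer c s := mk_outer (c.mapLabel V) s

/-- The map `x(y_1,…,y_r) ↦ x(v(y_1),…,v(y_r))`. -/
def mapLabel (M : DGSymModule.{u, v} K) (V : LabelFam N N' m 0) :
    CompositeModule M N m →ₗ[K] CompositeModule M N' m :=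
  CompositeModule.lift _ (mapLabel_respects V).rel

theorem mapLabel_mk (V : LabelFam N N' m 0) (c : CompositeSymbol M N m) :
    mapLabel M V (CompositeModule.mk c) = CompositeModule.mk (c.mapLabel V) :=
  CompositeModule.lift_mk _ _ _

theorem dHom_mapLabel (V : LabelFam N N' m 0)
    (h : ∀ (n : ℕ) (f : Fin n → Fin m) (y : N n), N'.d n (V.toFun f y) = V.toFun f (N.d n y))
    (z : CompositeModule M N m) :
    dHom M N' m (mapLabel M V z) = mapLabel M V (dHom M N m z) := by
  refine LinearMap.congr_fun (f := dHom M N' m ∘ₗ mapLabel M V) (g := mapLabel M V ∘ₗ dHom M N m)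
    (CompositeModule.hom_ext fun c => ?_) z
  rw [LinearMap.comp_apply, LinearMap.comp_apply, mapLabel_mk, dHom_mk, dHom_mk, dMk, dMk, map_add,
    map_sum, mapLabel_mk]
  congr 1
  refine Finset.sum_congr rfl fun i _ => ?_
  rw [map_smul, mapLabel_mk]
  refine congrArg _ (mk_eq_mk (fun _ => rfl) rfl fun j => ?_)
  rcases eq_or_ne j i with rfl | hj
  · simp [h]
  · simp [hj]

end Inner

section Slot

/-- The composite element `x(y_1,…,z,…,y_r)`. -/
abbrev CompositeSymbol.slot (c : CompositeSymbol M N m) (i : Fin c.r) {β : ℕ} {z : N (c.n i)}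
    (hz : z ∈ N.gr (c.n i) β) : CompositeSymbol M N m :=
  { c with
    b := Function.update c.b i β
    y := Function.update c.y i z
    hy := by
      intro j
      rcases eq_or_ne j i with rfl | hj
      · simpa using hz
      · simpa [Function.update_of_ne hj] using c.hy j }

variable (V : LabelFam N N m 1)

/-- The composite element `x(y_1,…,v(y_i),…,y_r)`. -/
abbrev CompositeSymbol.slotLabel (c : CompositeSymbol M N m) (i : Fin c.r) : CompositeSymbol M N m :=
  c.slot i (V.map_mem (fun k => c.e ⟨i, k⟩) _ _ (c.hy i))

/-- `∑_i ± x(y_1,…,v(y_i),…,y_r)` -/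
def slotSum (c : CompositeSymbol M N m) : CompositeModule M N m :=
  ∑ i, (-1 : K) ^ c.dExp i • CompositeModule.mk (c.slotLabel V i)

/-- This is `koszul_sign` for the degrees with the relevant one raised by 1. An operator of degree
+1 on one factor obeys the same sign rule as the differential. -/
theorem koszul_sign_succ {r : ℕ} (s : Equiv.Perm (Fin r)) (b : Fin r → ℕ) (i : Fin r) :
    (-1 : K) ^ (∑ j, if j < s i then b j else 0)
        * (-1) ^ koszulExp s (Function.update b (s i) (b (s i) + 1))
      = (-1 : K) ^ koszulExp s b * (-1) ^ (∑ j, if j < i then b (s j) else 0) := by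
  have h := koszul_sign (K := K) s (Function.update b (s i) (b (s i) + 1)) i (by simp)
  rw [Function.update_self, Nat.add_sub_cancel, Function.update_idem, Function.update_eq_self] at h
  have h1 : (∑ j, if j < s i then Function.update b (s i) (b (s i) + 1) j else 0)
      = ∑ j, if j < s i then b j else 0 := Finset.sum_congr rfl fun j _ => by
    split_ifs with hj
    · rw [Function.update_of_ne hj.ne]
    · rfl
  have h2 : (∑ j, if j < i then Function.update b (s i) (b (s i) + 1) (s j) else 0)
      = ∑ j, if j < i then b (s j) else 0 := Finset.sum_congr rfl fun j _ => by
    split_ifs with hj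
    · rw [Function.update_of_ne (fun h => hj.ne (s.injective h))]
    · rfl
  rw [h1, h2] at h
  generalize (∑ j, if j < s i then b j else 0) = A at *
  generalize (∑ j, if j < i then b (s j) else 0) = B at *
  have hA := neg_one_pow_mul_self (K := K) A
  have hB := neg_one_pow_mul_self (K := K) B
  generalize (-1 : K) ^ koszulExp s (Function.update b (s i) (b (s i) + 1)) = k at *
  generalize (-1 : K) ^ koszulExp s b = l at *
  linear_combination (-1 : K) ^ A * (-1) ^ B * (-h) + (-1) ^ B * l * hA - (-1) ^ A * k * hB

theorem slotSum_respects :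
    CompositeSymbol.Respects (slotSum V : CompositeSymbol M N m → CompositeModule M N m) where
  lin_left c α β x' x'' hx' hx'' h := by
    simp only [slotSum]
    rw [Finset.smul_sum, Finset.smul_sum, ← Finset.sum_add_distrib]
    refine Finset.sum_congr rfl fun i _ => ?_
    exact smul_lin_comb _ (mk_lin_left (c.slotLabel V i) α β x' x'' hx' hx'' h)
  lin_right c i α β y' y'' hy' hy'' h h' h'' := by
    simp only [slotSum]
    rw [Finset.smul_sum, Finset.smul_sum, ← Finset.sum_add_distrib]
    refine Finset.sum_congr rfl fun k _ => smul_lin_comb _ ?_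
    refine mk_lin_right (c.slotLabel V k) i α β _ _
      (CompositeSymbol.slotLabel V { c with y := y', hy := hy' } k).hy
      (CompositeSymbol.slotLabel V { c with y := y'', hy := hy'' } k).hy ?_ ?_ ?_
    · rcases eq_or_ne i k with rfl | hk
      · simp [h]
      · simp [Function.update_of_ne hk, h]
    · intro (j : Fin c.r) hj
      rcases eq_or_ne j k with rfl | hk
      · simp [h' _ hj]
      · simp [Function.update_of_ne hk, h' _ hj]
    · intro (j : Fin c.r) hj
      rcases eq_or_ne j k with rfl | hk
      · simp [h'' _ hj]
      · simp [Function.update_of_ne hk, h'' _ hj]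
  inner c σ := by
    refine Finset.sum_congr rfl fun k _ => congrArg _ ?_
    refine Eq.trans ?_ (mk_inner (CompositeSymbol.mk c.r c.n c.e c.a c.x c.hx _
      ((c.innerLabel σ).slotLabel V k).y ((c.innerLabel σ).slotLabel V k).hy) σ)
    refine mk_eq_mk (fun _ => rfl) rfl fun j => ?_
    rcases eq_or_ne j k with rfl | hk
    · simp only [Function.update_self]
      exact (V.map_rep _ (c.label_injective j) (σ j) (c.y j)).symm
    · simp [Function.update_of_ne hk]
  outer c s := by
    have h2 : ∀ i : Fin c.r, (-1 : K) ^ (c.outer s).dExp (s i) •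
          CompositeModule.mk ((c.outer s).slotLabel V (s i))
        = (-1 : K) ^ koszulExp s c.b •
          ((-1 : K) ^ (c.outerPerm s).dExp i • CompositeModule.mk ((c.outerPerm s).slotLabel V i)) := by
      intro i
      have e1 : CompositeModule.mk ((c.outer s).slotLabel V (s i))
            = (-1 : K) ^ koszulExp s (c.slotLabel V (s i)).b •
              CompositeModule.mk ((c.slotLabel V (s i)).outerPerm s) :=
        mk_outer (c.slotLabel V (s i)) s
      have e2 : CompositeModule.mk ((c.outerPerm s).slotLabel V i)
          = CompositeModule.mk ((c.slotLabel V (s i)).outerPerm s) := by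
        refine mk_eq_mk (fun _ => rfl) rfl fun j => ?_
        rcases eq_or_ne j i with rfl | hj
        · simp only [Function.update_self]; rfl
        · have : s j ≠ s i := fun h => hj (s.injective h)
          rw [Function.update_of_ne hj]
          exact (Function.update_of_ne this _ _).symm
      rw [e1, e2, smul_smul, smul_smul]
      congr 1
      have := koszul_sign_succ (K := K) s c.b i
      simp only [CompositeSymbol.dExp, pow_add]
      change (-1 : K) ^ c.a * (-1) ^ (∑ j, if j < s i then c.b j else 0)
          * (-1) ^ koszulExp s (Function.update c.b (s i) (c.b (s i) + 1))
        = (-1) ^ koszulExp s c.b * ((-1) ^ c.a * (-1) ^ (∑ j, if j < i then c.b (s j) else 0))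
      linear_combination (-1 : K) ^ c.a * this
    have h3 : slotSum V (c.outer s) = ∑ i, (-1 : K) ^ (c.outer s).dExp (s i) •
          CompositeModule.mk ((c.outer s).slotLabel V (s i)) :=
      (Equiv.sum_comp s (fun i => (-1 : K) ^ (c.outer s).dExp i •
          CompositeModule.mk ((c.outer s).slotLabel V i))).symm
    rw [h3, slotSum, Finset.smul_sum]
    exact Finset.sum_congr rfl fun i _ => h2 i

/-- The map `x(y_1,…,y_r) ↦ ∑_i ± x(y_1,…,v(y_i),…,y_r)`. -/
def slotHom (M : DGSymModule.{u, v} K) (V : LabelFam N N m 1) :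
    CompositeModule M N m →ₗ[K] CompositeModule M N m :=
  CompositeModule.lift _ (slotSum_respects V).rel

theorem slotHom_mk (c : CompositeSymbol M N m) :
    slotHom M V (CompositeModule.mk c) = slotSum V c :=
  CompositeModule.lift_mk _ _ _

theorem sum_update_succ {r : ℕ} (b : Fin r → ℕ) (i j : Fin r) (h : i < j) :
    (∑ l, if l < j then Function.update b i (b i + 1) l else 0)
      = (∑ l, if l < j then b l else 0) + 1 := by
  have := sum_update_of_lt (Function.update b i (b i + 1)) i j h (by simp)
  rw [Function.update_self, Nat.add_sub_cancel, Function.update_idem, Function.update_eq_self] at this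
  exact this.symm

variable {V} {W : ∀ {n : ℕ}, (Fin n → Fin m) → N n →ₗ[K] N n}

/-- The commutator of `slotHom` with the differential. -/
theorem dHom_slotHom
    (hW : ∀ {n : ℕ} (f : Fin n → Fin m) (y : N n), W f y = N.d n (V.toFun f y) + V.toFun f (N.d n y))
    (hWm : ∀ {n : ℕ} (f : Fin n → Fin m) (b : ℕ) (y : N n), y ∈ N.gr n b → W f y ∈ N.gr n b)
    (c : CompositeSymbol M N m) :
    dHom M N m (slotHom M V (CompositeModule.mk c)) + slotHom M V (dHom M N m (CompositeModule.mk c))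
      = ∑ i, CompositeModule.mk (c.slot i (hWm (fun k => c.e ⟨i, k⟩) _ _ (c.hy i))) := by
  rw [slotHom_mk, slotSum, dHom_mk, dMk, map_add, map_sum, map_sum, slotHom_mk, slotSum]
  simp only [map_smul, dHom_mk, slotHom_mk, dMk, slotSum, smul_add, Finset.smul_sum, smul_smul]
  rw [Finset.sum_add_distrib, add_add_add_comm, ← Finset.sum_add_distrib]
  -- Terms with the differential on the root cancel: the operator crosses a root whose degree has
  -- dropped by one, or the term is zero.
  have hleft : ∀ i, (-1 : K) ^ c.dExp i • CompositeModule.mk (c.slotLabel V i).dLeft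
      + (-1 : K) ^ c.dLeft.dExp i • CompositeModule.mk (c.dLeft.slotLabel V i) = 0 := by
    intro i
    by_cases ha : c.a = 0
    · have hd : M.d c.r c.x = 0 := M.d_zero _ _ (ha ▸ c.hx)
      rw [mk_eq_zero_of_left (c.slotLabel V i).dLeft hd, smul_zero, smul_zero, add_zero]
    · have e : c.dExp i = c.dLeft.dExp i + 1 := by
        simp only [CompositeSymbol.dExp]
        omega
      rw [e, pow_succ, mul_neg_one, neg_smul]
      exact neg_add_cancel _
  rw [Finset.sum_eq_zero fun i _ => hleft i, zero_add]
  refine (congrArg (· + _) (Finset.sum_comm (s := Finset.univ) (t := Finset.univ)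
    (f := fun i j : Fin c.r => ((-1 : K) ^ c.dExp i * (-1) ^ (c.slotLabel V i).dExp j) •
      CompositeModule.mk ((c.slotLabel V i).dRight j)))).trans ?_
  rw [← Finset.sum_add_distrib]
  refine Finset.sum_congr rfl fun j _ => ?_
  refine (Finset.sum_add_distrib (s := Finset.univ)
    (f := fun i : Fin c.r => ((-1 : K) ^ c.dExp i * (-1) ^ (c.slotLabel V i).dExp j) •
      CompositeModule.mk ((c.slotLabel V i).dRight j))).symm.trans ?_
  -- When the operator and the differential hit the same factor the two signs multiply to 1 and the
  -- commutator W remains; for different factors the two orders of application cancel.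
  rw [Finset.sum_eq_single j]
  · have h1 : (c.slotLabel V j).dExp j = c.dExp j := by
      simp only [CompositeSymbol.dExp]
      rw [sum_update_of_not_lt c.b j j (lt_irrefl j)]
    have h2 : (c.dRight j).dExp j = c.dExp j := by
      simp only [CompositeSymbol.dExp]
      rw [sum_update_of_not_lt c.b j j (lt_irrefl j)]
    have h3 : V.toFun (fun k => c.e ⟨j, k⟩) (N.d _ (c.y j)) ∈ N.gr (c.n j) (c.b j) := by
      by_cases hb : c.b j = 0
      · rw [N.d_zero _ _ (hb ▸ c.hy j), map_zero]; exact zero_mem _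
      · have := V.map_mem (fun k => c.e ⟨j, k⟩) _ _ (N.d_mem_pred _ _ _ (c.hy j))
        rwa [Nat.sub_add_cancel (Nat.one_le_iff_ne_zero.2 hb)] at this
    have h4 : N.d _ (V.toFun (fun k => c.e ⟨j, k⟩) (c.y j)) ∈ N.gr (c.n j) (c.b j) :=
      N.d_mem _ _ _ (V.map_mem _ _ _ (c.hy j))
    rw [h1, h2, neg_one_pow_mul_self, one_smul, one_smul]
    refine Eq.trans ?_ (mk_lin_right (c.slot j (hWm (fun k => c.e ⟨j, k⟩) _ _ (c.hy j))) j 1 1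
      (c.slot j h4).y (c.slot j h3).y (c.slot j h4).hy (c.slot j h3).hy ?_ ?_ ?_).symm
    · rw [one_smul, one_smul]
      refine congrArg₂ (· + ·) (mk_eq_mk (fun _ => rfl) rfl fun l => ?_)
        (mk_eq_mk (fun _ => rfl) rfl fun l => ?_)
      · simp only [Function.update_idem, Function.update_self]
      · simp only [Function.update_idem, Function.update_self]
    · simp [hW]
    · intro l hl
      simp only [Function.update_of_ne hl]
    · intro l hl
      simp only [Function.update_of_ne hl]
  · intro i _ hij
    have e : CompositeModule.mk ((c.slotLabel V i).dRight j)
        = CompositeModule.mk ((c.dRight j).slotLabel V i) := by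
      refine mk_eq_mk (fun _ => rfl) rfl fun l => ?_
      simp only
      rw [Function.update_of_ne hij.symm, Function.update_of_ne hij, Function.update_comm hij]
    rw [e, ← add_smul]
    by_cases hb : c.b j = 0
    · have hd : N.d _ (c.y j) = 0 := N.d_zero _ _ (hb ▸ c.hy j)
      rw [mk_eq_zero_of_right ((c.dRight j).slotLabel V i) j, smul_zero]
      simp [Function.update_of_ne hij.symm, hd]
    · refine (congrArg (· • _) ?_).trans (zero_smul K _)
      rcases lt_or_gt_of_ne hij with h | h
      · have h1 : (c.slotLabel V i).dExp j = c.dExp j + 1 := by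
          simp only [CompositeSymbol.dExp]
          rw [sum_update_succ c.b i j h]; rfl
        have h2 : (c.dRight j).dExp i = c.dExp i := by
          simp only [CompositeSymbol.dExp]
          rw [sum_update_of_not_lt c.b j i h.not_gt]
        rw [h1, h2, pow_succ]
        ring
      · have h1 : (c.slotLabel V i).dExp j = c.dExp j := by
          simp only [CompositeSymbol.dExp]
          rw [sum_update_of_not_lt c.b i j h.not_gt]
        have h2 : c.dExp i = (c.dRight j).dExp i + 1 := by
          simp only [CompositeSymbol.dExp]
          rw [← sum_update_of_lt c.b j i h hb]; rfl
        rw [h1, h2, pow_succ]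
        ring
  · simp

end Slot

end LabelOperators


/-! ### A Künneth argument for morphisms of the factors. -/

noncomputable section RightKunneth

variable {K : Type u} [CommRing K]

open CompositeModule CompositeSymbol

variable {M : DGSymModule.{u, v} K} {N : DGSymModule.{u, w} K} {N' : DGSymModule.{u, v₁} K}
  {m n : ℕ}

/-- Labels are distinct, so the sorting permutation is unique and hence transforms like a torsor
under permutations of the inputs. This allows non-equivariant maps to be applied to a factor whose
inputs have been sorted. -/
theorem sort_comp {f : Fin n → Fin m} (hf : Function.Injective f) (σ : Equiv.Perm (Fin n)) :
    Tuple.sort (f ∘ σ) = σ⁻¹ * Tuple.sort f := by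
  refine (Tuple.eq_sort_iff.2 ⟨?_, fun i j hij h => ?_⟩).symm
  · have : (f ∘ σ) ∘ (σ⁻¹ * Tuple.sort f : Equiv.Perm (Fin n)) = f ∘ Tuple.sort f := by
      funext i; simp
    rw [this]
    exact Tuple.monotone_sort f
  · exact absurd (Equiv.injective _ (σ.injective (hf h))) hij.ne

/-- The map `v`, applied after the inputs have been sorted by their labels. -/
def sortedMap (v : ∀ n, N n →ₗ[K] N' n) (f : Fin n → Fin m) : N n →ₗ[K] N' n :=
  N'.rep n (Tuple.sort f) ∘ₗ v n ∘ₗ N.rep n (Tuple.sort f)⁻¹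

theorem sortedMap_apply (v : ∀ n, N n →ₗ[K] N' n) (f : Fin n → Fin m) (y : N n) :
    sortedMap v f y = N'.rep n (Tuple.sort f) (v n (N.rep n (Tuple.sort f)⁻¹ y)) := rfl

theorem sortedMap_rep (v : ∀ n, N n →ₗ[K] N' n) {f : Fin n → Fin m} (hf : Function.Injective f)
    (σ : Equiv.Perm (Fin n)) (y : N n) :
    N'.rep n σ (sortedMap v (f ∘ σ) y) = sortedMap v f (N.rep n σ y) := by
  rw [sortedMap_apply, sortedMap_apply, sort_comp hf]
  simp only [map_mul, mul_inv_rev, inv_inv, Module.End.mul_apply]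
  rw [← Module.End.mul_apply, ← map_mul, mul_inv_cancel, map_one, Module.End.one_apply]

theorem sortedMap_mem {v : ∀ n, N n →ₗ[K] N' n} {ε : ℕ}
    (hv : ∀ n b y, y ∈ N.gr n b → v n y ∈ N'.gr n (b + ε)) (f : Fin n → Fin m) (b : ℕ) (y : N n)
    (hy : y ∈ N.gr n b) : sortedMap v f y ∈ N'.gr n (b + ε) :=
  N'.rep_mem _ _ _ _ (hv _ _ _ (N.rep_mem _ _ _ _ hy))

/-- The family of operators given by maps on sorted elements. -/
def sortedFam (v : ∀ n, N n →ₗ[K] N' n) (m : ℕ) {ε : ℕ}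
    (hv : ∀ n b y, y ∈ N.gr n b → v n y ∈ N'.gr n (b + ε)) : LabelFam N N' m ε where
  toFun f := sortedMap v f
  map_mem := sortedMap_mem hv
  map_rep _ hf := sortedMap_rep v hf

/-- `k` is the least label. -/
def IsMinLabel (k : Fin m) (f : Fin n → Fin m) : Prop := (∃ l, f l = k) ∧ ∀ l, k ≤ f l

theorem isMinLabel_comp {k : Fin m} {f : Fin n → Fin m} (σ : Equiv.Perm (Fin n)) :
    IsMinLabel k (f ∘ σ) ↔ IsMinLabel k f := by
  simp only [IsMinLabel, Function.comp_apply]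
  rw [σ.exists_congr_left, σ.forall_congr_left]
  simp

open Classical in
/-- The operator on the block with the least label `k`. -/
def minMap (v : ∀ n, N n →ₗ[K] N' n) (k : Fin m) (f : Fin n → Fin m) : N n →ₗ[K] N' n :=
  if IsMinLabel k f then sortedMap v f else 0

open Classical in
/-- The family of operators on the block with the least label `k`. -/
def minFam (v : ∀ n, N n →ₗ[K] N' n) (k : Fin m) {ε : ℕ}
    (hv : ∀ n b y, y ∈ N.gr n b → v n y ∈ N'.gr n (b + ε)) : LabelFam N N' m ε where
  toFun f := minMap v k f
  map_mem f b y hy := by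
    rw [minMap]
    split_ifs
    · exact sortedMap_mem hv f b y hy
    · exact zero_mem _
  map_rep f hf σ y := by
    rw [minMap, minMap]
    by_cases h : IsMinLabel k f
    · rw [if_pos h, if_pos ((isMinLabel_comp σ).2 h), sortedMap_rep v hf]
    · rw [if_neg h, if_neg (fun h' => h ((isMinLabel_comp σ).1 h')), LinearMap.zero_apply, map_zero]
      rfl

open Classical in
/-- The operators `1 + w` on the blocks with the least label in `A`. -/
def setMap (w : ∀ n, N n →ₗ[K] N n) (A : Finset (Fin m)) (f : Fin n → Fin m) : N n →ₗ[K] N n :=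
  if ∃ k ∈ A, IsMinLabel k f then LinearMap.id + sortedMap w f else LinearMap.id

open Classical in
/-- The operators `1 + w` on the blocks with the least label in `A`. -/
def setFam (w : ∀ n, N n →ₗ[K] N n) (A : Finset (Fin m))
    (hw : ∀ n b y, y ∈ N.gr n b → w n y ∈ N.gr n b) : LabelFam N N m 0 where
  toFun f := setMap w A f
  map_mem f b y hy := by
    rw [setMap]
    split_ifs
    · exact add_mem hy (sortedMap_mem (ε := 0) hw f b y hy)
    · exact hy
  map_rep f hf σ y := by
    rw [setMap, setMap]
    have e : (∃ k ∈ A, IsMinLabel k (f ∘ σ)) ↔ ∃ k ∈ A, IsMinLabel k f := by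
      simp only [isMinLabel_comp]
    by_cases h : ∃ k ∈ A, IsMinLabel k f
    · rw [if_pos h, if_pos (e.2 h)]
      simp only [LinearMap.add_apply, LinearMap.id_apply, map_add, sortedMap_rep w hf]
    · rw [if_neg h, if_neg (fun h' => h (e.1 h'))]
      rfl

section Homotopy

variable (h : ∀ n, N n →ₗ[K] N n)

/-- The commutator with the differential. -/
def bracketD (n : ℕ) : N n →ₗ[K] N n := N.d n ∘ₗ h n + h n ∘ₗ N.d n

variable (hh : ∀ n b y, y ∈ N.gr n b → h n y ∈ N.gr n (b + 1))

include hh in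
theorem bracketD_mem (n b : ℕ) (y : N n) (hy : y ∈ N.gr n b) : bracketD h n y ∈ N.gr n b :=
  N.homotopy_mem (h n) (hh n) b y hy

theorem minMap_bracketD (k : Fin m) (f : Fin n → Fin m) (y : N n) :
    minMap (bracketD h) k f y = N.d n (minMap h k f y) + minMap h k f (N.d n y) := by
  rw [minMap, minMap]
  split_ifs
  · simp only [sortedMap_apply, bracketD, LinearMap.add_apply, LinearMap.comp_apply, map_add,
      N.d_rep]
  · simp

include hh in
theorem minMap_bracketD_mem (k : Fin m) {n : ℕ} (f : Fin n → Fin m) (b : ℕ) (y : N n)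
    (hy : y ∈ N.gr n b) : minMap (bracketD h) k f y ∈ N.gr n b :=
  (minFam (bracketD h) k (ε := 0) (bracketD_mem h hh)).map_mem f b y hy

include hh in
-- Adding k to A changes at most the block whose least label is k, where the operator passes from 1
-- to 1 + [d, h]. The extra term is the commutator of d with h acting on that block alone.
-- Designating blocks by their least label is independent of their order, which coinvariants
-- require.
theorem mapLabel_setFam_insert (A : Finset (Fin m)) (k : Fin m) (hk : k ∉ A)
    (c : CompositeSymbol M N m) :
    CompositeModule.mk (c.mapLabel (setFam (bracketD h) (insert k A) (bracketD_mem h hh)))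
      = CompositeModule.mk (c.mapLabel (setFam (bracketD h) A (bracketD_mem h hh)))
        + (dHom M N m (slotHom M (minFam h k hh) (CompositeModule.mk
            (c.mapLabel (setFam (bracketD h) A (bracketD_mem h hh)))))
          + slotHom M (minFam h k hh) (dHom M N m (CompositeModule.mk
            (c.mapLabel (setFam (bracketD h) A (bracketD_mem h hh)))))) := by
  classical
  rw [dHom_slotHom (V := minFam h k hh) (W := fun f => minMap (bracketD h) k f)
    (minMap_bracketD h k) (minMap_bracketD_mem h hh k)]
  set i := (c.e.symm k).1 with hi
  have hne : ∀ j, j ≠ i → ¬ IsMinLabel k fun l => c.e ⟨j, l⟩ := by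
    rintro j hj ⟨⟨l, hl⟩, -⟩
    exact hj (by rw [hi, ← hl]; simp)
  have hset : ∀ j, ¬ IsMinLabel k (fun l => c.e ⟨j, l⟩) →
      setMap (bracketD h) (insert k A) (fun l => c.e ⟨j, l⟩)
        = setMap (bracketD h) A (fun l => c.e ⟨j, l⟩) := by
    intro j hj
    rw [setMap, setMap]
    refine if_congr ?_ rfl rfl
    simp [hj]
  set c' := c.mapLabel (setFam (bracketD h) A (bracketD_mem h hh)) with hc'
  rw [Finset.sum_eq_single i]
  · by_cases hmin : IsMinLabel k fun l => c.e ⟨i, l⟩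
    · have hA : ¬ ∃ k' ∈ A, IsMinLabel k' fun l => c.e ⟨i, l⟩ := by
        rintro ⟨k', hk', ⟨⟨l, hl⟩, h2⟩⟩
        obtain ⟨⟨l', hl'⟩, h4⟩ := hmin
        have : k' = k := le_antisymm ((h2 l').trans hl'.le) ((h4 l).trans hl.le)
        exact hk (this ▸ hk')
      have e1 : setMap (bracketD h) A (fun l => c.e ⟨i, l⟩) = LinearMap.id := if_neg hA
      have e2 : setMap (bracketD h) (insert k A) (fun l => c.e ⟨i, l⟩)
          = LinearMap.id + sortedMap (bracketD h) fun l => c.e ⟨i, l⟩ :=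
        if_pos ⟨k, Finset.mem_insert_self _ _, hmin⟩
      have e3 : minMap (bracketD h) k (fun l => c.e ⟨i, l⟩)
          = sortedMap (bracketD h) fun l => c.e ⟨i, l⟩ := if_pos hmin
      refine (mk_lin_right (c.mapLabel (setFam (bracketD h) (insert k A) (bracketD_mem h hh))) i 1 1
        c'.y (Function.update c'.y i (minMap (bracketD h) k (fun l => c.e ⟨i, l⟩) (c'.y i)))
        c'.hy (fun j => ?_) ?_ ?_ ?_).trans ?_
      · rcases eq_or_ne j i with rfl | hj
        · rw [Function.update_self]
          exact minMap_bracketD_mem h hh k _ _ _ (c'.hy _)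
        · rw [Function.update_of_ne hj]
          exact c'.hy j
      · rw [Function.update_self, one_smul, one_smul, e3]
        change setMap (bracketD h) (insert k A) (fun l => c.e ⟨i, l⟩) (c.y i)
          = setMap (bracketD h) A (fun l => c.e ⟨i, l⟩) (c.y i)
            + sortedMap (bracketD h) (fun l => c.e ⟨i, l⟩)
              (setMap (bracketD h) A (fun l => c.e ⟨i, l⟩) (c.y i))
        rw [e1, e2]; rfl
      · intro j hj
        exact congrArg (· (c.y j)) (hset j (hne j hj)).symm
      · intro j hj
        rw [Function.update_of_ne hj]
        exact congrArg (· (c.y j)) (hset j (hne j hj)).symm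
      · rw [one_smul, one_smul]
        exact congrArg (CompositeModule.mk c' + ·) (mk_eq_mk (fun _ => rfl) rfl fun _ => rfl)
    · rw [mk_eq_zero_of_right (c'.slot i (minMap_bracketD_mem h hh k (fun l => c'.e ⟨i, l⟩) _ _
        (c'.hy i))) i, add_zero]
      · refine mk_eq_mk (fun _ => rfl) rfl fun j => congrArg (· (c.y j)) (hset j ?_)
        rcases eq_or_ne j i with rfl | hj
        · exact hmin
        · exact hne j hj
      · refine (Function.update_self i _ c'.y).trans ?_
        exact LinearMap.congr_fun (f := minMap (bracketD h) k fun l => c.e ⟨i, l⟩) (g := 0)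
          (if_neg hmin) _
  · intro j _ hj
    refine mk_eq_zero_of_right _ j ?_
    refine (Function.update_self j _ c'.y).trans ?_
    exact LinearMap.congr_fun (f := minMap (bracketD h) k fun l => c.e ⟨j, l⟩) (g := 0)
      (if_neg (hne j hj)) _
  · simp

/-- The tensor product of the maps 1 + [d, h] is homotopic to the identity: the blocks are treated
one after the other and the homotopies add up. -/
theorem exists_homotopy_setFam (M : DGSymModule.{u, v} K) (A : Finset (Fin m)) :
    ∃ H : CompositeModule M N m →ₗ[K] CompositeModule M N m, ∀ z,
      mapLabel M (setFam (bracketD h) A (bracketD_mem h hh)) z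
        = z + (dHom M N m (H z) + H (dHom M N m z)) := by
  classical
  induction A using Finset.induction_on with
  | empty =>
    refine ⟨0, fun z => ?_⟩
    simp only [LinearMap.zero_apply, map_zero, add_zero]
    refine LinearMap.congr_fun (f := mapLabel M _) (g := LinearMap.id)
      (CompositeModule.hom_ext fun c => ?_) z
    rw [mapLabel_mk]
    refine mk_eq_mk (fun _ => rfl) rfl fun j => ?_
    have : setMap (bracketD h) ∅ (fun l => c.e ⟨j, l⟩) = LinearMap.id := if_neg (by simp)
    exact congrArg (· (c.y j)) this
  | insert k A hk ih =>
    obtain ⟨H, hH⟩ := ih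
    set T := mapLabel M (setFam (bracketD h) A (bracketD_mem h hh)) with hT
    set S := slotHom M (minFam h k hh) with hS
    have h1 : ∀ z, mapLabel M (setFam (bracketD h) (insert k A) (bracketD_mem h hh)) z
        = T z + (dHom M N m (S (T z)) + S (dHom M N m (T z))) := by
      intro z
      refine LinearMap.congr_fun (g := T + (dHom M N m ∘ₗ S ∘ₗ T + S ∘ₗ dHom M N m ∘ₗ T))
        (CompositeModule.hom_ext fun c => ?_) z
      rw [mapLabel_mk, mapLabel_setFam_insert h hh A k hk c, ← mapLabel_mk]
      rfl
    have hdd : ∀ z, dHom M N m (dHom M N m z) = 0 := (compose M N).d_d m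
    -- A map homotopic to the identity commutes with d; hence S ∘ T is a homotopy between T and the
    -- next map.
    have h2 : ∀ z, dHom M N m (T z) = T (dHom M N m z) := by
      intro z
      rw [hH, hH, map_add, map_add, hdd, hdd, map_zero, zero_add, add_zero]
    refine ⟨H + S ∘ₗ T, fun z => ?_⟩
    rw [h1, h2]
    nth_rewrite 1 [hH z]
    simp only [LinearMap.add_apply, LinearMap.comp_apply, map_add]
    abel

end Homotopy

/-- Each of the other r - 1 blocks uses at least one label. In weight at least 2 every factor thus
has arity less than m, as the induction on arity needs. -/
theorem CompositeSymbol.n_add_r_le (c : CompositeSymbol M N m) (hn : ∀ i, c.n i ≠ 0) (i : Fin c.r) :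
    c.n i + c.r ≤ m + 1 := by
  have h1 := Fintype.card_congr c.e
  simp only [Fintype.card_sigma, Fintype.card_fin] at h1
  have h2 : ∑ j, (1 + if j = i then c.n i - 1 else 0) ≤ ∑ j, c.n j :=
    Finset.sum_le_sum fun j _ => by
      have := hn j
      split_ifs with h
      · subst h; omega
      · omega
  rw [Finset.sum_add_distrib] at h2
  simp at h2
  have := hn i
  omega

theorem exists_isMinLabel (hn : n ≠ 0) (f : Fin n → Fin m) : ∃ k, IsMinLabel k f := by
  have : Nonempty (Fin n) := ⟨⟨0, Nat.pos_of_ne_zero hn⟩⟩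
  obtain ⟨l, hl⟩ := Finite.exists_min f
  exact ⟨f l, ⟨l, rfl⟩, hl⟩

theorem mapLabel_eq_of_weight {s : ℕ} (hN : N.Connected)
    {A B : CompositeModule M N m →ₗ[K] CompositeModule M N' m}
    (V V' : LabelFam N N' m 0) (hA : ∀ c, A (CompositeModule.mk c) = CompositeModule.mk (c.mapLabel V))
    (hB : ∀ c, B (CompositeModule.mk c) = CompositeModule.mk (c.mapLabel V'))
    (h : ∀ n (f : Fin n → Fin m) (y : N n), n ≠ 0 → n + s ≤ m + 1 → V.toFun f y = V'.toFun f y)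
    (z : CompositeModule M N m) (hz : weightProj M N m s z = z) : A z = B z := by
  rw [← hz]
  refine LinearMap.congr_fun (f := A ∘ₗ weightProj M N m s) (g := B ∘ₗ weightProj M N m s)
    (CompositeModule.hom_ext fun c => ?_) z
  simp only [LinearMap.comp_apply, weightProj_mk]
  split_ifs with hc
  · by_cases hn : ∀ i, c.n i ≠ 0
    · rw [hA, hB]
      exact mk_eq_mk (fun _ => rfl) rfl fun i => h _ _ _ (hn i) (hc ▸ c.n_add_r_le hn i)
    · push Not at hn
      obtain ⟨i, hi⟩ := hn
      rw [mk_eq_zero_of_n hN c hi, map_zero, map_zero]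
  · simp only [map_zero]

/-- Only the arities that can occur in weight s are required to have homotopy inverses. The tensor
product of the inverses is a homotopy inverse in weight s: both composites are tensor products of
maps 1 + [d, h], and with all labels in A every nonempty block is reached. -/
theorem weightAcyclic_mapHom_right (M : DGSymModule.{u, v} K) (φ : DGHom N N') (hN : N.Connected)
    (hN' : N'.Connected) (m s : ℕ)
    (hφ : ∀ n, n ≠ 0 → n + s ≤ m + 1 → φ.HasHomotopyInverse n) :
    WeightAcyclic ((weightProj M N m s).prodMap (weightProj M N' m s))
      (coneD (dHom M N m) (dHom M N' m) (compose.mapHom (GrHom.id M) φ.toGrHom m)) := by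
  have key : ∀ n, ∃ (g : N' n →ₗ[K] N n) (h : N n →ₗ[K] N n) (h' : N' n →ₗ[K] N' n),
    (∀ a, ∀ x ∈ N'.gr n a, g x ∈ N.gr n a) ∧ (∀ a, ∀ x ∈ N.gr n a, h x ∈ N.gr n (a + 1)) ∧
    (∀ a, ∀ x ∈ N'.gr n a, h' x ∈ N'.gr n (a + 1)) ∧ (∀ x, N.d n (g x) = g (N'.d n x)) ∧
    (n ≠ 0 → n + s ≤ m + 1 → ∀ x, g (φ.toFun n x) = x + (N.d n (h x) + h (N.d n x))) ∧
    (n ≠ 0 → n + s ≤ m + 1 → ∀ x, φ.toFun n (g x) = x + (N'.d n (h' x) + h' (N'.d n x))) := by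
    -- In arities that cannot occur zero maps are chosen, and the homotopy identities are not
    -- claimed.
    intro n
    by_cases hn : n ≠ 0 ∧ n + s ≤ m + 1
    · obtain ⟨g, h, h', h1, h2, h3, h4, h5, h6⟩ := hφ n hn.1 hn.2
      exact ⟨g, h, h', h1, h2, h3, h4, fun _ _ => h5, fun _ _ => h6⟩
    · exact ⟨0, 0, 0, by simp, by simp, by simp, by simp, fun h h' => absurd ⟨h, h'⟩ hn,
        fun h h' => absurd ⟨h, h'⟩ hn⟩
  choose g h h' hg hh hh' hgd hgf hfg using key
  obtain ⟨H, hH⟩ := exists_homotopy_setFam h hh M (Finset.univ : Finset (Fin m))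
  obtain ⟨H', hH'⟩ := exists_homotopy_setFam h' hh' M (Finset.univ : Finset (Fin m))
  have hgφ : ∀ n b y, y ∈ N.gr n b → (g n ∘ₗ φ.toFun n) y ∈ N.gr n (b + 0) :=
    fun n b y hy => hg n _ _ (φ.map_mem _ _ _ hy)
  have hφg : ∀ n b y, y ∈ N'.gr n b → (φ.toFun n ∘ₗ g n) y ∈ N'.gr n (b + 0) :=
    fun n b y hy => φ.map_mem _ _ _ (hg n _ _ hy)
  refine weightAcyclic_of_homotopy _ _ H _ _ H' _
    (mapLabel M (sortedFam g m (ε := 0) hg)) (weightProj_self s) (weightProj_self s)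
    (weightProj_dHom s) (weightProj_dHom s) (weightProj_mapHom _ _ s)
    (fun z => (compose.map (DGHom.id M) φ).map_d m z)
    (fun z _ => dHom_mapLabel _ (fun n f y => ?_) z) (fun z hz => ?_) (fun z hz => ?_)
  · change N.d n (sortedMap g f y) = sortedMap g f (N'.d n y)
    rw [sortedMap_apply, sortedMap_apply, N.d_rep, hgd, N'.d_rep]
  · rw [← hH]
    refine mapLabel_eq_of_weight (A := mapLabel M (sortedFam g m (ε := 0) hg) ∘ₗ
      compose.mapHom (GrHom.id M) φ.toGrHom m) hN
      (sortedFam (fun n => g n ∘ₗ φ.toFun n) m hgφ) _ (fun c => ?_) (mapLabel_mk _)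
      (fun n f y hn hn' => ?_) z hz
    · rw [LinearMap.comp_apply, compose.mapHom_mk, mapLabel_mk]
      refine mk_eq_mk (fun _ => rfl) rfl fun i => ?_
      change sortedMap g _ (φ.toFun _ _) = sortedMap _ _ _
      simp only [sortedMap_apply, LinearMap.comp_apply, φ.map_rep]
    · obtain ⟨k, hk⟩ := exists_isMinLabel hn f
      have : setMap (bracketD h) Finset.univ f = LinearMap.id + sortedMap (bracketD h) f :=
        if_pos ⟨k, Finset.mem_univ k, hk⟩
      change sortedMap _ f y = setMap _ _ f y
      rw [this, LinearMap.add_apply, sortedMap_apply, sortedMap_apply, LinearMap.comp_apply,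
        hgf n hn hn', map_add, ← Module.End.mul_apply, ← map_mul, mul_inv_cancel, map_one]
      rfl
  · rw [← hH']
    refine mapLabel_eq_of_weight (A := compose.mapHom (GrHom.id M) φ.toGrHom m ∘ₗ
      mapLabel M (sortedFam g m (ε := 0) hg)) hN'
      (sortedFam (fun n => φ.toFun n ∘ₗ g n) m hφg) _ (fun c => ?_) (mapLabel_mk _)
      (fun n f y hn hn' => ?_) z hz
    · rw [LinearMap.comp_apply, mapLabel_mk, compose.mapHom_mk]
      refine mk_eq_mk (fun _ => rfl) rfl fun i => ?_
      change φ.toFun _ (sortedMap g _ _) = sortedMap _ _ _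
      simp only [sortedMap_apply, LinearMap.comp_apply, φ.map_rep]
    · obtain ⟨k, hk⟩ := exists_isMinLabel hn f
      have : setMap (bracketD h') Finset.univ f = LinearMap.id + sortedMap (bracketD h') f :=
        if_pos ⟨k, Finset.mem_univ k, hk⟩
      change sortedMap _ f y = setMap _ _ f y
      rw [this, LinearMap.add_apply, sortedMap_apply, sortedMap_apply, LinearMap.comp_apply,
        hfg n hn hn', map_add, ← Module.End.mul_apply, ← map_mul, mul_inv_cancel, map_one]
      rfl

end RightKunneth


/-! ### The differential of a quasi-free left module, up to higher weight. -/

noncomputable section LeftLeading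

variable {K : Type u} [CommRing K]

open CompositeModule CompositeSymbol TripleSymbol

/-- Telescoping: the entries are exchanged one at a time, and each difference has one entry in the
prescribed submodule. -/
theorem MultilinearMap.map_sub_mem {ι : Type*} [Fintype ι] [DecidableEq ι] {V : ι → Type*}
    [∀ i, AddCommGroup (V i)] [∀ i, Module K (V i)] {X : Type*} [AddCommGroup X] [Module K X]
    (E : MultilinearMap K V X) (S : Submodule K X) (W : ∀ i, Submodule K (V i))
    (hE : ∀ v i, v i ∈ W i → E v ∈ S) (v u : ∀ i, V i) (h : ∀ i, v i - u i ∈ W i) :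
    E v - E u ∈ S := by
  suffices H : ∀ s : Finset ι, E (s.piecewise v u) - E u ∈ S by simpa using H Finset.univ
  intro s
  induction s using Finset.induction_on with
  | empty => simp
  | insert i s hi ih =>
    have h1 := E.map_update_sub (s.piecewise v u) i (v i) (u i)
    have h2 : Function.update (s.piecewise v u) i (u i) = s.piecewise v u := by
      rw [Function.update_eq_self_iff, Finset.piecewise_eq_of_notMem _ _ _ hi]
    rw [h2] at h1
    rw [Finset.piecewise_insert, ← sub_add_sub_cancel _ (E (s.piecewise v u)), ← h1]
    exact add_mem (hE _ i (by simpa using h i)) ih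

/-- The submodule generated by the composite elements of weight `≥ k`. -/
def upperSpan (M : DGSymModule.{u, v₁} K) (N : DGSymModule.{u, v₂} K) (m k : ℕ) :
    Submodule K (CompositeModule M N m) :=
  Submodule.span K {z | ∃ c : CompositeSymbol M N m, k ≤ c.r ∧ z = CompositeModule.mk c}

theorem weightProj_of_mem_upperSpan {M : DGSymModule.{u, v₁} K} {N : DGSymModule.{u, v₂} K}
    {m k j : ℕ} (hj : j < k) {z : CompositeModule M N m} (hz : z ∈ upperSpan M N m k) :
    weightProj M N m j z = 0 := by
  have : upperSpan M N m k ≤ LinearMap.ker (weightProj M N m j) := by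
    refine Submodule.span_le.2 ?_
    rintro _ ⟨c, hc, rfl⟩
    change weightProj M N m j (CompositeModule.mk c) = 0
    rw [weightProj_mk, if_neg (by omega)]
  exact this hz

theorem mem_upperSpan_zero {M : DGSymModule.{u, v₁} K} {N : DGSymModule.{u, v₂} K} {m : ℕ}
    (z : CompositeModule M N m) : z ∈ upperSpan M N m 0 := by
  have : (⊤ : Submodule K (CompositeModule M N m)) ≤ upperSpan M N m 0 := by
    rw [← span_mk]
    refine Submodule.span_mono ?_
    rintro _ ⟨c, rfl⟩
    exact ⟨c, Nat.zero_le _, rfl⟩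
  exact this trivial

section

variable {L : DGSymModule.{u, v₁} K} {P : DGSymModule.{u, v₂} K} {N : DGSymModule.{u, v₃} K}
  {A : DGSymModule.{u, v₄} K} {R : DGSymModule.{u, v} K} {m : ℕ}
  (act : GrHom (compose L P) A) (c : CompositeSymbol L R m)

/-- The root of λ(x(p_*)) has arity the sum of the arities of the p_i. Since P(0) = 0, each nonzero
p_i contributes at least 1, whence the maximum. -/
theorem multiEval_mem_of_weights (hP : P.Connected) (κ : Fin c.r → ℕ)
    (v : ∀ i, CompositeModule P N (c.n i)) (hv : ∀ i, v i ∈ upperSpan P N (c.n i) (κ i)) (k : ℕ)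
    (hk : k ≤ ∑ i, max 1 (κ i)) : c.multiEval act N v ∈ upperSpan A N m k := by
  refine pi_span_induction (K := K) (V := fun i => CompositeModule P N (c.n i))
    (fun i => {z | ∃ d : CompositeSymbol P N (c.n i), κ i ≤ d.r ∧ z = CompositeModule.mk d})
    (fun v => c.multiEval act N v ∈ upperSpan A N m k) ?_ ?_ ?_ v hv
  · intro v hv
    choose D hκ hD using hv
    obtain rfl : v = fun i => CompositeModule.mk (D i) := funext hD
    by_cases h0 : ∃ i, (D i).r = 0
    · obtain ⟨i, hi⟩ := h0
      have : CompositeModule.mk (D i) = 0 := by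
        refine mk_eq_zero_of_left _ ?_
        have : Subsingleton (P (D i).r) := by rw [hi]; exact hP
        exact Subsingleton.elim _ _
      rw [(c.multiEval act N).map_coord_zero i this]
      exact zero_mem _
    · push Not at h0
      rw [multiEval_mk, multiSymbol]
      refine Submodule.smul_mem _ _ (Submodule.subset_span ⟨_, ?_, rfl⟩)
      refine hk.trans (Finset.sum_le_sum fun i _ => max_le ?_ (hκ i))
      exact Nat.one_le_iff_ne_zero.2 (h0 i)
  · intro v i hi
    rw [(c.multiEval act N).map_coord_zero i hi]
    exact zero_mem _
  · intro v i α β x y _ _ _ hx hy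
    rw [(c.multiEval act N).map_update_add, (c.multiEval act N).map_update_smul,
      (c.multiEval act N).map_update_smul]
    exact add_mem (Submodule.smul_mem _ _ hx) (Submodule.smul_mem _ _ hy)

theorem multiEval_mem_upperSpan (hP : P.Connected) (v : ∀ i, CompositeModule P N (c.n i)) :
    c.multiEval act N v ∈ upperSpan A N m c.r :=
  multiEval_mem_of_weights act c hP (fun _ => 0) v (fun i => mem_upperSpan_zero (v i)) c.r
    (by simp)

theorem multiEval_mem_upperSpan_succ (hP : P.Connected) (v : ∀ i, CompositeModule P N (c.n i))
    (i : Fin c.r) (hi : v i ∈ upperSpan P N (c.n i) 2) :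
    c.multiEval act N v ∈ upperSpan A N m (c.r + 1) := by
  refine multiEval_mem_of_weights act c hP (fun j => if j = i then 2 else 0) v (fun j => ?_) _ ?_
  · split_ifs with h
    · subst h; exact hi
    · exact mem_upperSpan_zero _
  · have : ∀ j, max 1 (if j = i then 2 else 0) = 1 + if j = i then 1 else 0 := fun j => by
      split_ifs <;> rfl
    simp only [this, Finset.sum_add_distrib]
    simp

end

namespace DGLeftModule.QuasiFree

variable {P : DGOperad.{u, v} K} {R : DGLeftModule.{u, v, v₁} P} {N : DGSymModule.{u, v₂} K}
  (F : R.QuasiFree N) (hP : P.toDGSymModule.Connected)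

theorem coord_mem_upperSpan {n : ℕ} {x : R.carrier n} (hx : x ∈ Submodule.span K
      {z | ∃ c : CompositeSymbol P.toDGSymModule N n, 2 ≤ c.r ∧ z = R.extend F.ι n (compose.mk c)}) :
    F.coord.toFun n x ∈ upperSpan P.toDGSymModule N n 2 := by
  suffices H : Submodule.span K {z | ∃ c : CompositeSymbol P.toDGSymModule N n, 2 ≤ c.r ∧
      z = R.extend F.ι n (compose.mk c)}
        ≤ (upperSpan P.toDGSymModule N n 2).comap (F.coord.toFun n) from H hx
  refine Submodule.span_le.2 ?_
  rintro _ ⟨c, hc, rfl⟩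
  exact Submodule.subset_span ⟨c, hc, F.coord_ext n (CompositeModule.mk c)⟩

variable {L : DGSymModule.{u, v₃} K} (act : GrHom (compose L P.toDGSymModule) L)
  (hact : ∀ (r a : ℕ) (x : L r) (hx : x ∈ L.gr r a),
      act.toFun r (compose.mk (unitRight hx P.one_mem)) = x)
  {m : ℕ} {X : Type*} [AddCommGroup X] [Module K X]
  (f : CompositeModule L R.toDGSymModule m →ₗ[K] X)
  (hf : ∀ t : TripleSymbol L P.toDGSymModule R.toDGSymModule m,
      f (t.evalLeft act) = f (t.evalRight R.action.toGrHom))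

include hP hact hf

/-- Changing one factor by a composite of weight at least 2, while every other factor contributes at
least one input, raises the weight of the whole. -/
theorem lead_perturbation (c : CompositeSymbol L N m) (y : ∀ i, R.carrier (c.n i))
    (hy : ∀ i, y i ∈ R.gr (c.n i) (c.b i))
    (h : ∀ i, F.coord.toFun _ (y i - F.ι.toFun _ (c.y i)) ∈ upperSpan P.toDGSymModule N (c.n i) 2) :
    ∃ z ∈ upperSpan L N m (c.r + 1),
      f (CompositeModule.mk ⟨c.r, c.n, c.e, c.a, c.x, c.hx, c.b, y, hy⟩)
        = F.lead f (CompositeModule.mk c + z) := by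
  set c₁ : CompositeSymbol L R.toDGSymModule m := ⟨c.r, c.n, c.e, c.a, c.x, c.hx, c.b, y, hy⟩
    with hc₁
  set c₂ := compose.mapSymbol (GrHom.id L) F.ι c with hc₂
  have h1 : rightSubst act F.coord m (CompositeModule.mk c₂) = CompositeModule.mk c := by
    have := F.rightSubst_mapHom_ι act (GrHom.id L) hact (CompositeModule.mk c)
    rw [compose.mapHom_mk, compose.mapHom_mk] at this
    exact this
  have h2 : CompositeSymbol.multiEval act N c₂ = CompositeSymbol.multiEval act N c₁ :=
    multiEval_ext fun D => (multiEval_mk act c₂ D).trans (multiEval_mk act c₁ D).symm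
  refine ⟨rightSubst act F.coord m (CompositeModule.mk c₁) - CompositeModule.mk c, ?_, ?_⟩
  · rw [← h1, rightSubst_mk, rightSubst_mk, h2]
    refine MultilinearMap.map_sub_mem (CompositeSymbol.multiEval act N c₁)
      (upperSpan L N m (c.r + 1)) (fun i => upperSpan P.toDGSymModule N (c.n i) 2)
      (fun v i hv => multiEval_mem_upperSpan_succ act c₁ hP v i hv) _ _ fun i => ?_
    have := h i
    rw [map_sub] at this
    exact this
  · rw [add_sub_cancel, F.lead_rightSubst act f hf]

theorem lead_d (d : X →ₗ[K] X) (hd : ∀ z, d (f z) = f (dHom L R.toDGSymModule m z))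
    (c : CompositeSymbol L N m) :
    ∃ z ∈ upperSpan L N m (c.r + 1),
      d (F.lead f (CompositeModule.mk c)) = F.lead f (dHom L N m (CompositeModule.mk c) + z) := by
  have key : ∀ i : Fin c.r, ∃ z ∈ upperSpan L N m (c.r + 1),
      f (CompositeModule.mk ((compose.mapSymbol (GrHom.id L) F.ι c).dRight i))
        = F.lead f (CompositeModule.mk (c.dRight i) + z) := by
    intro i
    refine F.lead_perturbation hP act hact f hf (c.dRight i)
      ((compose.mapSymbol (GrHom.id L) F.ι c).dRight i).y
      ((compose.mapSymbol (GrHom.id L) F.ι c).dRight i).hy ?_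
    intro (j : Fin c.r)
    rcases eq_or_ne j i with rfl | hj
    · simp only [Function.update_self]
      exact F.coord_mem_upperSpan (F.decomposable _ (c.y j))
    · simp only [Function.update_of_ne hj, sub_self, map_zero]
      exact zero_mem _
  choose z hz hzi using key
  refine ⟨∑ i, (-1 : K) ^ c.dExp i • z i,
    Submodule.sum_mem _ fun i _ => Submodule.smul_mem _ _ (hz i), ?_⟩
  rw [lead_mk, hd, dHom_mk, dHom_mk, dMk, dMk, map_add, map_sum, add_assoc,
    ← Finset.sum_add_distrib, map_add, map_sum]
  refine congrArg₂ (· + ·) ?_ (Finset.sum_congr rfl fun i _ => ?_)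
  · rw [lead_mk]; rfl
  · rw [map_smul, hzi i, ← smul_add, map_smul]

end DGLeftModule.QuasiFree

end LeftLeading


/-! ### The counit P ∘ N → N and indecomposables of quasi-free left modules. -/

noncomputable section LeftCounit

variable {K : Type u} [CommRing K]

open CompositeModule CompositeSymbol TripleSymbol

variable {P : DGOperad.{u, v} K} (hP : P.IsConnected) {N : DGSymModule.{u, v₁} K}
  {N' : DGSymModule.{u, v₂} K} {m : ℕ}

/-- The labels of a composite element of weight one. -/
abbrev oneBlock {n : Fin 1 → ℕ} (e : (Σ i, Fin (n i)) ≃ Fin m) : Fin (n 0) ≃ Fin m :=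
  (Equiv.uniqueSigma fun i => Fin (n i)).symm.trans e

/-- The value of the counit `P ∘ N → N` on a composite element. -/
def leftCounitSymbol : CompositeSymbol P.toDGSymModule N m → N m
  | ⟨0, _, _, _, _, _, _, _, _⟩ => 0
  | ⟨1, _, lab, _, p, _, _, z, _⟩ => P.aug hP 1 p • N.tr (oneBlock lab) (z 0)
  | ⟨_ + 2, _, _, _, _, _, _, _, _⟩ => 0

theorem leftCounitSymbol_respects :
    CompositeSymbol.Respects
      (leftCounitSymbol hP : CompositeSymbol P.toDGSymModule N m → N m) where
  lin_left c α β x' x'' hx' hx'' h := by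
    obtain ⟨_ | _ | r, n, e, a, x, hx, b, y, hy⟩ := c
    · simp [leftCounitSymbol]
    · have h1 := congrArg (P.aug hP 1) h
      rw [map_add, map_smul, map_smul] at h1
      refine (congrArg (· • N.tr (oneBlock e) (y 0)) h1).trans ?_
      rw [add_smul, smul_assoc, smul_assoc]
      rfl
    · simp [leftCounitSymbol]
  lin_right c i α β y' y'' hy' hy'' h h' h'' := by
    obtain ⟨_ | _ | r, n, e, a, x, hx, b, y, hy⟩ := c
    · simp [leftCounitSymbol]
    · obtain rfl : i = (0 : Fin 1) := Subsingleton.elim (α := Fin 1) _ _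
      have h1 := congrArg (fun z => P.aug hP 1 x • N.tr (oneBlock e) z) h
      simp only [map_add, map_smul, smul_add, smul_comm _ α, smul_comm _ β] at h1
      exact h1
    · simp [leftCounitSymbol]
  inner c σ := by
    obtain ⟨_ | _ | r, n, e, a, x, hx, b, y, hy⟩ := c
    · rfl
    · refine congrArg (P.aug hP 1 x • ·) ?_
      change N.tr (oneBlock e) (N.rep _ (σ 0) (y 0)) = N.tr _ (y 0)
      rw [← N.tr_perm, ← N.tr_trans]
      exact congrArg (fun τ => N.tr τ (y 0)) (Equiv.ext fun _ => rfl)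
    · rfl
  outer c s := by
    obtain ⟨_ | _ | r, n, e, a, x, hx, b, y, hy⟩ := c
    · exact (smul_zero _).symm
    · obtain rfl : s = 1 := Subsingleton.elim (α := Equiv.Perm (Fin 1)) _ _
      rw [outer_one, outerPerm_one, koszulExp_one, pow_zero, one_smul]
    · exact (smul_zero _).symm

/-- The counit `P ∘ N → N`. -/
def leftCounitHom (N : DGSymModule.{u, v₁} K) (m : ℕ) :
    CompositeModule P.toDGSymModule N m →ₗ[K] N m :=
  CompositeModule.lift _ (leftCounitSymbol_respects hP).rel

theorem leftCounitHom_mk (c : CompositeSymbol P.toDGSymModule N m) :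
    leftCounitHom hP N m (CompositeModule.mk c) = leftCounitSymbol hP c :=
  CompositeModule.lift_mk _ _ _

theorem leftCounitHom_mk_of_le (c : CompositeSymbol P.toDGSymModule N m) (hc : 2 ≤ c.r) :
    leftCounitHom hP N m (CompositeModule.mk c) = 0 := by
  rw [leftCounitHom_mk]
  obtain ⟨_ | _ | r, n, e, a, x, hx, b, y, hy⟩ := c
  · rfl
  · simp at hc
  · rfl

theorem leftCounitHom_of_mem_upperSpan {z : CompositeModule P.toDGSymModule N m}
    (hz : z ∈ upperSpan P.toDGSymModule N m 2) : leftCounitHom hP N m z = 0 := by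
  have : upperSpan P.toDGSymModule N m 2 ≤ LinearMap.ker (leftCounitHom hP N m) := by
    refine Submodule.span_le.2 ?_
    rintro _ ⟨c, hc, rfl⟩
    exact leftCounitHom_mk_of_le hP c hc
  exact this hz

/-- The counit `P ∘ N → N`. -/
def leftCounit (N : DGSymModule.{u, v₁} K) : DGHom (compose P.toDGSymModule N) N where
  toFun := leftCounitHom hP N
  map_mem m k z hz := by
    induction hz using Submodule.span_induction with
    | mem z h =>
      obtain ⟨c, rfl, rfl⟩ := h
      rw [leftCounitHom_mk]
      obtain ⟨_ | _ | r, n, e, a, x, hx, b, y, hy⟩ := c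
      · exact zero_mem _
      · by_cases ha : a = 0
        · subst ha
          have : (0 + ∑ i : Fin 1, b i) = b 0 := by simp
          change _ ∈ N.gr m (0 + ∑ i : Fin 1, b i)
          rw [this]
          exact Submodule.smul_mem _ _ (N.tr_mem _ (hy 0))
        · change P.aug hP 1 x • _ ∈ _
          rw [P.aug_of_mem hP ha hx, zero_smul]
          exact zero_mem _
      · exact zero_mem _
    | zero => rw [map_zero]; exact zero_mem _
    | add x y _ _ hx hy => rw [map_add]; exact add_mem hx hy
    | smul t x _ hx => rw [map_smul]; exact Submodule.smul_mem _ _ hx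
  map_rep m s z := by
    refine LinearMap.congr_fun (f := leftCounitHom hP N m ∘ₗ CompositeModule.repHom s)
      (g := N.rep m s ∘ₗ leftCounitHom hP N m) (CompositeModule.hom_ext fun c => ?_) z
    rw [LinearMap.comp_apply, LinearMap.comp_apply, repHom_mk, leftCounitHom_mk, leftCounitHom_mk]
    obtain ⟨_ | _ | r, n, e, a, x, hx, b, y, hy⟩ := c
    · exact (map_zero _).symm
    · change P.aug hP 1 x • N.tr (oneBlock (e.trans s)) (y 0)
        = N.rep m s (P.aug hP 1 x • N.tr (oneBlock e) (y 0))
      rw [map_smul, ← N.tr_perm, ← N.tr_trans]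
      rfl
    · exact (map_zero _).symm
  map_d m z := by
    refine LinearMap.congr_fun (f := leftCounitHom hP N m ∘ₗ dHom P.toDGSymModule N m)
      (g := N.d m ∘ₗ leftCounitHom hP N m) (CompositeModule.hom_ext fun c => ?_) z
    rw [LinearMap.comp_apply, LinearMap.comp_apply, dHom_mk, dMk, map_add, map_sum,
      leftCounitHom_mk, leftCounitHom_mk]
    simp only [map_smul, leftCounitHom_mk]
    obtain ⟨_ | _ | r, n, e, a, x, hx, b, y, hy⟩ := c
    · simp [leftCounitSymbol]
    · change P.aug hP 1 (P.d 1 x) • N.tr (oneBlock e) (y 0)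
          + ∑ i : Fin 1, (-1 : K) ^ (a + ∑ j, if j < i then b j else 0) •
            (P.aug hP 1 x • N.tr (oneBlock e) (Function.update y i (N.d _ (y i)) 0))
        = N.d m (P.aug hP 1 x • N.tr (oneBlock e) (y 0))
      rw [P.aug_d hP, zero_smul, zero_add, map_smul, ← N.tr_d]
      simp only [Finset.univ_unique, Fin.default_eq_zero, Finset.sum_singleton,
        Function.update_self, lt_irrefl, if_false, add_zero]
      -- The differential crosses the root with sign (-1)^a; the augmentation vanishes unless a = 0,
      -- so the sign plays no role.
      by_cases ha : a = 0
      · rw [ha, pow_zero, one_smul]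
      · rw [P.aug_of_mem hP ha hx]; simp
    · simp [leftCounitSymbol]

theorem leftCounitHom_unitLeft {b : ℕ} {y : N m} (hy : y ∈ N.gr m b) :
    leftCounitHom hP N m (CompositeModule.mk (unitLeft P.one_mem hy)) = y := by
  rw [leftCounitHom_mk]
  change P.aug hP 1 P.one • N.tr _ y = y
  rw [P.aug_one hP, one_smul]
  exact N.tr_refl _ (fun _ => rfl) _

theorem leftCounitHom_mapHom (f : GrHom N N') (z : CompositeModule P.toDGSymModule N m) :
    leftCounitHom hP N' m (compose.mapHom (GrHom.id P.toDGSymModule) f m z)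
      = f.toFun m (leftCounitHom hP N m z) := by
  refine LinearMap.congr_fun
    (f := leftCounitHom hP N' m ∘ₗ compose.mapHom (GrHom.id P.toDGSymModule) f m)
    (g := f.toFun m ∘ₗ leftCounitHom hP N m) (CompositeModule.hom_ext fun c => ?_) z
  simp only [LinearMap.comp_apply]
  rw [compose.mapHom_mk, leftCounitHom_mk, leftCounitHom_mk]
  obtain ⟨_ | _ | r, n, e, a, x, hx, b, y, hy⟩ := c
  · exact (map_zero _).symm
  · change P.aug hP 1 x • N'.tr (oneBlock e) (f.toFun _ (y 0))
      = f.toFun m (P.aug hP 1 x • N.tr (oneBlock e) (y 0))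
    rw [map_smul, f.map_tr]
  · exact (map_zero _).symm

theorem weightProj_zero_eq_zero (z : CompositeModule P.toDGSymModule N m) (hP : P.IsConnected) :
    weightProj P.toDGSymModule N m 0 z = 0 := by
  refine LinearMap.congr_fun (f := weightProj P.toDGSymModule N m 0) (g := 0)
    (CompositeModule.hom_ext fun c => ?_) z
  rw [weightProj_mk]
  split_ifs with hc
  · refine mk_eq_zero_of_left _ ?_
    have : Subsingleton (P.carrier c.r) := by rw [hc]; exact hP.1
    exact Subsingleton.elim _ _
  · rfl

namespace DGLeftModule.QuasiFree

variable {R : DGLeftModule.{u, v, v₃} P} (F : R.QuasiFree N)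

/-- The unit `N → P ∘ N`. -/
abbrev unitHom (m : ℕ) : N m →ₗ[K] CompositeModule P.toDGSymModule N m :=
  F.coord.toFun m ∘ₗ F.ι.toFun m

theorem weightProj_unitHom (y : N m) :
    weightProj P.toDGSymModule N m 1 (F.unitHom m y) = F.unitHom m y := by
  refine LinearMap.congr_fun (f := weightProj P.toDGSymModule N m 1 ∘ₗ F.unitHom m)
    (N.hom_ext_of_mem fun b y hy => ?_) y
  simp only [LinearMap.comp_apply]
  rw [F.coord_ι hy, weightProj_mk, if_pos rfl]

theorem leftCounitHom_unitHom (y : N m) : leftCounitHom hP N m (F.unitHom m y) = y := by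
  refine LinearMap.congr_fun (f := leftCounitHom hP N m ∘ₗ F.unitHom m) (g := LinearMap.id)
    (N.hom_ext_of_mem fun b y hy => ?_) y
  simp only [LinearMap.comp_apply]
  rw [F.coord_ι hy, leftCounitHom_unitLeft]
  rfl

/-- As P(1) = K·1, the part of weight one of P ∘ N is N itself. -/
theorem mk_one_eq_unitHom {n : Fin 1 → ℕ} (e : (Σ i, Fin (n i)) ≃ Fin m) {a : ℕ} {x : P.carrier 1}
    (hx : x ∈ P.gr 1 a) {b : Fin 1 → ℕ} {y : ∀ i, N (n i)} (hy : ∀ i, y i ∈ N.gr (n i) (b i)) :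
    CompositeModule.mk (⟨1, n, e, a, x, hx, b, y, hy⟩ : CompositeSymbol P.toDGSymModule N m)
      = F.unitHom m (P.aug hP 1 x • N.tr (oneBlock e) (y 0)) := by
  have hone : P.one ∈ P.gr 1 0 := P.one_mem
  by_cases ha : a = 0
  · subst ha
    have h1 : x = P.aug hP 1 x • P.one + (0 : K) • P.one := by
      rw [zero_smul, add_zero, P.aug_smul_one hP]
    rw [mk_lin_left ⟨1, n, e, 0, x, hx, b, y, hy⟩ (P.aug hP 1 x) 0 P.one P.one hone hone h1,
      zero_smul, add_zero, map_smul]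
    refine congrArg _ (Eq.trans ?_ (F.coord_ι (N.tr_mem (oneBlock e) (hy 0))).symm)
    refine mk_relabel_blocks e _ hone hone hy _ (fun i => ?_) (fun i k => ?_) fun i => ?_
    · exact (Equiv.cast (by rw [Subsingleton.elim i 0])).trans (oneBlock e)
    · obtain rfl : i = 0 := Subsingleton.elim _ _
      rfl
    · obtain rfl : i = 0 := Subsingleton.elim _ _
      rfl
  · rw [P.aug_of_mem hP ha hx, zero_smul, map_zero]
    refine mk_eq_zero_of_left _ ?_
    change x = 0
    rw [← P.aug_smul_one hP x, P.aug_of_mem hP ha hx, zero_smul]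

theorem dHom_unitHom (y : N m) :
    dHom P.toDGSymModule N m (F.unitHom m y) = F.unitHom m (N.d m y) := by
  refine LinearMap.congr_fun (f := dHom P.toDGSymModule N m ∘ₗ F.unitHom m)
    (g := F.unitHom m ∘ₗ N.d m) (N.hom_ext_of_mem fun b y hy => ?_) y
  simp only [LinearMap.comp_apply]
  rw [F.coord_ι hy, F.coord_ι (N.d_mem_pred _ _ _ hy), dHom_mk, dMk, mk_eq_zero_of_left, zero_add]
  · refine (Fin.sum_univ_one _).trans ?_
    have h1 : (unitLeft P.one_mem hy).dExp 0 = 0 := by simp [CompositeSymbol.dExp]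
    rw [h1, pow_zero, one_smul]
    refine mk_eq_mk (fun _ => rfl) rfl fun i => ?_
    obtain rfl : i = 0 := Subsingleton.elim _ _
    exact Function.update_self _ _ _
  · exact P.d_zero _ _ P.one_mem

theorem sub_unitHom_leftCounit (z : CompositeModule P.toDGSymModule N m) :
    z - F.unitHom m (leftCounitHom hP N m z) ∈ upperSpan P.toDGSymModule N m 2 := by
  suffices H : (upperSpan P.toDGSymModule N m 2).mkQ ∘ₗ
      (LinearMap.id - F.unitHom m ∘ₗ leftCounitHom hP N m) = 0 from
    (Submodule.Quotient.mk_eq_zero _).1 (LinearMap.congr_fun H z)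
  refine CompositeModule.hom_ext fun c => (Submodule.Quotient.mk_eq_zero _).2 ?_
  change CompositeModule.mk c - F.unitHom m (leftCounitHom hP N m (CompositeModule.mk c)) ∈ _
  by_cases hc : 2 ≤ c.r
  · rw [leftCounitHom_mk_of_le hP c hc, map_zero, sub_zero]
    exact Submodule.subset_span ⟨c, hc, rfl⟩
  · rw [leftCounitHom_mk]
    obtain ⟨_ | _ | r, n, e, a, x, hx, b, y, hy⟩ := c
    · rw [mk_eq_zero_of_left _ (hP.1.elim _ _)]
      simp [leftCounitSymbol]
    · rw [F.mk_one_eq_unitHom hP e hx hy]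
      simp only [leftCounitSymbol]
      rw [sub_self]
      exact zero_mem _
    · simp at hc

variable {R' : DGLeftModule.{u, v, v₄} P} (F' : R'.QuasiFree N') (ψ : R.Hom R')

theorem mapHom_unitHom (f : GrHom N N') (y : N m) :
    compose.mapHom (GrHom.id P.toDGSymModule) f m (F.unitHom m y) = F'.unitHom m (f.toFun m y) := by
  refine LinearMap.congr_fun
    (f := compose.mapHom (GrHom.id P.toDGSymModule) f m ∘ₗ F.unitHom m)
    (g := F'.unitHom m ∘ₗ f.toFun m) (N.hom_ext_of_mem fun b y hy => ?_) y
  simp only [LinearMap.comp_apply]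
  rw [F.coord_ι hy, F'.coord_ι (f.map_mem _ _ _ hy), compose.mapHom_mk]
  rfl

include hP in
-- For a root of arity at least 1 the perturbation has weight at least 2, where the counit vanishes;
-- roots of arity 0 are zero.
theorem leftCounit_coord_d (z : CompositeModule P.toDGSymModule N m) :
    leftCounitHom hP N m (F.coord.toFun m (R.d m (F.ext.toFun m z)))
      = N.d m (leftCounitHom hP N m z) := by
  refine LinearMap.congr_fun
    (f := leftCounitHom hP N m ∘ₗ F.coord.toFun m ∘ₗ R.d m ∘ₗ F.ext.toFun m)
    (g := N.d m ∘ₗ leftCounitHom hP N m) (CompositeModule.hom_ext fun c => ?_) z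
  simp only [LinearMap.comp_apply]
  by_cases hc : c.r = 0
  · have : CompositeModule.mk c = 0 := by
      refine mk_eq_zero_of_left _ ?_
      have : Subsingleton (P.carrier c.r) := by rw [hc]; exact hP.1
      exact Subsingleton.elim _ _
    rw [this]; simp only [map_zero]
  · obtain ⟨z, hz, e⟩ := F.lead_d hP.1 P.mul.toGrHom P.mul_one (R.action.toFun m)
      (fun t => (R.assoc m t).trans (map_smul (R.action.toFun m) _ _).symm) (R.d m)
      (fun z => (R.action.map_d m z).symm) c
    have e' : R.d m (F.ext.toFun m (CompositeModule.mk c))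
        = F.ext.toFun m (dHom P.toDGSymModule N m (CompositeModule.mk c) + z) := e
    have hz' : z ∈ upperSpan P.toDGSymModule N m 2 := by
      refine Submodule.span_mono ?_ hz
      rintro _ ⟨d, hd, rfl⟩
      exact ⟨d, by omega, rfl⟩
    rw [e', coord_ext, map_add, leftCounitHom_of_mem_upperSpan hP hz', add_zero]
    exact (leftCounit hP N).map_d m _

include hP in
-- By P-linearity ψ(p(ι(y_*))) = p(ψ(ι(y_*))). A root p of arity at least 2 gives weight at least 2
-- after multiplication, because P(0) = 0.
theorem leftCounit_coord_map_eq_zero {x : R.carrier m} (hx : x ∈ Submodule.span K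
      {z | ∃ c : CompositeSymbol P.toDGSymModule N m, 2 ≤ c.r ∧
        z = R.extend F.ι m (compose.mk c)}) :
    leftCounitHom hP N' m (F'.coord.toFun m (ψ.toFun m x)) = 0 := by
  suffices H : Submodule.span K {z | ∃ c : CompositeSymbol P.toDGSymModule N m, 2 ≤ c.r ∧
        z = R.extend F.ι m (compose.mk c)}
      ≤ LinearMap.ker (leftCounitHom hP N' m ∘ₗ F'.coord.toFun m ∘ₗ ψ.toFun m) from H hx
  refine Submodule.span_le.2 ?_
  rintro _ ⟨c, hc, rfl⟩
  change leftCounitHom hP N' m (F'.coord.toFun m (ψ.toFun m (F.ext.toFun m (compose.mk c)))) = 0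
  rw [F.ext_mk, ψ.map_action]
  have h1 := F'.coord_action ((compose.map (DGHom.id P.toDGSymModule) ψ.toDGHom).toFun m
    (compose.mk (compose.mapSymbol (GrHom.id P.toDGSymModule) F.ι c)))
  rw [h1, compose.map_mk]
  refine (congrArg _ (rightSubst_mk P.mul.toGrHom F'.coord _)).trans ?_
  refine leftCounitHom_of_mem_upperSpan hP ?_
  refine Submodule.span_mono ?_ (multiEval_mem_upperSpan P.mul.toGrHom _ hP.1 _)
  rintro _ ⟨d, hd, rfl⟩
  exact ⟨d, hc.trans hd, rfl⟩

/-- The morphism induced on indecomposable quotients. -/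
def indec : DGHom N N' where
  toGrHom := ((leftCounit hP N').toGrHom.comp F'.coord).comp (ψ.toGrHom.comp F.ι)
  map_d m x := by
    change leftCounitHom hP N' m (F'.coord.toFun m (ψ.toFun m (F.ι.toFun m (N.d m x))))
      = N'.d m (leftCounitHom hP N' m (F'.coord.toFun m (ψ.toFun m (F.ι.toFun m x))))
    have h1 := F.leftCounit_coord_map_eq_zero hP F' ψ (F.decomposable m x)
    rw [map_sub, map_sub, map_sub, sub_eq_zero] at h1
    rw [← h1, ← F'.leftCounit_coord_d hP, ext_coord, ψ.map_d]

theorem coord_map_ι_sub (y : N m) :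
    F'.coord.toFun m (ψ.toFun m (F.ι.toFun m y) - F'.ι.toFun m ((F.indec hP F' ψ).toFun m y))
      ∈ upperSpan P.toDGSymModule N' m 2 := by
  rw [map_sub]
  exact F'.sub_unitHom_leftCounit hP (F'.coord.toFun m (ψ.toFun m (F.ι.toFun m y)))

end DGLeftModule.QuasiFree

end LeftCounit


/-- For L = P the weight 0 part vanishes. It is the last one in the downward numbering, and dropping
it puts weight 1 in the top position, where `weightAcyclic_top` applies. -/
theorem WeightPerturbation.restrict {K : Type*} [CommRing K] {Z : Type*} [AddCommGroup Z]
    [Module K Z] {p : ℕ → Z →ₗ[K] Z} {N : ℕ} {D₀ D : Z →ₗ[K] Z}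
    (h : WeightPerturbation p (N + 1) D₀ D) (h0 : ∀ z, p N z = 0) : WeightPerturbation p N D₀ D :=
  { h with
    sum_proj := fun z => by
      have := h.sum_proj z
      rwa [Finset.sum_range_succ, h0, add_zero] at this }

/-! ### Downward numbering of weights and proof of the statement on left modules. -/

noncomputable section LeftFinal

variable {K : Type u} [CommRing K]

open CompositeModule CompositeSymbol TripleSymbol

/-- The projections onto the parts of a given weight, numbered downwards from `m`. -/
def coweightProj (M : DGSymModule.{u, v₁} K) (N : DGSymModule.{u, v₂} K) (m k : ℕ) :
    CompositeModule M N m →ₗ[K] CompositeModule M N m :=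
  if k ≤ m then weightProj M N m (m - k) else 0

section

variable {M : DGSymModule.{u, v₁} K} {N : DGSymModule.{u, v₂} K} {M' : DGSymModule.{u, v₃} K}
  {N' : DGSymModule.{u, v₄} K} {m : ℕ}

theorem coweightProj_of_le {k : ℕ} (h : k ≤ m) : coweightProj M N m k = weightProj M N m (m - k) :=
  if_pos h

theorem coweightProj_of_lt {k : ℕ} (h : m < k) : coweightProj M N m k = 0 := if_neg h.not_ge

theorem weightGrading_coweightProj (M : DGSymModule.{u, v₁} K) (hN : N.Connected) (m : ℕ) :
    WeightGrading (coweightProj M N m) (m + 1) where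
  proj_self k z := by
    rcases le_or_gt k m with h | h
    · rw [coweightProj_of_le h, weightProj_self]
    · rw [coweightProj_of_lt h]; rfl
  proj_ne j k z hjk := by
    rcases le_or_gt k m with h | h
    · rcases le_or_gt j m with h' | h'
      · rw [coweightProj_of_le h, coweightProj_of_le h', weightProj_ne (by omega)]
      · rw [coweightProj_of_lt h']; rfl
    · rw [coweightProj_of_lt h, LinearMap.zero_apply, map_zero]
  sum_proj z := by
    rw [← Finset.sum_range_reflect]
    refine Eq.trans (Finset.sum_congr rfl fun k hk => ?_) (sum_weightProj hN z)
    have := Finset.mem_range.1 hk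
    rw [coweightProj_of_le (by omega)]
    congr 2
    omega

theorem coweightProj_comm {T : CompositeModule M N m →ₗ[K] CompositeModule M' N' m}
    (h : ∀ s z, weightProj M' N' m s (T z) = T (weightProj M N m s z)) (k : ℕ)
    (z : CompositeModule M N m) : coweightProj M' N' m k (T z) = T (coweightProj M N m k z) := by
  rcases le_or_gt k m with hk | hk
  · rw [coweightProj_of_le hk, coweightProj_of_le hk, h]
  · rw [coweightProj_of_lt hk, coweightProj_of_lt hk, LinearMap.zero_apply, LinearMap.zero_apply,
      map_zero]

theorem coweightProj_congr_of_upper {T T₀ : CompositeModule M N m →ₗ[K] CompositeModule M' N' m}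
    (h : ∀ c, ∃ z ∈ upperSpan M' N' m (c.r + 1),
      T (CompositeModule.mk c) = T₀ (CompositeModule.mk c) + z)
    (j k : ℕ) (z : CompositeModule M N m) (hk : k ≤ j) :
    coweightProj M' N' m j (T (coweightProj M N m k z))
      = coweightProj M' N' m j (T₀ (coweightProj M N m k z)) := by
  rcases le_or_gt j m with hj | hj
  · rw [coweightProj_of_le hj, coweightProj_of_le (hk.trans hj)]
    refine LinearMap.congr_fun (f := weightProj M' N' m (m - j) ∘ₗ T ∘ₗ weightProj M N m (m - k))
      (g := weightProj M' N' m (m - j) ∘ₗ T₀ ∘ₗ weightProj M N m (m - k))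
      (CompositeModule.hom_ext fun c => ?_) z
    simp only [LinearMap.comp_apply, weightProj_mk]
    split_ifs with hc
    · obtain ⟨z, hz, e⟩ := h c
      rw [e, map_add, weightProj_of_mem_upperSpan (by omega) hz, add_zero]
    · simp only [map_zero]
  · rw [coweightProj_of_lt hj]; rfl

end

namespace DGLeftModule.QuasiFree

variable {P : DGOperad.{u, v} K} (hP : P.IsConnected) {R : DGLeftModule.{u, v, v₁} P}
  {N : DGSymModule.{u, v₂} K} (F : R.QuasiFree N) {R' : DGLeftModule.{u, v, v₃} P}
  {N' : DGSymModule.{u, v₄} K} (F' : R'.QuasiFree N') (ψ : R.Hom R')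
  (hN : N.Connected) (hN' : N'.Connected)

section Perturbation

variable {L : DGSymModule.{u, w} K} (act : GrHom (compose L P.toDGSymModule) L)
  (hact : ∀ (r a : ℕ) (x : L r) (hx : x ∈ L.gr r a),
      act.toFun r (compose.mk (unitRight hx P.one_mem)) = x)
  {m : ℕ} {X X' : Type*} [AddCommGroup X] [Module K X] [AddCommGroup X'] [Module K X']
  (f : CompositeModule L R.toDGSymModule m →ₗ[K] X)
  (hf : ∀ t : TripleSymbol L P.toDGSymModule R.toDGSymModule m,
      f (t.evalLeft act) = f (t.evalRight R.action.toGrHom))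
  (f' : CompositeModule L R'.toDGSymModule m →ₗ[K] X')
  (hf' : ∀ t : TripleSymbol L P.toDGSymModule R'.toDGSymModule m,
      f' (t.evalLeft act) = f' (t.evalRight R'.action.toGrHom))
  {d : X →ₗ[K] X} {d' : X' →ₗ[K] X'} {Φ : X →ₗ[K] X'}
  (hd : ∀ z, d (f z) = f (dHom L R.toDGSymModule m z))
  (hd' : ∀ z, d' (f' z) = f' (dHom L R'.toDGSymModule m z))
  (hΦ : ∀ z, Φ (f z) = f' (compose.mapHom (GrHom.id L) ψ.toGrHom m z))
  (hdd : ∀ z, d (d z) = 0) (hdd' : ∀ z, d' (d' z) = 0) (hΦd : ∀ z, Φ (d z) = d' (Φ z))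
  (hb : Function.Bijective (F.lead f)) (hb' : Function.Bijective (F'.lead f'))

include hN hN' hact hf hf' hd hd' hΦ hdd hdd' hΦd hb hb'

/-- Conjugation of the cone of Φ by the bijections from L ∘ N and L ∘ N'. Perturbations raise the
weight, hence lower the index k = m - weight. The target X is again either R(m), with L = P, or (L
∘_P R)(m). -/
theorem weightPerturbation : ∃ D,
    WeightPerturbation (fun k => (coweightProj L N m k).prodMap (coweightProj L N' m k)) (m + 1)
      (coneD (dHom L N m) (dHom L N' m)
        (compose.mapHom (GrHom.id L) (F.indec hP F' ψ).toGrHom m)) D ∧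
      ((∀ z, D z = 0 → ∃ y, D y = z) ↔ ConeAcyclic d d' Φ) := by
  set e := LinearEquiv.ofBijective (F.lead f) hb
  set e' := LinearEquiv.ofBijective (F'.lead f') hb'
  have he : ∀ z, e z = F.lead f z := fun _ => rfl
  have he' : ∀ z, e' z = F'.lead f' z := fun _ => rfl
  refine ⟨_, ?_, coneAcyclic_conj (d := d) (d' := d') (F := Φ) e e'⟩
  refine (weightGrading_coweightProj L hN m).cone (weightGrading_coweightProj L hN' m)
    (coweightProj_comm weightProj_dHom) (coweightProj_comm weightProj_dHom)
    (coweightProj_comm (weightProj_mapHom _ _)) ?_ ?_ ?_ ?_ ?_ ?_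
  · refine coweightProj_congr_of_upper fun c => ?_
    obtain ⟨z, hz, h⟩ := F.lead_d hP.1 act hact f hf d hd c
    exact ⟨z, hz, by simp only [LinearMap.comp_apply, LinearEquiv.coe_coe, he, h]
                     exact e.symm_apply_apply _⟩
  · refine coweightProj_congr_of_upper fun c => ?_
    obtain ⟨z, hz, h⟩ := F'.lead_d hP.1 act hact f' hf' d' hd' c
    exact ⟨z, hz, by simp only [LinearMap.comp_apply, LinearEquiv.coe_coe, he', h]
                     exact e'.symm_apply_apply _⟩
  · refine coweightProj_congr_of_upper fun c => ?_
    obtain ⟨z, hz, h⟩ := F'.lead_perturbation hP.1 act hact f' hf'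
      (compose.mapSymbol (GrHom.id L) (F.indec hP F' ψ).toGrHom c)
      (fun i => ψ.toFun _ (F.ι.toFun _ (c.y i)))
      (fun i => ψ.map_mem _ _ _ (F.ι.map_mem _ _ _ (c.hy i)))
      fun i => F.coord_map_ι_sub hP F' ψ (c.y i)
    refine ⟨z, hz, ?_⟩
    simp only [LinearMap.comp_apply, LinearEquiv.coe_coe, he]
    rw [lead_mk, hΦ, compose.mapHom_mk, compose.mapHom_mk]
    exact (congrArg e'.symm h).trans (e'.symm_apply_apply _)
  · intro z; simp [hdd]
  · intro z; simp [hdd']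
  · intro z; simp [hΦd]

end Perturbation

include hN hN' in
-- Strong induction on the arity through R(m) ≅ (P ∘ N)(m), where N(m) is a retract of the part of
-- weight 1, the top one in the downward numbering.
theorem indec_coneAcyclic (hψ : ψ.toDGHom.QuasiIso) (hNp : N.KProjective) (hNp' : N'.KProjective)
    (m : ℕ) : ConeAcyclic (N.d m) (N'.d m) ((F.indec hP F' ψ).toFun m) := by
  induction m using Nat.strong_induction_on with
  | _ m ih =>
    obtain _ | m := m
    · have : Subsingleton (N 0) := hN
      have : Subsingleton (N' 0) := hN'
      exact fun z _ => ⟨0, Subsingleton.elim _ _⟩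
    obtain ⟨D, hD, hD'⟩ := F.weightPerturbation hP F' ψ hN hN' P.mul.toGrHom P.mul_one
      (R.action.toFun (m + 1))
      (fun t => (R.assoc _ t).trans (map_smul (R.action.toFun _) _ _).symm)
      (R'.action.toFun (m + 1))
      (fun t => (R'.assoc _ t).trans (map_smul (R'.action.toFun _) _ _).symm)
      (fun z => (R.action.map_d _ z).symm) (fun z => (R'.action.map_d _ z).symm)
      (ψ.map_action _) (R.d_d _) (R'.d_d _) (ψ.map_d _) (F.bijective _) (F'.bijective _)
    have h0 : ∀ z, ((coweightProj P.toDGSymModule N (m + 1) (m + 1)).prodMap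
        (coweightProj P.toDGSymModule N' (m + 1) (m + 1))) z = 0 := by
      intro z
      rw [coweightProj_of_le le_rfl, coweightProj_of_le le_rfl, Nat.sub_self]
      exact Prod.ext (weightProj_zero_eq_zero z.1 hP) (weightProj_zero_eq_zero z.2 hP)
    have h1 := (hD.restrict h0).weightAcyclic_top rfl
      (hD'.2 ((ψ.bijective_homologyMap_iff _).1 (hψ _))) fun i hi => by
        rw [coweightProj_of_le (by omega), coweightProj_of_le (by omega)]
        -- The index i < m stands for the weight m + 1 - i ≥ 2 in arity m + 1, so every factor has
        -- arity n ≤ m and the induction hypothesis applies.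
        refine weightAcyclic_mapHom_right _ _ hN hN' _ _ fun n _ hn => ?_
        have := hNp n
        have := hNp' n
        exact (F.indec hP F' ψ).hasHomotopyInverse n (ih n (by omega))
    rw [coweightProj_of_le (Nat.le_add_right m 1), coweightProj_of_le (Nat.le_add_right m 1),
      Nat.add_sub_cancel_left] at h1
    exact h1.retract (F.unitHom _) (F'.unitHom _) (leftCounitHom hP N _) (leftCounitHom hP N' _)
      F.weightProj_unitHom F'.weightProj_unitHom F.dHom_unitHom F'.dHom_unitHom
      (F.mapHom_unitHom F' _) (F.leftCounitHom_unitHom hP) (F'.leftCounitHom_unitHom hP)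
      ((leftCounit hP N).map_d _) ((leftCounit hP N').map_d _) (leftCounitHom_mapHom hP _)

include F F' hP hN hN' in
theorem relComp_map_quasiIso (L : DGRightModule.{u, v, w} P) (hψ : ψ.toDGHom.QuasiIso)
    (hNp : N.KProjective) (hNp' : N'.KProjective) :
    (relComp.map (DGRightModule.Hom.id L) ψ).QuasiIso := by
  intro m
  rw [DGHom.bijective_homologyMap_iff]
  obtain ⟨D, hD, hD'⟩ := F.weightPerturbation hP F' ψ hN hN' L.action.toGrHom L.action_one
    (relComp.mkQ L R m) (relComp.mkQ_eval L R) (relComp.mkQ L R' m) (relComp.mkQ_eval L R')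
    (d := (relComp L R).d m) (d' := (relComp L R').d m)
    (Φ := (relComp.map (DGRightModule.Hom.id L) ψ).toFun m) (fun _ => rfl) (fun _ => rfl)
    (fun _ => rfl) ((relComp L R).d_d m) ((relComp L R').d_d m)
    ((relComp.map (DGRightModule.Hom.id L) ψ).map_d m) (F.lead_mkQ_bijective L m)
    (F'.lead_mkQ_bijective L m)
  refine hD'.1 (hD.acyclic fun i hi => ?_)
  rw [coweightProj_of_le (by omega), coweightProj_of_le (by omega)]
  refine weightAcyclic_mapHom_right _ _ hN hN' _ _ fun n _ _ => ?_
  have := hNp n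
  have := hNp' n
  exact (F.indec hP F' ψ).hasHomotopyInverse n
    (F.indec_coneAcyclic hP F' ψ hN hN' hψ hNp hNp' n)

end DGLeftModule.QuasiFree

end LeftFinal

theorem mainTheorem8 {K : Type u} [CommRing K] (P : DGOperad.{u, u} K) (hP : P.IsConnected) :
    -- quasi-isomorphisms of quasi-free right `P`-modules `L = M ∘ P`, `L' = M' ∘ P`
    (∀ (L L' : DGRightModule.{u, u, u} P) (M M' : DGSymModule.{u, u} K)
        (_ : L.QuasiFree M) (_ : L'.QuasiFree M') (φ : L.Hom L')
        (R : DGLeftModule.{u, u, u} P),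
        R.toDGSymModule.Connected →
        (¬ IsField K → P.toDGSymModule.KProjective ∧ M.KProjective ∧ M'.KProjective ∧
          R.toDGSymModule.KProjective) →
        φ.toDGHom.QuasiIso →
        (relComp.map φ (DGLeftModule.Hom.id R)).QuasiIso) ∧
    -- quasi-isomorphisms of connected quasi-free left `P`-modules `R = P ∘ N`, `R' = P ∘ N'`
    (∀ (R R' : DGLeftModule.{u, u, u} P) (N N' : DGSymModule.{u, u} K)
        (_ : R.QuasiFree N) (_ : R'.QuasiFree N') (ψ : R.Hom R')
        (L : DGRightModule.{u, u, u} P),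
        N.Connected → N'.Connected →
        (¬ IsField K → N.KProjective ∧ N'.KProjective) →
        ψ.toDGHom.QuasiIso →
        (relComp.map (DGRightModule.Hom.id L) ψ).QuasiIso) := by
  refine ⟨fun L L' M M' F F' φ R hR hproj hφ => ?_,
    fun R R' N N' F F' ψ L hN hN' hproj hψ => ?_⟩
  -- Over a field every module is free, so the projectivity needed for homotopy inverses is
  -- automatic.
  · by_cases hK : IsField K
    · exact F.relComp_map_quasiIso F' hP φ R hR hφ (DGSymModule.kprojective_of_isField hK M)
        (DGSymModule.kprojective_of_isField hK M')
    · obtain ⟨-, hM, hM', -⟩ := hproj hK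
      exact F.relComp_map_quasiIso F' hP φ R hR hφ hM hM'
  · by_cases hK : IsField K
    · exact F.relComp_map_quasiIso hP F' ψ hN hN' L hψ (DGSymModule.kprojective_of_isField hK N)
        (DGSymModule.kprojective_of_isField hK N')
    · obtain ⟨hNp, hNp'⟩ := hproj hK
      exact F.relComp_map_quasiIso hP F' ψ hN hN' L hψ hNp hNp'
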